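/- **Model.** Consider $k\ge 1$ autonomous, anonymous, identical point robots at distinct points of the infinite grid $\mathbb Z^2$; each carries a light with a constant number of possible colours, all initially showing the same colour `off`. All robots agree on the positive direction of the $X$-axis; each robot has its own local frame, centred at itself, with its own fixed orientation of the $Y$-axis (chosen adversarially), and there is no other agreement. Robots are opaque: a robot sees another one (its position and its light) if and only if no robot lies strictly between them on the straight segment joining them. Robots work in Look–Compute–Move cycles: Look takes a snapshot of the visible robots, Compute determines by one common deterministic algorithm, from the snapshot, the robot's own light and the input pattern only, a new light and a move, and Move is an instantaneous step to one of the four neighbouring grid points or a null move. The light is persistent; otherwise the robots have no memory. The scheduler is asynchronous and adversarial: inactive periods and the phases of a cycle have arbitrary finite durations, so a robot may act on an outdated snapshot. A *pattern* is a set $P\subset\mathbb Z^2$ of $k$ points, given to all robots as input. An algorithm *forms* $P$ from an initial configuration if, for all local orientations and all schedules, no two robots are ever on the same grid point, and after a finite time the robots stay for ever on a set of positions that equals $P$ up to a translation and possibly a reflection $y\mapsto -y$. *Arbitrary pattern formation is deterministically solvable* from an initial configuration if some algorithm forms every pattern of $k$ points from it. **Theorem.** (a) Arbitrary pattern formation is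 deterministically solvable from an initial configuration if and only if that configuration is not symmetric with respect to a line $K$ such that (1) $K$ is parallel to the agreed axis and (2) $K$ passes through no robot. (b) Moreover, there are a single algorithm with 8 colours and an absolute constant $C$ such that for every $k\ge1$, every initial configuration of $k$ robots without such a symmetry and every pattern $P$ of $k$ points, the algorithm forms $P$, and in every execution the robots make in total at most $C\,k\,D$ moves, where $D=\max\{m,n,M,N,k\}$, $m,n$ are the height and width of the smallest enclosing rectangle of the initial configuration and $M,N$ those of $P$. -/

import Mathlib

/-- The vertices of the infinite grid. The first coordinate is the agreed X-axis, positive direction to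
the right. -/
abbrev GridPt : Type := ℤ × ℤ

/-- A grid point, seen as a point of the real plane. -/
def GridPt.toPlane (p : GridPt) : ℝ × ℝ := ((p.1 : ℝ), (p.2 : ℝ))

/-- The coordinate change between the global frame and a local frame. All frames agree on the
positive X-direction; the unit `s = ± 1` is the orientation of the local Y-axis. -/
def flipY (s : ℤˣ) (p : GridPt) : GridPt := (p.1, (s : ℤ) * p.2)

/-- The five possible outcomes of a computation: the null move, or a move of unit length along a grid
line. The names refer to the local frame of the robot. -/
inductive GridMove : Type
  | stay | left | right | up | down

/-- The displacement of a move, in the local frame of the robot. -/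
def GridMove.disp : GridMove → GridPt
  | .stay => (0, 0)
  | .left => (-1, 0)
  | .right => (1, 0)
  | .up => (0, 1)
  | .down => (0, -1)

/-- What a robot sees in a Look phase: the positions of the other visible robots, in its local frame
with itself at the origin, each with the light shown there. There are no identifiers. -/
abbrev Snapshot (c : ℕ) : Type := Finset (GridPt × Fin c)

/-- A deterministic algorithm with `c` lights, executed by every robot. From the target pattern (the
input), the robot's own light and the snapshot it computes a new light and a move. Apart from its light a
robot has no memory of earlier cycles. -/
structure RobotAlgorithm (c : ℕ) where
  /-- the light of every robot at the beginning -/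
  off : Fin c
  /-- the outcome of a Compute phase: a new light and a move -/
  compute : (pattern : Finset GridPt) → (ownLight : Fin c) → (view : Snapshot c) → Fin c × GridMove

/-- The stage of a robot in its Look-Compute-Move cycle. -/
inductive RobotStage (c : ℕ) : Type
  /-- inactive; the next action is a Look -/
  | idle
  /-- a snapshot was taken, the computation is not finished yet -/
  | looked (view : Snapshot c)
  /-- the new light is displayed, the computed move is not made yet -/
  | computed (m : GridMove)

/-- A global state of `k` robots with `c` lights. -/
structure SwarmState (k c : ℕ) where
  pos : Fin k → GridPt
  light : Fin k → Fin c
  stage : Fin k → RobotStage c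

/-- Obstructed visibility: robot `i` sees robot `j` iff no robot is strictly inside the straight line
segment between them. -/
def Sees {k : ℕ} (pos : Fin k → GridPt) (i j : Fin k) : Prop :=
  ∀ l : Fin k, ¬ Sbtw ℝ (pos i).toPlane (pos l).toPlane (pos j).toPlane

open Classical in
/-- The snapshot robot `i` takes in the state `σ`, where `s` is the orientation of its Y-axis. -/
noncomputable def SwarmState.view {k c : ℕ} (σ : SwarmState k c) (s : ℤˣ) (i : Fin k) : Snapshot c :=
  (Finset.univ.filter fun j => j ≠ i ∧ Sees σ.pos i j).image
    fun j => (flipY s (σ.pos j - σ.pos i), σ.light j)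

/-- One time step. Each robot of the set `active` performs its next action: a Look (of the state before
the step), the end of a Compute, or an instantaneous Move. The other robots do nothing. -/
noncomputable def SwarmState.next {k c : ℕ} (A : RobotAlgorithm c) (P : Finset GridPt)
    (orient : Fin k → ℤˣ) (active : Finset (Fin k)) (σ : SwarmState k c) : SwarmState k c where
  pos i :=
    if i ∈ active then
      match σ.stage i with
      | .computed m => σ.pos i + flipY (orient i) m.disp
      | _ => σ.pos i
    else σ.pos i
  light i :=
    if i ∈ active then
      match σ.stage i with
      | .looked v => (A.compute P (σ.light i) v).1
      | _ => σ.light i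
    else σ.light i
  stage i :=
    if i ∈ active then
      match σ.stage i with
      | .idle => .looked (σ.view (orient i) i)
      | .looked v => .computed (A.compute P (σ.light i) v).2
      | .computed _ => .idle
    else σ.stage i

/-- The execution of the algorithm `A` with target pattern `P` from the initial positions `init`, all
lights off, under the schedule `sched` and the local orientations `orient`. -/
noncomputable def execution {k c : ℕ} (A : RobotAlgorithm c) (P : Finset GridPt)
    (init : Fin k → GridPt) (orient : Fin k → ℤˣ) (sched : ℕ → Finset (Fin k)) : ℕ → SwarmState k c
  | 0 => { pos := init, light := fun _ => A.off, stage := fun _ => .idle }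
  | t + 1 => (execution A P init orient sched t).next A P orient (sched t)

/-- The only restriction on the asynchronous scheduler: every robot acts infinitely often, that is,
every inactive period and every phase of a cycle has a finite, but unbounded, duration. -/
def FairSchedule {k : ℕ} (sched : ℕ → Finset (Fin k)) : Prop :=
  ∀ i : Fin k, ∀ t : ℕ, ∃ t' : ℕ, t ≤ t' ∧ i ∈ sched t'

/-- The robots form the pattern `P`: in some frame with the agreed positive X-direction (an arbitrary
origin, either orientation of the Y-axis) the set of occupied grid points is `P`. -/
def FormsPattern {k : ℕ} (pos : Fin k → GridPt) (P : Finset GridPt) : Prop :=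
  ∃ (v : GridPt) (s : ℤˣ), Finset.univ.image pos = P.image fun q => v + flipY s q

/-- The algorithm `A` forms the pattern `P` from the initial positions `init`: whatever the local
orientations and the schedule are, no two robots ever share a grid point, and at some time the pattern is
formed and no robot moves any more. -/
def SolvesPattern {k c : ℕ} (A : RobotAlgorithm c) (P : Finset GridPt) (init : Fin k → GridPt) : Prop :=
  ∀ (orient : Fin k → ℤˣ) (sched : ℕ → Finset (Fin k)), FairSchedule sched →
    (∀ t, Function.Injective (execution A P init orient sched t).pos) ∧
    ∃ T, FormsPattern (execution A P init orient sched T).pos P ∧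
      ∀ t, T ≤ t →
        (execution A P init orient sched t).pos = (execution A P init orient sched T).pos

/-- Arbitrary pattern formation is deterministically solvable from `init`: some algorithm with finitely
many lights forms every pattern that has as many points as there are robots. -/
def APFSolvable {k : ℕ} (init : Fin k → GridPt) : Prop :=
  ∃ (c : ℕ) (A : RobotAlgorithm c), ∀ P : Finset GridPt, P.card = k → SolvesPattern A P init

/-- The configuration is symmetric with respect to a line `K` (the line `y = κ`) that is parallel to the
agreed axis and passes through no robot. -/
def HasFreeAxisSymmetry {k : ℕ} (init : Fin k → GridPt) : Prop :=
  ∃ κ : ℝ,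
    (∀ i, ∃ j, (init j).1 = (init i).1 ∧ ((init j).2 : ℝ) = 2 * κ - ((init i).2 : ℝ)) ∧
    ∀ i, ((init i).2 : ℝ) ≠ κ

/-- The width of the smallest enclosing rectangle of a finite set of grid points. -/
def gridWidth (S : Finset GridPt) : ℕ := S.sup fun p => S.sup fun q => (p.1 - q.1).toNat

/-- The height of the smallest enclosing rectangle of a finite set of grid points. -/
def gridHeight (S : Finset GridPt) : ℕ := S.sup fun p => S.sup fun q => (p.2 - q.2).toNat

/-- The size parameter: the maximum of the heights and widths of the initial configuration and of the
target, and of the number of robots. -/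
def sizeParam {k : ℕ} (init : Fin k → GridPt) (P : Finset GridPt) : ℕ :=
  max (max (gridHeight (Finset.univ.image init)) (gridWidth (Finset.univ.image init)))
    (max (max (gridHeight P) (gridWidth P)) k)

/-- The total number of (non-null) moves made by all robots before time `T`. -/
noncomputable def moveCount {k c : ℕ} (A : RobotAlgorithm c) (P : Finset GridPt)
    (init : Fin k → GridPt) (orient : Fin k → ℤˣ) (sched : ℕ → Finset (Fin k)) (T : ℕ) : ℕ :=
  ∑ t ∈ Finset.range T, (Finset.univ.filter fun i : Fin k =>
    (execution A P init orient sched (t + 1)).pos i ≠ (execution A P init orient sched t).pos i).card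

/-!
# Pattern formation by opaque robots with lights on the grid

**Impossibility.** If the configuration is symmetric about a horizontal line without robots, the robots come
in mirror pairs. Give the two robots of a pair opposite orientations and activate all robots at once: their
snapshots agree in their local frames, so the symmetry persists for ever, and with it the absence of robots
from the axis. A horizontal segment is not formed (`not_solvable_of_freeAxisSymmetry`).

**Asynchrony.** A robot whose snapshot leads to a null action may be ignored until it takes a new snapshot.
So only *effective* actions matter, each consisting of a computed outcome, a light change and possibly a
move, and it suffices to consider configurations in which these parts are performed one at a time in any
order (`Completes`). An induction on a bound for the number of parts yields both the formation of the
pattern and the bound for the number of moves (`Completes.solves`, `Completes.moveCount_le`). In the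
algorithm, at each time all robots rest but one (`Completes.seq_step`) or two, whose actions do not disturb
each other (`Completes.two_robots`).

**The algorithm** has two phases. The first one elects a robot in a column on the left of all others.
* If the leftmost column contains one robot, this robot is elected (`Apf.completes_of_sole`).
* Otherwise the two ends of this column step out to the left (`Apf.Ends.completes`), and all others always
  see two robots to the left, which keeps them at rest. The two robots fully see the next column. If it is
  not symmetric about their midline, one of them gives in, and the other one is elected
  (`Apf.Pair.completes_front`).
* If it is symmetric, the two robots climb away from each other until each of them sees all others. Every two
  robots hide each other from at most one point of the column, so this takes at most `k ^ 2` moves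
  (`Apf.exists_clear`, `Apf.Pair.completes_search`). If now the other robots are not in symmetric position,
  one of the two gives in, and the other one is elected (`Apf.Pair.completes_asymmetric`).
* If they are symmetric, then by assumption some robot is on the axis, and by the full view of the two
  robots the leftmost robot on the axis sees both of them. It is elected and walks to the left between the two
  (`Apf.Centre.completes_walk`), which then return, such that the configuration is as small as before
  (`Apf.Return.completes`).

In the second phase the elected robot walks to the row above all others and becomes the leader, who defines
a common frame (`Apf.Elected.completes`). One by one, from the left and in each column from the top, the
others walk by the column of the leader to the targets, which are placed to the lower left of the leader and
are filled by columns from the left, in each column from below. In this order the next robot and the next target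
can be found in spite of the obstructed visibility (`Apf.Scene.called_iff`, `Apf.Walking.guided_iff`). In
the end the leader takes the last place of the pattern (`Apf.Finale`).

The rules distinguish above and below. A robot applies them in its own frame or, if they do not tell it to
act, in the mirrored frame; the lemmas `Apf.outcome_of_rule` and `Apf.outcome_of_both` are used to show that
the result does not depend on the frame.
-/

/-! ### Visibility and coordinates -/

theorem flipY_flipY (s t : ℤˣ) (p : GridPt) : flipY s (flipY t p) = flipY (s * t) p := by
  simp [flipY, mul_assoc]

@[simp] theorem flipY_one (p : GridPt) : flipY 1 p = p := by simp [flipY]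

@[simp] theorem flipY_zero (s : ℤˣ) : flipY s 0 = 0 := by simp [flipY]

theorem flipY_add (s : ℤˣ) (p q : GridPt) : flipY s (p + q) = flipY s p + flipY s q := by
  simp [flipY, mul_add]

theorem flipY_sub (s : ℤˣ) (p q : GridPt) : flipY s (p - q) = flipY s p - flipY s q := by
  simp [flipY, mul_sub]

@[simp] theorem flipY_fst (s : ℤˣ) (p : GridPt) : (flipY s p).1 = p.1 := rfl

@[simp] theorem flipY_snd (s : ℤˣ) (p : GridPt) : (flipY s p).2 = (s : ℤ) * p.2 := rfl

theorem units_mul_self (s : ℤˣ) : s * s = 1 := by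
  rcases Int.units_eq_one_or s with rfl | rfl <;> rfl

theorem flipY_injective (s : ℤˣ) : Function.Injective (flipY s) := by
  intro p q h
  have := congrArg (flipY s) h
  simpa [flipY_flipY, units_mul_self] using this

/-- Strict betweenness of grid points as an explicit convex combination. -/
theorem sbtw_iff_exists {a b c : GridPt} :
    Sbtw ℝ a.toPlane b.toPlane c.toPlane ↔
      a ≠ c ∧ ∃ t : ℝ, 0 < t ∧ t < 1 ∧ (b.1 : ℝ) = a.1 + t * (c.1 - a.1) ∧
        (b.2 : ℝ) = a.2 + t * (c.2 - a.2) := by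
  have hinj : ∀ p q : GridPt, p.toPlane = q.toPlane → p = q := by
    intro p q h
    simp only [GridPt.toPlane, Prod.mk.injEq, Int.cast_inj] at h
    exact Prod.ext h.1 h.2
  rw [sbtw_iff_mem_image_Ioo_and_ne]
  constructor
  · rintro ⟨⟨t, ⟨h0, h1⟩, h⟩, hne⟩
    refine ⟨fun h => hne (by rw [h]), t, h0, h1, ?_, ?_⟩
    · have := congrArg Prod.fst h
      simp [GridPt.toPlane, AffineMap.lineMap_apply] at this
      linarith
    · have := congrArg Prod.snd h
      simp [GridPt.toPlane, AffineMap.lineMap_apply] at this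
      linarith
  · rintro ⟨hne, t, h0, h1, hx, hy⟩
    refine ⟨⟨t, ⟨h0, h1⟩, ?_⟩, fun h => hne (hinj _ _ h)⟩
    simp only [GridPt.toPlane, AffineMap.lineMap_apply]
    ext <;> simp <;> linarith

/-- Betweenness is invariant under the isometries of the plane that keep the direction of the X-axis. -/
theorem sbtw_congr {a b c a' b' c' : GridPt} (s : ℤˣ)
    (h1 : b' - a' = flipY s (b - a)) (h2 : c' - a' = flipY s (c - a)) :
    Sbtw ℝ a'.toPlane b'.toPlane c'.toPlane ↔ Sbtw ℝ a.toPlane b.toPlane c.toPlane := by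
  have key : ∀ {a b c a' b' c' : GridPt} (s : ℤˣ), b' - a' = flipY s (b - a) →
      c' - a' = flipY s (c - a) → Sbtw ℝ a.toPlane b.toPlane c.toPlane →
      Sbtw ℝ a'.toPlane b'.toPlane c'.toPlane := by
    intro a b c a' b' c' s h1 h2 h
    rw [sbtw_iff_exists] at h ⊢
    obtain ⟨hne, t, h0, ht, hx, hy⟩ := h
    have e1 := congrArg Prod.fst h1
    have e2 := congrArg Prod.snd h1
    have e3 := congrArg Prod.fst h2
    have e4 := congrArg Prod.snd h2
    simp only [flipY, Prod.fst_sub, Prod.snd_sub] at e1 e2 e3 e4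
    refine ⟨?_, t, h0, ht, ?_, ?_⟩
    · rintro rfl
      rw [sub_self] at h2
      have : flipY s (c - a) = flipY s 0 := by rw [← h2]; simp
      exact hne (sub_eq_zero.1 (flipY_injective s this)).symm
    · have e1' : (b'.1 : ℝ) - a'.1 = b.1 - a.1 := by exact_mod_cast e1
      have e3' : (c'.1 : ℝ) - a'.1 = c.1 - a.1 := by exact_mod_cast e3
      rw [e3']; linarith
    · have e2' : (b'.2 : ℝ) - a'.2 = (s : ℤ) * (b.2 - a.2) := by exact_mod_cast e2
      have e4' : (c'.2 : ℝ) - a'.2 = (s : ℤ) * (c.2 - a.2) := by exact_mod_cast e4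
      rw [e4']
      have : (b.2 : ℝ) - a.2 = t * (c.2 - a.2) := by linarith
      rw [this] at e2'
      linarith
  refine ⟨key s ?_ ?_, key s h1 h2⟩
  · rw [h1, flipY_flipY, units_mul_self, flipY_one]
  · rw [h2, flipY_flipY, units_mul_self, flipY_one]

/-! ### A free axis of symmetry makes the problem unsolvable -/

/-- Two states of the same robots, mirror images of each other under a fixed relabelling `f`, stay
mirror images when all robots act at once and mirrored robots have opposite orientations. -/
theorem mirror_execution {k c : ℕ} (A : RobotAlgorithm c) (P : Finset GridPt)
    (init : Fin k → GridPt) (orient : Fin k → ℤˣ) (f : Fin k → Fin k) (hf : ∀ i, f (f i) = i)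
    (hor : ∀ i, orient (f i) = - orient i) (κ : ℤ)
    (hinit : ∀ i, init (f i) = ((init i).1, κ - (init i).2)) (t : ℕ) :
    let σ := execution A P init orient (fun _ => Finset.univ) t
    ∀ i, σ.pos (f i) = ((σ.pos i).1, κ - (σ.pos i).2) ∧ σ.light (f i) = σ.light i ∧
      σ.stage (f i) = σ.stage i := by
  induction t with
  | zero => intro σ i; exact ⟨hinit i, rfl, rfl⟩
  | succ t ih =>
    intro σ i
    set τ := execution A P init orient (fun _ => Finset.univ) t with hτ
    have hσ : σ = τ.next A P orient Finset.univ := rfl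
    have hd : ∀ i j, τ.pos (f j) - τ.pos (f i) = flipY (-1) (τ.pos j - τ.pos i) := by
      intro i j
      rw [(ih i).1, (ih j).1]
      ext <;> simp
    have hsees : ∀ i j, Sees τ.pos (f i) (f j) ↔ Sees τ.pos i j := by
      intro i j
      constructor
      · intro h l hl
        exact h (f l) ((sbtw_congr (-1) (hd i l) (hd i j)).2 hl)
      · intro h l hl
        refine h (f l) ?_
        rw [← hf l] at hl
        exact (sbtw_congr (-1) (hd i (f l)) (hd i j)).1 hl
    have hview : τ.view (orient (f i)) (f i) = τ.view (orient i) i := by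
      ext x
      simp only [SwarmState.view, Finset.mem_image, Finset.mem_filter, Finset.mem_univ, true_and]
      have key : ∀ i j, flipY (orient (f i)) (τ.pos (f j) - τ.pos (f i)) =
          flipY (orient i) (τ.pos j - τ.pos i) := by
        intro i j
        rw [hd, flipY_flipY, hor]
        congr 1
        simp
      constructor
      · rintro ⟨j, ⟨hj, hs⟩, rfl⟩
        refine ⟨f j, ⟨fun h => hj (by rw [← h, hf]), ?_⟩, ?_⟩
        · rw [← hsees, hf]; exact hs
        · rw [← key, hf, (ih j).2.1]
      · rintro ⟨j, ⟨hj, hs⟩, rfl⟩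
        refine ⟨f j, ⟨fun h => hj ?_, (hsees _ _).2 hs⟩, ?_⟩
        · rw [← hf j, h, hf]
        · rw [key, (ih j).2.1]
    obtain ⟨h1, h2, h3⟩ := ih i
    simp only [hσ, SwarmState.next, Finset.mem_univ, if_true, h3, h2, hview]
    refine ⟨?_, trivial, trivial⟩
    cases τ.stage i with
    | idle => exact h1
    | looked v => exact h1
    | computed m =>
      simp only [h1, hor]
      ext <;> simp
      ring

theorem not_solvable_of_freeAxisSymmetry {k : ℕ} (hk : 0 < k) (init : Fin k → GridPt)
    (hinj : Function.Injective init) (hsym : HasFreeAxisSymmetry init) : ¬ APFSolvable init := by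
  rintro ⟨c, A, hA⟩
  obtain ⟨κ, hκ, hfree⟩ := hsym
  choose f hf1 hf2 using hκ
  have hff : ∀ i, f (f i) = i := by
    intro i
    apply hinj
    have h1 := hf2 (f i)
    rw [hf2 i] at h1
    have h2 : ((init (f (f i))).2 : ℝ) = (init i).2 := by rw [h1]; ring
    exact Prod.ext (by rw [hf1, hf1]) (by exact_mod_cast h2)
  have hfne : ∀ i, f i ≠ i := by
    intro i h
    have := hf2 i
    rw [h] at this
    exact hfree i (by linarith)
  let i₀ : Fin k := ⟨0, hk⟩
  set K : ℤ := (init (f i₀)).2 + (init i₀).2 with hK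
  have hKκ : (K : ℝ) = 2 * κ := by
    have := hf2 i₀
    rw [hK]; push_cast; linarith
  have hinit : ∀ i, init (f i) = ((init i).1, K - (init i).2) := by
    intro i
    refine Prod.ext (hf1 i) ?_
    have := hf2 i
    rw [← hKκ] at this
    exact_mod_cast this
  let orient : Fin k → ℤˣ := fun i => if i < f i then 1 else -1
  have hor : ∀ i, orient (f i) = - orient i := by
    intro i
    simp only [orient, hff]
    rcases lt_or_gt_of_ne (hfne i) with h | h
    · rw [if_pos h, if_neg (not_lt.2 h.le)]; simp
    · rw [if_neg (not_lt.2 h.le), if_pos h]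
  let P : Finset GridPt := (Finset.range k).image fun n : ℕ => ((n : ℤ), (0 : ℤ))
  have hP : P.card = k := by
    rw [Finset.card_image_of_injective _ (fun a b h => by simpa using h), Finset.card_range]
  obtain ⟨hi, T, ⟨v, s, hform⟩, -⟩ := hA P hP orient (fun _ => Finset.univ)
    (fun i t => ⟨t, le_rfl, Finset.mem_univ _⟩)
  obtain ⟨hm, -, -⟩ := mirror_execution A P init orient f hff hor K hinit T i₀
  set pos := (execution A P init orient (fun _ => Finset.univ) T).pos
  -- the pattern is a horizontal segment, so all robots end in one row
  have hrow : ∀ i, (pos i).2 = v.2 := by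
    intro i
    have : pos i ∈ Finset.univ.image pos := Finset.mem_image_of_mem _ (Finset.mem_univ _)
    rw [hform] at this
    simp only [P, Finset.mem_image] at this
    obtain ⟨q, ⟨n, -, rfl⟩, h⟩ := this
    rw [← h]; simp
  refine hfne i₀ (hi T (Prod.ext ?_ ?_))
  · have := congrArg Prod.fst hm
    simpa using this
  · exact (hrow _).trans (hrow _).symm

/-! ### Serial executions and completion -/

/-- What a robot is engaged in, as far as the future is concerned. A robot is `idle` when nothing
effective is pending: it is inactive, or it holds a snapshot from which it will compute a null action, or
a null move is pending. Displacements are those of the global frame. -/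
inductive Engagement (c : ℕ) : Type
  | idle
  /-- a snapshot was taken which leads to this light and this displacement -/
  | decided (l : Fin c) (d : GridPt)
  /-- the new light is shown, this displacement is pending -/
  | moving (d : GridPt)

/-- A swarm state in which snapshots are replaced by their outcomes in the global frame. -/
structure Cfg (k c : ℕ) where
  pos : Fin k → GridPt
  light : Fin k → Fin c
  act : Fin k → Engagement c

theorem view_congr {k c : ℕ} {σ τ : SwarmState k c} (hp : σ.pos = τ.pos) (hl : σ.light = τ.light)
    (s : ℤˣ) (i : Fin k) : σ.view s i = τ.view s i := by
  cases σ; cases τ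
  simp only at hp hl
  subst hp hl
  rfl

/-- The snapshot of robot `i`, in the frame with `Y`-orientation `s`. -/
noncomputable def snapshot {k c : ℕ} (pos : Fin k → GridPt) (light : Fin k → Fin c) (s : ℤˣ)
    (i : Fin k) : Snapshot c :=
  SwarmState.view ⟨pos, light, fun _ => .idle⟩ s i

/-- The light and the displacement, in the global frame, that robot `i` computes from a snapshot
taken now. -/
noncomputable def outcome {k c : ℕ} (A : RobotAlgorithm c) (P : Finset GridPt) (orient : Fin k → ℤˣ)
    (pos : Fin k → GridPt) (light : Fin k → Fin c) (i : Fin k) : Fin c × GridPt :=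
  ((A.compute P (light i) (snapshot pos light (orient i) i)).1,
    flipY (orient i) (A.compute P (light i) (snapshot pos light (orient i) i)).2.disp)

section Completion

variable {k c : ℕ} (A : RobotAlgorithm c) (P : Finset GridPt) (orient : Fin k → ℤˣ)

/-- Robot `i` is going to do something effective at one of its next activations. -/
def Cfg.Enabled (C : Cfg k c) (i : Fin k) : Prop :=
  C.act i ≠ .idle ∨ outcome A P orient C.pos C.light i ≠ (C.light i, 0)

/-- The next effective action of robot `i`, performed while the other robots do nothing. -/
noncomputable def Cfg.advance (C : Cfg k c) (i : Fin k) : Cfg k c :=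
  match C.act i with
  | .idle => ⟨C.pos, C.light, Function.update C.act i
      (.decided (outcome A P orient C.pos C.light i).1 (outcome A P orient C.pos C.light i).2)⟩
  | .decided l d => ⟨C.pos, Function.update C.light i l,
      Function.update C.act i (if d = 0 then .idle else .moving d)⟩
  | .moving d => ⟨Function.update C.pos i (C.pos i + d), C.light, Function.update C.act i .idle⟩

/-- `Completes n C`: however effective actions are interleaved, one at a time, from `C` on, there are at
most `n` of them, no two robots ever share a grid point, and the pattern is formed in the end. -/
inductive Completes : ℕ → Cfg k c → Prop
  | done {n : ℕ} {C : Cfg k c} : Function.Injective C.pos → (∀ i, ¬ C.Enabled A P orient i) →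
      FormsPattern C.pos P → Completes n C
  | step {n : ℕ} {C : Cfg k c} : Function.Injective C.pos → (∃ i, C.Enabled A P orient i) →
      (∀ i, C.Enabled A P orient i → Completes n (C.advance A P orient i)) → Completes (n + 1) C

variable {A P orient}

theorem Completes.mono {n m : ℕ} {C : Cfg k c} (h : Completes A P orient n C) (hnm : n ≤ m) :
    Completes A P orient m C := by
  induction h generalizing m with
  | done h1 h2 h3 => exact .done h1 h2 h3
  | step h1 h2 _ ih =>
    obtain ⟨m, rfl⟩ : ∃ m', m = m' + 1 := ⟨m - 1, by omega⟩
    exact .step h1 h2 fun i hi => ih i hi (by omega)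

theorem Completes.injective {n : ℕ} {C : Cfg k c} (h : Completes A P orient n C) :
    Function.Injective C.pos := by
  cases h <;> assumption

variable (A P orient) in
/-- The stage of a robot in a swarm state fits an engagement. -/
def StageFits (l : Fin c) (s : ℤˣ) : RobotStage c → Engagement c → Prop
  | .idle, .idle => True
  | .looked v, .idle => (A.compute P l v).1 = l ∧ flipY s (A.compute P l v).2.disp = 0
  | .computed m, .idle => flipY s m.disp = 0
  | .looked v, .decided l' d => (A.compute P l v).1 = l' ∧ flipY s (A.compute P l v).2.disp = d
  | .computed m, .moving d => flipY s m.disp = d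
  | _, _ => False

variable (A P orient) in
/-- The configuration `C` is the abstraction of the swarm state `σ`. -/
structure Abstracts (σ : SwarmState k c) (C : Cfg k c) : Prop where
  pos : C.pos = σ.pos
  light : C.light = σ.light
  fits : ∀ i, StageFits A P (σ.light i) (orient i) (σ.stage i) (C.act i)

theorem next_insert {σ : SwarmState k c} {i : Fin k} {s : Finset (Fin k)} (hi : i ∉ s)
    (h : (∀ j ∈ s, σ.stage j = .idle) ∨ σ.stage i ≠ .idle) :
    σ.next A P orient (insert i s) = (σ.next A P orient s).next A P orient {i} := by
  have hst : (σ.next A P orient s).stage i = σ.stage i := by simp [SwarmState.next, hi]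
  have hpos : (σ.next A P orient s).pos i = σ.pos i := by simp [SwarmState.next, hi]
  have hl : (σ.next A P orient s).light i = σ.light i := by simp [SwarmState.next, hi]
  have hview : σ.stage i = .idle → (σ.next A P orient s).view (orient i) i = σ.view (orient i) i := by
    intro hid
    have hs : ∀ j ∈ s, σ.stage j = .idle := h.resolve_right (not_not.2 hid)
    have e1 : (σ.next A P orient s).pos = σ.pos := by
      funext j
      by_cases hj : j ∈ s <;> simp [SwarmState.next, hj]
      rw [hs j hj]
    have e2 : (σ.next A P orient s).light = σ.light := by
      funext j
      by_cases hj : j ∈ s <;> simp [SwarmState.next, hj]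
      rw [hs j hj]
    exact view_congr e1 e2 _ _
  rw [SwarmState.mk.injEq (pos := (σ.next A P orient (insert i s)).pos)]
  refine ⟨?_, ?_, ?_⟩ <;> funext j <;> by_cases hj : j = i
  all_goals first
    | subst hj
    | skip
  · simp only [SwarmState.next, Finset.mem_insert, true_or, if_true, Finset.mem_singleton]
    simp only [hi, if_false]
  · simp [SwarmState.next, hj]
  · simp only [SwarmState.next, Finset.mem_insert, true_or, if_true, Finset.mem_singleton]
    simp only [hi, if_false]
  · simp [SwarmState.next, hj]
  · conv_rhs => rw [SwarmState.next]
    simp only [Finset.mem_singleton, if_true, hst, hl]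
    simp only [SwarmState.next, Finset.mem_insert, true_or, if_true]
    cases hs : σ.stage j with
    | idle => simp only; rw [← hview hs]; rfl
    | looked v => rfl
    | computed m => rfl
  · simp [SwarmState.next, hj]

/-- How far a robot without effective pending action is from its next snapshot. This decreases with every
activation that does not advance the abstraction, so an enabled robot does something effective after at
most three activations. -/
def RobotStage.rank : RobotStage c → ℕ
  | .idle => 0
  | .computed _ => 1
  | .looked _ => 2

/-- One robot acts: the abstraction is unchanged, or it advances by one effective action. -/
theorem Abstracts.next_single {σ : SwarmState k c} {C : Cfg k c} (h : Abstracts A P orient σ C)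
    (i : Fin k) :
    (Abstracts A P orient (σ.next A P orient {i}) C ∧ (σ.next A P orient {i}).pos = σ.pos ∧
      (C.Enabled A P orient i → C.act i = .idle ∧
        (σ.stage i).rank = ((σ.next A P orient {i}).stage i).rank + 1)) ∨
    (C.Enabled A P orient i ∧ Abstracts A P orient (σ.next A P orient {i}) (C.advance A P orient i)) := by
  obtain ⟨hp, hl, hf⟩ := h
  have hfi := hf i
  have hother : ∀ j, j ≠ i → (σ.next A P orient {i}).pos j = σ.pos j ∧
      (σ.next A P orient {i}).light j = σ.light j ∧ (σ.next A P orient {i}).stage j = σ.stage j := by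
    intro j hj
    simp [SwarmState.next, hj]
  have hself : (σ.next A P orient {i}).pos i =
        (match σ.stage i with
        | .computed m => σ.pos i + flipY (orient i) m.disp
        | _ => σ.pos i) ∧
      (σ.next A P orient {i}).light i =
        (match σ.stage i with
        | .looked v => (A.compute P (σ.light i) v).1
        | _ => σ.light i) ∧
      (σ.next A P orient {i}).stage i =
        (match σ.stage i with
        | .idle => .looked (σ.view (orient i) i)
        | .looked v => .computed (A.compute P (σ.light i) v).2
        | .computed _ => .idle) := by
    refine ⟨?_, ?_, ?_⟩ <;> simp only [SwarmState.next, Finset.mem_singleton, if_true]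
  generalize σ.next A P orient {i} = τ at hother hself ⊢
  have hsnap : snapshot σ.pos σ.light (orient i) i = σ.view (orient i) i := rfl
  have hout : outcome A P orient C.pos C.light i =
      ((A.compute P (σ.light i) (σ.view (orient i) i)).1,
        flipY (orient i) (A.compute P (σ.light i) (σ.view (orient i) i)).2.disp) := by
    rw [outcome, hp, hl, hsnap]
  -- an action without effect
  have null : τ.pos i = σ.pos i → τ.light i = σ.light i →
      StageFits A P (σ.light i) (orient i) (τ.stage i) (C.act i) →
      Abstracts A P orient τ C ∧ τ.pos = σ.pos := by
    intro h1 h2 h3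
    have e1 : τ.pos = σ.pos := by
      funext j
      by_cases hj : j = i
      · rw [hj, h1]
      · exact (hother j hj).1
    have e2 : τ.light = σ.light := by
      funext j
      by_cases hj : j = i
      · rw [hj, h2]
      · exact (hother j hj).2.1
    refine ⟨⟨hp.trans e1.symm, hl.trans e2.symm, fun j => ?_⟩, e1⟩
    by_cases hj : j = i
    · rw [hj, h2]; exact h3
    · rw [e2, (hother j hj).2.2]; exact hf j
  have hupd : ∀ (C' : Cfg k c) (x : Engagement c), C'.act = Function.update C.act i x →
      C'.pos = Function.update C.pos i (τ.pos i) → C'.light = Function.update C.light i (τ.light i) →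
      StageFits A P (τ.light i) (orient i) (τ.stage i) x → Abstracts A P orient τ C' := by
    intro C' x h1 h2 h3 h4
    refine ⟨?_, ?_, fun j => ?_⟩
    · rw [h2]
      funext j
      by_cases hj : j = i
      · rw [hj]; simp
      · simp [hj, hp, (hother j hj).1]
    · rw [h3]
      funext j
      by_cases hj : j = i
      · rw [hj]; simp
      · simp [hj, hl, (hother j hj).2.1]
    · rw [h1]
      by_cases hj : j = i
      · rw [hj]; simpa using h4
      · simpa [hj, (hother j hj).2.1, (hother j hj).2.2] using hf j
  have hpi := congrFun hp i
  have hli := congrFun hl i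
  cases hC : C.act i with
  | idle =>
    cases hs : σ.stage i with
    | idle =>
      rw [hs] at hself
      by_cases hen : outcome A P orient C.pos C.light i = (C.light i, 0)
      · left
        have e : Abstracts A P orient τ C ∧ τ.pos = σ.pos := by
          refine null hself.1 hself.2.1 ?_
          rw [hself.2.2, hC]
          rw [hout, Prod.mk.injEq, hli] at hen
          exact hen
        refine ⟨e.1, e.2, ?_⟩
        rintro (h | h)
        · exact absurd hC h
        · exact absurd hen h
      · right
        refine ⟨.inr hen, hupd _ (.decided (outcome A P orient C.pos C.light i).1
          (outcome A P orient C.pos C.light i).2) ?_ ?_ ?_ ?_⟩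
        · simp only [Cfg.advance, hC]
        · simp only [Cfg.advance, hC, hself.1, ← hpi, Function.update_eq_self]
        · simp only [Cfg.advance, hC, hself.2.1, ← hli, Function.update_eq_self]
        · rw [hself.2.2, hout, hself.2.1]
          exact ⟨rfl, rfl⟩
    | looked v =>
      rw [hs] at hself
      rw [hs, hC] at hfi
      left
      have e : Abstracts A P orient τ C ∧ τ.pos = σ.pos := by
        refine null hself.1 (hself.2.1.trans hfi.1) ?_
        rw [hself.2.2, hC]
        exact hfi.2
      refine ⟨e.1, e.2, fun _ => ⟨rfl, ?_⟩⟩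
      rw [hself.2.2]; rfl
    | computed m =>
      rw [hs] at hself
      rw [hs, hC] at hfi
      left
      have e : Abstracts A P orient τ C ∧ τ.pos = σ.pos := by
        refine null ?_ hself.2.1 ?_
        · rw [hself.1]
          have : flipY (orient i) m.disp = 0 := hfi
          simp [this]
        · rw [hself.2.2, hC]
          trivial
      refine ⟨e.1, e.2, fun _ => ⟨rfl, ?_⟩⟩
      rw [hself.2.2]; rfl
  | decided l d =>
    right
    refine ⟨.inl (by rw [hC]; simp), ?_⟩
    cases hs : σ.stage i with
    | idle => rw [hs, hC] at hfi; exact hfi.elim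
    | computed m => rw [hs, hC] at hfi; exact hfi.elim
    | looked v =>
      rw [hs] at hself
      rw [hs, hC] at hfi
      refine hupd _ (if d = 0 then .idle else .moving d) ?_ ?_ ?_ ?_
      · simp only [Cfg.advance, hC]
      · simp only [Cfg.advance, hC, hself.1, ← hpi, Function.update_eq_self]
      · simp only [Cfg.advance, hC, hself.2.1]
        rw [hfi.1]
      · rw [hself.2.2]
        split_ifs with hd
        · exact hfi.2.trans hd
        · exact hfi.2
  | moving d =>
    right
    refine ⟨.inl (by rw [hC]; simp), ?_⟩
    cases hs : σ.stage i with
    | idle => rw [hs, hC] at hfi; exact hfi.elim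
    | looked v => rw [hs, hC] at hfi; exact hfi.elim
    | computed m =>
      rw [hs] at hself
      rw [hs, hC] at hfi
      have hm : flipY (orient i) m.disp = d := hfi
      refine hupd _ .idle ?_ ?_ ?_ ?_
      · simp only [Cfg.advance, hC]
      · simp only [Cfg.advance, hC, hself.1]
        rw [hm, hpi]
      · simp only [Cfg.advance, hC, hself.2.1, ← hli, Function.update_eq_self]
      · rw [hself.2.2]
        trivial

/-- A time step, as a sequence of effective actions of single robots. -/
theorem Abstracts.next {σ : SwarmState k c} {C : Cfg k c} {n : ℕ} (h : Abstracts A P orient σ C)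
    (hC : Completes A P orient n C) (s : Finset (Fin k)) :
    ∃ C' n', Abstracts A P orient (σ.next A P orient s) C' ∧ Completes A P orient n' C' ∧
      n' + (s.filter fun i => (σ.next A P orient s).pos i ≠ σ.pos i).card ≤ n ∧
      (n' < n ∨ C' = C ∧ n' = n ∧ ∀ i ∈ s, C.Enabled A P orient i →
        (σ.stage i).rank = ((σ.next A P orient s).stage i).rank + 1) := by
  classical
  -- robots that take a snapshot come first, since snapshots show the state before the step
  have main : ∀ s' : Finset (Fin k), ∀ i, i ∉ s' →
      ((∀ j ∈ s', σ.stage j = .idle) ∨ σ.stage i ≠ .idle) →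
      (∃ C' n', Abstracts A P orient (σ.next A P orient s') C' ∧ Completes A P orient n' C' ∧
      n' + (s'.filter fun i => (σ.next A P orient s').pos i ≠ σ.pos i).card ≤ n ∧
      (n' < n ∨ C' = C ∧ n' = n ∧ ∀ i ∈ s', C.Enabled A P orient i →
        (σ.stage i).rank = ((σ.next A P orient s').stage i).rank + 1)) →
      (∃ C' n', Abstracts A P orient (σ.next A P orient (insert i s')) C' ∧ Completes A P orient n' C' ∧
      n' + ((insert i s').filter fun j => (σ.next A P orient (insert i s')).pos j ≠ σ.pos j).card ≤ n ∧
      (n' < n ∨ C' = C ∧ n' = n ∧ ∀ j ∈ insert i s', C.Enabled A P orient j →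
        (σ.stage j).rank = ((σ.next A P orient (insert i s')).stage j).rank + 1)) := by
    intro s' i hi hor
    rw [next_insert hi hor]
    have hpi : (σ.next A P orient s').pos i = σ.pos i := by simp [SwarmState.next, hi]
    have hsi : (σ.next A P orient s').stage i = σ.stage i := by simp [SwarmState.next, hi]
    generalize σ.next A P orient s' = τ at hpi hsi ⊢
    rintro ⟨C', n', h1, h2, h3, h4⟩
    have hother : ∀ j, j ≠ i → (τ.next A P orient {i}).pos j = τ.pos j ∧
        (τ.next A P orient {i}).stage j = τ.stage j := by
      intro j hj
      simp [SwarmState.next, hj]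
    have hfilt : (s'.filter fun j => (τ.next A P orient {i}).pos j ≠ σ.pos j) =
        s'.filter fun j => τ.pos j ≠ σ.pos j := by
      apply Finset.filter_congr
      intro j hj
      rw [(hother j (fun e => hi (e ▸ hj))).1]
    rw [Finset.filter_insert, hfilt]
    rcases h1.next_single i with ⟨h5, h6, h7⟩ | ⟨h5, h6⟩
    · refine ⟨C', n', h5, h2, ?_, ?_⟩
      · rw [if_neg]
        · exact h3
        · rw [h6, hpi]; simp
      · refine h4.imp_right fun ⟨e1, e2, e3⟩ => ⟨e1, e2, fun j hj hen => ?_⟩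
        by_cases hji : j = i
        · subst hji
          rw [← hsi]
          exact (h7 (e1 ▸ hen)).2
        · rw [(hother j hji).2]
          exact e3 j (Finset.mem_of_mem_insert_of_ne hj hji) hen
    · cases h2 with
      | done _ hno _ => exact absurd h5 (hno i)
      | @step m _ _ _ hst =>
        refine ⟨_, m, h6, hst i h5, ?_, .inl ?_⟩
        · have : (if (τ.next A P orient {i}).pos i ≠ σ.pos i then
              insert i (s'.filter fun j => τ.pos j ≠ σ.pos j)
              else s'.filter fun j => τ.pos j ≠ σ.pos j).card ≤
              (s'.filter fun j => τ.pos j ≠ σ.pos j).card + 1 := by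
            split_ifs
            · exact Finset.card_insert_le _ _
            · omega
          omega
        · rcases h4 with h4 | ⟨-, h4, -⟩ <;> omega
  have hlook : ∀ s' : Finset (Fin k), (∀ j ∈ s', σ.stage j = .idle) →
      (∃ C' n', Abstracts A P orient (σ.next A P orient s') C' ∧ Completes A P orient n' C' ∧
      n' + (s'.filter fun i => (σ.next A P orient s').pos i ≠ σ.pos i).card ≤ n ∧
      (n' < n ∨ C' = C ∧ n' = n ∧ ∀ i ∈ s', C.Enabled A P orient i →
        (σ.stage i).rank = ((σ.next A P orient s').stage i).rank + 1)) := by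
    intro s' 
    induction s' using Finset.induction_on with
    | empty =>
      intro _
      refine ⟨C, n, ?_, hC, by simp, .inr ⟨rfl, rfl, by simp⟩⟩
      have : σ.next A P orient ∅ = σ := by simp [SwarmState.next]
      rw [this]; exact h
    | insert i s' hi ih =>
      intro hs
      exact main s' i hi (.inl fun j hj => hs j (Finset.mem_insert_of_mem hj))
        (ih fun j hj => hs j (Finset.mem_insert_of_mem hj))
  have hall : ∀ r : Finset (Fin k), (∀ j ∈ r, σ.stage j ≠ .idle) → r ⊆ s → 
      (∃ C' n', Abstracts A P orient (σ.next A P orient (r ∪ s.filter fun j => σ.stage j = .idle)) C' ∧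
      Completes A P orient n' C' ∧
      n' + ((r ∪ s.filter fun j => σ.stage j = .idle).filter fun i =>
        (σ.next A P orient (r ∪ s.filter fun j => σ.stage j = .idle)).pos i ≠ σ.pos i).card ≤ n ∧
      (n' < n ∨ C' = C ∧ n' = n ∧ ∀ i ∈ r ∪ s.filter fun j => σ.stage j = .idle,
        C.Enabled A P orient i →
        (σ.stage i).rank =
          ((σ.next A P orient (r ∪ s.filter fun j => σ.stage j = .idle)).stage i).rank + 1)) := by
    intro r
    induction r using Finset.induction_on with
    | empty =>
      intro _ _
      rw [Finset.empty_union]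
      exact hlook _ (by simp)
    | insert i r hi ih =>
      intro hr hrs
      rw [Finset.insert_union]
      refine main _ i ?_ (.inr (hr i (Finset.mem_insert_self _ _)))
        (ih (fun j hj => hr j (Finset.mem_insert_of_mem hj))
          ((Finset.subset_insert _ _).trans hrs))
      simp [hi, hr i (Finset.mem_insert_self _ _)]
  have := hall (s.filter fun j => σ.stage j ≠ .idle) (by simp) (Finset.filter_subset _ _)
  have e : (s.filter fun j => σ.stage j ≠ .idle) ∪ (s.filter fun j => σ.stage j = .idle) = s := by
    ext j; simp only [Finset.mem_union, Finset.mem_filter]; tauto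
  rw [e] at this
  exact this

variable {init : Fin k → GridPt} {sched : ℕ → Finset (Fin k)}

/-- Under a fair schedule an enabled robot brings the execution nearer to its end. -/
theorem exists_progress (hfair : FairSchedule sched) {C : Cfg k c} {n : ℕ}
    (hC : Completes A P orient n C) {i : Fin k} (hi : C.Enabled A P orient i) (r : ℕ) :
    ∀ t, Abstracts A P orient (execution A P init orient sched t) C →
      ((execution A P init orient sched t).stage i).rank < r →
      ∃ t' C' n', t ≤ t' ∧ n' < n ∧ Abstracts A P orient (execution A P init orient sched t') C' ∧
        Completes A P orient n' C' := by
  induction r with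
  | zero => intro t _ h; omega
  | succ r ih =>
    -- induction on the number `d` of steps until the next activation of the robot
    suffices H : ∀ d t, i ∈ sched (t + d) →
        Abstracts A P orient (execution A P init orient sched t) C →
        ((execution A P init orient sched t).stage i).rank < r + 1 →
        ∃ t' C' n', t ≤ t' ∧ n' < n ∧ Abstracts A P orient (execution A P init orient sched t') C' ∧
          Completes A P orient n' C' by
      intro t
      obtain ⟨t', ht, hmem⟩ := hfair i t
      obtain ⟨d, rfl⟩ := Nat.exists_eq_add_of_le ht
      exact H d t hmem
    intro d
    induction d with
    | zero =>
      intro t hmem habs hrk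
      obtain ⟨C', n', h1, h2, -, h4 | ⟨rfl, rfl, h4⟩⟩ := habs.next hC (sched t)
      · exact ⟨t + 1, C', n', by omega, h4, h1, h2⟩
      · have := h4 i hmem hi
        obtain ⟨t', C'', n'', h5, h6⟩ := ih (t + 1) h1 (by
          change ((SwarmState.next A P orient (sched t) _).stage i).rank < r
          omega)
        exact ⟨t', C'', n'', by omega, h6⟩
    | succ d ihd =>
      intro t hmem habs hrk
      by_cases hit : i ∈ sched t
      · obtain ⟨C', n', h1, h2, -, h4 | ⟨rfl, rfl, h4⟩⟩ := habs.next hC (sched t)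
        · exact ⟨t + 1, C', n', by omega, h4, h1, h2⟩
        · have := h4 i hit hi
          obtain ⟨t', C'', n'', h5, h6⟩ := ih (t + 1) h1 (by
            change ((SwarmState.next A P orient (sched t) _).stage i).rank < r
            omega)
          exact ⟨t', C'', n'', by omega, h6⟩
      · obtain ⟨C', n', h1, h2, -, h4 | ⟨rfl, rfl, -⟩⟩ := habs.next hC (sched t)
        · exact ⟨t + 1, C', n', by omega, h4, h1, h2⟩
        · obtain ⟨t', C'', n'', h5, h6⟩ := ihd (t + 1) (by rwa [Nat.add_right_comm]) h1 (by
            simpa [execution, SwarmState.next, hit] using hrk)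
          exact ⟨t', C'', n'', by omega, h6⟩

theorem exists_formed (hfair : FairSchedule sched) (n : ℕ) : ∀ (C : Cfg k c) (t : ℕ),
    Completes A P orient n C → Abstracts A P orient (execution A P init orient sched t) C →
    ∃ (T : ℕ) (C' : Cfg k c), Completes A P orient 0 C' ∧ FormsPattern C'.pos P ∧
      Abstracts A P orient (execution A P init orient sched T) C' := by
  induction n using Nat.strong_induction_on with
  | _ n ih =>
    intro C t hC habs
    cases hC with
    | done h1 h2 h3 => exact ⟨t, C, .done h1 h2 h3, h3, habs⟩
    | step h1 h2 h3 =>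
      obtain ⟨i, hi⟩ := h2
      obtain ⟨t', C', n', -, h4, h5, h6⟩ := exists_progress (init := init) hfair
        (Completes.step h1 ⟨i, hi⟩ h3) hi _ t habs (Nat.lt_succ_self _)
      exact ih n' h4 C' t' h6 h5

/-- The initial configuration as a serial configuration. -/
def Cfg.start (off : Fin c) (init : Fin k → GridPt) : Cfg k c :=
  ⟨init, fun _ => off, fun _ => .idle⟩

/-- The numbers of moves made so far and of effective actions still possible add up to at most `n`. -/
theorem exists_abstraction {n : ℕ} (hC : Completes A P orient n (Cfg.start A.off init)) (t : ℕ) :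
    ∃ C' n', Abstracts A P orient (execution A P init orient sched t) C' ∧
      Completes A P orient n' C' ∧ n' + moveCount A P init orient sched t ≤ n := by
  classical
  induction t with
  | zero =>
    exact ⟨Cfg.start A.off init, n, ⟨rfl, rfl, fun _ => trivial⟩, hC, by simp [moveCount]⟩
  | succ t ih =>
    obtain ⟨C, m, h1, h2, h3⟩ := ih
    obtain ⟨C', n', h4, h5, h6, -⟩ := h1.next h2 (sched t)
    refine ⟨C', n', h4, h5, ?_⟩
    have : (Finset.univ.filter fun i : Fin k => (execution A P init orient sched (t + 1)).pos i ≠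
        (execution A P init orient sched t).pos i) =
        (sched t).filter fun i => ((execution A P init orient sched t).next A P orient (sched t)).pos i ≠
          (execution A P init orient sched t).pos i := by
      ext i
      simp only [Finset.mem_filter, Finset.mem_univ, true_and]
      refine ⟨fun h => ⟨?_, h⟩, fun h => h.2⟩
      by_contra hi
      exact h (by simp [execution, SwarmState.next, hi])
    unfold moveCount at h3 ⊢
    rw [Finset.sum_range_succ, this]
    omega

/-- Serial completion is enough: the asynchronous executions form the pattern. -/
theorem Completes.solves (h : ∀ orient, ∃ n, Completes A P orient n (Cfg.start A.off init)) :
    SolvesPattern A P init := by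
  intro orient sched hfair
  obtain ⟨n, hC⟩ := h orient
  refine ⟨fun t => ?_, ?_⟩
  · obtain ⟨C', n', h1, h2, -⟩ := exists_abstraction (sched := sched) hC t
    rw [← h1.pos]
    exact h2.injective
  · have h0 : Abstracts A P orient (execution A P init orient sched 0) (Cfg.start A.off init) :=
      ⟨rfl, rfl, fun _ => trivial⟩
    obtain ⟨T, C, h1, h2, h3⟩ := exists_formed hfair n _ 0 hC h0
    have hstay : ∀ t, T ≤ t → Abstracts A P orient (execution A P init orient sched t) C := by
      intro t ht
      induction t, ht using Nat.le_induction with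
      | base => exact h3
      | succ t _ ih =>
        obtain ⟨C', n', h4, -, -, h6 | ⟨rfl, -, -⟩⟩ := ih.next h1 (sched t)
        · omega
        · exact h4
    exact ⟨T, h3.pos ▸ h2, fun t ht => (hstay t ht).pos.symm.trans h3.pos⟩

theorem Completes.moveCount_le {n : ℕ} (h : Completes A P orient n (Cfg.start A.off init)) (T : ℕ) :
    moveCount A P init orient sched T ≤ n := by
  obtain ⟨C', n', -, -, h3⟩ := exists_abstraction (sched := sched) h T
  omega

end Completion

/-! ### Sequential and two-robot phases -/

section Phases

variable {k c : ℕ} {A : RobotAlgorithm c} {P : Finset GridPt} {orient : Fin k → ℤˣ}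

/-- The configuration in which no effective action is pending. -/
def Cfg.quiet (pos : Fin k → GridPt) (light : Fin k → Fin c) : Cfg k c :=
  ⟨pos, light, fun _ => .idle⟩

variable (A P orient) in
/-- A snapshot taken now by robot `i` leads to a null action. -/
def Rests (pos : Fin k → GridPt) (light : Fin k → Fin c) (i : Fin k) : Prop :=
  outcome A P orient pos light i = (light i, 0)

/-- If `j` is the only robot that does not rest, it performs its light change and its move before anything
else happens. -/
theorem Completes.seq_step {n : ℕ} {pos : Fin k → GridPt} {light : Fin k → Fin c}
    (hinj : Function.Injective pos) {j : Fin k} {l : Fin c} {d : GridPt}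
    (hj : outcome A P orient pos light j = (l, d)) (hne : (l, d) ≠ (light j, 0))
    (hrest : ∀ i, i ≠ j → Rests A P orient pos light i)
    (hrest' : d ≠ 0 → ∀ i, i ≠ j → Rests A P orient pos (Function.update light j l) i)
    (h : Completes A P orient n
      (Cfg.quiet (Function.update pos j (pos j + d)) (Function.update light j l))) :
    Completes A P orient (n + 3) (Cfg.quiet pos light) := by
  have only : ∀ {C : Cfg k c}, C.pos = pos → (∀ i, i ≠ j → C.act i = .idle) →
      (∀ i, i ≠ j → Rests A P orient pos C.light i) → ∀ i, C.Enabled A P orient i → i = j := by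
    intro C h1 h2 h3 i hi
    by_contra hij
    rcases hi with hi | hi
    · exact hi (h2 i hij)
    · rw [h1] at hi
      exact hi (h3 i hij)
  have hen : (Cfg.quiet pos light).Enabled A P orient j := .inr (by
    change outcome A P orient pos light j ≠ (light j, 0)
    rwa [hj])
  refine .step hinj ⟨j, hen⟩ fun i hi => ?_
  obtain rfl := only (C := Cfg.quiet pos light) rfl (fun _ _ => rfl) hrest i hi
  have e1 : (Cfg.quiet pos light).advance A P orient i =
      ⟨pos, light, Function.update (fun _ => .idle) i (.decided l d)⟩ := by
    simp [Cfg.advance, Cfg.quiet, hj]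
  rw [e1]
  refine .step hinj ⟨i, .inl (by simp)⟩ fun i' hi' => ?_
  obtain rfl := only rfl (fun i' h => by simp [h]) hrest i' hi'
  have e2 : Cfg.advance A P orient ⟨pos, light, Function.update (fun _ => .idle) i' (.decided l d)⟩ i' =
      ⟨pos, Function.update light i' l,
        Function.update (fun _ => .idle) i' (if d = 0 then .idle else .moving d)⟩ := by
    simp [Cfg.advance]
  rw [e2]
  by_cases hd : d = 0
  · subst hd
    refine Completes.mono (n := n) ?_ (by omega)
    simpa [Cfg.quiet] using h
  · rw [if_neg hd]
    refine .step hinj ⟨i', .inl (by simp)⟩ fun i hi => ?_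
    obtain rfl := only rfl (fun i' h => by simp [h]) (hrest' hd) i hi
    have e3 : Cfg.advance A P orient ⟨pos, Function.update light i l,
        Function.update (fun _ => .idle) i (.moving d)⟩ i =
        Cfg.quiet (Function.update pos i (pos i + d)) (Function.update light i l) := by
      simp [Cfg.advance, Cfg.quiet]
    rwa [e3]

theorem Completes.light_step {n : ℕ} {pos : Fin k → GridPt} {light : Fin k → Fin c}
    (hinj : Function.Injective pos) {j : Fin k} {l : Fin c}
    (hj : outcome A P orient pos light j = (l, 0)) (hne : l ≠ light j)
    (hrest : ∀ i, i ≠ j → Rests A P orient pos light i)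
    (h : Completes A P orient n (Cfg.quiet pos (Function.update light j l))) :
    Completes A P orient (n + 3) (Cfg.quiet pos light) := by
  refine Completes.seq_step hinj hj (fun e => hne (congrArg Prod.fst e)) hrest (fun h => absurd rfl h) ?_
  simpa using h

theorem Completes.move_step {n : ℕ} {pos : Fin k → GridPt} {light : Fin k → Fin c}
    (hinj : Function.Injective pos) {j : Fin k} {d : GridPt}
    (hj : outcome A P orient pos light j = (light j, d)) (hne : d ≠ 0)
    (hrest : ∀ i, i ≠ j → Rests A P orient pos light i)
    (h : Completes A P orient n (Cfg.quiet (Function.update pos j (pos j + d)) light)) :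
    Completes A P orient (n + 3) (Cfg.quiet pos light) := by
  refine Completes.seq_step hinj hj (fun e => hne (congrArg Prod.snd e)) hrest (fun _ => ?_) ?_
  · simpa using hrest
  · simpa using h

/-- The function that takes given values at two places. -/
def two {α : Type*} (a b : Fin k) (x y : α) (z : Fin k → α) : Fin k → α :=
  fun i => if i = a then x else if i = b then y else z i

@[simp] theorem two_left {α : Type*} (a b : Fin k) (x y : α) (z : Fin k → α) :
    two a b x y z a = x := by simp [two]

theorem two_right {α : Type*} {a b : Fin k} (hab : a ≠ b) (x y : α) (z : Fin k → α) :
    two a b x y z b = y := by simp [two, hab.symm]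

theorem two_other {α : Type*} {a b i : Fin k} (ha : i ≠ a) (hb : i ≠ b) (x y : α) (z : Fin k → α) :
    two a b x y z i = z i := by simp [two, ha, hb]

theorem two_swap {α : Type*} {a b : Fin k} (hab : a ≠ b) (x y : α) (z : Fin k → α) :
    two a b x y z = two b a y x z := by
  funext i
  by_cases h1 : i = a
  · subst h1; simp [two, hab]
  · simp [two, h1]

theorem update_two_left {α : Type*} (a b : Fin k) (x x' y : α) (z : Fin k → α) :
    Function.update (two a b x y z) a x' = two a b x' y z := by
  funext i
  by_cases h : i = a
  · subst h; simp
  · simp [two, h]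

theorem update_two_right {α : Type*} {a b : Fin k} (hab : a ≠ b) (x y y' : α) (z : Fin k → α) :
    Function.update (two a b x y z) b y' = two a b x y' z := by
  rw [two_swap hab, update_two_left, two_swap hab.symm]

/-- The engagement of a robot whose next action leads from `p` with light `l` to `p'` with light `l'`,
after `s` of the three parts look, compute, move of this action. -/
def partialAct (s : ℕ) (p p' : GridPt) (l' : Fin c) : Engagement c :=
  if s = 0 then .idle else if s = 1 then .decided l' (p' - p) else .moving (p' - p)

/-- Two robots `a`, `b` follow fixed itineraries (the `m`-th stop of `a` is the position `pa m` with the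
light `la m`), each at its own pace and possibly waiting for the other, while all others rest. If the
interleaving cannot disturb them they both reach their final stops. The index `x ≤ 1` in `la (m + x)`
allows for a robot that already shows the light of its next stop. -/
theorem Completes.two_robots {a b : Fin k} (hab : a ≠ b) (pos : Fin k → GridPt) (light : Fin k → Fin c)
    (pa pb : ℕ → GridPt) (la lb : ℕ → Fin c) (Na Nb n : ℕ)
    (hinj : ∀ m ≤ Na, ∀ m' ≤ Nb, Function.Injective (two a b (pa m) (pb m') pos))
    (hrest : ∀ m m' x y, m + x ≤ Na → m' + y ≤ Nb → x ≤ 1 → y ≤ 1 →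
      (x = 1 → pa (m + 1) ≠ pa m) → (y = 1 → pb (m' + 1) ≠ pb m') → ¬ (m = Na ∧ m' = Nb) →
      ∀ i, i ≠ a → i ≠ b → Rests A P orient (two a b (pa m) (pb m') pos)
        (two a b (la (m + x)) (lb (m' + y)) light) i)
    (ha : ∀ m m' y, m ≤ Na → m' + y ≤ Nb → y ≤ 1 →
      (y = 1 → pb (m' + 1) ≠ pb m') → ¬ (m = Na ∧ m' = Nb) →
      Rests A P orient (two a b (pa m) (pb m') pos) (two a b (la m) (lb (m' + y)) light) a ∨
      m < Na ∧ outcome A P orient (two a b (pa m) (pb m') pos) (two a b (la m) (lb (m' + y)) light) a =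
        (la (m + 1), pa (m + 1) - pa m))
    (hb : ∀ m m' x, m + x ≤ Na → m' ≤ Nb → x ≤ 1 →
      (x = 1 → pa (m + 1) ≠ pa m) → ¬ (m = Na ∧ m' = Nb) →
      Rests A P orient (two a b (pa m) (pb m') pos) (two a b (la (m + x)) (lb m') light) b ∨
      m' < Nb ∧ outcome A P orient (two a b (pa m) (pb m') pos) (two a b (la (m + x)) (lb m') light) b =
        (lb (m' + 1), pb (m' + 1) - pb m'))
    (hprog : ∀ m ≤ Na, ∀ m' ≤ Nb, ¬ (m = Na ∧ m' = Nb) →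
      ¬ Rests A P orient (two a b (pa m) (pb m') pos) (two a b (la m) (lb m') light) a ∨
      ¬ Rests A P orient (two a b (pa m) (pb m') pos) (two a b (la m) (lb m') light) b)
    (hend : Completes A P orient n
      (Cfg.quiet (two a b (pa Na) (pb Nb) pos) (two a b (la Na) (lb Nb) light))) :
    Completes A P orient (n + (3 * Na + 3 * Nb))
      (Cfg.quiet (two a b (pa 0) (pb 0) pos) (two a b (la 0) (lb 0) light)) := by
  -- a robot shows its new light after two of the three parts of an action
  let lit : ℕ → ℕ := fun s => if s = 2 then 1 else 0
  have lit_le : ∀ s, lit s ≤ 1 := fun s => by simp only [lit]; split_ifs <;> omega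
  -- `a` has performed `m` actions and `s` parts of the next one, `b` has performed `m'` and `s'` parts
  let conf : ℕ → ℕ → ℕ → ℕ → Cfg k c := fun m s m' s' =>
    ⟨two a b (pa m) (pb m') pos, two a b (la (m + lit s)) (lb (m' + lit s')) light,
      two a b (partialAct s (pa m) (pa (m + 1)) (la (m + 1)))
        (partialAct s' (pb m') (pb (m' + 1)) (lb (m' + 1))) fun _ => .idle⟩
  have conf0 : ∀ m m', conf m 0 m' 0 =
      Cfg.quiet (two a b (pa m) (pb m') pos) (two a b (la m) (lb m') light) := by
    intro m m'
    simp only [conf, Cfg.quiet, lit, partialAct]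
    congr 1
    funext i
    simp [two]
  suffices H : ∀ N m s m' s', m + (if s = 0 then 0 else 1) ≤ Na → m' + (if s' = 0 then 0 else 1) ≤ Nb →
      s ≤ 2 → s' ≤ 2 → (s = 2 → pa (m + 1) ≠ pa m) → (s' = 2 → pb (m' + 1) ≠ pb m') →
      3 * (Na - m) - s + (3 * (Nb - m') - s') ≤ N →
      Completes A P orient (n + N) (conf m s m' s') by
    rw [← conf0]
    exact H _ 0 0 0 0 (by simp) (by simp) (by omega) (by omega) (by omega) (by omega) (by omega)
  intro N
  induction N with
  | zero =>
    intro m s m' s' h1 h2 h3 h4 h6 h7 h5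
    have : m = Na ∧ m' = Nb ∧ s = 0 ∧ s' = 0 := by
      split_ifs at h1 h2 <;> omega
    obtain ⟨rfl, rfl, rfl, rfl⟩ := this
    rw [conf0]
    exact hend
  | succ N ih =>
    intro m s m' s' h1 h2 h3 h4 h6 h7 h5
    by_cases hex : m = Na ∧ m' = Nb
    · obtain ⟨rfl, rfl⟩ := hex
      have : s = 0 ∧ s' = 0 := by split_ifs at h1 h2 <;> omega
      obtain ⟨rfl, rfl⟩ := this
      rw [conf0]
      exact hend.mono (by omega)
    have hmN : m + lit s ≤ Na := by
      simp only [lit]; split_ifs at h1 ⊢ <;> omega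
    have hmN' : m' + lit s' ≤ Nb := by
      simp only [lit]; split_ifs at h2 ⊢ <;> omega
    have hlit : lit s = 1 → pa (m + 1) ≠ pa m := fun h => h6 (by
      simp only [lit] at h; split_ifs at h with h'; exact h')
    have hlit' : lit s' = 1 → pb (m' + 1) ≠ pb m' := fun h => h7 (by
      simp only [lit] at h; split_ifs at h with h'; exact h')
    have acta : (conf m s m' s').act a = partialAct s (pa m) (pa (m + 1)) (la (m + 1)) := by
      simp only [conf, two_left]
    have actb : (conf m s m' s').act b = partialAct s' (pb m') (pb (m' + 1)) (lb (m' + 1)) := by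
      simp only [conf, two_right hab]
    refine .step (hinj m (by omega) m' (by omega)) ?_ fun i hi => ?_
    · by_cases hs : s = 0
      · by_cases hs' : s' = 0
        · subst hs hs'
          rw [conf0]
          rcases hprog m (by omega) m' (by omega) hex with h | h
          · exact ⟨a, .inr h⟩
          · exact ⟨b, .inr h⟩
        · exact ⟨b, .inl (by rw [actb, partialAct, if_neg hs']; split_ifs <;> simp)⟩
      · exact ⟨a, .inl (by rw [acta, partialAct, if_neg hs]; split_ifs <;> simp)⟩
    · by_cases hia : i = a
      · subst hia
        obtain rfl | rfl | rfl : s = 0 ∨ s = 1 ∨ s = 2 := by omega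
        · have hout : m < Na ∧ outcome A P orient (conf m 0 m' s').pos (conf m 0 m' s').light i =
              (la (m + 1), pa (m + 1) - pa m) := by
            refine (ha m m' (lit s') (by omega) hmN' (lit_le _) hlit' hex).resolve_left fun h => ?_
            rcases hi with hi | hi
            · exact hi acta
            · refine hi (Eq.trans (b := (two i b (la m) (lb (m' + lit s')) light i, 0)) h ?_)
              simp [conf, lit]
          have e : (conf m 0 m' s').advance A P orient i = conf m 1 m' s' := by
            have : (conf m 0 m' s').act i = .idle := acta
            rw [Cfg.advance, this]
            simp only [hout.2]
            simp [conf, update_two_left, lit, partialAct]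
          rw [e]
          exact ih m 1 m' s' (by simp; omega) h2 (by omega) h4 (by omega) h7 (by omega)
        · have h1' : m + 1 ≤ Na := by simpa using h1
          by_cases hd : pa (m + 1) = pa m
          · have e : (conf m 1 m' s').advance A P orient i = conf (m + 1) 0 m' s' := by
              have : (conf m 1 m' s').act i = .decided (la (m + 1)) (pa (m + 1) - pa m) := acta
              rw [Cfg.advance, this]
              simp [conf, update_two_left, lit, partialAct, hd]
            rw [e]
            exact ih (m + 1) 0 m' s' (by simp; omega) h2 (by omega) h4 (by omega) h7 (by omega)
          · have e : (conf m 1 m' s').advance A P orient i = conf m 2 m' s' := by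
              have : (conf m 1 m' s').act i = .decided (la (m + 1)) (pa (m + 1) - pa m) := acta
              rw [Cfg.advance, this]
              simp [conf, update_two_left, lit, partialAct, sub_eq_zero, hd]
            rw [e]
            exact ih m 2 m' s' (by simp; omega) h2 (by omega) h4 (fun _ => hd) h7 (by omega)
        · have h1' : m + 1 ≤ Na := by simpa using h1
          have e : (conf m 2 m' s').advance A P orient i = conf (m + 1) 0 m' s' := by
            have : (conf m 2 m' s').act i = .moving (pa (m + 1) - pa m) := acta
            rw [Cfg.advance, this]
            simp [conf, update_two_left, lit, partialAct]
          rw [e]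
          exact ih (m + 1) 0 m' s' (by simp; omega) h2 (by omega) h4 (by omega) h7 (by omega)
      by_cases hib : i = b
      · subst hib
        obtain rfl | rfl | rfl : s' = 0 ∨ s' = 1 ∨ s' = 2 := by omega
        · have hout : m' < Nb ∧ outcome A P orient (conf m s m' 0).pos (conf m s m' 0).light i =
              (lb (m' + 1), pb (m' + 1) - pb m') := by
            refine (hb m m' (lit s) hmN (by omega) (lit_le _) hlit hex).resolve_left fun h => ?_
            rcases hi with hi | hi
            · exact hi actb
            · refine hi (Eq.trans (b := (two a i (la (m + lit s)) (lb m') light i, 0)) h ?_)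
              simp [conf, lit]
          have e : (conf m s m' 0).advance A P orient i = conf m s m' 1 := by
            have : (conf m s m' 0).act i = .idle := actb
            rw [Cfg.advance, this]
            simp only [hout.2]
            simp [conf, update_two_right hab, lit, partialAct]
          rw [e]
          exact ih m s m' 1 h1 (by simp; omega) h3 (by omega) h6 (by omega) (by omega)
        · have h2' : m' + 1 ≤ Nb := by simpa using h2
          by_cases hd : pb (m' + 1) = pb m'
          · have e : (conf m s m' 1).advance A P orient i = conf m s (m' + 1) 0 := by
              have : (conf m s m' 1).act i = .decided (lb (m' + 1)) (pb (m' + 1) - pb m') := actb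
              rw [Cfg.advance, this]
              simp [conf, update_two_right hab, lit, partialAct, hd]
            rw [e]
            exact ih m s (m' + 1) 0 h1 (by simp; omega) h3 (by omega) h6 (by omega) (by omega)
          · have e : (conf m s m' 1).advance A P orient i = conf m s m' 2 := by
              have : (conf m s m' 1).act i = .decided (lb (m' + 1)) (pb (m' + 1) - pb m') := actb
              rw [Cfg.advance, this]
              simp [conf, update_two_right hab, lit, partialAct, sub_eq_zero, hd]
            rw [e]
            exact ih m s m' 2 h1 (by simp; omega) h3 (by omega) h6 (fun _ => hd) (by omega)
        · have h2' : m' + 1 ≤ Nb := by simpa using h2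
          have e : (conf m s m' 2).advance A P orient i = conf m s (m' + 1) 0 := by
            have : (conf m s m' 2).act i = .moving (pb (m' + 1) - pb m') := actb
            rw [Cfg.advance, this]
            simp [conf, update_two_right hab, two_right hab, lit, partialAct]
          rw [e]
          exact ih m s (m' + 1) 0 h1 (by simp; omega) h3 (by omega) h6 (by omega) (by omega)
      · exfalso
        rcases hi with hi | hi
        · exact hi (by simp only [conf, two_other hia hib])
        · exact hi (hrest m m' (lit s) (lit s') hmN hmN' (lit_le _) (lit_le _) hlit hlit' hex i hia hib)

/-! ### Reflection invariance -/

theorem snapshot_flip (s : ℤˣ) (pos : Fin k → GridPt) (light : Fin k → Fin c) (t : ℤˣ) (i : Fin k) :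
    snapshot (fun j => flipY s (pos j)) light (t * s) i = snapshot pos light t i := by
  have hs : ∀ j, Sees (fun j => flipY s (pos j)) i j ↔ Sees pos i j := fun j =>
    forall_congr' fun l => not_congr (sbtw_congr s (flipY_sub ..).symm (flipY_sub ..).symm)
  ext x
  simp only [snapshot, SwarmState.view, Finset.mem_image, Finset.mem_filter, hs, ← flipY_sub,
    flipY_flipY, mul_assoc, units_mul_self, mul_one]

theorem outcome_flip (s : ℤˣ) (pos : Fin k → GridPt) (light : Fin k → Fin c) (i : Fin k) :
    outcome A P (fun j => orient j * s) (fun j => flipY s (pos j)) light i =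
      ((outcome A P orient pos light i).1, flipY s (outcome A P orient pos light i).2) := by
  simp only [outcome, snapshot_flip, flipY_flipY, mul_comm s]

/-- The mirror image of an engagement. -/
def Engagement.flip (s : ℤˣ) : Engagement c → Engagement c
  | .idle => .idle
  | .decided l d => .decided l (flipY s d)
  | .moving d => .moving (flipY s d)

/-- The mirror image of a configuration. -/
def Cfg.flip (s : ℤˣ) (C : Cfg k c) : Cfg k c :=
  ⟨fun i => flipY s (C.pos i), C.light, fun i => (C.act i).flip s⟩

theorem flipY_eq_zero {s : ℤˣ} {p : GridPt} : flipY s p = 0 ↔ p = 0 := by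
  refine ⟨fun h => flipY_injective s (h.trans (flipY_zero s).symm), ?_⟩
  rintro rfl
  exact flipY_zero s

theorem FormsPattern.flip {pos : Fin k → GridPt} (h : FormsPattern pos P) (s : ℤˣ) :
    FormsPattern (fun i => flipY s (pos i)) P := by
  obtain ⟨v, t, h⟩ := h
  refine ⟨flipY s v, s * t, ?_⟩
  have := congrArg (Finset.image (flipY s)) h
  simp only [Finset.image_image] at this
  rw [show (flipY s ∘ fun q => v + flipY t q) = fun q => flipY s v + flipY (s * t) q from
    funext fun q => by simp [flipY_add, flipY_flipY]] at this
  exact this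

theorem Completes.flip {n : ℕ} {C : Cfg k c} (h : Completes A P orient n C) (s : ℤˣ) :
    Completes A P (fun j => orient j * s) n (C.flip s) := by
  have hen : ∀ (C : Cfg k c) i, (C.flip s).Enabled A P (fun j => orient j * s) i ↔
      C.Enabled A P orient i := by
    intro C i
    have h1 : (C.flip s).act i ≠ .idle ↔ C.act i ≠ .idle := by
      simp only [Cfg.flip]
      cases C.act i <;> simp [Engagement.flip]
    have h2 : outcome A P (fun j => orient j * s) (C.flip s).pos (C.flip s).light i =
        ((C.flip s).light i, 0) ↔ outcome A P orient C.pos C.light i = (C.light i, 0) := by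
      simp only [Cfg.flip, outcome_flip]
      rcases outcome A P orient C.pos C.light i with ⟨l, d⟩
      simp only [Prod.mk.injEq, flipY_eq_zero]
    exact or_congr h1 (not_congr h2)
  induction h with
  | done h1 h2 h3 =>
    exact .done ((flipY_injective s).comp h1) (fun i hi => h2 i ((hen _ i).1 hi)) (h3.flip s)
  | @step n C h1 h2 h3 ih =>
    obtain ⟨i, hi⟩ := h2
    refine .step ((flipY_injective s).comp h1) ⟨i, (hen _ i).2 hi⟩ fun j hj => ?_
    have := ih j ((hen _ j).1 hj)
    have e : (C.flip s).advance A P (fun j => orient j * s) j = (C.advance A P orient j).flip s := by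
      cases hC : C.act j with
      | idle =>
        simp only [Cfg.advance, Cfg.flip, hC, Engagement.flip, outcome_flip]
        congr 1
        funext i
        by_cases hij : i = j
        · subst hij; simp
        · simp [hij]
      | decided l d =>
        simp only [Cfg.advance, Cfg.flip, hC, Engagement.flip, flipY_eq_zero]
        congr 1
        funext i
        by_cases hij : i = j
        · subst hij; by_cases hd : d = 0 <;> simp [hd]
        · simp [hij]
      | moving d =>
        simp only [Cfg.advance, Cfg.flip, hC, Engagement.flip]
        congr 1
        · funext i
          by_cases hij : i = j
          · subst hij; simp [flipY_add]
          · simp [hij]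
        · funext i
          by_cases hij : i = j
          · subst hij; simp
          · simp [hij]
    rw [e]
    exact this

/-- It is enough to treat configurations up to a reflection. -/
theorem Completes.of_flip {n : ℕ} {pos : Fin k → GridPt} {light : Fin k → Fin c} (s : ℤˣ)
    (h : Completes A P (fun j => orient j * s) n (Cfg.quiet (fun i => flipY s (pos i)) light)) :
    Completes A P orient n (Cfg.quiet pos light) := by
  have := h.flip s
  simpa [Cfg.flip, Cfg.quiet, flipY_flipY, units_mul_self, mul_assoc, Engagement.flip] using this

end Phases

/-! ### What a robot sees -/

/-- Coordinatewise consequences of strict betweenness. -/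
theorem sbtw_coords {a b c : GridPt} (h : Sbtw ℝ a.toPlane b.toPlane c.toPlane) :
    (a.1 < b.1 ∧ b.1 < c.1 ∨ c.1 < b.1 ∧ b.1 < a.1 ∨ a.1 = b.1 ∧ b.1 = c.1) ∧
    (a.2 < b.2 ∧ b.2 < c.2 ∨ c.2 < b.2 ∧ b.2 < a.2 ∨ a.2 = b.2 ∧ b.2 = c.2) ∧
    ¬ (a.1 = c.1 ∧ a.2 = c.2) := by
  rw [sbtw_iff_exists] at h
  obtain ⟨hne, t, h0, h1, hx, hy⟩ := h
  have key : ∀ {x y z : ℤ}, (y : ℝ) = x + t * (z - x) →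
      (x < y ∧ y < z ∨ z < y ∧ y < x ∨ x = y ∧ y = z) := by
    intro x y z h
    rcases lt_trichotomy x z with hxz | hxz | hxz
    · left
      have : (x : ℝ) < z := by exact_mod_cast hxz
      constructor
      · have : (x : ℝ) < y := by nlinarith
        exact_mod_cast this
      · have : (y : ℝ) < z := by nlinarith
        exact_mod_cast this
    · right; right
      subst hxz
      have : (y : ℝ) = x := by rw [h]; ring
      have : y = x := by exact_mod_cast this
      omega
    · right; left
      have : (z : ℝ) < x := by exact_mod_cast hxz
      constructor
      · have : (z : ℝ) < y := by nlinarith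
        exact_mod_cast this
      · have : (y : ℝ) < x := by nlinarith
        exact_mod_cast this
  exact ⟨key hx, key hy, fun h => hne (Prod.ext h.1 h.2)⟩

section Visibility

variable {k : ℕ} {pos : Fin k → GridPt}

/-- Robot `z` lies on the segment from robot `i` to robot `j`, and is not `i`. -/
def Toward (pos : Fin k → GridPt) (i j z : Fin k) : Prop :=
  ∃ t : ℝ, 0 < t ∧ t ≤ 1 ∧ ((pos z).1 : ℝ) = (pos i).1 + t * ((pos j).1 - (pos i).1) ∧
    ((pos z).2 : ℝ) = (pos i).2 + t * ((pos j).2 - (pos i).2)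

theorem Toward.coords {i j z : Fin k} (hinj : Function.Injective pos) (h : Toward pos i j z) :
    z = j ∨ Sbtw ℝ (pos i).toPlane (pos z).toPlane (pos j).toPlane ∨ i = j := by
  obtain ⟨t, h0, h1, hx, hy⟩ := h
  rcases h1.lt_or_eq with h1 | rfl
  · by_cases hij : i = j
    · exact .inr (.inr hij)
    · exact .inr (.inl (sbtw_iff_exists.2 ⟨fun e => hij (hinj e), t, h0, h1, hx, hy⟩))
  · left
    apply hinj
    have hx' : ((pos z).1 : ℝ) = (pos j).1 := by rw [hx]; ring
    have hy' : ((pos z).2 : ℝ) = (pos j).2 := by rw [hy]; ring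
    exact Prod.ext (by exact_mod_cast hx') (by exact_mod_cast hy')

/-- In the direction of every other robot some robot is visible. -/
theorem exists_sees_toward {i j : Fin k} (hij : i ≠ j) :
    ∃ z, z ≠ i ∧ Sees pos i z ∧ Toward pos i j z := by
  classical
  obtain ⟨z, hz, hmin⟩ := Finset.exists_min_image
    (Finset.univ.filter fun z => z ≠ i ∧ Toward pos i j z)
    (fun z => ((pos z).1 - (pos i).1).natAbs + ((pos z).2 - (pos i).2).natAbs)
    ⟨j, by simp only [Finset.mem_filter, Finset.mem_univ, true_and]
           exact ⟨hij.symm, 1, one_pos, le_rfl, by ring, by ring⟩⟩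
  simp only [Finset.mem_filter, Finset.mem_univ, true_and] at hz hmin
  refine ⟨z, hz.1, fun l hl => ?_, hz.2⟩
  have hc := sbtw_coords hl
  rw [sbtw_iff_exists] at hl
  obtain ⟨-, t, h0, h1, hx, hy⟩ := hl
  obtain ⟨-, u, h0', h1', hx', hy'⟩ := hz
  have hli : l ≠ i := by
    rintro rfl
    omega
  have := hmin l ⟨hli, t * u, by positivity, by nlinarith, by rw [hx, hx']; ring, by rw [hy, hy']; ring⟩
  omega

/-- A visible robot in the direction of a given one, with its coordinates. -/
theorem exists_sees_coords (hinj : Function.Injective pos) {i j : Fin k} (hij : i ≠ j) :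
    ∃ z, z ≠ i ∧ Sees pos i z ∧ (z = j ∨ Sbtw ℝ (pos i).toPlane (pos z).toPlane (pos j).toPlane) := by
  obtain ⟨z, h1, h2, h3⟩ := exists_sees_toward (pos := pos) hij
  refine ⟨z, h1, h2, ?_⟩
  rcases h3.coords hinj with h | h | h
  · exact .inl h
  · exact .inr h
  · exact absurd h hij

/-- Two robots in one column are seen in different directions from outside of this column. -/
theorem toward_ne_of_column (hinj : Function.Injective pos) {i a b z w : Fin k} (hab : a ≠ b)
    (hcol : (pos a).1 = (pos b).1) (hi : (pos i).1 ≠ (pos a).1) (hz : Toward pos i a z)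
    (hw : Toward pos i b w) : z ≠ w := by
  rintro rfl
  obtain ⟨t, h0, -, hx, hy⟩ := hz
  obtain ⟨u, -, -, hx', hy'⟩ := hw
  rw [← hcol] at hx'
  have hne : ((pos a).1 : ℝ) - (pos i).1 ≠ 0 := by
    rw [sub_ne_zero]; exact_mod_cast hi.symm
  have htu : t = u := mul_right_cancel₀ hne (by linarith)
  subst htu
  have : ((pos a).2 : ℝ) = (pos b).2 := by
    have : t * ((pos a).2 - (pos b).2 : ℝ) = 0 := by linarith
    rcases mul_eq_zero.1 this with h | h
    · exact absurd h h0.ne'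
    · linarith
  exact hab (hinj (Prod.ext hcol (by exact_mod_cast this)))

end Visibility

section Snapshots

variable {k c : ℕ} {pos : Fin k → GridPt} {light : Fin k → Fin c} {e : ℤˣ} {i : Fin k}

theorem mem_snapshot {x : GridPt × Fin c} :
    x ∈ snapshot pos light e i ↔
      ∃ j, j ≠ i ∧ Sees pos i j ∧ (flipY e (pos j - pos i), light j) = x := by
  simp only [snapshot, SwarmState.view, Finset.mem_image, Finset.mem_filter, Finset.mem_univ, true_and,
    and_assoc]

theorem forall_mem_snapshot {Q : GridPt × Fin c → Prop} :
    (∀ p ∈ snapshot pos light e i, Q p) ↔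
      ∀ j, j ≠ i → Sees pos i j → Q (flipY e (pos j - pos i), light j) := by
  simp only [mem_snapshot]
  constructor
  · intro h j h1 h2
    exact h _ ⟨j, h1, h2, rfl⟩
  · rintro h _ ⟨j, h1, h2, rfl⟩
    exact h j h1 h2

theorem mem_snapshot_of_sees {j : Fin k} (hj : j ≠ i) (h : Sees pos i j) :
    (flipY e (pos j - pos i), light j) ∈ snapshot pos light e i :=
  mem_snapshot.2 ⟨j, hj, h, rfl⟩

theorem snapshot_image_flip (s : ℤˣ) :
    (snapshot pos light e i).image (fun p => (flipY s p.1, p.2)) = snapshot pos light (s * e) i := by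
  classical
  ext x
  simp only [Finset.mem_image, mem_snapshot]
  constructor
  · rintro ⟨_, ⟨j, h1, h2, rfl⟩, rfl⟩
    exact ⟨j, h1, h2, by rw [flipY_flipY]⟩
  · rintro ⟨j, h1, h2, rfl⟩
    exact ⟨_, ⟨j, h1, h2, rfl⟩, by rw [flipY_flipY]⟩

end Snapshots

theorem injective_update {α β : Type*} [DecidableEq α] {f : α → β} (hf : Function.Injective f) {a : α}
    {b : β} (h : ∀ x, x ≠ a → f x ≠ b) : Function.Injective (Function.update f a b) := by
  intro x y hxy
  by_cases hx : x = a <;> by_cases hy : y = a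
  · rw [hx, hy]
  · subst hx
    rw [Function.update_of_ne hy, Function.update_self] at hxy
    exact absurd hxy.symm (h y hy)
  · subst hy
    rw [Function.update_of_ne hx, Function.update_self] at hxy
    exact absurd hxy (h x hx)
  · rw [Function.update_of_ne hx, Function.update_of_ne hy] at hxy
    exact hf hxy

/-! ### The algorithm -/

namespace Apf

/-- The light of all robots at the beginning, and later of robots waiting to be called. -/
abbrev off : Fin 8 := 0
/-- The light of a robot stepping out of the leftmost column, or returning from a search. -/
abbrev step : Fin 8 := 1
/-- The light of a robot that has stepped out of the leftmost column. -/
abbrev wait : Fin 8 := 2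
/-- The light of a robot climbing to a point from which it sees all others. -/
abbrev search : Fin 8 := 3
/-- The light of an elected robot on its way to the top, and of two robots that found a symmetry. -/
abbrev elect : Fin 8 := 4
/-- The light of the leader, which marks the origin of the common frame. -/
abbrev lead : Fin 8 := 5
/-- The light of the robot that is called next, or on its way to its target. -/
abbrev walk : Fin 8 := 6
/-- The light of a robot on its target. -/
abbrev fixed : Fin 8 := 7

/-- The set `A` is symmetric about the line `2 y = c`. -/
def SymAbout (A : Set GridPt) (c : ℤ) : Prop := ∀ p ∈ A, (p.1, c - p.2) ∈ A

/-- Among the points of `A` whose mirror image in the line `2 y = c` is not in `A`, those in the leftmost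
column and nearest to the line include one above the line (below it for `e = -1`). At most one point is
nearest, so for an asymmetric set exactly one side wins. -/
def Wins (e : ℤˣ) (A : Set GridPt) (c : ℤ) : Prop :=
  ∃ p ∈ A, e * c < e * (2 * p.2) ∧ (p.1, c - p.2) ∉ A ∧
    ∀ q ∈ A, (q.1, c - q.2) ∉ A → p.1 < q.1 ∨ p.1 = q.1 ∧ |2 * p.2 - c| ≤ |2 * q.2 - c|

/-- No point of `A` hides another one from `v`. -/
def Clear (v : GridPt) (A : Set GridPt) : Prop :=
  ∀ p ∈ A, ∀ q ∈ A, ¬ Sbtw ℝ v.toPlane p.toPlane q.toPlane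

/-- `r` is the rightmost point in the top row of `A`. -/
def IsTopRight (A : Set GridPt) (r : GridPt) : Prop :=
  r ∈ A ∧ ∀ p ∈ A, p.2 < r.2 ∨ p.2 = r.2 ∧ p.1 ≤ r.1

open Classical in
/-- The rightmost point in the top row of a nonempty finite set. -/
noncomputable def topRight (P : Finset GridPt) : GridPt :=
  if h : ∃ r, IsTopRight (P : Set GridPt) r then h.choose else 0

open Classical in
/-- The largest abscissa of a nonempty finite set. -/
noncomputable def maxX (P : Finset GridPt) : ℤ :=
  if h : ∃ x, (∃ p ∈ P, p.1 = x) ∧ ∀ p ∈ P, p.1 ≤ x then h.choose else 0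

/-- The translation that puts a pattern to the lower left of the leader, which is at the origin. -/
noncomputable def place (P : Finset GridPt) (p : GridPt) : GridPt :=
  (p.1 - maxX P - 1, p.2 - (topRight P).2 - 1)

/-- The targets of all robots but the leader, in the frame of the leader. -/
noncomputable def targets (P : Finset GridPt) : Finset GridPt :=
  (P.erase (topRight P)).image (place P)

/-- The abscissa of the final position of the leader, relative to the rightmost point in the top row of
the other points of the pattern. The leader sees that point, but possibly not all others, and it cannot
remember where it stood when the targets were occupied. -/
noncomputable def headOffset (P : Finset GridPt) : ℤ :=
  (topRight P).1 - (topRight (P.erase (topRight P))).1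

/-- The order in which the targets are occupied: by columns from the left, each from below. -/
def LexLT (p q : GridPt) : Prop := p.1 < q.1 ∨ p.1 = q.1 ∧ p.2 < q.2

/-- Nobody is seen strictly to the left. -/
def NoneLeft (V : Snapshot 8) : Prop := ∀ p ∈ V, 0 ≤ p.1.1

/-- Nobody is seen above in the own column. -/
def NoneAbove (V : Snapshot 8) : Prop := ∀ p ∈ V, p.1.1 = 0 → p.1.2 ≤ 0

/-- Exactly one robot is seen strictly to the left, with light `l` at `q`. -/
def OneLeft (V : Snapshot 8) (l : Fin 8) (q : GridPt) : Prop :=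
  (q, l) ∈ V ∧ q.1 < 0 ∧ ∀ p ∈ V, p.1.1 < 0 → p = (q, l)

/-- A robot with light `l` is seen below in the own column, at height `y`. -/
def Below (V : Snapshot 8) (l : Fin 8) (y : ℤ) : Prop := ((0, y), l) ∈ V ∧ y < 0

/-- The robots seen strictly to the right. -/
def ahead (V : Snapshot 8) : Set GridPt := {p | 0 < p.1 ∧ ∃ l, (p, l) ∈ V}

/-- The leftmost of the columns to the right. -/
def front (V : Snapshot 8) : Set GridPt := {p | p ∈ ahead V ∧ ∀ q ∈ ahead V, p.1 ≤ q.1}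

/-- The robot is half way between the only two `elect` lights, which are in one column to the left, and
sees nobody to the left in its own row. -/
def OnAxis (V : Snapshot 8) : Prop :=
  (∃ x y : ℤ, x < 0 ∧ 0 < y ∧ ((x, y), elect) ∈ V ∧ ((x, -y), elect) ∈ V ∧
    ∀ p ∈ V, p.2 = elect → p.1 = (x, y) ∨ p.1 = (x, -y)) ∧ ∀ p ∈ V, p.1.1 < 0 → p.1.2 ≠ 0

/-- The robot is the next one to walk to a target. -/
def Called (V : Snapshot 8) : Prop :=
  (∃ p ∈ V, p.2 = lead ∧ p.1.1 < 0 ∧ 0 < p.1.2) ∧ (∀ p ∈ V, p.2 ≠ walk) ∧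
    (∀ p ∈ V, p.1.1 < 0 → p.2 = lead ∨ p.2 = fixed) ∧ NoneAbove V

/-- The leader is seen at `q`, above, and `t` is the first free target, in the frame of the leader. -/
def Guided (P : Finset GridPt) (V : Snapshot 8) (q t : GridPt) : Prop :=
  (q, lead) ∈ V ∧ 0 < q.2 ∧ t ∈ targets P ∧ (∀ p, (p, fixed) ∈ V → LexLT (p - q) t) ∧
    ∀ t' ∈ targets P, (∀ p, (p, fixed) ∈ V → LexLT (p - q) t') → ¬ LexLT t' t

open Classical in
/-- The rule for robots with light `off`. A robot alone in the leftmost column is elected, and the two ends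
of a leftmost column with several robots step out, one of them possibly after the other has done so. A
robot half way between two searching robots that found a symmetry is elected. Later the robots are called
one after the other. -/
noncomputable def ruleOff (V : Snapshot 8) : Option (Fin 8 × GridMove) :=
  if NoneLeft V then
    if ∀ p ∈ V, p.1.1 ≠ 0 then some (elect, .stay)
    else if NoneAbove V then some (step, .left) else none
  else if (∃ q, OneLeft V wait q ∧ q.2 < 0) ∧ NoneAbove V then some (step, .left)
  else if OnAxis V then some (elect, .stay)
  else if Called V then some (walk, .stay)
  else none

open Classical in
/-- The rule for robots with light `step`. A robot that has just stepped out waits; a returning robot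
approaches the row of the elected robot, which is in the next column on the left. -/
noncomputable def ruleStep (V : Snapshot 8) : Option (Fin 8 × GridMove) :=
  if NoneLeft V then some (wait, .stay)
  else if ∃ q, OneLeft V elect q ∧ q.2 < -1 then some (step, .down)
  else if ∃ q, OneLeft V elect q ∧ |q.2| ≤ 1 then some (off, .stay)
  else none

open Classical in
/-- The rule for robots with light `wait`. The next column decides between the two waiting robots if it
is not symmetric. The one that gives in shows `walk`, and only then the other one takes the lead. -/
noncomputable def ruleWait (V : Snapshot 8) : Option (Fin 8 × GridMove) :=
  if ¬ NoneLeft V then none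
  else if ∃ y, Below V search y then some (search, .stay)
  else if ∃ y, Below V wait y ∧ SymAbout (front V) y then some (search, .stay)
  else if ∃ y, Below V wait y ∧ ¬ SymAbout (front V) y ∧ ¬ Wins 1 (front V) y then some (walk, .stay)
  else if ∃ y, Below V walk y then some (elect, .left)
  else none

open Classical in
/-- The rule for robots with light `search`. The robot climbs until it sees all others. When both robots
see everything, the configuration decides between them, or both find it symmetric. The axis of symmetry is
read off from the next column, so that it does not depend on how far the robots have climbed. -/
noncomputable def ruleSearch (P : Finset GridPt) (V : Snapshot 8) : Option (Fin 8 × GridMove) :=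
  if ¬ NoneLeft V ∨ ¬ ∃ l y, Below V l y then none
  else if V.card < P.card - 1 then some (search, .up)
  else if ∃ y, Below V search y ∧ Clear (0, y) (ahead V) ∧
      ∃ c, SymAbout (front V) c ∧ SymAbout (ahead V) c then some (elect, .stay)
  else if ∃ y, Below V search y ∧ Clear (0, y) (ahead V) ∧
      ∃ c, SymAbout (front V) c ∧ ¬ SymAbout (ahead V) c ∧ ¬ Wins 1 (ahead V) c then some (walk, .stay)
  else if ∃ y, Below V elect y then some (elect, .stay)
  else if ∃ y, Below V walk y then some (elect, .left)
  else none

open Classical in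
/-- The rule for robots with light `elect`. A robot elected on the axis walks to the left, between the two
searching robots, which return when they see it alone on their left. Then, or if the elected robot was on
the left from the beginning, it walks to the row above all others and becomes the leader there. -/
noncomputable def ruleElect (V : Snapshot 8) : Option (Fin 8 × GridMove) :=
  if ∃ p ∈ V, ∃ q ∈ V, p ≠ q ∧ p.1.1 < 0 ∧ q.1.1 < 0 then some (elect, .left)
  else if NoneLeft V ∧ (∃ p ∈ V, p.1.1 = 0 ∧ 0 < p.1.2) ∧ ∃ p ∈ V, p.1.1 = 0 ∧ p.1.2 < 0 then
    some (elect, .left)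
  else if ∃ q, OneLeft V elect q then some (step, .stay)
  else if (∀ p ∈ V, 0 < p.1.1) ∧ ∀ p ∈ V, p.2 ≠ elect ∧ p.2 ≠ step then
    if ∀ p ∈ V, p.1.2 < 0 then
      if ∃ p ∈ V, p.1.2 = -1 then some (lead, .stay) else some (elect, .down)
    else if (∃ p ∈ V, p.1.2 ≤ 0) ∧ ∀ p ∈ V, p.2 = walk → p.1.2 < 0 then some (elect, .up)
    else none
  else none

open Classical in
/-- The rule for the leader. It waits until all others are on their targets, walks along its row to the
right column, and one step down to the top row of the pattern. -/
noncomputable def ruleLead (P : Finset GridPt) (V : Snapshot 8) : Option (Fin 8 × GridMove) :=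
  if ∀ p ∈ V, p.2 = fixed ∧ p.1.2 < 0 then
    if ∃ r, IsTopRight {p | ∃ l, (p, l) ∈ V} r ∧ r.1 + headOffset P < 0 then some (lead, .left)
    else if ∃ r, IsTopRight {p | ∃ l, (p, l) ∈ V} r ∧ r.1 + headOffset P = 0 then some (fixed, .down)
    else none
  else none

open Classical in
/-- The rule for robots with light `walk`. The robot walks to the left to the column of the leader, in this
column to the row of its target, and in this row to its target. -/
noncomputable def ruleWalk (P : Finset GridPt) (V : Snapshot 8) : Option (Fin 8 × GridMove) :=
  if ∃ q t, Guided P V q t ∧ (q.1 < 0 ∨ q.1 = 0 ∧ -q.2 = t.2 ∨ 0 < q.1 ∧ t.1 < -q.1) then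
    some (walk, .left)
  else if ∃ q t, Guided P V q t ∧ q.1 = 0 ∧ -q.2 < t.2 then some (walk, .up)
  else if ∃ q t, Guided P V q t ∧ q.1 = 0 ∧ t.2 < -q.2 then some (walk, .down)
  else if ∃ q t, Guided P V q t ∧ 0 < q.1 ∧ t.1 = -q.1 then some (fixed, .stay)
  else none

/-- What a robot with light `l` does if its frame is the right one; all rules distinguish the upper from
the lower side. -/
noncomputable def rule (P : Finset GridPt) (l : Fin 8) (V : Snapshot 8) : Option (Fin 8 × GridMove) :=
  if l = off then ruleOff V
  else if l = step then ruleStep V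
  else if l = wait then ruleWait V
  else if l = search then ruleSearch P V
  else if l = elect then ruleElect V
  else if l = lead then ruleLead P V
  else if l = walk then ruleWalk P V
  else none

/-- The mirror image of a move. -/
def flipMove : GridMove → GridMove
  | .up => .down
  | .down => .up
  | m => m

open Classical in
/-- A robot tries the rules in its own frame, and then in the mirror image of its frame. A pattern of at
most one point is formed from the beginning, and nobody moves. -/
noncomputable def algorithm : RobotAlgorithm 8 where
  off := off
  compute P l V :=
    if P.card ≤ 1 then (l, .stay)
    else match rule P l V with
      | some o => o
      | none => match rule P l (V.image fun p => (flipY (-1) p.1, p.2)) with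
        | some o => (o.1, flipMove o.2)
        | none => (l, .stay)

theorem disp_flipMove (m : GridMove) : (flipMove m).disp = flipY (-1) m.disp := by
  cases m <;> rfl

section Evaluation

variable {k : ℕ} {P : Finset GridPt} {orient : Fin k → ℤˣ} {pos : Fin k → GridPt}
  {light : Fin k → Fin 8} {i : Fin k}

theorem compute_eq (hP : 1 < P.card) (l : Fin 8) (s : ℤˣ) :
    algorithm.compute P l (snapshot pos light s i) =
      match rule P l (snapshot pos light s i) with
      | some o => o
      | none => match rule P l (snapshot pos light (-s) i) with
        | some o => (o.1, flipMove o.2)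
        | none => (l, .stay) := by
  have : (-1 : ℤˣ) * s = -s := by simp
  simp only [algorithm, if_neg (not_le.2 hP), snapshot_image_flip, this]

/-- The rule of the own frame comes first. -/
theorem outcome_of_own (hP : 1 < P.card) {o : Fin 8 × GridMove}
    (h : rule P (light i) (snapshot pos light (orient i) i) = some o) :
    outcome algorithm P orient pos light i = (o.1, flipY (orient i) o.2.disp) := by
  rw [outcome, compute_eq hP, h]

/-- A rule that applies in exactly one of the two frames. -/
theorem outcome_of_rule (hP : 1 < P.card) {o : Fin 8 × GridMove} (e : ℤˣ)
    (h : rule P (light i) (snapshot pos light e i) = some o)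
    (h' : rule P (light i) (snapshot pos light (-e) i) = none) :
    outcome algorithm P orient pos light i = (o.1, flipY e o.2.disp) := by
  rw [outcome, compute_eq hP]
  rcases Int.units_eq_one_or (orient i * e) with he | he
  · have : orient i = e := by
      rw [← mul_one (orient i), ← units_mul_self e, ← mul_assoc, he, one_mul]
    rw [this, h]
  · have : orient i = -e := by
      rw [← mul_one (orient i), ← units_mul_self e, ← mul_assoc, he]; simp
    rw [this, h', neg_neg, h]
    simp only [disp_flipMove, flipY_flipY]
    simp

/-- A light change that both frames agree on. -/
theorem outcome_of_both (hP : 1 < P.card) {l : Fin 8}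
    (h : ∀ e, rule P (light i) (snapshot pos light e i) = some (l, .stay)) :
    outcome algorithm P orient pos light i = (l, 0) := by
  rw [outcome_of_own hP (h _)]
  exact congrArg _ (flipY_zero _)

theorem outcome_of_both_left (hP : 1 < P.card) {l : Fin 8}
    (h : ∀ e, rule P (light i) (snapshot pos light e i) = some (l, .left)) :
    outcome algorithm P orient pos light i = (l, (-1, 0)) := by
  rw [outcome_of_own hP (h _)]
  simp [flipY, GridMove.disp]

theorem rests_of_none (hP : 1 < P.card)
    (h : ∀ e, rule P (light i) (snapshot pos light e i) = none) :
    Rests algorithm P orient pos light i := by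
  rw [Rests, outcome, compute_eq hP, h, h]
  exact congrArg _ (flipY_zero _)

theorem rests_of_card_le (hP : P.card ≤ 1) : Rests algorithm P orient pos light i := by
  rw [Rests, outcome]
  simp only [algorithm, if_pos hP]
  exact congrArg _ (flipY_zero _)

theorem rests_fixed (hP : 1 < P.card) (h : light i = fixed) : Rests algorithm P orient pos light i := by
  refine rests_of_none hP fun e => ?_
  rw [h]
  rfl

end Evaluation

end Apf

namespace Apf

/-! ### Targets -/

theorem isTopRight_unique {A : Set GridPt} {r s : GridPt} (hr : IsTopRight A r) (hs : IsTopRight A s) :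
    r = s := by
  have h1 := hr.2 s hs.1
  have h2 := hs.2 r hr.1
  exact Prod.ext (by omega) (by omega)

theorem isTopRight_topRight {P : Finset GridPt} (hP : P.Nonempty) :
    IsTopRight (P : Set GridPt) (topRight P) := by
  have : ∃ r, IsTopRight (P : Set GridPt) r := by
    obtain ⟨r, hr, hmax⟩ := Finset.exists_max_image P (fun p => toLex (p.2, p.1)) hP
    refine ⟨r, hr, fun p hp => ?_⟩
    have := hmax p hp
    rw [Prod.Lex.toLex_le_toLex] at this
    exact this
  rw [topRight, dif_pos this]
  exact this.choose_spec

theorem maxX_spec {P : Finset GridPt} (hP : P.Nonempty) :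
    (∃ p ∈ P, p.1 = maxX P) ∧ ∀ p ∈ P, p.1 ≤ maxX P := by
  have : ∃ x, (∃ p ∈ P, p.1 = x) ∧ ∀ p ∈ P, p.1 ≤ x := by
    obtain ⟨r, hr, hmax⟩ := Finset.exists_max_image P (fun p => p.1) hP
    exact ⟨r.1, ⟨r, hr, rfl⟩, hmax⟩
  rw [maxX, dif_pos this]
  exact this.choose_spec

theorem place_injective (P : Finset GridPt) : Function.Injective (place P) := by
  intro p q h
  simp only [place, Prod.mk.injEq] at h
  exact Prod.ext (by omega) (by omega)

section

variable {P : Finset GridPt}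

theorem pattern_nonempty (hP : 1 < P.card) : P.Nonempty := Finset.card_pos.1 (by omega)

theorem topRight_mem (hP : 1 < P.card) : topRight P ∈ P := (isTopRight_topRight (pattern_nonempty hP)).1

theorem card_targets (hP : 1 < P.card) : (targets P).card = P.card - 1 := by
  rw [targets, Finset.card_image_of_injective _ (place_injective P),
    Finset.card_erase_of_mem (topRight_mem hP)]

theorem place_neg (hP : 1 < P.card) {p : GridPt} (hp : p ∈ P) : (place P p).1 < 0 ∧ (place P p).2 < 0 := by
  have h1 := (maxX_spec (pattern_nonempty hP)).2 p hp
  have h2 := (isTopRight_topRight (pattern_nonempty hP)).2 p hp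
  simp only [place]
  omega

theorem targets_neg (hP : 1 < P.card) {t : GridPt} (ht : t ∈ targets P) : t.1 < 0 ∧ t.2 < 0 := by
  simp only [targets, Finset.mem_image] at ht
  obtain ⟨p, hp, rfl⟩ := ht
  exact place_neg hP (Finset.mem_of_mem_erase hp)

theorem place_topRight_snd : (place P (topRight P)).2 = -1 := by
  simp [place]

theorem erase_nonempty (hP : 1 < P.card) : (P.erase (topRight P)).Nonempty := by
  rw [← Finset.card_pos, Finset.card_erase_of_mem (topRight_mem hP)]
  omega

/-- The rightmost point in the top row of the targets determines the last move of the leader. -/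
theorem isTopRight_targets (hP : 1 < P.card) :
    ∃ r, IsTopRight (targets P : Set GridPt) r ∧
    r.1 + headOffset P = (place P (topRight P)).1 := by
  obtain ⟨h1, h2⟩ := isTopRight_topRight (erase_nonempty hP)
  refine ⟨place P (topRight (P.erase (topRight P))), ⟨?_, ?_⟩, ?_⟩
  · exact Finset.mem_coe.2 (Finset.mem_image_of_mem _ h1)
  · intro t ht
    simp only [targets, Finset.mem_coe, Finset.mem_image] at ht
    obtain ⟨p, hp, rfl⟩ := ht
    have := h2 p hp
    simp only [place]
    omega
  · simp only [place, headOffset]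
    ring

end

theorem LexLT.irrefl (p : GridPt) : ¬ LexLT p p := by
  simp [LexLT]

theorem LexLT.total {p q : GridPt} (h : p ≠ q) : LexLT p q ∨ LexLT q p := by
  by_contra h'
  simp only [LexLT] at h'
  exact h (Prod.ext (by omega) (by omega))

theorem exists_lexMin {S : Finset GridPt} (hS : S.Nonempty) : ∃ p ∈ S, ∀ q ∈ S, ¬ LexLT q p := by
  obtain ⟨p, hp, h⟩ := Finset.exists_min_image S (fun p => toLex p) hS
  refine ⟨p, hp, fun q hq hlt => ?_⟩
  have := h q hq
  rw [Prod.Lex.toLex_le_toLex] at this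
  simp only [LexLT] at hlt
  omega

theorem exists_lexMax {S : Finset GridPt} (hS : S.Nonempty) : ∃ p ∈ S, ∀ q ∈ S, ¬ LexLT p q := by
  obtain ⟨p, hp, h⟩ := Finset.exists_max_image S (fun p => toLex p) hS
  refine ⟨p, hp, fun q hq hlt => ?_⟩
  have := h q hq
  rw [Prod.Lex.toLex_le_toLex] at this
  simp only [LexLT] at hlt
  omega

/-! ### The robots walk to their targets -/

variable {k : ℕ} {P : Finset GridPt} {orient : Fin k → ℤˣ} {pos : Fin k → GridPt}
  {light : Fin k → Fin 8} {ℓ m : Fin k} {t : GridPt}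

/-- The leader `ℓ` is in place: strictly above all others, which wait to its right, or walk, or are fixed
on an initial segment of the targets. -/
structure Scene (P : Finset GridPt) (pos : Fin k → GridPt) (light : Fin k → Fin 8) (ℓ : Fin k) :
    Prop where
  inj : Function.Injective pos
  lead : light ℓ = lead
  low : ∀ j, j ≠ ℓ → (pos j).2 < (pos ℓ).2
  kinds : ∀ j, j ≠ ℓ → light j = off ∧ (pos ℓ).1 < (pos j).1 ∨
    light j = fixed ∧ pos j - pos ℓ ∈ targets P ∨ light j = walk
  initial : ∀ j, light j = fixed → ∀ t ∈ targets P, LexLT t (pos j - pos ℓ) →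
    ∃ j', light j' = fixed ∧ pos j' - pos ℓ = t

/-- In addition, `m` is the only walking robot, and `t` is its target. -/
structure Walking (P : Finset GridPt) (pos : Fin k → GridPt) (light : Fin k → Fin 8) (ℓ m : Fin k)
    (t : GridPt) : Prop extends Scene P pos light ℓ where
  walk : light m = walk
  only : ∀ j, light j = Apf.walk → j = m
  target : t ∈ targets P
  free : ∀ j, light j = fixed → LexLT (pos j - pos ℓ) t
  next : ∀ t' ∈ targets P, LexLT t' t → ∃ j, light j = fixed ∧ pos j - pos ℓ = t'
  before : ∀ j, light j = off → (pos m).1 < (pos j).1 ∨ (pos m).1 = (pos j).1 ∧ (pos j).2 < (pos m).2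
  route : (pos ℓ).1 ≤ (pos m).1 ∨ t.1 ≤ (pos m - pos ℓ).1 ∧ (pos m - pos ℓ).2 = t.2

theorem Scene.fixed_neg (hP : 1 < P.card) (h : Scene P pos light ℓ) {j : Fin k} (hj : light j = fixed) :
    (pos j).1 < (pos ℓ).1 := by
  have hjl : j ≠ ℓ := by
    rintro rfl
    rw [h.lead] at hj
    exact absurd hj (by decide)
  rcases h.kinds j hjl with h' | h' | h'
  · rw [hj] at h'; exact absurd h'.1 (by decide)
  · have := (targets_neg hP h'.2).1
    simp only [Prod.fst_sub] at this
    omega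
  · rw [hj] at h'; exact absurd h' (by decide)

theorem Scene.off_pos (h : Scene P pos light ℓ) {j : Fin k} (hj : light j = off) :
    (pos ℓ).1 < (pos j).1 := by
  have hjl : j ≠ ℓ := by
    rintro rfl
    rw [h.lead] at hj
    exact absurd hj (by decide)
  rcases h.kinds j hjl with h' | h' | h'
  · exact h'.2
  · rw [hj] at h'; exact absurd h'.1 (by decide)
  · rw [hj] at h'; exact absurd h' (by decide)

theorem Scene.cases (h : Scene P pos light ℓ) (j : Fin k) :
    j = ℓ ∨ light j = off ∨ light j = fixed ∨ light j = walk := by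
  by_cases hj : j = ℓ
  · exact .inl hj
  · rcases h.kinds j hj with h' | h' | h'
    · exact .inr (.inl h'.1)
    · exact .inr (.inr (.inl h'.1))
    · exact .inr (.inr (.inr h'))

theorem Scene.light_cases (h : Scene P pos light ℓ) (j : Fin k) :
    light j = Apf.lead ∨ light j = off ∨ light j = fixed ∨ light j = Apf.walk := by
  rcases h.cases j with rfl | h'
  · exact .inl h.lead
  · exact .inr h'

theorem ruleOff_eq {i : Fin k} (hleft : ∃ j, j ≠ i ∧ Sees pos i j ∧ (pos j).1 < (pos i).1)
    (hlight : ∀ j, light j ≠ wait ∧ light j ≠ elect) (e : ℤˣ) :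
    (Called (snapshot pos light e i) → ruleOff (snapshot pos light e i) = some (walk, .stay)) ∧
    (¬ Called (snapshot pos light e i) → ruleOff (snapshot pos light e i) = none) := by
  have h1 : ¬ NoneLeft (snapshot pos light e i) := by
    obtain ⟨j, h1, h2, h3⟩ := hleft
    intro h
    have := h _ (mem_snapshot_of_sees h1 h2)
    simp only [flipY_fst, Prod.fst_sub] at this
    omega
  have h2 : ∀ q, ¬ OneLeft (snapshot pos light e i) wait q := by
    rintro q ⟨hq, -⟩
    obtain ⟨j, -, -, hj⟩ := mem_snapshot.1 hq
    exact (hlight j).1 (congrArg Prod.snd hj)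
  have h3 : ¬ OnAxis (snapshot pos light e i) := by
    rintro ⟨⟨x, y, -, -, hq, -⟩, -⟩
    obtain ⟨j, -, -, hj⟩ := mem_snapshot.1 hq
    exact (hlight j).2 (congrArg Prod.snd hj)
  have h4 : ¬ ((∃ q, OneLeft (snapshot pos light e i) wait q ∧ q.2 < 0) ∧
      NoneAbove (snapshot pos light e i)) := fun ⟨⟨q, h, _⟩, _⟩ => h2 q h
  rw [ruleOff, if_neg h1, if_neg h4, if_neg h3]
  exact ⟨fun h => if_pos h, fun h => if_neg h⟩

/-- Robots with light `off` rest as long as they see a robot to the left, no `wait` and `elect` lights, and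
are not called. -/
theorem rests_off (hP : 1 < P.card) {i : Fin k} (hi : light i = off)
    (hleft : ∃ j, j ≠ i ∧ Sees pos i j ∧ (pos j).1 < (pos i).1)
    (hlight : ∀ j, light j ≠ wait ∧ light j ≠ elect)
    (hcall : ∀ e, ¬ Called (snapshot pos light e i)) :
    Rests algorithm P orient pos light i := by
  refine rests_of_none hP fun e => ?_
  rw [rule, if_pos hi]
  exact (ruleOff_eq hleft hlight e).2 (hcall e)

theorem Scene.lights (h : Scene P pos light ℓ) (j : Fin k) : light j ≠ wait ∧ light j ≠ elect := by
  rcases h.light_cases j with h | h | h | h <;> rw [h] <;> decide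

theorem Scene.exists_left (h : Scene P pos light ℓ) {i : Fin k} (hi : light i = off) :
    ∃ j, j ≠ i ∧ Sees pos i j ∧ (pos j).1 < (pos i).1 := by
  have h1 := h.off_pos hi
  have hil : i ≠ ℓ := by rintro rfl; omega
  obtain ⟨z, hz, hs, hz'⟩ := exists_sees_coords h.inj hil
  refine ⟨z, hz, hs, ?_⟩
  rcases hz' with rfl | hb
  · exact h1
  · have := sbtw_coords hb
    omega

/-- In a mirrored frame the leader is below, so nobody is called. -/
theorem Scene.not_called_neg (h : Scene P pos light ℓ) (i : Fin k) :
    ¬ Called (snapshot pos light (-1) i) := by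
  rintro ⟨⟨p, hp, h1, h2, h3⟩, -⟩
  obtain ⟨j, hj, -, rfl⟩ := mem_snapshot.1 hp
  have hjl : j = ℓ := by
    have hj' : light j = Apf.lead := h1
    rcases h.cases j with e | e | e | e
    · exact e
    all_goals rw [e] at hj'; exact absurd hj' (by decide)
  subst hjl
  have := h.low i (Ne.symm hj)
  simp only [flipY_snd, Prod.snd_sub, Units.val_neg, Units.val_one] at h3
  omega

theorem rests_lead (hP : 1 < P.card) {i : Fin k} (hi : light i = lead)
    (h : ∃ j, j ≠ i ∧ Sees pos i j ∧ light j ≠ fixed) : Rests algorithm P orient pos light i := by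
  refine rests_of_none hP fun e => ?_
  obtain ⟨j, h1, h2, h3⟩ := h
  have : ¬ ∀ p ∈ snapshot pos light e i, p.2 = fixed ∧ p.1.2 < 0 := fun h =>
    h3 (h _ (mem_snapshot_of_sees h1 h2)).1
  rw [hi]
  change ruleLead P _ = none
  rw [ruleLead, if_neg this]

/-- While somebody waits, the leader waits. -/
theorem Scene.rests_leader (hP : 1 < P.card) (h : Scene P pos light ℓ) {j : Fin k} (hj : light j = off) :
    Rests algorithm P orient pos light ℓ := by
  have h1 := h.off_pos hj
  have hjl : ℓ ≠ j := by rintro rfl; omega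
  refine rests_lead hP h.lead ?_
  obtain ⟨z, hz, hs, hz'⟩ := exists_sees_coords h.inj hjl
  refine ⟨z, hz, hs, fun hf => ?_⟩
  have h2 := h.fixed_neg hP hf
  rcases hz' with rfl | hb
  · omega
  · have := sbtw_coords hb
    omega

theorem Walking.ne (h : Walking P pos light ℓ m t) : m ≠ ℓ := by
  rintro rfl
  have := h.walk
  rw [h.lead] at this
  exact absurd this (by decide)

/-- No fixed robot lies strictly to the right of the walking robot. -/
theorem Walking.fixed_le (hP : 1 < P.card) (h : Walking P pos light ℓ m t) {j : Fin k}
    (hj : light j = fixed) : (pos j).1 ≤ (pos m).1 := by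
  have h1 := h.fixed_neg hP hj
  have h2 := h.free j hj
  have h3 := h.route
  simp only [LexLT, Prod.fst_sub, Prod.snd_sub] at h2 h3
  omega

theorem Walking.rests_leader (hP : 1 < P.card) (h : Walking P pos light ℓ m t) :
    Rests algorithm P orient pos light ℓ := by
  refine rests_lead hP h.lead ?_
  obtain ⟨z, hz, hs, hz'⟩ := exists_sees_coords h.inj h.ne.symm
  refine ⟨z, hz, hs, fun hf => ?_⟩
  have h2 := h.fixed_neg hP hf
  have h3 := h.fixed_le hP hf
  rcases hz' with rfl | hb
  · have := h.walk
    rw [hf] at this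
    exact absurd this (by decide)
  · have := sbtw_coords hb
    omega

/-- A waiting robot that would be called if there were no walking robot sees the walking robot, or another
waiting robot that keeps it from starting. -/
theorem Walking.rests_off (hP : 1 < P.card) (h : Walking P pos light ℓ m t) {i : Fin k}
    (hi : light i = off) : Rests algorithm P orient pos light i := by
  refine Apf.rests_off hP hi (h.exists_left hi) h.lights fun e => ?_
  rcases Int.units_eq_one_or e with rfl | rfl
  swap
  · exact h.not_called_neg i
  rintro ⟨-, h2, h3, h4⟩
  -- the first robot in the direction of the walking one contradicts the call
  have him : i ≠ m := by
    rintro rfl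
    have := h.walk
    rw [hi] at this
    exact absurd this (by decide)
  have hb := h.before i hi
  have hip := h.off_pos hi
  obtain ⟨z, hz, hs, hz'⟩ := exists_sees_coords h.inj him
  have hmem := mem_snapshot_of_sees (light := light) (e := 1) hz hs
  rcases hz' with rfl | hbtw
  · exact h2 _ hmem h.walk
  have hc := sbtw_coords hbtw
  rcases h.cases z with rfl | hzo | hzf | hzw
  · have := h.low i (by rintro rfl; omega)
    have := h.low m h.ne
    omega
  · by_cases hcol : (pos z).1 < (pos i).1
    · have := h3 _ hmem (by simp only [flipY_fst, Prod.fst_sub]; omega)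
      simp only [hzo] at this
      revert this; decide
    · have := h4 _ hmem (by simp only [flipY_fst, Prod.fst_sub]; omega)
      simp only [flipY_snd, Prod.snd_sub, Units.val_one] at this
      omega
  · have h5 := h.fixed_neg hP hzf
    have h6 := h.fixed_le hP hzf
    omega
  · exact h2 _ hmem hzw

theorem Walking.sees_leader (hP : 1 < P.card) (h : Walking P pos light ℓ m t) : Sees pos m ℓ := by
  intro l hl
  have hc := sbtw_coords hl
  have hlow := h.low m h.ne
  rcases h.cases l with rfl | hlo | hlf | hlw
  · omega
  · have h1 := h.before l hlo
    have h2 := h.off_pos hlo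
    omega
  · have h1 := h.fixed_neg hP hlf
    have h2 := h.fixed_le hP hlf
    omega
  · have := h.only l hlw
    subst this
    omega

/-- The walking robot sees the last occupied target. By the order in which the targets are occupied, this
is all it has to see in order to know the first free one. -/
theorem Walking.sees_last (hP : 1 < P.card) (h : Walking P pos light ℓ m t) {j : Fin k}
    (hj : light j = fixed) (hmax : ∀ j', light j' = fixed → ¬ LexLT (pos j - pos ℓ) (pos j' - pos ℓ)) :
    Sees pos m j := by
  intro l hl
  have hc := sbtw_coords hl
  have h1 := h.fixed_neg hP hj
  have h2 := h.fixed_le hP hj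
  have h3 := h.free j hj
  have h4 := h.route
  simp only [LexLT, Prod.fst_sub, Prod.snd_sub] at h3 h4
  rcases h.cases l with rfl | hlo | hlf | hlw
  · have h5 := h.low m h.ne
    have h6 := h.low j (by rintro rfl; omega)
    omega
  · have h5 := h.before l hlo
    have h6 := h.off_pos hlo
    omega
  · have h5 := h.fixed_le hP hlf
    have h6 := hmax l hlf
    have h7 := h.free l hlf
    simp only [LexLT, Prod.fst_sub, Prod.snd_sub] at h6 h7
    omega
  · have := h.only l hlw
    subst this
    omega

theorem Walking.guided_iff (hP : 1 < P.card) (h : Walking P pos light ℓ m t) (q t' : GridPt) :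
    Guided P (snapshot pos light 1 m) q t' ↔ q = pos ℓ - pos m ∧ t' = t := by
  classical
  have hfix : ∀ p, (p, fixed) ∈ snapshot pos light 1 m →
      ∃ j, light j = fixed ∧ p - (pos ℓ - pos m) = pos j - pos ℓ := by
    intro p hp
    obtain ⟨j, -, -, hj⟩ := mem_snapshot.1 hp
    rw [Prod.mk.injEq, flipY_one] at hj
    refine ⟨j, hj.2, ?_⟩
    rw [← hj.1]
    abel
  -- a target after all visible occupied ones is not before `t`
  have hkey : ∀ t' ∈ targets P, (∀ p, (p, fixed) ∈ snapshot pos light 1 m →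
      LexLT (p - (pos ℓ - pos m)) t') → ¬ LexLT t' t := by
    intro t' ht' hvis hlt
    obtain ⟨j, hj, hjt⟩ := h.next t' ht' hlt
    obtain ⟨p, hp, hmax⟩ := exists_lexMax
      (S := (Finset.univ.filter fun j => light j = fixed).image fun j => pos j - pos ℓ)
      ⟨_, Finset.mem_image_of_mem _ (Finset.mem_filter.2 ⟨Finset.mem_univ j, hj⟩)⟩
    simp only [Finset.mem_image, Finset.mem_filter, Finset.mem_univ, true_and, forall_exists_index,
      and_imp, forall_apply_eq_imp_iff₂] at hp hmax
    obtain ⟨j', hj', rfl⟩ := hp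
    have hs := h.sees_last hP hj' hmax
    have hne : j' ≠ m := by
      rintro rfl
      have := h.walk
      rw [hj'] at this
      exact absurd this (by decide)
    have hmem := mem_snapshot_of_sees (light := light) (e := 1) hne hs
    rw [flipY_one, hj'] at hmem
    have := hvis _ hmem
    rw [show pos j' - pos m - (pos ℓ - pos m) = pos j' - pos ℓ by abel] at this
    rw [← hjt] at this
    exact hmax j hj this
  constructor
  · rintro ⟨h1, -, h3, h4, h5⟩
    have hq : q = pos ℓ - pos m := by
      obtain ⟨j, -, -, hj⟩ := mem_snapshot.1 h1
      rw [Prod.mk.injEq, flipY_one] at hj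
      have : j = ℓ := by
        rcases h.cases j with e | e | e | e
        · exact e
        all_goals rw [e] at hj; exact absurd hj.2 (by decide)
      rw [← hj.1, this]
    subst hq
    refine ⟨rfl, ?_⟩
    by_contra hne
    rcases LexLT.total hne with hlt | hlt
    · exact hkey t' h3 h4 hlt
    · refine h5 t h.target (fun p hp => ?_) hlt
      obtain ⟨j, hj, e⟩ := hfix p hp
      rw [e]
      exact h.free j hj
  · rintro ⟨rfl, rfl⟩
    refine ⟨?_, ?_, h.target, fun p hp => ?_, hkey⟩
    · have := mem_snapshot_of_sees (light := light) (e := 1) h.ne.symm (h.sees_leader hP)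
      rwa [flipY_one, h.lead] at this
    · have := h.low m h.ne
      simp only [Prod.snd_sub]
      omega
    · obtain ⟨j, hj, e⟩ := hfix p hp
      rw [e]
      exact h.free j hj

theorem Scene.not_guided_neg (h : Scene P pos light ℓ) (i : Fin k) (q t' : GridPt) :
    ¬ Guided P (snapshot pos light (-1) i) q t' := by
  rintro ⟨h1, h2, -⟩
  obtain ⟨j, hj, -, hj'⟩ := mem_snapshot.1 h1
  rw [Prod.mk.injEq] at hj'
  have hjl : j = ℓ := by
    rcases h.cases j with e | e | e | e
    · exact e
    all_goals rw [e] at hj'; exact absurd hj'.2 (by decide)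
  subst hjl
  have := h.low i (Ne.symm hj)
  rw [← hj'.1] at h2
  simp only [flipY_snd, Prod.snd_sub, Units.val_neg, Units.val_one] at h2
  omega

theorem ruleWalk_eq_none {V : Snapshot 8} (h : ∀ q t, ¬ Guided P V q t) : ruleWalk P V = none := by
  unfold ruleWalk
  simp [h]

/-- The move of the walking robot. -/
theorem Walking.outcome (hP : 1 < P.card) (h : Walking P pos light ℓ m t) (o : Fin 8 × GridMove)
    (ho : ruleWalk P (snapshot pos light 1 m) = some o) :
    outcome algorithm P orient pos light m = (o.1, o.2.disp) := by
  rw [outcome_of_rule hP 1 (o := o), flipY_one]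
  · rw [h.walk]
    exact ho
  · rw [h.walk]
    exact ruleWalk_eq_none (h.not_guided_neg m)

theorem Walking.rests (hP : 1 < P.card) (h : Walking P pos light ℓ m t) (i : Fin k) (hi : i ≠ m) :
    Rests algorithm P orient pos light i := by
  rcases h.cases i with rfl | h' | h' | h'
  · exact h.rests_leader hP
  · exact h.rests_off hP h'
  · exact rests_fixed hP h'
  · exact absurd (h.only i h') hi

/-- A step of the walking robot to a free place on its route. -/
theorem Walking.update (h : Walking P pos light ℓ m t) (d : GridPt)
    (hinj : ∀ j, j ≠ m → pos j ≠ pos m + d) (hlow : (pos m + d).2 < (pos ℓ).2) (hleft : d.1 ≤ 0)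
    (hup : (pos m).1 = (pos m + d).1 → (pos m).1 = (pos ℓ).1)
    (hroute : (pos ℓ).1 ≤ (pos m + d).1 ∨ t.1 ≤ (pos m + d - pos ℓ).1 ∧ (pos m + d - pos ℓ).2 = t.2) :
    Walking P (Function.update pos m (pos m + d)) light ℓ m t := by
  have hne : ∀ j, j ≠ m → Function.update pos m (pos m + d) j = pos j := fun j hj => by simp [hj]
  have hl := hne ℓ h.ne.symm
  have hmne : ∀ j, light j = fixed ∨ light j = off → j ≠ m := by
    rintro j hj rfl
    rw [h.walk] at hj
    revert hj; decide
  refine ⟨⟨?_, h.lead, ?_, ?_, ?_⟩, h.walk, h.only, h.target, ?_, ?_, ?_, ?_⟩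
  · exact injective_update h.inj hinj
  · intro j hj
    rw [hl]
    by_cases h1 : j = m
    · subst h1; simpa using hlow
    · rw [hne j h1]; exact h.low j hj
  · intro j hj
    rw [hl]
    by_cases h1 : j = m
    · subst h1; exact .inr (.inr h.walk)
    · rw [hne j h1]; exact h.kinds j hj
  · intro j hj t' ht'
    rw [hl, hne j (hmne j (.inl hj))]
    intro hlt
    obtain ⟨j', hj', e⟩ := h.initial j hj t' ht' hlt
    exact ⟨j', hj', by rw [hne j' (hmne j' (.inl hj'))]; exact e⟩
  · intro j hj
    rw [hl, hne j (hmne j (.inl hj))]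
    exact h.free j hj
  · intro t' ht' hlt
    obtain ⟨j', hj', e⟩ := h.next t' ht' hlt
    exact ⟨j', hj', by rw [hl, hne j' (hmne j' (.inl hj'))]; exact e⟩
  · intro j hj
    rw [Function.update_self, hne j (hmne j (.inr hj))]
    have h1 := h.before j hj
    have h2 := h.off_pos hj
    simp only [Prod.fst_add, Prod.snd_add] at hup ⊢
    omega
  · rw [Function.update_self, hl]
    exact hroute

theorem Walking.completes (hP : 1 < P.card) {n : ℕ} (N : ℕ) : ∀ {pos : Fin k → GridPt},
    Walking P pos light ℓ m t →
    (pos m - pos ℓ).1 - t.1 + |(pos m - pos ℓ).2 - t.2| = N →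
    Completes algorithm P orient n
      (Cfg.quiet (Function.update pos m (pos ℓ + t)) (Function.update light m fixed)) →
    Completes algorithm P orient (n + 3 * N + 3) (Cfg.quiet pos light) := by
  induction N with
  | zero =>
    intro pos h hN hend
    have hroute := h.route
    simp only [Prod.fst_sub, Prod.snd_sub] at hN hroute
    have htn := targets_neg hP h.target
    have habs := abs_nonneg ((pos m).2 - (pos ℓ).2 - t.2)
    have h1 : (pos m).1 - (pos ℓ).1 = t.1 := by omega
    have h2 : (pos m).2 - (pos ℓ).2 = t.2 := by omega
    have hpos : pos m = pos ℓ + t := Prod.ext (by simp; omega) (by simp; omega)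
    have hr : ruleWalk P (snapshot pos light 1 m) = some (fixed, .stay) := by
      unfold ruleWalk
      rw [if_neg, if_neg, if_neg, if_pos]
      · refine ⟨_, _, (h.guided_iff hP _ _).2 ⟨rfl, rfl⟩, ?_, ?_⟩ <;> rw [Prod.fst_sub] <;> omega
      all_goals
        rintro ⟨q, t', hg, hq⟩
        obtain ⟨rfl, rfl⟩ := (h.guided_iff hP _ _).1 hg
        simp only [Prod.fst_sub, Prod.snd_sub] at hq
        omega
    rw [← hpos, Function.update_eq_self] at hend
    exact (Completes.light_step (l := fixed) h.inj (h.outcome hP _ hr) (by rw [h.walk]; decide)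
      (fun i hi => h.rests hP i hi) hend).mono (by omega)
  | succ N ih =>
    intro pos h hN hend
    have hroute := h.route
    have hlow := h.low m h.ne
    have htn := targets_neg hP h.target
    simp only [Prod.fst_sub, Prod.snd_sub] at hN hroute
    have hfin : ∀ d : GridPt, Walking P (Function.update pos m (pos m + d)) light ℓ m t →
        (pos m + d - pos ℓ).1 - t.1 + |(pos m + d - pos ℓ).2 - t.2| = N → d ≠ 0 →
        _root_.outcome algorithm P orient pos light m = (Apf.walk, d) →
        Completes algorithm P orient (n + 3 * (N + 1) + 3) (Cfg.quiet pos light) := by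
      intro d hw hm hd hout
      rw [show n + 3 * (N + 1) + 3 = (n + 3 * N + 3) + 3 by ring]
      refine Completes.move_step h.inj (d := d) (by rw [hout, h.walk]) hd (fun i hi => h.rests hP i hi) ?_
      refine ih hw ?_ ?_
      · rw [Function.update_self, Function.update_of_ne h.ne.symm]
        exact hm
      · rw [Function.update_of_ne h.ne.symm, Function.update_idem]
        exact hend
    by_cases hcase : (pos ℓ).1 < (pos m).1 ∨ (pos m).1 = (pos ℓ).1 ∧ (pos m).2 - (pos ℓ).2 = t.2 ∨
        (pos m).1 < (pos ℓ).1
    · -- a step to the left; the robots in its way would have been called before, or stand on later targets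
      refine hfin (-1, 0) ?_ ?_ (by decide) ?_
      · refine h.update _ (fun j hj e => ?_) ?_ (by decide) ?_ ?_
        · have e1 := congrArg Prod.fst e
          have e2 := congrArg Prod.snd e
          simp only [Prod.fst_add, Prod.snd_add] at e1 e2
          have habs := abs_nonneg ((pos m).2 - (pos ℓ).2 - t.2)
          rcases h.cases j with rfl | h' | h' | h'
          · omega
          · have := h.before j h'
            omega
          · have h3 := h.free j h'
            have h4 := h.fixed_neg hP h'
            simp only [LexLT, Prod.fst_sub, Prod.snd_sub] at h3
            have h5 : (pos m).2 - (pos ℓ).2 = t.2 := by omega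
            rw [h5, sub_self, abs_zero] at hN
            omega
          · exact hj (h.only j h')
        · simpa using hlow
        · simp
        · simp only [Prod.fst_add, Prod.snd_add, Prod.fst_sub, Prod.snd_sub]
          have habs := abs_nonneg ((pos m).2 - (pos ℓ).2 - t.2)
          by_cases h5 : (pos ℓ).1 < (pos m).1
          · left; omega
          · right
            have h5 : (pos m).2 - (pos ℓ).2 = t.2 := by omega
            rw [h5, sub_self, abs_zero] at hN
            omega
      · simp only [Prod.fst_add, Prod.snd_add, Prod.fst_sub, Prod.snd_sub, add_zero]
        push_cast at hN
        omega
      · refine h.outcome hP (Apf.walk, .left) ?_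
        unfold ruleWalk
        rw [if_pos]
        refine ⟨_, _, (h.guided_iff hP _ _).2 ⟨rfl, rfl⟩, ?_⟩
        simp only [Prod.fst_sub, Prod.snd_sub]
        by_cases h5 : (pos ℓ).1 ≤ (pos m).1
        · omega
        · have h5 : (pos m).2 - (pos ℓ).2 = t.2 := by omega
          rw [h5, sub_self, abs_zero] at hN
          push_cast at hN
          omega
    · -- a vertical step in the column of the leader
      have hcol : (pos m).1 = (pos ℓ).1 := by omega
      have hfree : ∀ d : GridPt, d.1 = 0 → (pos m + d).2 < (pos ℓ).2 → ∀ j, j ≠ m → pos j ≠ pos m + d := by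
        intro d hd hd' j hj e
        have e1 := congrArg Prod.fst e
        have e2 := congrArg Prod.snd e
        simp only [Prod.fst_add, Prod.snd_add] at e1 e2 hd'
        rcases h.cases j with rfl | h' | h' | h'
        · omega
        · have := h.off_pos h'
          omega
        · have := h.fixed_neg hP h'
          omega
        · exact hj (h.only j h')
      rcases lt_or_gt_of_ne (a := (pos m).2 - (pos ℓ).2) (b := t.2) (by omega) with hlt | hlt
      · refine hfin (0, 1) ?_ ?_ (by decide) ?_
        · refine h.update _ (hfree _ rfl ?_) ?_ (by decide) ?_ ?_ <;>
            simp only [Prod.fst_add, Prod.snd_add, Prod.fst_sub, Prod.snd_sub] <;> omega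
        · simp only [Prod.fst_add, Prod.snd_add, Prod.fst_sub, Prod.snd_sub, add_zero]
          rw [abs_of_nonpos (by omega)] at hN ⊢
          push_cast at hN
          omega
        · refine h.outcome hP (Apf.walk, .up) ?_
          unfold ruleWalk
          rw [if_neg, if_pos]
          · refine ⟨_, _, (h.guided_iff hP _ _).2 ⟨rfl, rfl⟩, ?_⟩
            simp only [Prod.fst_sub, Prod.snd_sub]
            omega
          · rintro ⟨q, t', hg, hq⟩
            obtain ⟨rfl, rfl⟩ := (h.guided_iff hP _ _).1 hg
            simp only [Prod.fst_sub, Prod.snd_sub] at hq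
            omega
      · refine hfin (0, -1) ?_ ?_ (by decide) ?_
        · refine h.update _ (hfree _ rfl ?_) ?_ (by decide) ?_ ?_ <;>
            simp only [Prod.fst_add, Prod.snd_add, Prod.fst_sub, Prod.snd_sub] <;> omega
        · simp only [Prod.fst_add, Prod.snd_add, Prod.fst_sub, Prod.snd_sub, add_zero]
          rw [abs_of_nonneg (by omega)] at hN ⊢
          push_cast at hN
          omega
        · refine h.outcome hP (Apf.walk, .down) ?_
          unfold ruleWalk
          rw [if_neg, if_neg, if_pos]
          · refine ⟨_, _, (h.guided_iff hP _ _).2 ⟨rfl, rfl⟩, ?_⟩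
            simp only [Prod.fst_sub, Prod.snd_sub]
            omega
          all_goals
            rintro ⟨q, t', hg, hq⟩
            obtain ⟨rfl, rfl⟩ := (h.guided_iff hP _ _).1 hg
            simp only [Prod.fst_sub, Prod.snd_sub] at hq
            omega

end Apf

namespace Apf

variable {k : ℕ} {P : Finset GridPt} {orient : Fin k → ℤˣ} {pos : Fin k → GridPt}
  {light : Fin k → Fin 8} {ℓ m : Fin k} {t : GridPt}

/-- The robot that arrived at its target stays there. -/
theorem Walking.arrive (hP : 1 < P.card) (h : Walking P pos light ℓ m t) :
    Scene P (Function.update pos m (pos ℓ + t)) (Function.update light m fixed) ℓ := by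
  have htn := targets_neg hP h.target
  have hl : Function.update pos m (pos ℓ + t) ℓ = pos ℓ := Function.update_of_ne h.ne.symm _ _
  have hfree : ∀ j, j ≠ m → pos j ≠ pos ℓ + t := by
    intro j hj e
    have e1 := congrArg Prod.fst e
    simp only [Prod.fst_add] at e1
    rcases h.cases j with rfl | h' | h' | h'
    · omega
    · have := h.off_pos h'
      omega
    · have := h.free j h'
      rw [e, add_sub_cancel_left] at this
      exact LexLT.irrefl _ this
    · exact hj (h.only j h')
  refine ⟨?_, ?_, ?_, ?_, ?_⟩
  · exact injective_update h.inj hfree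
  · rw [Function.update_of_ne h.ne.symm]
    exact h.lead
  · intro j hj
    rw [hl]
    by_cases h1 : j = m
    · subst h1
      rw [Function.update_self, Prod.snd_add]
      omega
    · rw [Function.update_of_ne h1]
      exact h.low j hj
  · intro j hj
    rw [hl]
    by_cases h1 : j = m
    · subst h1
      rw [Function.update_self, Function.update_self, add_sub_cancel_left]
      exact .inr (.inl ⟨rfl, h.target⟩)
    · rw [Function.update_of_ne h1, Function.update_of_ne h1]
      exact h.kinds j hj
  · have key : ∀ t' ∈ targets P, (∃ j, light j = fixed ∧ pos j - pos ℓ = t') →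
        ∃ j, Function.update light m fixed j = fixed ∧
          Function.update pos m (pos ℓ + t) j - Function.update pos m (pos ℓ + t) ℓ = t' := by
      rintro t' - ⟨j, hj, e⟩
      have : j ≠ m := by
        rintro rfl
        have := h.walk
        rw [hj] at this
        exact absurd this (by decide)
      exact ⟨j, by rw [Function.update_of_ne this, hj], by rw [Function.update_of_ne this, hl, e]⟩
    intro j hj t' ht' hlt
    rw [hl] at hlt
    by_cases h1 : j = m
    · subst h1
      rw [Function.update_self, add_sub_cancel_left] at hlt
      exact key t' ht' (h.next t' ht' hlt)
    · rw [Function.update_of_ne h1] at hj hlt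
      exact key t' ht' (h.initial j hj t' ht' hlt)

/-- A robot `j` with light `off` comes before all others of this light: in the order by columns, from the
top in each column. -/
def FirstOff (pos : Fin k → GridPt) (light : Fin k → Fin 8) (j : Fin k) : Prop :=
  light j = off ∧ ∀ i, light i = off → i ≠ j →
    (pos j).1 < (pos i).1 ∨ (pos j).1 = (pos i).1 ∧ (pos i).2 < (pos j).2

theorem exists_firstOff (hinj : Function.Injective pos) (h : ∃ j, light j = off) :
    ∃ j, FirstOff pos light j := by
  classical
  obtain ⟨j0, hj0⟩ := h
  obtain ⟨j, hj, hmin⟩ := Finset.exists_min_image (Finset.univ.filter fun j => light j = off)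
    (fun j => toLex ((pos j).1, -(pos j).2)) ⟨j0, by simpa using hj0⟩
  simp only [Finset.mem_filter, Finset.mem_univ, true_and] at hj hmin
  refine ⟨j, hj, fun i hi hij => ?_⟩
  have h1 := hmin i hi
  rw [Prod.Lex.toLex_le_toLex] at h1
  have h2 : ¬ ((pos i).1 = (pos j).1 ∧ (pos i).2 = (pos j).2) := fun h => hij (hinj (Prod.ext h.1 h.2))
  simp only at h1
  omega

/-- Without a walking robot, exactly the first waiting robot is called. -/
theorem Scene.called_iff (h : Scene P pos light ℓ) (hP : 1 < P.card) (hw : ∀ j, light j ≠ walk)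
    {j : Fin k} (hj : FirstOff pos light j) {i : Fin k} (hi : light i = off) (e : ℤˣ) :
    Called (snapshot pos light e i) ↔ e = 1 ∧ i = j := by
  rcases Int.units_eq_one_or e with rfl | rfl
  swap
  · exact iff_of_false (h.not_called_neg i) (fun h => absurd h.1 (by decide))
  have hpi := h.off_pos hi
  have hil : i ≠ ℓ := by rintro rfl; omega
  constructor
  · intro hc
    refine ⟨rfl, ?_⟩
    by_contra hij
    -- the first robot in the direction of `j` contradicts the call
    obtain ⟨z, hz, hs, hz'⟩ := exists_sees_coords h.inj hij
    have hpj := h.off_pos hj.1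
    have hfirst := hj.2 i hi hij
    have hmem := mem_snapshot_of_sees (light := light) (e := 1) hz hs
    have hoff : light z = off := by
      rcases hz' with rfl | hb
      · exact hj.1
      have hc := sbtw_coords hb
      rcases h.cases z with rfl | h' | h' | h'
      · omega
      · exact h'
      · have := h.fixed_neg hP h'
        omega
      · exact absurd h' (hw z)
    by_cases hcol : (pos z).1 < (pos i).1
    · have := hc.2.2.1 _ hmem (by simp only [flipY_fst, Prod.fst_sub]; omega)
      simp only [hoff] at this
      revert this; decide
    · have h1 : (pos z).1 = (pos i).1 ∧ (pos i).2 < (pos z).2 := by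
        rcases hz' with rfl | hb
        · omega
        · have := sbtw_coords hb
          omega
      have := hc.2.2.2 _ hmem (by simp only [flipY_fst, Prod.fst_sub]; omega)
      simp only [flipY_snd, Prod.snd_sub, Units.val_one] at this
      omega
  · rintro ⟨-, rfl⟩
    have hleft : ∀ l, l ≠ i → (pos l).1 ≤ (pos i).1 → light l = Apf.lead ∨ light l = fixed ∨
        (pos l).1 = (pos i).1 ∧ (pos l).2 < (pos i).2 := by
      intro l hl hli
      rcases h.cases l with rfl | h' | h' | h'
      · exact .inl h.lead
      · have := hj.2 l h' hl
        omega
      · exact .inr (.inl h')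
      · exact absurd h' (hw l)
    have hsee : Sees pos i ℓ := by
      intro l hl
      have hc := sbtw_coords hl
      rcases h.cases l with rfl | h' | h' | h'
      · omega
      · by_cases hli : l = i
        · subst hli; omega
        · have := hj.2 l h' hli
          omega
      · have := h.fixed_neg hP h'
        omega
      · exact absurd h' (hw l)
    refine ⟨⟨_, mem_snapshot_of_sees hil.symm hsee, h.lead, ?_, ?_⟩, ?_, ?_, ?_⟩
    · simp only [flipY_fst, Prod.fst_sub]; omega
    · have := h.low i hil
      simp only [flipY_snd, Prod.snd_sub, Units.val_one]; omega
    · rw [forall_mem_snapshot]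
      exact fun l _ _ => hw l
    · rw [forall_mem_snapshot]
      intro l hl _ hlt
      simp only [flipY_fst, Prod.fst_sub] at hlt
      rcases hleft l hl (by omega) with h' | h' | h'
      · exact .inl h'
      · exact .inr h'
      · omega
    · rw [NoneAbove, forall_mem_snapshot]
      intro l hl _ h0
      simp only [flipY_fst, flipY_snd, Prod.fst_sub, Prod.snd_sub, Units.val_one] at h0 ⊢
      rcases h.cases l with rfl | h' | h' | h'
      · omega
      · have := hj.2 l h' hl
        omega
      · have := h.fixed_neg hP h'
        omega
      · exact absurd h' (hw l)

theorem Scene.outcome_first (h : Scene P pos light ℓ) (hP : 1 < P.card) (hw : ∀ j, light j ≠ walk)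
    {j : Fin k} (hj : FirstOff pos light j) :
    outcome algorithm P orient pos light j = (walk, 0) := by
  have hleft := h.exists_left hj.1
  rw [outcome_of_rule hP 1 (o := (walk, .stay))]
  · exact congrArg _ (flipY_zero _)
  · rw [rule, if_pos hj.1]
    exact (ruleOff_eq hleft h.lights 1).1 ((h.called_iff hP hw hj hj.1 1).2 ⟨rfl, rfl⟩)
  · rw [rule, if_pos hj.1]
    refine (ruleOff_eq hleft h.lights (-1)).2 fun hc => ?_
    exact absurd ((h.called_iff hP hw hj hj.1 (-1)).1 hc).1 (by decide)

theorem Scene.rests_others (h : Scene P pos light ℓ) (hP : 1 < P.card) (hw : ∀ j, light j ≠ walk)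
    {j : Fin k} (hj : FirstOff pos light j) (i : Fin k) (hi : i ≠ j) :
    Rests algorithm P orient pos light i := by
  rcases h.cases i with rfl | h' | h' | h'
  · exact h.rests_leader hP hj.1
  · exact rests_off hP h' (h.exists_left h') h.lights fun e hc =>
      hi ((h.called_iff hP hw hj h' e).1 hc).2
  · exact rests_fixed hP h'
  · exact absurd h' (hw i)

/-- As long as some robot waits, some target is free; the first one is the next to be occupied. -/
theorem Scene.exists_target (h : Scene P pos light ℓ) (hP : 1 < P.card) (hk : P.card = k) {m : Fin k}
    (hm : light m ≠ fixed) (hml : m ≠ ℓ) :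
    ∃ t ∈ targets P, (∀ j, light j = fixed → LexLT (pos j - pos ℓ) t) ∧
      ∀ t' ∈ targets P, LexLT t' t → ∃ j, light j = fixed ∧ pos j - pos ℓ = t' := by
  classical
  have hne : ((targets P).filter fun t => ¬ ∃ j, light j = fixed ∧ pos j - pos ℓ = t).Nonempty := by
    by_contra hemp
    rw [Finset.not_nonempty_iff_eq_empty, Finset.filter_eq_empty_iff] at hemp
    have hsub : targets P ⊆
        ((Finset.univ.erase ℓ).erase m).image fun j => pos j - pos ℓ := by
      intro t ht
      obtain ⟨j, hj, e⟩ := not_not.1 (hemp ht)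
      refine Finset.mem_image.2 ⟨j, ?_, e⟩
      simp only [Finset.mem_erase, Finset.mem_univ, and_true]
      refine ⟨?_, ?_⟩
      · rintro rfl; exact hm hj
      · rintro rfl
        rw [h.lead] at hj
        exact absurd hj (by decide)
    have h1 := (Finset.card_le_card hsub).trans Finset.card_image_le
    rw [card_targets hP, Finset.card_erase_of_mem (by simpa using hml),
      Finset.card_erase_of_mem (Finset.mem_univ _), Finset.card_univ, Fintype.card_fin] at h1
    omega
  obtain ⟨t, ht, hmin⟩ := exists_lexMin hne
  simp only [Finset.mem_filter] at ht hmin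
  refine ⟨t, ht.1, fun j hj => ?_, fun t' ht' hlt => ?_⟩
  · have hne : pos j - pos ℓ ≠ t := fun e => ht.2 ⟨j, hj, e⟩
    rcases LexLT.total hne with hlt | hlt
    · exact hlt
    · exact absurd (h.initial j hj t ht.1 hlt) ht.2
  · by_contra hno
    exact hmin t' ⟨ht', hno⟩ hlt

/-- The robot that was called walks to the first free target. -/
theorem Scene.call (h : Scene P pos light ℓ) (hP : 1 < P.card) (hk : P.card = k)
    (hw : ∀ j, light j ≠ walk) {m : Fin k} (hm : FirstOff pos light m) :
    ∃ t, Walking P pos (Function.update light m walk) ℓ m t := by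
  have hml : m ≠ ℓ := by
    rintro rfl
    have := h.off_pos hm.1
    omega
  have hmf : light m ≠ fixed := by rw [hm.1]; decide
  obtain ⟨t, ht, hfree, hnext⟩ := h.exists_target hP hk hmf hml
  have hup : ∀ {j l}, Function.update light m walk j = l → l ≠ walk → light j = l := by
    intro j l hj hl
    by_cases h1 : j = m
    · subst h1
      rw [Function.update_self] at hj
      exact absurd hj.symm hl
    · rwa [Function.update_of_ne h1] at hj
  have hdown : ∀ {j}, light j = fixed → Function.update light m walk j = fixed := by
    intro j hj
    rw [Function.update_of_ne, hj]
    rintro rfl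
    exact hmf hj
  refine ⟨t, ⟨h.inj, ?_, h.low, ?_, ?_⟩, ?_, ?_, ht, ?_, ?_, ?_, ?_⟩
  · rw [Function.update_of_ne hml.symm]
    exact h.lead
  · intro j hj
    by_cases h1 : j = m
    · subst h1
      exact .inr (.inr (Function.update_self _ _ _))
    · rw [Function.update_of_ne h1]
      exact h.kinds j hj
  · intro j hj t' ht' hlt
    obtain ⟨j', hj', e⟩ := h.initial j (hup hj (by decide)) t' ht' hlt
    exact ⟨j', hdown hj', e⟩
  · exact Function.update_self _ _ _
  · intro j hj
    by_contra h1
    rw [Function.update_of_ne h1] at hj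
    exact hw j hj
  · exact fun j hj => hfree j (hup hj (by decide))
  · intro t' ht' hlt
    obtain ⟨j', hj', e⟩ := hnext t' ht' hlt
    exact ⟨j', hdown hj', e⟩
  · intro j hj
    have hjo := hup hj (by decide)
    refine hm.2 j hjo ?_
    rintro rfl
    rw [Function.update_self] at hj
    exact absurd hj (by decide)
  · have := h.off_pos hm.1
    omega

/-! ### The last move of the leader -/

/-- All robots but the leader are fixed on the targets given by an earlier position `o` of the leader,
which has since been walking along its row. -/
structure Finale (P : Finset GridPt) (pos : Fin k → GridPt) (light : Fin k → Fin 8) (ℓ : Fin k)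
    (o : GridPt) : Prop where
  inj : Function.Injective pos
  lead : light ℓ = lead
  done : ∀ j, j ≠ ℓ → light j = fixed
  target : ∀ j, j ≠ ℓ → pos j - o ∈ targets P
  filled : ∀ t ∈ targets P, ∃ j, j ≠ ℓ ∧ pos j - o = t
  row : (pos ℓ).2 = o.2

theorem Scene.finale (h : Scene P pos light ℓ) (hP : 1 < P.card) (hk : P.card = k)
    (hf : ∀ j, j ≠ ℓ → light j = fixed) : Finale P pos light ℓ (pos ℓ) := by
  classical
  have htar : ∀ j, j ≠ ℓ → pos j - pos ℓ ∈ targets P := by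
    intro j hj
    have h1 := hf j hj
    rcases h.kinds j hj with h' | h' | h'
    · rw [h1] at h'; exact absurd h'.1 (by decide)
    · exact h'.2
    · rw [h1] at h'; exact absurd h' (by decide)
  refine ⟨h.inj, h.lead, hf, htar, ?_, rfl⟩
  have heq : (Finset.univ.erase ℓ).image (fun j => pos j - pos ℓ) = targets P := by
    refine Finset.eq_of_subset_of_card_le ?_ ?_
    · intro t ht
      obtain ⟨j, hj, rfl⟩ := Finset.mem_image.1 ht
      exact htar j (Finset.mem_erase.1 hj).1
    · rw [Finset.card_image_of_injective _ fun i j e => h.inj (sub_left_injective e), card_targets hP,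
        Finset.card_erase_of_mem (Finset.mem_univ _), Finset.card_univ, Fintype.card_fin, hk]
  intro t ht
  rw [← heq] at ht
  obtain ⟨j, hj, e⟩ := Finset.mem_image.1 ht
  exact ⟨j, (Finset.mem_erase.1 hj).1, e⟩

section Finale

variable {o : GridPt}

theorem Finale.below (hP : 1 < P.card) (h : Finale P pos light ℓ o) {j : Fin k} (hj : j ≠ ℓ) :
    (pos j).2 < (pos ℓ).2 := by
  have := (targets_neg hP (h.target j hj)).2
  have h2 := h.row
  simp only [Prod.snd_sub] at this
  omega

/-- The leader sees the rightmost robot in the top row of the others. -/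
theorem Finale.exists_isTopRight (hP : 1 < P.card) (h : Finale P pos light ℓ o) :
    ∃ r, IsTopRight {p | ∃ l, (p, l) ∈ snapshot pos light 1 ℓ} r ∧
      r.1 + headOffset P = o.1 + (place P (topRight P)).1 - (pos ℓ).1 := by
  obtain ⟨r, hr, hoff⟩ := isTopRight_targets hP
  obtain ⟨j, hj, e⟩ := h.filled r hr.1
  have hsee : Sees pos ℓ j := by
    intro l hl
    have hc := sbtw_coords hl
    have hlℓ : l ≠ ℓ := by rintro rfl; omega
    have h1 := hr.2 _ (h.target l hlℓ)
    have h2 := h.below hP hlℓ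
    have h3 := h.below hP hj
    rw [← e] at h1
    simp only [Prod.snd_sub, Prod.fst_sub] at h1
    omega
  refine ⟨pos j - pos ℓ, ⟨⟨light j, ?_⟩, ?_⟩, ?_⟩
  · have := mem_snapshot_of_sees (light := light) (e := 1) hj hsee
    rwa [flipY_one] at this
  · rintro p ⟨l, hl⟩
    obtain ⟨i, hi, -, e'⟩ := mem_snapshot.1 hl
    rw [flipY_one] at e'
    have h1 := hr.2 _ (h.target i hi)
    rw [← e] at h1
    rw [Prod.mk.injEq] at e'
    rw [← e'.1]
    simp only [Prod.snd_sub, Prod.fst_sub] at h1 ⊢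
    omega
  · have h1 := congrArg Prod.fst e
    simp only [Prod.fst_sub] at h1 ⊢
    omega

theorem Finale.all_fixed (hP : 1 < P.card) (h : Finale P pos light ℓ o) :
    ∀ p ∈ snapshot pos light 1 ℓ, p.2 = fixed ∧ p.1.2 < 0 := by
  rw [forall_mem_snapshot]
  intro j hj _
  refine ⟨h.done j hj, ?_⟩
  have := h.below hP hj
  simp only [flipY_one, Prod.snd_sub]
  omega

theorem Finale.exists_ne (hP : 1 < P.card) (h : Finale P pos light ℓ o) : ∃ j, j ≠ ℓ := by
  obtain ⟨r, hr, -⟩ := isTopRight_targets hP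
  obtain ⟨j, hj, -⟩ := h.filled r hr.1
  exact ⟨j, hj⟩

theorem Finale.rule_neg (hP : 1 < P.card) (h : Finale P pos light ℓ o) :
    rule P (light ℓ) (snapshot pos light (-1) ℓ) = none := by
  obtain ⟨j, hj⟩ := h.exists_ne hP
  obtain ⟨z, hz, hs, -⟩ := exists_sees_coords h.inj hj.symm
  have hb := h.below hP hz
  rw [h.lead]
  change ruleLead P _ = none
  rw [ruleLead, if_neg]
  intro hall
  have := (hall _ (mem_snapshot_of_sees hz hs)).2
  simp only [flipY_snd, Prod.snd_sub, Units.val_neg, Units.val_one] at this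
  omega

theorem Finale.outcome_left (hP : 1 < P.card) (h : Finale P pos light ℓ o)
    (hlt : o.1 + (place P (topRight P)).1 < (pos ℓ).1) :
    outcome algorithm P orient pos light ℓ = (Apf.lead, (-1, 0)) := by
  obtain ⟨r, hr, hoff⟩ := h.exists_isTopRight hP
  rw [outcome_of_rule hP 1 (o := (Apf.lead, .left)) _ (h.rule_neg hP)]
  · rfl
  · rw [h.lead]
    change ruleLead P _ = _
    rw [ruleLead, if_pos (h.all_fixed hP), if_pos ⟨r, hr, by omega⟩]

theorem Finale.outcome_down (hP : 1 < P.card) (h : Finale P pos light ℓ o)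
    (heq : o.1 + (place P (topRight P)).1 = (pos ℓ).1) :
    outcome algorithm P orient pos light ℓ = (fixed, (0, -1)) := by
  obtain ⟨r, hr, hoff⟩ := h.exists_isTopRight hP
  rw [outcome_of_rule hP 1 (o := (fixed, .down)) _ (h.rule_neg hP)]
  · rfl
  · rw [h.lead]
    change ruleLead P _ = _
    rw [ruleLead, if_pos (h.all_fixed hP), if_neg, if_pos ⟨r, hr, by omega⟩]
    rintro ⟨r', hr', hlt⟩
    rw [isTopRight_unique hr' hr] at hlt
    omega

theorem Completes.of_formed (hP : 1 < P.card) (hinj : Function.Injective pos)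
    (hall : ∀ i, light i = fixed) (hform : FormsPattern pos P) (n : ℕ) :
    Completes algorithm P orient n (Cfg.quiet pos light) := by
  refine .done hinj (fun i hi => ?_) hform
  rcases hi with hi | hi
  · exact hi rfl
  · exact hi (rests_fixed hP (hall i))

theorem Finale.completes (hP : 1 < P.card) (N : ℕ) : ∀ {pos : Fin k → GridPt},
    Finale P pos light ℓ o → (pos ℓ).1 - (o.1 + (place P (topRight P)).1) = N →
    Completes algorithm P orient (3 * N + 3) (Cfg.quiet pos light) := by
  classical
  induction N with
  | zero =>
    intro pos h hN
    have heq : o.1 + (place P (topRight P)).1 = (pos ℓ).1 := by push_cast at hN; omega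
    have hdest : pos ℓ + (0, -1) = o + place P (topRight P) := by
      have := h.row
      refine Prod.ext ?_ ?_ <;> simp only [Prod.fst_add, Prod.snd_add, place_topRight_snd] <;> omega
    have hne : ∀ j, j ≠ ℓ → pos j ≠ pos ℓ + (0, -1) := by
      intro j hj e
      have ht := h.target j hj
      rw [e, hdest, add_sub_cancel_left, targets, Finset.mem_image] at ht
      obtain ⟨p, hp, e'⟩ := ht
      exact (Finset.mem_erase.1 hp).1 (place_injective P e')
    have hrest : ∀ i, i ≠ ℓ → Rests algorithm P orient pos light i :=
      fun i hi => rests_fixed hP (h.done i hi)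
    refine Completes.seq_step h.inj (h.outcome_down hP heq) (by simp) hrest
      (fun _ i hi => rests_fixed hP (by rw [Function.update_of_ne hi]; exact h.done i hi)) ?_
    refine Completes.of_formed hP ?_ ?_ ?_ _
    · exact injective_update h.inj hne
    · intro i
      by_cases h1 : i = ℓ
      · subst h1; exact Function.update_self _ _ _
      · rw [Function.update_of_ne h1]; exact h.done i h1
    · refine ⟨(o.1 - maxX P - 1, o.2 - (topRight P).2 - 1), 1, ?_⟩
      have hplace : ∀ q, ((o.1 - maxX P - 1, o.2 - (topRight P).2 - 1) : GridPt) + flipY 1 q =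
          o + place P q := by
        intro q
        rw [flipY_one]
        refine Prod.ext ?_ ?_ <;> simp only [Prod.fst_add, Prod.snd_add, place] <;> ring
      simp only [hplace]
      ext p
      simp only [Finset.mem_image, Finset.mem_univ, true_and]
      constructor
      · rintro ⟨j, rfl⟩
        by_cases h1 : j = ℓ
        · subst h1
          exact ⟨topRight P, topRight_mem hP, by rw [Function.update_self, hdest]⟩
        · have ht := h.target j h1
          rw [targets, Finset.mem_image] at ht
          obtain ⟨q, hq, e⟩ := ht
          exact ⟨q, (Finset.mem_erase.1 hq).2, by rw [Function.update_of_ne h1, e]; abel⟩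
      · rintro ⟨q, hq, rfl⟩
        by_cases h1 : q = topRight P
        · subst h1
          exact ⟨ℓ, by rw [Function.update_self, hdest]⟩
        · obtain ⟨j, hj, e⟩ := h.filled (place P q)
            (Finset.mem_image_of_mem _ (Finset.mem_erase.2 ⟨h1, hq⟩))
          exact ⟨j, by rw [Function.update_of_ne hj, ← e]; abel⟩
  | succ N ih =>
    intro pos h hN
    push_cast at hN
    rw [show 3 * (N + 1) + 3 = (3 * N + 3) + 3 by ring]
    have hout := h.outcome_left (orient := orient) hP (by omega)
    refine Completes.move_step h.inj (d := (-1, 0)) (by rw [hout, h.lead]) (by decide)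
      (fun i hi => rests_fixed hP (h.done i hi)) ?_
    have hne : ∀ j, j ≠ ℓ → pos j ≠ pos ℓ + (-1, 0) := by
      intro j hj e
      have := h.below hP hj
      rw [e] at this
      simp at this
    refine ih ⟨?_, h.lead, h.done, ?_, ?_, ?_⟩ ?_
    · exact injective_update h.inj hne
    · intro j hj
      rw [Function.update_of_ne hj]
      exact h.target j hj
    · intro t ht
      obtain ⟨j, hj, e⟩ := h.filled t ht
      exact ⟨j, hj, by rw [Function.update_of_ne hj]; exact e⟩
    · rw [Function.update_self, ← h.row]
      simp
    · rw [Function.update_self]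
      simp only [Prod.fst_add]
      omega

end Finale

/-- The leader is in place; `E` bounds the lengths of the walks, `G` the last walk of the leader. -/
theorem Scene.completes (hP : 1 < P.card) (hk : P.card = k) {E G : ℕ}
    (hG : -(place P (topRight P)).1 ≤ G) (r : ℕ) : ∀ {pos : Fin k → GridPt} {light : Fin k → Fin 8},
    Scene P pos light ℓ → (∀ j, light j ≠ walk) →
    (Finset.univ.filter fun j => light j = off).card = r →
    (∀ j, light j = off → ∀ t ∈ targets P, (pos j - pos ℓ).1 - t.1 + |(pos j - pos ℓ).2 - t.2| ≤ E) →
    Completes algorithm P orient (r * (3 * E + 6) + (3 * G + 3)) (Cfg.quiet pos light) := by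
  induction r with
  | zero =>
    intro pos light h hw hr _
    rw [Finset.card_eq_zero, Finset.filter_eq_empty_iff] at hr
    have hf : ∀ j, j ≠ ℓ → light j = fixed := by
      intro j hj
      rcases h.cases j with h' | h' | h' | h'
      · exact absurd h' hj
      · exact absurd h' (hr (Finset.mem_univ j))
      · exact h'
      · exact absurd h' (hw j)
    have hneg := place_neg hP (topRight_mem hP)
    refine ((h.finale hP hk hf).completes hP (-(place P (topRight P)).1).toNat ?_).mono (by omega)
    rw [Int.toNat_of_nonneg (by omega)]
    ring
  | succ r ih =>
    intro pos light h hw hr hE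
    have hex : ∃ j, light j = off := by
      have : (Finset.univ.filter fun j => light j = off).Nonempty := by
        rw [← Finset.card_pos]; omega
      obtain ⟨j, hj⟩ := this
      exact ⟨j, by simpa using hj⟩
    obtain ⟨m, hm⟩ := exists_firstOff h.inj hex
    obtain ⟨t, hwalk⟩ := h.call hP hk hw hm
    have hml := hwalk.ne
    have hEm := hE m hm.1 t hwalk.target
    have htn := targets_neg hP hwalk.target
    have hpos := h.off_pos hm.1
    have hnn : 0 ≤ (pos m - pos ℓ).1 - t.1 + |(pos m - pos ℓ).2 - t.2| := by
      have := abs_nonneg ((pos m - pos ℓ).2 - t.2)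
      simp only [Prod.fst_sub] at this ⊢
      omega
    have hstep : Completes algorithm P orient (r * (3 * E + 6) + (3 * G + 3))
        (Cfg.quiet (Function.update pos m (pos ℓ + t))
          (Function.update (Function.update light m walk) m fixed)) := by
      refine ih (hwalk.arrive hP) ?_ ?_ ?_
      · intro j
        rw [Function.update_idem]
        by_cases h1 : j = m
        · subst h1; rw [Function.update_self]; decide
        · rw [Function.update_of_ne h1]; exact hw j
      · have : (Finset.univ.filter fun j => Function.update (Function.update light m walk) m fixed j = off) =
            (Finset.univ.filter fun j => light j = off).erase m := by
          ext j
          simp only [Function.update_idem, Finset.mem_filter, Finset.mem_univ, true_and, Finset.mem_erase]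
          by_cases h1 : j = m
          · subst h1; simp; decide
          · simp [h1]
        rw [this, Finset.card_erase_of_mem (by simpa using hm.1), hr]
        rfl
      · intro j hj
        rw [Function.update_idem] at hj
        have h1 : j ≠ m := by
          rintro rfl
          rw [Function.update_self] at hj
          exact absurd hj (by decide)
        rw [Function.update_of_ne h1] at hj ⊢
        rw [Function.update_of_ne hml.symm]
        exact hE j hj
    have := hwalk.completes (orient := orient) hP
      ((pos m - pos ℓ).1 - t.1 + |(pos m - pos ℓ).2 - t.2|).toNat (Int.toNat_of_nonneg hnn).symm hstep
    refine (Completes.light_step h.inj (h.outcome_first hP hw hm) (by rw [hm.1]; decide)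
      (h.rests_others hP hw hm) this).mono ?_
    have : ((pos m - pos ℓ).1 - t.1 + |(pos m - pos ℓ).2 - t.2|).toNat ≤ E := by omega
    have hmul : (r + 1) * (3 * E + 6) = r * (3 * E + 6) + (3 * E + 6) := by ring
    rw [hmul]
    generalize r * (3 * E + 6) = z
    omega

end Apf

namespace Apf

variable {k : ℕ} {P : Finset GridPt} {orient : Fin k → ℤˣ} {pos : Fin k → GridPt}
  {light : Fin k → Fin 8} {ℓ m : Fin k}

/-! ### The leader goes to its row -/

theorem ruleOff_eq_none {V : Snapshot 8} (h1 : ∃ p ∈ V, p.1.1 < 0)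
    (h2 : ∀ q, OneLeft V wait q → q.2 < 0 → ¬ NoneAbove V) (h3 : ¬ OnAxis V) (h4 : ¬ Called V) :
    ruleOff V = none := by
  rw [ruleOff, if_neg, if_neg, if_neg h3, if_neg h4]
  · rintro ⟨⟨q, hq, hlt⟩, hn⟩
    exact h2 q hq hlt hn
  · obtain ⟨p, hp, hlt⟩ := h1
    exact fun h => absurd (h p hp) (by omega)

theorem not_called_of_no_lead (h : ∀ j, light j ≠ lead) (e : ℤˣ) (i : Fin k) :
    ¬ Called (snapshot pos light e i) := by
  rintro ⟨⟨p, hp, hl, -⟩, -⟩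
  obtain ⟨j, -, -, rfl⟩ := mem_snapshot.1 hp
  exact h j hl

theorem rests_walk_of_no_lead (hP : 1 < P.card) {i : Fin k} (hi : light i = walk)
    (h : ∀ j, light j ≠ lead) : Rests algorithm P orient pos light i := by
  refine rests_of_none hP fun e => ?_
  rw [hi]
  refine ruleWalk_eq_none fun q t hg => ?_
  obtain ⟨j, -, -, hj⟩ := mem_snapshot.1 hg.1
  exact h j (congrArg Prod.snd hj)

open Classical in
theorem ruleElect_alone {V : Snapshot 8} (h1 : ∀ p ∈ V, 0 < p.1.1)
    (h2 : ∀ p ∈ V, p.2 ≠ elect ∧ p.2 ≠ step) :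
    ruleElect V = if ∀ p ∈ V, p.1.2 < 0 then
      if ∃ p ∈ V, p.1.2 = -1 then some (lead, .stay) else some (elect, .down)
    else if (∃ p ∈ V, p.1.2 ≤ 0) ∧ ∀ p ∈ V, p.2 = walk → p.1.2 < 0 then some (elect, .up)
    else none := by
  rw [ruleElect, if_neg, if_neg, if_neg, if_pos ⟨h1, h2⟩]
  · rintro ⟨q, hq, hlt, -⟩
    exact absurd (h1 _ hq) (by simp only; omega)
  · rintro ⟨-, ⟨p, hp, h0, -⟩, -⟩
    exact absurd (h1 p hp) (by omega)
  · rintro ⟨p, hp, -, -, -, h0, -⟩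
    exact absurd (h1 p hp) (by omega)

/-- The elected robot `ℓ` is alone in the leftmost column. At most one other robot, alone in the leftmost
of the other columns and not in the row of `ℓ`, was told to walk; all others show the light `off`. -/
structure Elected (pos : Fin k → GridPt) (light : Fin k → Fin 8) (ℓ : Fin k) : Prop where
  inj : Function.Injective pos
  lit : light ℓ = elect
  right : ∀ j, j ≠ ℓ → (pos ℓ).1 < (pos j).1
  kinds : ∀ j, j ≠ ℓ → light j = off ∨ light j = walk
  sole : ∀ m, light m = walk → (pos m).2 ≠ (pos ℓ).2 ∧ ∀ j, j ≠ ℓ → j ≠ m → (pos m).1 < (pos j).1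

namespace Elected

variable (h : Elected pos light ℓ)
include h

theorem no_lead (j : Fin k) : light j ≠ lead := by
  by_cases hj : j = ℓ
  · rw [hj, h.lit]; decide
  · rcases h.kinds j hj with h' | h' <;> rw [h'] <;> decide

theorem rests_others (hP : 1 < P.card) (i : Fin k) (hi : i ≠ ℓ) :
    Rests algorithm P orient pos light i := by
  rcases h.kinds i hi with h' | h'
  swap
  · exact rests_walk_of_no_lead hP h' h.no_lead
  refine rests_of_none hP fun e => ?_
  rw [rule, if_pos h']
  refine ruleOff_eq_none ?_ ?_ ?_ (not_called_of_no_lead h.no_lead e i)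
  · obtain ⟨z, hz, hs, hz'⟩ := exists_sees_coords h.inj hi
    refine ⟨_, mem_snapshot_of_sees hz hs, ?_⟩
    have := h.right i hi
    simp only [flipY_fst, Prod.fst_sub]
    rcases hz' with rfl | hb
    · omega
    · have := sbtw_coords hb
      omega
  · rintro q ⟨hq, -⟩
    obtain ⟨j, -, -, hj⟩ := mem_snapshot.1 hq
    have hj' : light j = wait := congrArg Prod.snd hj
    by_cases hjl : j = ℓ
    · rw [hjl, h.lit] at hj'; exact absurd hj' (by decide)
    · rcases h.kinds j hjl with h'' | h'' <;> rw [h''] at hj' <;> exact absurd hj' (by decide)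
  · rintro ⟨⟨x, y, -, hy, h1, h2, -⟩, -⟩
    have hall : ∀ p, (p, elect) ∈ snapshot pos light e i → p = flipY e (pos ℓ - pos i) := by
      intro p hp
      obtain ⟨j, -, -, hj⟩ := mem_snapshot.1 hp
      rw [Prod.mk.injEq] at hj
      have hjl : j = ℓ := by
        by_contra hjl
        rcases h.kinds j hjl with h'' | h'' <;> rw [h''] at hj <;> exact absurd hj.2 (by decide)
      rw [← hj.1, hjl]
    have h3 := (hall _ h1).trans (hall _ h2).symm
    rw [Prod.mk.injEq] at h3
    omega

theorem snapshot_spec (e : ℤˣ) : (∀ p ∈ snapshot pos light e ℓ, 0 < p.1.1) ∧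
    ∀ p ∈ snapshot pos light e ℓ, p.2 ≠ elect ∧ p.2 ≠ step := by
  constructor
  · rw [forall_mem_snapshot]
    intro j hj _
    have := h.right j hj
    simp only [flipY_fst, Prod.fst_sub]
    omega
  · rw [forall_mem_snapshot]
    intro j hj _
    rcases h.kinds j hj with h' | h' <;> simp only [h'] <;> decide

omit h in
theorem all_below_iff (hinj : Function.Injective pos) :
    (∀ p ∈ snapshot pos light 1 ℓ, p.1.2 < 0) ↔ ∀ j, j ≠ ℓ → (pos j).2 < (pos ℓ).2 := by
  rw [forall_mem_snapshot]
  simp only [flipY_one, Prod.snd_sub]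
  constructor
  · intro hall j hj
    obtain ⟨z, hz, hs, hz'⟩ := exists_sees_coords hinj hj.symm
    have := hall z hz hs
    rcases hz' with rfl | hb
    · omega
    · have := sbtw_coords hb
      omega
  · intro hall j hj _
    have := hall j hj
    omega

omit h in
theorem exists_below_iff (hinj : Function.Injective pos) :
    (∃ p ∈ snapshot pos light 1 ℓ, p.1.2 ≤ 0) ↔ ∃ j, j ≠ ℓ ∧ (pos j).2 ≤ (pos ℓ).2 := by
  constructor
  · rintro ⟨p, hp, hle⟩
    obtain ⟨j, hj, -, rfl⟩ := mem_snapshot.1 hp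
    refine ⟨j, hj, ?_⟩
    simp only [flipY_one, Prod.snd_sub] at hle
    omega
  · rintro ⟨j, hj, hle⟩
    obtain ⟨z, hz, hs, hz'⟩ := exists_sees_coords hinj hj.symm
    refine ⟨_, mem_snapshot_of_sees hz hs, ?_⟩
    simp only [flipY_one, Prod.snd_sub]
    rcases hz' with rfl | hb
    · omega
    · have := sbtw_coords hb
      omega

/-- The neighbouring row below is visible. -/
theorem exists_neg_one_iff :
    (∃ p ∈ snapshot pos light 1 ℓ, p.1.2 = -1) ↔ ∃ j, j ≠ ℓ ∧ (pos j).2 = (pos ℓ).2 - 1 := by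
  constructor
  · rintro ⟨p, hp, hle⟩
    obtain ⟨j, hj, -, rfl⟩ := mem_snapshot.1 hp
    refine ⟨j, hj, ?_⟩
    simp only [flipY_one, Prod.snd_sub] at hle
    omega
  · rintro ⟨j, hj, hle⟩
    obtain ⟨z, hz, hs, hz'⟩ := exists_sees_coords h.inj hj.symm
    refine ⟨_, mem_snapshot_of_sees hz hs, ?_⟩
    simp only [flipY_one, Prod.snd_sub]
    rcases hz' with rfl | hb
    · omega
    · have := sbtw_coords hb
      omega

/-- In a frame in which somebody is above and nobody below, or the walking robot is above, there is
nothing to do. -/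
theorem rule_neg (hP : 1 < P.card) (hk : P.card = k)
    (hside : (∀ j, j ≠ ℓ → (pos j).2 < (pos ℓ).2) ∨ ∃ m, light m = walk ∧ (pos m).2 < (pos ℓ).2) :
    rule P (light ℓ) (snapshot pos light (-1) ℓ) = none := by
  obtain ⟨hs1, hs2⟩ := h.snapshot_spec (-1)
  rw [h.lit]
  change ruleElect _ = none
  have hex : ∃ z, z ≠ ℓ := by
    have : Nontrivial (Fin k) := Fin.nontrivial_iff_two_le.2 (by omega)
    exact exists_ne ℓ
  have habove : ∃ p ∈ snapshot pos light (-1) ℓ, ¬ p.1.2 < 0 := by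
    have key : ∀ j, j ≠ ℓ → (pos j).2 < (pos ℓ).2 → ∃ p ∈ snapshot pos light (-1) ℓ, ¬ p.1.2 < 0 := by
      intro j hj hlt
      obtain ⟨z, hz, hs, hz'⟩ := exists_sees_coords h.inj hj.symm
      refine ⟨_, mem_snapshot_of_sees hz hs, ?_⟩
      simp only [flipY_snd, Prod.snd_sub, Units.val_neg, Units.val_one]
      rcases hz' with rfl | hb
      · omega
      · have := sbtw_coords hb
        omega
    obtain ⟨j, hj⟩ := hex
    rcases hside with hside | ⟨m, hm, hlt⟩
    · exact key j hj (hside j hj)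
    · refine key m ?_ hlt
      rintro rfl
      omega
  rw [ruleElect_alone hs1 hs2, if_neg, if_neg]
  · rintro ⟨⟨p, hp, hle⟩, hw⟩
    rcases hside with hside | ⟨m, hm, hlt⟩
    · obtain ⟨j, hj, -, rfl⟩ := mem_snapshot.1 hp
      have := hside j hj
      simp only [flipY_snd, Prod.snd_sub, Units.val_neg, Units.val_one] at hle
      omega
    · have hml : m ≠ ℓ := by rintro rfl; omega
      have hsee : Sees pos ℓ m := by
        intro l hl
        have hc := sbtw_coords hl
        have h1 := h.right m hml
        have h2 := (h.sole m hm).2 l (by rintro rfl; omega) (by rintro rfl; omega)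
        omega
      have := hw _ (mem_snapshot_of_sees hml hsee) hm
      simp only [flipY_snd, Prod.snd_sub, Units.val_neg, Units.val_one] at this
      omega
  · intro hall
    obtain ⟨p, hp, hn⟩ := habove
    exact hn (hall p hp)

/-- The elected robot on its way in its column. -/
theorem move (d : GridPt) (hd : d.1 = 0)
    (hrow : ∀ m, light m = walk → (pos m).2 ≠ (pos ℓ + d).2) :
    Elected (Function.update pos ℓ (pos ℓ + d)) light ℓ := by
  have hwl : ∀ m, light m = walk → m ≠ ℓ := by
    rintro m hm rfl
    rw [h.lit] at hm
    exact absurd hm (by decide)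
  refine ⟨injective_update h.inj fun j hj e => ?_, h.lit, fun j hj => ?_, h.kinds, fun m hm => ⟨?_, ?_⟩⟩
  · have e1 := congrArg Prod.fst e
    have := h.right j hj
    rw [Prod.fst_add] at e1
    omega
  · rw [Function.update_self, Function.update_of_ne hj, Prod.fst_add, hd, add_zero]
    exact h.right j hj
  · rw [Function.update_self, Function.update_of_ne (hwl m hm)]
    exact hrow m hm
  · intro j hj hjm
    rw [Function.update_of_ne (hwl m hm), Function.update_of_ne hj]
    exact (h.sole m hm).2 j hj hjm

end Elected

end Apf

namespace Apf

variable {k : ℕ} {P : Finset GridPt} {orient : Fin k → ℤˣ} {pos : Fin k → GridPt}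
  {light : Fin k → Fin 8} {ℓ m : Fin k}

namespace Elected

theorem scene (h : Elected pos light ℓ) (hlow : ∀ j, j ≠ ℓ → (pos j).2 < (pos ℓ).2) :
    Scene P pos (Function.update light ℓ lead) ℓ := by
  refine ⟨h.inj, Function.update_self _ _ _, hlow, fun j hj => ?_, fun j hj => ?_⟩
  · rw [Function.update_of_ne hj]
    rcases h.kinds j hj with h' | h'
    · exact .inl ⟨h', h.right j hj⟩
    · exact .inr (.inr h')
  · exfalso
    by_cases hjl : j = ℓ
    · subst hjl
      rw [Function.update_self] at hj
      exact absurd hj (by decide)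
    · rw [Function.update_of_ne hjl] at hj
      rcases h.kinds j hjl with h' | h' <;> rw [h'] at hj <;> exact absurd hj (by decide)

/-- A robot that was told to walk before the leader took its place is a walking robot. -/
theorem walking (h : Elected pos light ℓ) (hP : 1 < P.card) (hk : P.card = k)
    (hlow : ∀ j, j ≠ ℓ → (pos j).2 < (pos ℓ).2) (hm : light m = walk) :
    ∃ t, Walking P pos (Function.update light ℓ lead) ℓ m t := by
  have hs := h.scene (P := P) hlow
  have hml : m ≠ ℓ := by
    rintro rfl
    rw [h.lit] at hm
    exact absurd hm (by decide)
  have hm' : Function.update light ℓ lead m = walk := by rw [Function.update_of_ne hml, hm]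
  obtain ⟨t, ht, hfree, hnext⟩ := hs.exists_target hP hk (by rw [hm']; decide) hml
  refine ⟨t, hs, hm', fun j hj => ?_, ht, hfree, hnext, fun j hj => ?_, .inl (h.right m hml).le⟩
  · by_contra hjm
    have hjl : j ≠ ℓ := by
      rintro rfl
      rw [Function.update_self] at hj
      exact absurd hj (by decide)
    rw [Function.update_of_ne hjl] at hj
    have h1 := (h.sole m hm).2 j hjl hjm
    have h2 := (h.sole j hj).2 m hml (Ne.symm hjm)
    omega
  · have hjl : j ≠ ℓ := by
      rintro rfl
      rw [Function.update_self] at hj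
      exact absurd hj (by decide)
    refine .inl ((h.sole m hm).2 j hjl ?_)
    rintro rfl
    rw [hm'] at hj
    exact absurd hj (by decide)

end Elected

theorem card_off_le (hl : ∃ j, light j ≠ off) : (Finset.univ.filter fun j => light j = off).card + 1 ≤ k := by
  obtain ⟨j, hj⟩ := hl
  have h1 : (Finset.univ.filter fun j => light j = off) ⊆ Finset.univ.erase j := by
    intro i hi
    simp only [Finset.mem_filter, Finset.mem_univ, true_and] at hi
    simp only [Finset.mem_erase, Finset.mem_univ, and_true]
    rintro rfl
    exact hj hi
  have h2 := Finset.card_le_card h1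
  rw [Finset.card_erase_of_mem (Finset.mem_univ _), Finset.card_univ, Fintype.card_fin] at h2
  have := j.pos
  omega

theorem Walking.completes_all {t : GridPt} (h : Walking P pos light ℓ m t) (hP : 1 < P.card)
    (hk : P.card = k) {E F G : ℕ} (hG : -(place P (topRight P)).1 ≤ G)
    (hE : ∀ j, light j = off → ∀ t ∈ targets P,
      (pos j - pos ℓ).1 - t.1 + |(pos j - pos ℓ).2 - t.2| ≤ E)
    (hF : ∀ t ∈ targets P, (pos m - pos ℓ).1 - t.1 + |(pos m - pos ℓ).2 - t.2| ≤ F)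
    (hpos : (pos ℓ).1 ≤ (pos m).1) :
    Completes algorithm P orient (3 * F + 3 + (k * (3 * E + 6) + (3 * G + 3)))
      (Cfg.quiet pos light) := by
  have hEm := hF t h.target
  have htn := targets_neg hP h.target
  have hnn : 0 ≤ (pos m - pos ℓ).1 - t.1 + |(pos m - pos ℓ).2 - t.2| := by
    have := abs_nonneg ((pos m - pos ℓ).2 - t.2)
    simp only [Prod.fst_sub] at this ⊢
    omega
  have hupd : ∀ j, Function.update light m fixed j = off → j ≠ m ∧ light j = off := by
    intro j hj
    have hjm : j ≠ m := by
      rintro rfl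
      rw [Function.update_self] at hj
      exact absurd hj (by decide)
    rw [Function.update_of_ne hjm] at hj
    exact ⟨hjm, hj⟩
  have hrest := (h.arrive hP).completes (orient := orient) hP hk (E := E) hG _ (fun j hj => by
      by_cases hjm : j = m
      · subst hjm
        rw [Function.update_self] at hj
        exact absurd hj (by decide)
      · rw [Function.update_of_ne hjm] at hj
        exact hjm (h.only j hj)) rfl (fun j hj => by
      obtain ⟨hjm, hjo⟩ := hupd j hj
      rw [Function.update_of_ne hjm, Function.update_of_ne h.ne.symm]
      exact hE j hjo)
  refine (h.completes hP ((pos m - pos ℓ).1 - t.1 + |(pos m - pos ℓ).2 - t.2|).toNat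
    (Int.toNat_of_nonneg hnn).symm hrest).mono ?_
  have hle : ((pos m - pos ℓ).1 - t.1 + |(pos m - pos ℓ).2 - t.2|).toNat ≤ F := by omega
  have hcard := card_off_le (light := Function.update light m fixed) ⟨m, by
    rw [Function.update_self]; decide⟩
  have hmul := Nat.mul_le_mul_right (3 * E + 6) hcard
  rw [add_mul, one_mul] at hmul
  omega

namespace Elected

open Classical in
theorem outcome_one (h : Elected pos light ℓ) (hP : 1 < P.card) (hk : P.card = k)
    (hwalk : ∀ m, light m = walk → (pos m).2 < (pos ℓ).2)
    (hside : (∀ j, j ≠ ℓ → (pos j).2 < (pos ℓ).2) ∨ (∃ j, j ≠ ℓ ∧ (pos j).2 ≤ (pos ℓ).2) ∧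
      (orient ℓ = 1 ∨ ∃ m, light m = walk)) :
    outcome algorithm P orient pos light ℓ =
      if ∀ j, j ≠ ℓ → (pos j).2 < (pos ℓ).2 then
        if ∃ j, j ≠ ℓ ∧ (pos j).2 = (pos ℓ).2 - 1 then (lead, 0) else (elect, (0, -1))
      else (elect, (0, 1)) := by
  obtain ⟨h1, h2⟩ := h.snapshot_spec 1
  have hrule : ∃ o, rule P (light ℓ) (snapshot pos light 1 ℓ) = some o ∧ (o.1, o.2.disp) =
      if ∀ j, j ≠ ℓ → (pos j).2 < (pos ℓ).2 then
        if ∃ j, j ≠ ℓ ∧ (pos j).2 = (pos ℓ).2 - 1 then (lead, (0 : GridPt)) else (elect, (0, -1))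
      else (elect, (0, 1)) := by
    rw [h.lit]
    change ∃ o, ruleElect _ = some o ∧ _
    rw [ruleElect_alone h1 h2]
    by_cases hall : ∀ j, j ≠ ℓ → (pos j).2 < (pos ℓ).2
    · rw [if_pos hall, if_pos ((all_below_iff h.inj).2 hall)]
      by_cases hone : ∃ j, j ≠ ℓ ∧ (pos j).2 = (pos ℓ).2 - 1
      · rw [if_pos hone, if_pos (h.exists_neg_one_iff.2 hone)]
        exact ⟨_, rfl, rfl⟩
      · rw [if_neg hone, if_neg (fun h' => hone (h.exists_neg_one_iff.1 h'))]
        exact ⟨_, rfl, rfl⟩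
    · rw [if_neg hall, if_neg (fun h' => hall ((all_below_iff h.inj).1 h')), if_pos]
      · exact ⟨_, rfl, rfl⟩
      · refine ⟨(exists_below_iff h.inj).2 ?_, ?_⟩
        · rcases hside with hs | hs
          · exact absurd hs hall
          · exact hs.1
        · rw [forall_mem_snapshot]
          intro j _ _ hj
          have := hwalk j hj
          simp only [flipY_one, Prod.snd_sub]
          omega
  obtain ⟨o, ho, he⟩ := hrule
  rw [← he]
  by_cases ho1 : orient ℓ = 1
  · rw [outcome_of_own hP (o := o) (by rw [ho1]; exact ho), ho1, flipY_one]
  · rw [outcome_of_rule hP 1 ho, flipY_one]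
    refine h.rule_neg hP hk ?_
    rcases hside with hs | ⟨-, hs | ⟨m, hm⟩⟩
    · exact .inl hs
    · exact absurd hs ho1
    · exact .inr ⟨m, hm, hwalk m hm⟩

/-- The elected robot walks to the row `T` next to the top row of the others, from above, or from below if
its frame or a robot that was told to walk lets it choose this direction. Then the others are called. -/
theorem completes_upward (hP : 1 < P.card) (hk : P.card = k) {E F G : ℕ}
    (hG : -(place P (topRight P)).1 ≤ G) {T : ℤ} (N : ℕ) : ∀ {pos : Fin k → GridPt},
    Elected pos light ℓ → (∀ m, light m = walk → (pos m).2 < (pos ℓ).2) →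
    ((∀ j, j ≠ ℓ → (pos j).2 < (pos ℓ).2) ∨ (∃ j, j ≠ ℓ ∧ (pos j).2 ≤ (pos ℓ).2) ∧
      (orient ℓ = 1 ∨ ∃ m, light m = walk)) →
    (∀ j, j ≠ ℓ → (pos j).2 < T) → (∃ j, j ≠ ℓ ∧ (pos j).2 = T - 1) → |(pos ℓ).2 - T| = N →
    (∀ j, light j = off → ∀ t ∈ targets P, (pos j - pos ℓ).1 - t.1 + |(pos j).2 - T - t.2| ≤ E) →
    (∀ j, light j = walk → ∀ t ∈ targets P, (pos j - pos ℓ).1 - t.1 + |(pos j).2 - T - t.2| ≤ F) →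
    Completes algorithm P orient (3 * N + (3 * F + 6) + (k * (3 * E + 6) + (3 * G + 3)))
      (Cfg.quiet pos light) := by
  induction N with
  | zero =>
    intro pos h hwalk hside hT hT' hN hE hF
    have hrow : (pos ℓ).2 = T := by
      have := abs_eq_zero.1 hN
      omega
    subst hrow
    have hout := h.outcome_one hP hk hwalk hside
    rw [if_pos hT, if_pos hT'] at hout
    refine (Completes.light_step (l := lead) h.inj hout (by rw [h.lit]; decide) (h.rests_others hP)
      ?_).mono (by omega : 3 * F + 3 + (k * (3 * E + 6) + (3 * G + 3)) + 3 ≤ _)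
    have hE' : ∀ j, Function.update light ℓ lead j = off → ∀ t ∈ targets P,
        (pos j - pos ℓ).1 - t.1 + |(pos j - pos ℓ).2 - t.2| ≤ E := by
      intro j hj
      refine hE j ?_
      by_cases hjl : j = ℓ
      · subst hjl
        rw [Function.update_self] at hj
        exact absurd hj (by decide)
      · rwa [Function.update_of_ne hjl] at hj
    by_cases hw : ∃ m, light m = walk
    · obtain ⟨m, hm⟩ := hw
      obtain ⟨t, ht⟩ := h.walking hP hk hT hm
      exact ht.completes_all hP hk hG hE' (hF m hm) (h.right m ht.ne).le
    · have hs := h.scene (P := P) hT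
      refine (hs.completes hP hk (E := E) hG _ (fun j hj => ?_) rfl hE').mono ?_
      · by_cases hjl : j = ℓ
        · subst hjl
          rw [Function.update_self] at hj
          exact absurd hj (by decide)
        · rw [Function.update_of_ne hjl] at hj
          exact hw ⟨j, hj⟩
      · have hcard := card_off_le (light := Function.update light ℓ lead) ⟨ℓ, by
          rw [Function.update_self]; decide⟩
        have hmul := Nat.mul_le_mul_right (3 * E + 6) hcard
        rw [add_mul, one_mul] at hmul
        omega
  | succ N ih =>
    intro pos h hwalk hside hT hT' hN hE hF
    obtain ⟨j₀, hj₀, hj₀T⟩ := hT'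
    have hout := h.outcome_one hP hk hwalk hside
    have hmove : ∀ d : GridPt, d.1 = 0 → outcome algorithm P orient pos light ℓ = (elect, d) → d ≠ 0 →
        (∀ m, light m = walk → (pos m).2 < (pos ℓ + d).2) →
        ((∀ j, j ≠ ℓ → (pos j).2 < (pos ℓ + d).2) ∨ (∃ j, j ≠ ℓ ∧ (pos j).2 ≤ (pos ℓ + d).2) ∧
          (orient ℓ = 1 ∨ ∃ m, light m = walk)) → |(pos ℓ + d).2 - T| = N →
        Completes algorithm P orient (3 * (N + 1) + (3 * F + 6) + (k * (3 * E + 6) + (3 * G + 3)))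
          (Cfg.quiet pos light) := by
      intro d hd0 hd hne hw hs hn
      rw [show 3 * (N + 1) + (3 * F + 6) + (k * (3 * E + 6) + (3 * G + 3)) =
        3 * N + (3 * F + 6) + (k * (3 * E + 6) + (3 * G + 3)) + 3 by ring]
      refine Completes.move_step h.inj (d := d) (by rw [hd, h.lit]) hne (h.rests_others hP) ?_
      have hup : ∀ j, j ≠ ℓ → Function.update pos ℓ (pos ℓ + d) j = pos j :=
        fun j hj => Function.update_of_ne hj _ _
      refine ih (h.move d hd0 fun m hm => (hw m hm).ne) ?_ ?_ ?_ ⟨j₀, hj₀, ?_⟩ ?_ ?_ ?_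
      · intro m hm
        rw [Function.update_self, hup m]
        · exact hw m hm
        · rintro rfl
          rw [h.lit] at hm
          exact absurd hm (by decide)
      · rw [Function.update_self]
        rcases hs with hs | ⟨⟨j, hj, hle⟩, hs⟩
        · exact .inl fun j hj => by rw [hup j hj]; exact hs j hj
        · exact .inr ⟨⟨j, hj, by rw [hup j hj]; exact hle⟩, hs⟩
      · intro j hj
        rw [hup j hj]
        exact hT j hj
      · rw [hup _ hj₀, hj₀T]
      · rw [Function.update_self]
        exact hn
      · intro j hj t ht
        rw [hup j (by rintro rfl; rw [h.lit] at hj; exact absurd hj (by decide)), Function.update_self]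
        have := hE j hj t ht
        simp only [Prod.fst_sub, Prod.fst_add, hd0, add_zero] at this ⊢
        exact this
      · intro j hj t ht
        rw [hup j (by rintro rfl; rw [h.lit] at hj; exact absurd hj (by decide)), Function.update_self]
        have := hF j hj t ht
        simp only [Prod.fst_sub, Prod.fst_add, hd0, add_zero] at this ⊢
        exact this
    by_cases hall : ∀ j, j ≠ ℓ → (pos j).2 < (pos ℓ).2
    · have hlt : T < (pos ℓ).2 := by
        have h1 := hall j₀ hj₀
        have h2 : (pos ℓ).2 ≠ T := by
          intro e
          rw [e, sub_self, abs_zero] at hN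
          push_cast at hN
          omega
        omega
      rw [if_pos hall, if_neg] at hout
      · refine hmove _ rfl hout (by decide) ?_ (.inl ?_) ?_
        · intro m hm
          have := hT m (by
            rintro rfl
            rw [h.lit] at hm
            exact absurd hm (by decide))
          rw [Prod.snd_add]
          omega
        · intro j hj
          have := hT j hj
          rw [Prod.snd_add]
          omega
        · rw [Prod.snd_add]
          rw [abs_of_nonneg (by omega)] at hN ⊢
          push_cast at hN
          omega
      · rintro ⟨j, hj, e⟩
        have := hT j hj
        omega
    · have hlt : (pos ℓ).2 < T := by
        by_contra hge
        exact hall fun j hj => by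
          have := hT j hj
          omega
      rw [if_neg hall] at hout
      refine hmove _ rfl hout (by decide) ?_ ?_ ?_
      · intro m hm
        have := hwalk m hm
        rw [Prod.snd_add]
        omega
      · rcases hside with hs | ⟨⟨j, hj, hle⟩, hs⟩
        · exact absurd hs hall
        · refine .inr ⟨⟨j, hj, ?_⟩, hs⟩
          rw [Prod.snd_add]
          omega
      · rw [Prod.snd_add]
        rw [abs_of_nonpos (by omega)] at hN ⊢
        push_cast at hN
        omega

theorem flip (h : Elected pos light ℓ) (s : ℤˣ) : Elected (fun i => flipY s (pos i)) light ℓ := by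
  refine ⟨(flipY_injective s).comp h.inj, h.lit, h.right, h.kinds, fun m hm => ⟨fun e => ?_, ?_⟩⟩
  · refine (h.sole m hm).1 ?_
    have := congrArg (fun z => (s : ℤ) * z) e
    simpa only [flipY_snd, ← mul_assoc, ← Units.val_mul, units_mul_self, Units.val_one, one_mul] using this
  · exact (h.sole m hm).2

/-- Once a robot is elected the pattern is formed. The bound `B` concerns the extents of the target and of
the robots with light `off`; a robot told to walk can be further away, but only on the side away from the
elected robot, so that only its own walk and that of the elected robot are longer. -/
theorem completes (h : Elected pos light ℓ) (hP : 1 < P.card) (hk : P.card = k) {B L : ℕ}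
    (hx : ∀ i j, |(pos i).1 - (pos j).1| ≤ B) (hL : ∀ i j, |(pos i).2 - (pos j).2| ≤ L)
    (hy : ∀ i j, light i = off → light j = off → |(pos i).2 - (pos j).2| ≤ B)
    (hw : ∀ m i, light m = walk → light i = off →
      ((pos m).2 < (pos ℓ).2 → (pos m).2 ≤ (pos i).2 + B) ∧
      ((pos ℓ).2 < (pos m).2 → (pos i).2 ≤ (pos m).2 + B))
    (hBt : ∀ p ∈ P, -(place P p).1 ≤ B ∧ -(place P p).2 ≤ B) :
    Completes algorithm P orient
      (3 * (L + 1) + (3 * (3 * B + L) + 6) + (k * (3 * (3 * B) + 6) + (3 * B + 3)))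
      (Cfg.quiet pos light) := by
  classical
  -- it suffices to consider a frame in which the elected robot goes upwards
  suffices H : ∀ (orient : Fin k → ℤˣ) {pos : Fin k → GridPt}, Elected pos light ℓ →
      (∀ i j, |(pos i).1 - (pos j).1| ≤ B) → (∀ i j, |(pos i).2 - (pos j).2| ≤ L) →
      (∀ i j, light i = off → light j = off → |(pos i).2 - (pos j).2| ≤ B) →
      (∀ m i, light m = walk → light i = off → (pos m).2 ≤ (pos i).2 + B) →
      (∀ m, light m = walk → (pos m).2 < (pos ℓ).2) →
      ((∀ j, j ≠ ℓ → (pos j).2 < (pos ℓ).2) ∨ (∃ j, j ≠ ℓ ∧ (pos j).2 ≤ (pos ℓ).2) ∧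
        (orient ℓ = 1 ∨ ∃ m, light m = walk)) →
      Completes algorithm P orient
        (3 * (L + 1) + (3 * (3 * B + L) + 6) + (k * (3 * (3 * B) + 6) + (3 * B + 3)))
        (Cfg.quiet pos light) by
    have hflip : ∀ (s : ℤˣ) (i j : Fin k), |(flipY s (pos i)).2 - (flipY s (pos j)).2| =
        |(pos i).2 - (pos j).2| := by
      intro s i j
      rw [flipY_snd, flipY_snd, ← mul_sub, abs_mul]
      have : |(s : ℤ)| = 1 := by rcases Int.units_eq_one_or s with rfl | rfl <;> simp
      rw [this, one_mul]
    have hLf : ∀ (s : ℤˣ) i j, |(flipY s (pos i)).2 - (flipY s (pos j)).2| ≤ L :=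
      fun s i j => by rw [hflip]; exact hL i j
    have hyf : ∀ (s : ℤˣ) i j, light i = off → light j = off →
        |(flipY s (pos i)).2 - (flipY s (pos j)).2| ≤ B :=
      fun s i j hi hj => by rw [hflip]; exact hy i j hi hj
    by_cases hw' : ∃ m, light m = walk
    · obtain ⟨m, hm⟩ := hw'
      have hl : ∀ j, light j = walk → j ≠ ℓ := by
        rintro j hj rfl
        rw [h.lit] at hj
        exact absurd hj (by decide)
      have honly : ∀ m', light m' = walk → m' = m := by
        intro m' hm'
        by_contra hne
        have h1 := (h.sole m hm).2 m' (hl m' hm') hne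
        have h2 := (h.sole m' hm').2 m (hl m hm) (Ne.symm hne)
        omega
      have hml := hl m hm
      rcases lt_or_gt_of_ne (h.sole m hm).1 with hlt | hlt
      · refine H orient h hx hL hy (fun m' i hm' hi => ?_) (fun m' hm' => ?_)
          (.inr ⟨⟨m, hml, hlt.le⟩, .inr ⟨m, hm⟩⟩)
        · rw [honly m' hm']
          exact (hw m i hm hi).1 hlt
        · rw [honly m' hm']
          exact hlt
      · refine Completes.of_flip (-1) (H _ (h.flip (-1)) hx (hLf (-1)) (hyf (-1))
          (fun m' i hm' hi => ?_) (fun m' hm' => ?_) (.inr ⟨⟨m, hml, ?_⟩, .inr ⟨m, hm⟩⟩))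
        · rw [honly m' hm']
          have := (hw m i hm hi).2 hlt
          simp only [flipY_snd, Units.val_neg, Units.val_one]
          omega
        · rw [honly m' hm']
          simp only [flipY_snd, Units.val_neg, Units.val_one]
          omega
        · simp only [flipY_snd, Units.val_neg, Units.val_one]
          omega
    · have hone : orient ℓ * orient ℓ = 1 := units_mul_self _
      have hnow : ∀ m, light m ≠ walk := fun m hm => hw' ⟨m, hm⟩
      by_cases hbel : ∃ j, j ≠ ℓ ∧ (flipY (orient ℓ) (pos j)).2 ≤ (flipY (orient ℓ) (pos ℓ)).2
      · exact Completes.of_flip (orient ℓ) (H _ (h.flip _) hx (hLf _) (hyf _)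
          (fun m _ hm => absurd hm (hnow m)) (fun m hm => absurd hm (hnow m)) (.inr ⟨hbel, .inl hone⟩))
      · refine Completes.of_flip (-orient ℓ) (H _ (h.flip _) hx (hLf _) (hyf _)
          (fun m _ hm => absurd hm (hnow m)) (fun m hm => absurd hm (hnow m)) (.inl fun j hj => ?_))
        have : ¬ (flipY (orient ℓ) (pos j)).2 ≤ (flipY (orient ℓ) (pos ℓ)).2 :=
          fun hle => hbel ⟨j, hj, hle⟩
        simp only [flipY_snd, Units.val_neg] at this ⊢
        linarith
  intro orient pos h hx hL hy hw hwalk hside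
  have hex : ∃ z, z ≠ ℓ := by
    have : Nontrivial (Fin k) := Fin.nontrivial_iff_two_le.2 (by omega)
    exact exists_ne ℓ
  obtain ⟨j₀, hj₀, hmax⟩ := Finset.exists_max_image (Finset.univ.erase ℓ) (fun j => (pos j).2)
    (by obtain ⟨z, hz⟩ := hex; exact ⟨z, by simpa using hz⟩)
  simp only [Finset.mem_erase, Finset.mem_univ, and_true] at hj₀ hmax
  have hpl := hBt _ (topRight_mem hP)
  have hrow := abs_le.1 (hL ℓ j₀)
  have hne : ∀ {j l}, light j = l → l ≠ elect → j ≠ ℓ := by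
    rintro j l hj hl rfl
    rw [h.lit] at hj
    exact hl hj.symm
  have hbt : ∀ t ∈ targets P, t.1 < 0 ∧ t.2 < 0 ∧ -t.1 ≤ B ∧ -t.2 ≤ B := by
    intro t ht
    have h4 := targets_neg hP ht
    rw [targets, Finset.mem_image] at ht
    obtain ⟨p, hp, rfl⟩ := ht
    have h5 := hBt p (Finset.mem_erase.1 hp).2
    exact ⟨h4.1, h4.2, h5.1, h5.2⟩
  refine (completes_upward hP hk (E := 3 * B) (F := 3 * B + L) (G := B) (T := (pos j₀).2 + 1) hpl.1
    |(pos ℓ).2 - ((pos j₀).2 + 1)|.toNat h hwalk hside (fun j hj => ?_) ⟨j₀, hj₀, by ring⟩ ?_ ?_ ?_).mono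
    ?_
  · have := hmax j hj
    omega
  · rw [Int.toNat_of_nonneg (abs_nonneg _)]
  · intro j hj t ht
    have h1 := hmax j (hne hj (by decide))
    have h2 : (pos j₀).2 ≤ (pos j).2 + B := by
      rcases h.kinds j₀ hj₀ with h' | h'
      · have := abs_le.1 (hy j₀ j h' hj)
        omega
      · exact hw j₀ j h' hj
    have h3 := abs_le.1 (hx j ℓ)
    have h4 := hbt t ht
    have h6 : |(pos j).2 - ((pos j₀).2 + 1) - t.2| ≤ B := by
      rw [abs_le]
      omega
    simp only [Prod.fst_sub]
    push_cast
    omega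
  · intro j hj t ht
    have h1 := hmax j (hne hj (by decide))
    have h2 := abs_le.1 (hL j₀ j)
    have h3 := abs_le.1 (hx j ℓ)
    have h4 := hbt t ht
    have h6 : |(pos j).2 - ((pos j₀).2 + 1) - t.2| ≤ B + L := by
      rw [abs_le]
      omega
    simp only [Prod.fst_sub]
    push_cast
    omega
  · have : |(pos ℓ).2 - ((pos j₀).2 + 1)|.toNat ≤ L + 1 := by
      have : |(pos ℓ).2 - ((pos j₀).2 + 1)| ≤ L + 1 := by
        rw [abs_le]
        omega
      omega
    omega

end Elected

end Apf

namespace Apf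

/-! ### Symmetric sets -/

/-- The points in the leftmost column of `A`. -/
def frontOf (A : Set GridPt) : Set GridPt := {p | p ∈ A ∧ ∀ q ∈ A, p.1 ≤ q.1}

/-- The coordinates of `p` in a frame with orientation `e` centred at `o`. -/
def toFrame (e : ℤˣ) (o p : GridPt) : GridPt := flipY e (p - o)

section Symmetry

variable {A : Set GridPt} {c c' : ℤ} {e : ℤˣ} {o v : GridPt}

theorem mem_image_toFrame {q : GridPt} : q ∈ toFrame e o '' A ↔ o + flipY e q ∈ A := by
  constructor
  · rintro ⟨p, hp, rfl⟩
    rw [toFrame, flipY_flipY, units_mul_self, flipY_one]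
    simpa using hp
  · intro h
    exact ⟨_, h, by rw [toFrame, add_sub_cancel_left, flipY_flipY, units_mul_self, flipY_one]⟩

theorem mirror_toFrame (q : GridPt) :
    o + flipY e (q.1, (e : ℤ) * (c - 2 * o.2) - q.2) = ((o + flipY e q).1, c - (o + flipY e q).2) := by
  refine Prod.ext rfl ?_
  simp only [Prod.snd_add, flipY_snd]
  have : (e : ℤ) * e = 1 := by rw [← Units.val_mul, units_mul_self]; rfl
  linear_combination (c - 2 * o.2) * this

theorem forall_image_toFrame {Q : GridPt → Prop} :
    (∀ q ∈ toFrame e o '' A, Q (o + flipY e q)) ↔ ∀ p ∈ A, Q p := by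
  constructor
  · intro h p hp
    have hpe : o + flipY e (toFrame e o p) = p := by
      rw [toFrame, flipY_flipY, units_mul_self, flipY_one]; abel
    have := h (toFrame e o p) ⟨p, hp, rfl⟩
    rwa [hpe] at this
  · intro h q hq
    exact h _ (mem_image_toFrame.1 hq)

theorem symAbout_image : SymAbout (toFrame e o '' A) (e * (c - 2 * o.2)) ↔ SymAbout A c := by
  refine Iff.trans ?_ (forall_image_toFrame (e := e) (o := o) (Q := fun p => (p.1, c - p.2) ∈ A))
  refine forall_congr' fun q => forall_congr' fun _ => ?_
  rw [mem_image_toFrame, mirror_toFrame]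

theorem wins_image {e' : ℤˣ} :
    Wins e' (toFrame e o '' A) (e * (c - 2 * o.2)) ↔ Wins (e' * e) A c := by
  have hee : (e : ℤ) * e = 1 := by rw [← Units.val_mul, units_mul_self]; rfl
  have habs : ∀ q : GridPt, |2 * q.2 - e * (c - 2 * o.2)| = |2 * (o + flipY e q).2 - c| := by
    intro q
    have h1 : 2 * q.2 - e * (c - 2 * o.2) = e * (2 * (o + flipY e q).2 - c) := by
      simp only [Prod.snd_add, flipY_snd]
      linear_combination (-2 * q.2) * hee
    have h2 : |(e : ℤ)| = 1 := by rcases Int.units_eq_one_or e with rfl | rfl <;> simp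
    rw [h1, abs_mul, h2, one_mul]
  have hside : ∀ q : GridPt, (e' : ℤ) * (e * (c - 2 * o.2)) < e' * (2 * q.2) ↔
      ((e' * e : ℤˣ) : ℤ) * c < (e' * e : ℤˣ) * (2 * (o + flipY e q).2) := by
    intro q
    rw [← sub_pos, ← sub_pos (b := ((e' * e : ℤˣ) : ℤ) * c)]
    have : (e' : ℤ) * (2 * q.2) - e' * (e * (c - 2 * o.2)) =
        ((e' * e : ℤˣ) : ℤ) * (2 * (o + flipY e q).2) - (e' * e : ℤˣ) * c := by
      simp only [Prod.snd_add, flipY_snd, Units.val_mul]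
      linear_combination (-2 * e' * q.2) * hee
    rw [this]
  constructor
  · rintro ⟨q, hq, h1, h2, h3⟩
    refine ⟨o + flipY e q, mem_image_toFrame.1 hq, (hside q).1 h1, ?_, ?_⟩
    · rwa [mem_image_toFrame, mirror_toFrame] at h2
    · rw [← forall_image_toFrame (e := e) (o := o)]
      intro p hp hp'
      have := h3 p hp (by rwa [mem_image_toFrame, mirror_toFrame])
      rw [habs, habs] at this
      simpa using this
  · rintro ⟨p, hp, h1, h2, h3⟩
    obtain ⟨q, rfl⟩ : ∃ q, o + flipY e q = p :=
      ⟨toFrame e o p, by rw [toFrame, flipY_flipY, units_mul_self, flipY_one]; abel⟩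
    refine ⟨q, mem_image_toFrame.2 hp, (hside q).2 h1, ?_, ?_⟩
    · rwa [mem_image_toFrame, mirror_toFrame]
    · intro r hr hr'
      have := h3 _ (mem_image_toFrame.1 hr) (by rwa [mem_image_toFrame, mirror_toFrame] at hr')
      rw [habs, habs]
      simpa using this

theorem sbtw_toFrame {a b d : GridPt} :
    Sbtw ℝ (toFrame e o a).toPlane (toFrame e o b).toPlane (toFrame e o d).toPlane ↔
      Sbtw ℝ a.toPlane b.toPlane d.toPlane := by
  refine sbtw_congr e ?_ ?_ <;> rw [toFrame, toFrame, ← flipY_sub, sub_sub_sub_cancel_right]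

theorem clear_image : Clear (toFrame e o v) (toFrame e o '' A) ↔ Clear v A := by
  constructor
  · intro h p hp q hq hb
    exact h _ ⟨p, hp, rfl⟩ _ ⟨q, hq, rfl⟩ (sbtw_toFrame.2 hb)
  · rintro h _ ⟨p, hp, rfl⟩ _ ⟨q, hq, rfl⟩ hb
    exact h p hp q hq (sbtw_toFrame.1 hb)

theorem SymAbout.frontOf (h : SymAbout A c) : SymAbout (frontOf A) c :=
  fun p hp => ⟨h p hp.1, hp.2⟩

theorem SymAbout.clear (h : SymAbout A c) (hv : Clear v A) : Clear (v.1, c - v.2) A := by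
  intro p hp q hq hb
  refine hv _ (h p hp) _ (h q hq) ((sbtw_congr (-1) ?_ ?_).1 hb) <;>
  · refine Prod.ext ?_ ?_ <;> simp [flipY]; ring

theorem SymAbout.clear_iff (h : SymAbout A c) {x y : ℤ} : Clear (x, c - y) A ↔ Clear (x, y) A := by
  constructor
  · intro hv
    have := h.clear (v := (x, c - y)) hv
    rwa [sub_sub_cancel] at this
  · exact fun hv => h.clear (v := (x, y)) hv

/-- A finite set has at most one horizontal axis. -/
theorem SymAbout.unique (hA : A.Finite) (hne : A.Nonempty) (h : SymAbout A c) (h' : SymAbout A c') :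
    c = c' := by
  obtain ⟨p, hp, hmax⟩ := Set.exists_max_image A (fun p => p.2) hA hne
  obtain ⟨q, hq, hmin⟩ := Set.exists_min_image A (fun p => p.2) hA hne
  have h1 := hmax _ (h q hq)
  have h2 := hmin _ (h p hp)
  have h3 := hmax _ (h' q hq)
  have h4 := hmin _ (h' p hp)
  simp only at h1 h2 h3 h4
  omega

/-- One side of an asymmetric set wins, and only one. -/
theorem wins_neg_iff (hA : A.Finite) (h : ¬ SymAbout A c) : Wins (-e) A c ↔ ¬ Wins e A c := by
  have hU : (A ∩ {p | (p.1, c - p.2) ∉ A}).Nonempty := by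
    rw [SymAbout] at h
    push Not at h
    obtain ⟨p, hp, hp'⟩ := h
    exact ⟨p, hp, hp'⟩
  constructor
  · rintro ⟨p, hp, h1, h2, h3⟩ ⟨q, hq, h1', h2', h3'⟩
    have h4 := h3 q hq h2'
    have h5 := h3' p hp h2
    have hx : p.1 = q.1 := by omega
    have habs : |2 * p.2 - c| = |2 * q.2 - c| := by omega
    have hy : q.2 = c - p.2 := by
      rcases abs_eq_abs.1 habs with h6 | h6
      · exfalso
        have : p.2 = q.2 := by omega
        rw [this] at h1
        simp only [Units.val_neg, neg_mul] at h1
        omega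
      · omega
    exact h2 (by rw [← hy, hx]; exact hq)
  · intro hn
    obtain ⟨p, hp, hmin⟩ := Set.exists_min_image (A ∩ {p | (p.1, c - p.2) ∉ A})
      (fun p => toLex (p.1, |2 * p.2 - c|)) (hA.inter_of_left _) hU
    have hall : ∀ q ∈ A, (q.1, c - q.2) ∉ A → p.1 < q.1 ∨ p.1 = q.1 ∧ |2 * p.2 - c| ≤ |2 * q.2 - c| := by
      intro q hq hq'
      have := hmin q ⟨hq, hq'⟩
      rwa [Prod.Lex.toLex_le_toLex] at this
    refine ⟨p, hp.1, ?_, hp.2, hall⟩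
    by_contra hside
    simp only [Units.val_neg, neg_mul, neg_lt_neg_iff, not_lt] at hside
    rcases hside.lt_or_eq with hlt | heq
    · exact hn ⟨p, hp.1, hlt, hp.2, hall⟩
    · have hc : c = 2 * p.2 := by
        rcases Int.units_eq_one_or e with rfl | rfl
        · simpa using heq
        · simpa using heq
      refine hp.2 ?_
      have : c - p.2 = p.2 := by omega
      rw [this]
      exact hp.1

end Symmetry

/-! ### A place from which everything is visible -/

/-- Every two points hide each other from at most one point of a column on the left, so among many points
of the column some have a full view. -/
theorem exists_clear {S : Finset GridPt} {X : ℤ} (hS : ∀ p ∈ S, X < p.1) (r : ℤ) (e : ℤˣ) :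
    ∃ u ≤ S.card * S.card, Clear (X, r + e * (u : ℤ)) (S : Set GridPt) := by
  classical
  -- otherwise two of the points have the same pair hiding each other
  by_contra hno
  push Not at hno
  have hpair : ∀ u ∈ Finset.range (S.card * S.card + 1), ∃ x ∈ S ×ˢ S,
      Sbtw ℝ (GridPt.toPlane (X, r + e * (u : ℤ))) x.1.toPlane x.2.toPlane := by
    intro u hu
    have h1 := hno u (by rw [Finset.mem_range] at hu; omega)
    simp only [Clear] at h1
    push Not at h1
    obtain ⟨p, hp, q, hq, hb⟩ := h1
    exact ⟨(p, q), Finset.mem_product.2 ⟨hp, hq⟩, hb⟩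
  choose! f hf hb using hpair
  obtain ⟨u, hu, u', hu', hne, heq⟩ := Finset.exists_ne_map_eq_of_card_lt_of_maps_to
    (s := Finset.range (S.card * S.card + 1)) (t := S ×ˢ S) (f := f)
    (by rw [Finset.card_product, Finset.card_range]; omega) (fun u hu => hf u hu)
  have h1 := hb u hu
  have h2 := hb u' hu'
  rw [← heq] at h2
  have hfu := Finset.mem_product.1 (hf u hu)
  generalize f u = x at h1 h2 hfu
  obtain ⟨p, q⟩ := x
  have hc := sbtw_coords h1
  have hp := hS p hfu.1
  have hq := hS q hfu.2
  simp only at hc h1 h2 hp hq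
  have hpq : p.1 < q.1 := by omega
  rw [sbtw_iff_exists] at h1 h2
  obtain ⟨-, t, -, ht1, hx, hy⟩ := h1
  obtain ⟨-, t', -, -, hx', hy'⟩ := h2
  have hXq : ((q.1 : ℝ) - X) ≠ 0 := by
    have : (X : ℝ) < q.1 := by exact_mod_cast hq
    linarith
  have htt : t = t' := mul_right_cancel₀ hXq (by simp only at hx hx'; linarith)
  subst htt
  have hrow : (1 - t) * (((r + e * (u : ℤ) : ℤ) : ℝ) - ((r + e * (u' : ℤ) : ℤ) : ℝ)) = 0 := by
    simp only at hy hy'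
    linarith
  rcases mul_eq_zero.1 hrow with h | h
  · linarith
  · have h3 : r + e * (u : ℤ) = r + e * (u' : ℤ) := by exact_mod_cast sub_eq_zero.1 h
    apply hne
    rcases Int.units_eq_one_or e with rfl | rfl
    · simpa using h3
    · simpa using h3

end Apf

namespace Apf

variable {k : ℕ} {P : Finset GridPt} {orient : Fin k → ℤˣ} {pos : Fin k → GridPt}
  {light : Fin k → Fin 8} {a b : Fin k} {X c : ℤ} {e : ℤˣ}

/-! ### Two robots in the leftmost column -/

/-- The positions of all robots but `a` and `b`. -/
def others (pos : Fin k → GridPt) (a b : Fin k) : Set GridPt := {p | ∃ j, j ≠ a ∧ j ≠ b ∧ pos j = p}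

theorem finite_others : (others pos a b).Finite := by
  refine (Set.finite_range pos).subset ?_
  rintro p ⟨j, -, -, rfl⟩
  exact ⟨j, rfl⟩

theorem others_swap : others pos a b = others pos b a := by
  ext p
  exact exists_congr fun j => ⟨fun h => ⟨h.2.1, h.1, h.2.2⟩, fun h => ⟨h.2.1, h.1, h.2.2⟩⟩

/-- The leftmost column `X` contains exactly the robots `a` and `b`, with `b` below `a` in frames with
orientation `e`. -/
structure Pair (pos : Fin k → GridPt) (a b : Fin k) (X : ℤ) (e : ℤˣ) : Prop where
  inj : Function.Injective pos
  left : (pos a).1 = X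
  left' : (pos b).1 = X
  below : (e : ℤ) * (pos b).2 < e * (pos a).2
  right : ∀ j, j ≠ a → j ≠ b → X < (pos j).1

/-- Robots with light `off` rest if they see two robots to the left, no leader, and are not half way between
`elect` lights. -/
theorem rests_off_of_two_left (hP : 1 < P.card) {i z w : Fin k} (hinj : Function.Injective pos)
    (hi : light i = off)
    (hz : Sees pos i z) (hzl : (pos z).1 < (pos i).1) (hw : Sees pos i w) (hwl : (pos w).1 < (pos i).1)
    (hzw : z ≠ w) (haxis : ∀ e, ¬ OnAxis (snapshot pos light e i)) (hlead : ∀ j, light j ≠ lead) :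
    Rests algorithm P orient pos light i := by
  refine rests_of_none hP fun e => ?_
  have hzi : z ≠ i := by rintro rfl; omega
  have hwi : w ≠ i := by rintro rfl; omega
  rw [rule, if_pos hi]
  refine ruleOff_eq_none ⟨_, mem_snapshot_of_sees hzi hz, ?_⟩ ?_ (haxis e)
    (not_called_of_no_lead hlead e i)
  · simp only [flipY_fst, Prod.fst_sub]
    omega
  · rintro q ⟨-, -, hall⟩
    have h1 := hall _ (mem_snapshot_of_sees (e := e) hzi hz) (by
      simp only [flipY_fst, Prod.fst_sub]; omega)
    have h2 := hall _ (mem_snapshot_of_sees (e := e) hwi hw) (by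
      simp only [flipY_fst, Prod.fst_sub]; omega)
    have h3 := congrArg Prod.fst (h1.trans h2.symm)
    exact absurd (hinj (sub_left_injective (flipY_injective e h3))) hzw

theorem not_onAxis_of_sole {i : Fin k} (h : ∀ j j', light j = elect → light j' = elect → j = j')
    (e : ℤˣ) : ¬ OnAxis (snapshot pos light e i) := by
  rintro ⟨⟨x, y, -, hy, h1, h2, -⟩, -⟩
  obtain ⟨j, -, -, hj⟩ := mem_snapshot.1 h1
  obtain ⟨j', -, -, hj'⟩ := mem_snapshot.1 h2
  rw [Prod.mk.injEq] at hj hj'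
  have := h j j' hj.2 hj'.2
  subst this
  have h3 := hj.1.symm.trans hj'.1
  rw [Prod.mk.injEq] at h3
  omega

theorem ruleWait_eq_none {V : Snapshot 8} (h : ∀ l y, ¬ Below V l y) : ruleWait V = none := by
  rw [ruleWait]
  by_cases h1 : NoneLeft V
  · rw [if_neg (not_not.2 h1), if_neg, if_neg, if_neg, if_neg]
    · exact fun ⟨y, hy⟩ => h _ _ hy
    · exact fun ⟨y, hy, _⟩ => h _ _ hy
    · exact fun ⟨y, hy, _⟩ => h _ _ hy
    · exact fun ⟨y, hy⟩ => h _ _ hy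
  · rw [if_pos h1]

theorem ruleSearch_eq_none {V : Snapshot 8} (h : ∀ l y, ¬ Below V l y) : ruleSearch P V = none := by
  rw [ruleSearch, if_pos]
  exact .inr fun ⟨l, y, hly⟩ => h l y hly

namespace Pair

theorem ne (h : Pair pos a b X e) : a ≠ b := by
  rintro rfl
  exact absurd h.below (by omega)

theorem symm (h : Pair pos a b X e) : Pair pos b a X (-e) := by
  refine ⟨h.inj, h.left', h.left, ?_, fun j h1 h2 => h.right j h2 h1⟩
  have := h.below
  simp only [Units.val_neg, neg_mul]
  omega

theorem sees (h : Pair pos a b X e) : Sees pos a b := by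
  intro l hl
  have hc := sbtw_coords hl
  have h1 := h.left
  have h2 := h.left'
  by_cases h3 : l = a
  · subst h3; omega
  by_cases h4 : l = b
  · subst h4; omega
  have := h.right l h3 h4
  omega

/-- From the right two robots of the column are seen, or others in their directions. -/
theorem exists_two_left (h : Pair pos a b X e) {i : Fin k} (hia : i ≠ a) (hib : i ≠ b) :
    ∃ z w, z ≠ w ∧ Sees pos i z ∧ (pos z).1 < (pos i).1 ∧ Sees pos i w ∧ (pos w).1 < (pos i).1 := by
  have hi := h.right i hia hib
  have hleft : ∀ {j z}, (pos j).1 = X → i ≠ j → Toward pos i j z → (pos z).1 < (pos i).1 := by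
    intro j z hj hij hz
    rcases hz.coords h.inj with rfl | hb | rfl
    · omega
    · have := sbtw_coords hb
      omega
    · omega
  obtain ⟨z, -, hz, hzt⟩ := exists_sees_toward (pos := pos) hia
  obtain ⟨w, -, hw, hwt⟩ := exists_sees_toward (pos := pos) hib
  refine ⟨z, w, ?_, hz, hleft h.left hia hzt, hw, hleft h.left' hib hwt⟩
  exact toward_ne_of_column h.inj h.ne (by rw [h.left, h.left']) (by rw [h.left]; omega) hzt hwt

theorem rests_others (h : Pair pos a b X e) (hP : 1 < P.card) (hlead : ∀ j, light j ≠ lead)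
    {i : Fin k} (hia : i ≠ a) (hib : i ≠ b) (hi : light i = off)
    (haxis : ∀ e, ¬ OnAxis (snapshot pos light e i)) : Rests algorithm P orient pos light i := by
  obtain ⟨z, w, hzw, h1, h2, h3, h4⟩ := h.exists_two_left hia hib
  exact rests_off_of_two_left hP h.inj hi h1 h2 h3 h4 hzw haxis hlead

theorem mem_snapshot_partner (h : Pair pos a b X e) (e' : ℤˣ) :
    ((0, e' * ((pos b).2 - (pos a).2)), light b) ∈ snapshot pos light e' a := by
  have := mem_snapshot_of_sees (light := light) (e := e') h.ne.symm h.sees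
  rwa [show flipY e' (pos b - pos a) = (0, e' * ((pos b).2 - (pos a).2)) from
    Prod.ext (by simp [h.left, h.left']) (by simp)] at this

theorem noneLeft (h : Pair pos a b X e) (e' : ℤˣ) : NoneLeft (snapshot pos light e' a) := by
  rw [NoneLeft, forall_mem_snapshot]
  intro j hja _
  simp only [flipY_fst, Prod.fst_sub, h.left]
  by_cases hjb : j = b
  · rw [hjb, h.left']; omega
  · have := h.right j hja hjb
    omega

theorem column (h : Pair pos a b X e) {e' : ℤˣ} {p : GridPt × Fin 8} (hp : p ∈ snapshot pos light e' a)
    (h0 : p.1.1 = 0) : p = ((0, e' * ((pos b).2 - (pos a).2)), light b) := by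
  obtain ⟨j, hja, -, rfl⟩ := mem_snapshot.1 hp
  simp only [flipY_fst, Prod.fst_sub, h.left] at h0
  have hjb : j = b := by
    by_contra hjb
    have := h.right j hja hjb
    omega
  subst hjb
  refine Prod.ext (Prod.ext ?_ ?_) rfl
  · simp only [flipY_fst, Prod.fst_sub, h.left]
    exact h0
  · simp

theorem below_iff (h : Pair pos a b X e) {l : Fin 8} {y : ℤ} :
    Below (snapshot pos light e a) l y ↔ light b = l ∧ y = e * ((pos b).2 - (pos a).2) := by
  constructor
  · rintro ⟨h1, -⟩
    have := h.column h1 rfl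
    simp only [Prod.mk.injEq, true_and] at this
    exact ⟨this.2.symm, this.1⟩
  · rintro ⟨rfl, rfl⟩
    refine ⟨h.mem_snapshot_partner e, ?_⟩
    have := h.below
    rw [mul_sub]
    omega

theorem not_below_neg (h : Pair pos a b X e) (l : Fin 8) (y : ℤ) :
    ¬ Below (snapshot pos light (-e) a) l y := by
  rintro ⟨h1, h2⟩
  have := h.column h1 rfl
  simp only [Prod.mk.injEq, true_and, Units.val_neg, neg_mul, mul_sub] at this
  have := h.below
  omega

theorem mem_ahead (h : Pair pos a b X e) {e' : ℤˣ} {p : GridPt} (hp : p ∈ ahead (snapshot pos light e' a)) :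
    ∃ j, j ≠ a ∧ j ≠ b ∧ Sees pos a j ∧ p = toFrame e' (pos a) (pos j) := by
  obtain ⟨h0, l, hl⟩ := hp
  obtain ⟨j, hj, hs, e⟩ := mem_snapshot.1 hl
  rw [Prod.mk.injEq] at e
  refine ⟨j, hj, ?_, hs, e.1.symm⟩
  rintro rfl
  rw [← e.1] at h0
  simp only [flipY_fst, Prod.fst_sub, h.left, h.left'] at h0
  omega

theorem ahead_of_sees (h : Pair pos a b X e) {e' : ℤˣ} {j : Fin k} (hja : j ≠ a) (hjb : j ≠ b)
    (hs : Sees pos a j) : toFrame e' (pos a) (pos j) ∈ ahead (snapshot pos light e' a) := by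
  refine ⟨?_, light j, mem_snapshot_of_sees hja hs⟩
  have := h.right j hja hjb
  simp only [toFrame, flipY_fst, Prod.fst_sub, h.left]
  omega

/-- The leftmost of the columns to the right is fully visible. -/
theorem front_eq (h : Pair pos a b X e) (e' : ℤˣ) :
    front (snapshot pos light e' a) = toFrame e' (pos a) '' frontOf (others pos a b) := by
  ext p
  constructor
  · rintro ⟨hp, hmin⟩
    obtain ⟨j, hja, hjb, hs, rfl⟩ := h.mem_ahead hp
    refine ⟨pos j, ⟨⟨j, hja, hjb, rfl⟩, ?_⟩, rfl⟩
    rintro _ ⟨i, hia, hib, rfl⟩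
    obtain ⟨z, hz, hsz, hz'⟩ := exists_sees_coords h.inj (Ne.symm hia)
    have hi := h.right i hia hib
    have ha := h.left
    have hzb : z ≠ b ∧ (pos z).1 ≤ (pos i).1 := by
      rcases hz' with rfl | hbt
      · exact ⟨hib, le_rfl⟩
      · have hc := sbtw_coords hbt
        refine ⟨?_, by omega⟩
        rintro rfl
        have := h.left'
        omega
    have := hmin _ (h.ahead_of_sees hz hzb.1 hsz)
    simp only [toFrame, flipY_fst, Prod.fst_sub] at this
    omega
  · rintro ⟨_, ⟨⟨j, hja, hjb, rfl⟩, hmin⟩, rfl⟩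
    refine ⟨h.ahead_of_sees hja hjb ?_, ?_⟩
    · intro l hl
      have hc := sbtw_coords hl
      have ha := h.left
      have hj := h.right j hja hjb
      have hla : l ≠ a := by rintro rfl; omega
      have hlb : l ≠ b := by
        rintro rfl
        have := h.left'
        omega
      have := hmin _ ⟨l, hla, hlb, rfl⟩
      omega
    · intro q hq
      obtain ⟨i, hia, hib, -, rfl⟩ := h.mem_ahead hq
      have := hmin _ ⟨i, hia, hib, rfl⟩
      simp only [toFrame, flipY_fst, Prod.fst_sub]
      omega

theorem sees_of_clear (h : Pair pos a b X e) (hc : Clear (pos a) (others pos a b)) {j : Fin k}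
    (hja : j ≠ a) : Sees pos a j := by
  by_cases hjb : j = b
  · subst hjb; exact h.sees
  intro l hl
  have hb := sbtw_coords hl
  have ha := h.left
  have hj := h.right j hja hjb
  refine hc _ ⟨l, ?_, ?_, rfl⟩ _ ⟨j, hja, hjb, rfl⟩ hl
  · rintro rfl; omega
  · rintro rfl
    have := h.left'
    omega

theorem ahead_eq (h : Pair pos a b X e) (hc : Clear (pos a) (others pos a b)) (e' : ℤˣ) :
    ahead (snapshot pos light e' a) = toFrame e' (pos a) '' others pos a b := by
  ext p
  constructor
  · intro hp
    obtain ⟨j, hja, hjb, -, rfl⟩ := h.mem_ahead hp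
    exact ⟨_, ⟨j, hja, hjb, rfl⟩, rfl⟩
  · rintro ⟨_, ⟨j, hja, hjb, rfl⟩, rfl⟩
    exact h.ahead_of_sees hja hjb (h.sees_of_clear hc hja)

theorem card_lt_iff (h : Pair pos a b X e) (hk : P.card = k) (e' : ℤˣ) :
    (snapshot pos light e' a).card < P.card - 1 ↔ ¬ Clear (pos a) (others pos a b) := by
  classical
  have hcard : (snapshot pos light e' a).card =
      (Finset.univ.filter fun j => j ≠ a ∧ Sees pos a j).card := by
    rw [snapshot, SwarmState.view, Finset.card_image_of_injective]
    intro i j hij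
    exact h.inj (sub_left_injective (flipY_injective e' (congrArg Prod.fst hij)))
  have herase : (Finset.univ.erase a).card = P.card - 1 := by
    rw [Finset.card_erase_of_mem (Finset.mem_univ _), Finset.card_univ, Fintype.card_fin, hk]
  rw [hcard, ← herase]
  constructor
  · intro hlt hc
    refine absurd hlt (not_lt.2 (Finset.card_le_card fun j hj => ?_))
    simp only [Finset.mem_erase, Finset.mem_univ, and_true] at hj
    simp only [Finset.mem_filter, Finset.mem_univ, true_and]
    exact ⟨hj, h.sees_of_clear hc hj⟩
  · intro hc
    refine Finset.card_lt_card (Finset.ssubset_iff_of_subset (fun j hj => ?_) |>.2 ?_)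
    · simp only [Finset.mem_filter, Finset.mem_univ, true_and] at hj
      simpa using hj.1
    · simp only [Clear] at hc
      push Not at hc
      obtain ⟨_, ⟨l, hla, hlb, rfl⟩, _, ⟨j, hja, hjb, rfl⟩, hl⟩ := hc
      refine ⟨j, by simpa using hja, ?_⟩
      simp only [Finset.mem_filter, Finset.mem_univ, true_and, not_and]
      exact fun _ hs => hs l hl

end Pair

end Apf

namespace Apf

variable {k : ℕ} {P : Finset GridPt} {orient : Fin k → ℤˣ} {pos : Fin k → GridPt}
  {light : Fin k → Fin 8} {a b : Fin k} {X c : ℤ} {e : ℤˣ}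

namespace Pair

/-! ### The decisions of two robots in the leftmost column -/

theorem outcome_of_rule (h : Pair pos a b X e) (hP : 1 < P.card)
    (hl : light a = wait ∨ light a = search) {o : Fin 8 × GridMove}
    (ho : rule P (light a) (snapshot pos light e a) = some o) :
    outcome algorithm P orient pos light a = (o.1, flipY e o.2.disp) := by
  refine Apf.outcome_of_rule hP e ho ?_
  rcases hl with hl | hl <;> rw [hl]
  · exact ruleWait_eq_none h.not_below_neg
  · exact ruleSearch_eq_none h.not_below_neg

theorem rests_of_rule (h : Pair pos a b X e) (hP : 1 < P.card)
    (hl : light a = wait ∨ light a = search) (ho : rule P (light a) (snapshot pos light e a) = none) :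
    Rests algorithm P orient pos light a := by
  have hneg : rule P (light a) (snapshot pos light (-e) a) = none := by
    rcases hl with hl | hl <;> rw [hl]
    · exact ruleWait_eq_none h.not_below_neg
    · exact ruleSearch_eq_none h.not_below_neg
  refine rests_of_none hP fun e' => ?_
  rcases Int.units_eq_one_or (e' * e) with he | he
  · have : e' = e := by rw [← mul_one e', ← units_mul_self e, ← mul_assoc, he, one_mul]
    rw [this]
    exact ho
  · have : e' = -e := by rw [← mul_one e', ← units_mul_self e, ← mul_assoc, he]; simp
    rw [this]
    exact hneg

theorem symAbout_front (h : Pair pos a b X e) :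
    SymAbout (front (snapshot pos light e a)) (e * (c - 2 * (pos a).2)) ↔
      SymAbout (frontOf (others pos a b)) c := by
  rw [h.front_eq, symAbout_image]

theorem wins_front (h : Pair pos a b X e) :
    Wins 1 (front (snapshot pos light e a)) (e * (c - 2 * (pos a).2)) ↔
      Wins e (frontOf (others pos a b)) c := by
  rw [h.front_eq, wins_image, one_mul]

theorem wait_search (h : Pair pos a b X e) (hP : 1 < P.card) (ha : light a = wait)
    (hb : light b = search) : outcome algorithm P orient pos light a = (search, 0) := by
  rw [h.outcome_of_rule hP (.inl ha) (o := (search, .stay))]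
  · exact congrArg _ (flipY_zero _)
  · rw [ha]
    change ruleWait _ = _
    rw [ruleWait, if_neg (not_not.2 (h.noneLeft e)), if_pos ⟨_, h.below_iff.2 ⟨hb, rfl⟩⟩]

theorem below_sum (h : Pair pos a b X e) {l : Fin 8} (hb : light b = l) :
    Below (snapshot pos light e a) l (e * ((pos a).2 + (pos b).2 - 2 * (pos a).2)) := by
  refine h.below_iff.2 ⟨hb, ?_⟩
  ring

theorem below_eq (h : Pair pos a b X e) {l : Fin 8} {y : ℤ}
    (hy : Below (snapshot pos light e a) l y) : y = e * ((pos a).2 + (pos b).2 - 2 * (pos a).2) := by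
  rw [(h.below_iff.1 hy).2]
  ring

theorem not_below_of_ne (h : Pair pos a b X e) {l : Fin 8} (hb : light b ≠ l) :
    ¬ ∃ y, Below (snapshot pos light e a) l y :=
  fun ⟨_, hy⟩ => hb (h.below_iff.1 hy).1

/-- A symmetric next column makes the two robots search for a place with a full view. -/
theorem wait_sym (h : Pair pos a b X e) (hP : 1 < P.card) (ha : light a = wait) (hb : light b = wait)
    (hs : SymAbout (frontOf (others pos a b)) ((pos a).2 + (pos b).2)) :
    outcome algorithm P orient pos light a = (search, 0) := by
  rw [h.outcome_of_rule hP (.inl ha) (o := (search, .stay))]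
  · exact congrArg _ (flipY_zero _)
  · rw [ha]
    change ruleWait _ = _
    rw [ruleWait, if_neg (not_not.2 (h.noneLeft e)),
      if_neg (h.not_below_of_ne (by rw [hb]; decide)),
      if_pos ⟨_, h.below_sum hb, h.symAbout_front.2 hs⟩]

/-- In an asymmetric next column the robot on the losing side gives in. -/
theorem wait_lose (h : Pair pos a b X e) (hP : 1 < P.card) (ha : light a = wait) (hb : light b = wait)
    (hs : ¬ SymAbout (frontOf (others pos a b)) ((pos a).2 + (pos b).2))
    (hw : ¬ Wins e (frontOf (others pos a b)) ((pos a).2 + (pos b).2)) :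
    outcome algorithm P orient pos light a = (walk, 0) := by
  rw [h.outcome_of_rule hP (.inl ha) (o := (walk, .stay))]
  · exact congrArg _ (flipY_zero _)
  · rw [ha]
    change ruleWait _ = _
    rw [ruleWait, if_neg (not_not.2 (h.noneLeft e)),
      if_neg (h.not_below_of_ne (by rw [hb]; decide)), if_neg, if_pos]
    · exact ⟨_, h.below_sum hb, fun h' => hs (h.symAbout_front.1 h'), fun h' => hw (h.wins_front.1 h')⟩
    · rintro ⟨y, hy, h'⟩
      rw [h.below_eq hy] at h'
      exact hs (h.symAbout_front.1 h')

theorem wait_win (h : Pair pos a b X e) (hP : 1 < P.card) (ha : light a = wait) (hb : light b = wait)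
    (hs : ¬ SymAbout (frontOf (others pos a b)) ((pos a).2 + (pos b).2))
    (hw : Wins e (frontOf (others pos a b)) ((pos a).2 + (pos b).2)) :
    Rests algorithm P orient pos light a := by
  refine h.rests_of_rule hP (.inl ha) ?_
  rw [ha]
  change ruleWait _ = _
  rw [ruleWait, if_neg (not_not.2 (h.noneLeft e)),
    if_neg (h.not_below_of_ne (by rw [hb]; decide)), if_neg, if_neg,
    if_neg (h.not_below_of_ne (by rw [hb]; decide))]
  · rintro ⟨y, hy, -, h'⟩
    rw [h.below_eq hy] at h'
    exact h' (h.wins_front.2 hw)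
  · rintro ⟨y, hy, h'⟩
    rw [h.below_eq hy] at h'
    exact hs (h.symAbout_front.1 h')

/-- The other robot has given in. -/
theorem wait_elected (h : Pair pos a b X e) (hP : 1 < P.card) (ha : light a = wait)
    (hb : light b = walk) : outcome algorithm P orient pos light a = (elect, (-1, 0)) := by
  rw [h.outcome_of_rule hP (.inl ha) (o := (elect, .left))]
  · simp [GridMove.disp, flipY]
  · rw [ha]
    change ruleWait _ = _
    rw [ruleWait, if_neg (not_not.2 (h.noneLeft e)),
      if_neg (h.not_below_of_ne (by rw [hb]; decide)), if_neg, if_neg,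
      if_pos ⟨_, h.below_iff.2 ⟨hb, rfl⟩⟩]
    · exact fun ⟨y, hy, _⟩ => h.not_below_of_ne (by rw [hb]; decide) ⟨y, hy⟩
    · exact fun ⟨y, hy, _⟩ => h.not_below_of_ne (by rw [hb]; decide) ⟨y, hy⟩

theorem search_start (h : Pair pos a b X e) :
    ¬ (¬ NoneLeft (snapshot pos light e a) ∨ ¬ ∃ l y, Below (snapshot pos light e a) l y) := by
  rintro (h' | h')
  · exact h' (h.noneLeft e)
  · exact h' ⟨_, _, h.below_iff.2 ⟨rfl, rfl⟩⟩

theorem search_climb (h : Pair pos a b X e) (hP : 1 < P.card) (hk : P.card = k) (ha : light a = search)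
    (hc : ¬ Clear (pos a) (others pos a b)) :
    outcome algorithm P orient pos light a = (search, (0, (e : ℤ))) := by
  rw [h.outcome_of_rule hP (.inr ha) (o := (search, .up))]
  · simp [GridMove.disp, flipY]
  · rw [ha]
    change ruleSearch P _ = _
    rw [ruleSearch, if_neg h.search_start, if_pos ((h.card_lt_iff hk e).2 hc)]

/-- The place of the other robot, as it appears to `a`. -/
theorem clear_partner (h : Pair pos a b X e) (hc : Clear (pos a) (others pos a b)) {l : Fin 8} {y : ℤ}
    (hy : Below (snapshot pos light e a) l y) :
    Clear (0, y) (ahead (snapshot pos light e a)) ↔ Clear (pos b) (others pos a b) := by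
  have : ((0, e * ((pos b).2 - (pos a).2)) : GridPt) = toFrame e (pos a) (pos b) := by
    refine Prod.ext ?_ rfl
    simp [toFrame, h.left, h.left']
  rw [h.ahead_eq hc, (h.below_iff.1 hy).2, this]
  exact clear_image

theorem search_stay (h : Pair pos a b X e) (hP : 1 < P.card) (hk : P.card = k) (ha : light a = search)
    (hc : Clear (pos a) (others pos a b))
    (hb : light b = wait ∨ light b = search ∧ ¬ Clear (pos b) (others pos a b)) :
    Rests algorithm P orient pos light a := by
  refine h.rests_of_rule hP (.inr ha) ?_
  rw [ha]
  change ruleSearch P _ = _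
  have hno : ¬ ∃ y, Below (snapshot pos light e a) search y ∧
      Clear (0, y) (ahead (snapshot pos light e a)) := by
    rintro ⟨y, hy, hcy⟩
    rw [h.clear_partner hc hy] at hcy
    rcases hb with hb | hb
    · have := (h.below_iff.1 hy).1
      rw [hb] at this
      exact absurd this (by decide)
    · exact hb.2 hcy
  have hne : light b ≠ elect ∧ light b ≠ walk := by
    rcases hb with hb | ⟨hb, -⟩ <;> rw [hb] <;> decide
  rw [ruleSearch, if_neg h.search_start, if_neg (fun h' => (h.card_lt_iff hk e).1 h' hc), if_neg, if_neg,
    if_neg (h.not_below_of_ne hne.1), if_neg (h.not_below_of_ne hne.2)]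
  · exact fun ⟨y, h1, h2, _⟩ => hno ⟨y, h1, h2⟩
  · exact fun ⟨y, h1, h2, _⟩ => hno ⟨y, h1, h2⟩

/-- The axis of the next column, which decides about the symmetry of the configuration. -/
theorem axis_unique (h : Pair pos a b X e) (hne : (others pos a b).Nonempty)
    (hs : SymAbout (frontOf (others pos a b)) c) {c' : ℤ}
    (h' : SymAbout (front (snapshot pos light e a)) c') : c' = e * (c - 2 * (pos a).2) := by
  have h1 : SymAbout (front (snapshot pos light e a)) (e * (c - 2 * (pos a).2)) := h.symAbout_front.2 hs
  refine h'.unique ?_ ?_ h1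
  · rw [h.front_eq]
    exact (finite_others.subset fun p hp => hp.1).image _
  · rw [h.front_eq]
    obtain ⟨p, hp, hmin⟩ := Set.exists_min_image (others pos a b) (fun p => p.1) finite_others hne
    exact ⟨_, p, ⟨hp, hmin⟩, rfl⟩

theorem search_sym (h : Pair pos a b X e) (hP : 1 < P.card) (hk : P.card = k) (ha : light a = search)
    (hb : light b = search) (hc : Clear (pos a) (others pos a b)) (hc' : Clear (pos b) (others pos a b))
    (hs : SymAbout (others pos a b) c) :
    outcome algorithm P orient pos light a = (elect, 0) := by
  rw [h.outcome_of_rule hP (.inr ha) (o := (elect, .stay))]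
  · exact congrArg _ (flipY_zero _)
  · rw [ha]
    change ruleSearch P _ = _
    have hy : Below (snapshot pos light e a) search _ := h.below_iff.2 ⟨hb, rfl⟩
    rw [ruleSearch, if_neg h.search_start, if_neg (fun h' => (h.card_lt_iff hk e).1 h' hc), if_pos]
    refine ⟨_, hy, (h.clear_partner hc hy).2 hc', _, h.symAbout_front.2 hs.frontOf, ?_⟩
    rw [h.ahead_eq hc, symAbout_image]
    exact hs

theorem not_search_sym (h : Pair pos a b X e) (hc : Clear (pos a) (others pos a b))
    (hne : (others pos a b).Nonempty) (hs : SymAbout (frontOf (others pos a b)) c)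
    (hn : ¬ SymAbout (others pos a b) c) : ¬ ∃ y, Below (snapshot pos light e a) search y ∧
    Clear (0, y) (ahead (snapshot pos light e a)) ∧
      ∃ c, SymAbout (front (snapshot pos light e a)) c ∧ SymAbout (ahead (snapshot pos light e a)) c := by
  rintro ⟨y, -, -, c', h1, h2⟩
  rw [h.axis_unique hne hs h1, h.ahead_eq hc, symAbout_image] at h2
  exact hn h2

section Asymmetric

variable (h : Pair pos a b X e) (hP : 1 < P.card) (hk : P.card = k) (ha : light a = search)
  (hb : light b = search) (hc : Clear (pos a) (others pos a b)) (hc' : Clear (pos b) (others pos a b))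
  (hne : (others pos a b).Nonempty) (hs : SymAbout (frontOf (others pos a b)) c)
  (hn : ¬ SymAbout (others pos a b) c)
include h hP hk ha hb hc hne hs hn

include hc' in
theorem search_lose (hw : ¬ Wins e (others pos a b) c) :
    outcome algorithm P orient pos light a = (walk, 0) := by
  rw [h.outcome_of_rule hP (.inr ha) (o := (walk, .stay))]
  · exact congrArg _ (flipY_zero _)
  · rw [ha]
    change ruleSearch P _ = _
    have hy : Below (snapshot pos light e a) search _ := h.below_iff.2 ⟨hb, rfl⟩
    rw [ruleSearch, if_neg h.search_start, if_neg (fun h' => (h.card_lt_iff hk e).1 h' hc),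
      if_neg (h.not_search_sym hc hne hs hn), if_pos]
    refine ⟨_, hy, (h.clear_partner hc hy).2 hc', _, h.symAbout_front.2 hs, ?_, ?_⟩
    · rw [h.ahead_eq hc, symAbout_image]
      exact hn
    · rw [h.ahead_eq hc, wins_image, one_mul]
      exact hw

theorem search_win (hw : Wins e (others pos a b) c) : Rests algorithm P orient pos light a := by
  refine h.rests_of_rule hP (.inr ha) ?_
  rw [ha]
  change ruleSearch P _ = _
  rw [ruleSearch, if_neg h.search_start, if_neg (fun h' => (h.card_lt_iff hk e).1 h' hc),
    if_neg (h.not_search_sym hc hne hs hn), if_neg,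
    if_neg (h.not_below_of_ne (by rw [hb]; decide)), if_neg (h.not_below_of_ne (by rw [hb]; decide))]
  rintro ⟨y, -, -, c', h1, -, h3⟩
  rw [h.axis_unique hne hs h1, h.ahead_eq hc, wins_image, one_mul] at h3
  exact h3 hw

end Asymmetric

theorem search_elected (h : Pair pos a b X e) (hP : 1 < P.card) (hk : P.card = k) (ha : light a = search)
    (hc : Clear (pos a) (others pos a b)) (hb : light b = elect ∨ light b = walk) :
    outcome algorithm P orient pos light a = (elect, if light b = elect then 0 else (-1, 0)) := by
  have hns : ¬ ∃ y, Below (snapshot pos light e a) search y :=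
    h.not_below_of_ne (by rcases hb with hb | hb <;> rw [hb] <;> decide)
  by_cases hbe : light b = elect
  · rw [h.outcome_of_rule hP (.inr ha) (o := (elect, .stay)), if_pos hbe]
    · exact congrArg _ (flipY_zero _)
    · rw [ha]
      change ruleSearch P _ = _
      rw [ruleSearch, if_neg h.search_start, if_neg (fun h' => (h.card_lt_iff hk e).1 h' hc),
        if_neg (fun ⟨y, hy, _⟩ => hns ⟨y, hy⟩), if_neg (fun ⟨y, hy, _⟩ => hns ⟨y, hy⟩),
        if_pos ⟨_, h.below_iff.2 ⟨hbe, rfl⟩⟩]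
  · rw [h.outcome_of_rule hP (.inr ha) (o := (elect, .left)), if_neg hbe]
    · simp [GridMove.disp, flipY]
    · have hbw := hb.resolve_left hbe
      rw [ha]
      change ruleSearch P _ = _
      rw [ruleSearch, if_neg h.search_start, if_neg (fun h' => (h.card_lt_iff hk e).1 h' hc),
        if_neg (fun ⟨y, hy, _⟩ => hns ⟨y, hy⟩), if_neg (fun ⟨y, hy, _⟩ => hns ⟨y, hy⟩),
        if_neg (h.not_below_of_ne hbe), if_pos ⟨_, h.below_iff.2 ⟨hbw, rfl⟩⟩]

end Pair

/-- A robot with light `elect` rests if nobody is to the left, and somebody is on one side of its column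
only. -/
theorem rests_elect (hP : 1 < P.card) (ha : light a = elect) (hleft : ∀ j, j ≠ a → (pos a).1 ≤ (pos j).1)
    (hcol : ∃ j, j ≠ a ∧ Sees pos a j ∧ (pos j).1 = (pos a).1)
    (hside : ∃ s : ℤˣ, ∀ j, j ≠ a → (pos j).1 = (pos a).1 → (s : ℤ) * (pos j).2 < s * (pos a).2) :
    Rests algorithm P orient pos light a := by
  refine rests_of_none hP fun e => ?_
  rw [ha]
  change ruleElect _ = none
  have hnl : ∀ p ∈ snapshot pos light e a, ¬ p.1.1 < 0 := by
    rw [forall_mem_snapshot]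
    intro j hj _
    have := hleft j hj
    simp only [flipY_fst, Prod.fst_sub]
    omega
  rw [ruleElect, if_neg, if_neg, if_neg, if_neg]
  · rintro ⟨h1, -⟩
    obtain ⟨j, hj, hs, h0⟩ := hcol
    have := h1 _ (mem_snapshot_of_sees hj hs)
    simp only [flipY_fst, Prod.fst_sub] at this
    omega
  · rintro ⟨q, hq, hlt, -⟩
    exact hnl _ hq hlt
  · rintro ⟨-, ⟨p, hp, hp0, hp1⟩, q, hq, hq0, hq1⟩
    obtain ⟨i, hi, -, rfl⟩ := mem_snapshot.1 hp
    obtain ⟨j, hj, -, rfl⟩ := mem_snapshot.1 hq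
    simp only [flipY_fst, flipY_snd, Prod.fst_sub, Prod.snd_sub] at hp0 hp1 hq0 hq1
    obtain ⟨s, hs⟩ := hside
    have h1 := hs i hi (by omega)
    have h2 := hs j hj (by omega)
    rcases Int.units_eq_one_or s with rfl | rfl <;> rcases Int.units_eq_one_or e with rfl | rfl <;>
      simp only [Units.val_neg, Units.val_one] at * <;> omega
  · rintro ⟨p, hp, -, -, -, h0, -⟩
    exact hnl p hp h0

theorem Pair.rests_elect (h : Pair pos a b X e) (hP : 1 < P.card) (ha : light a = elect) :
    Rests algorithm P orient pos light a := by
  have hb : ∀ j, j ≠ a → (pos j).1 ≤ (pos a).1 → j = b := by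
    intro j hj hle
    by_contra hjb
    have h1 := h.right j hj hjb
    have h2 := h.left
    omega
  refine Apf.rests_elect hP ha (fun j hj => ?_) ⟨b, h.ne.symm, h.sees, by rw [h.left, h.left']⟩
    ⟨e, fun j hj hle => ?_⟩
  · by_cases hjb : j = b
    · rw [hjb, h.left, h.left']
    · have h1 := h.right j hj hjb
      have h2 := h.left
      omega
  · rw [hb j hj hle.le]
    exact h.below

end Apf

namespace Apf

variable {k : ℕ} {P : Finset GridPt} {orient : Fin k → ℤˣ} {pos : Fin k → GridPt}
  {light : Fin k → Fin 8} {a b : Fin k} {x : ℤ} {e : ℤˣ}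

/-! ### The ends of the leftmost column step out -/

/-- The robots `a` and `b` are the ends of the leftmost column `x`, with `b` below `a` in frames with
orientation `e`, or have already moved from there to the next column on the left. -/
structure Ends (pos : Fin k → GridPt) (a b : Fin k) (x : ℤ) (e : ℤˣ) : Prop where
  inj : Function.Injective pos
  place : (pos a).1 = x ∨ (pos a).1 = x - 1
  place' : (pos b).1 = x ∨ (pos b).1 = x - 1
  below : (e : ℤ) * (pos b).2 < e * (pos a).2
  right : ∀ j, j ≠ a → j ≠ b → x < (pos j).1 ∨
    (pos j).1 = x ∧ (e : ℤ) * (pos b).2 < e * (pos j).2 ∧ (e : ℤ) * (pos j).2 < e * (pos a).2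

namespace Ends

theorem ne (h : Ends pos a b x e) : a ≠ b := by
  rintro rfl
  exact absurd h.below (by omega)

theorem symm (h : Ends pos a b x e) : Ends pos b a x (-e) := by
  refine ⟨h.inj, h.place', h.place, ?_, fun j h1 h2 => ?_⟩
  · have := h.below
    simp only [Units.val_neg, neg_mul]
    omega
  · have := h.right j h2 h1
    simp only [Units.val_neg, neg_mul]
    omega

theorem pair (h : Ends pos a b x e) (ha : (pos a).1 = x - 1) (hb : (pos b).1 = x - 1) :
    Pair pos a b (x - 1) e := by
  refine ⟨h.inj, ha, hb, h.below, fun j h1 h2 => ?_⟩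
  have := h.right j h1 h2
  omega

theorem le_right (h : Ends pos a b x e) {j : Fin k} (hja : j ≠ a) (hjb : j ≠ b) : x ≤ (pos j).1 := by
  have := h.right j hja hjb
  omega

/-- Robots in the same or in neighbouring columns with nobody between see each other. -/
theorem sees_of_adjacent {i j : Fin k} (h : (pos i).1 = (pos j).1 + 1 ∨ (pos j).1 = (pos i).1 + 1) :
    Sees pos i j := by
  intro l hl
  have := sbtw_coords hl
  omega

/-- An end of the leftmost column steps out. -/
theorem off_first (h : Ends pos a b x e) (hP : 1 < P.card) (ha : light a = off) (hax : (pos a).1 = x)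
    (hbx : (pos b).1 = x) : outcome algorithm P orient pos light a = (step, (-1, 0)) := by
  have hnl : ∀ s, NoneLeft (snapshot pos light s a) := by
    intro s
    rw [NoneLeft, forall_mem_snapshot]
    intro j hja _
    simp only [flipY_fst, Prod.fst_sub]
    by_cases hjb : j = b
    · subst hjb; omega
    · have := h.le_right hja hjb
      omega
  -- somebody is visible below in the column
  obtain ⟨z, hz, hsz, hz'⟩ := exists_sees_coords h.inj h.ne
  have hcol : (pos z).1 = x ∧ (e : ℤ) * (pos z).2 < e * (pos a).2 := by
    have hb := h.below
    rcases hz' with rfl | hbt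
    · exact ⟨hbx, hb⟩
    · have := sbtw_coords hbt
      rcases Int.units_eq_one_or e with rfl | rfl <;>
        simp only [Units.val_neg, Units.val_one, neg_mul, one_mul] at hb ⊢ <;> omega
  have hmem : ∀ s, (flipY s (pos z - pos a), light z) ∈ snapshot pos light s a :=
    fun s => mem_snapshot_of_sees hz hsz
  have hnot : ∀ s, ¬ ∀ p ∈ snapshot pos light s a, p.1.1 ≠ 0 := by
    intro s hall
    refine hall _ (hmem s) ?_
    simp only [flipY_fst, Prod.fst_sub]
    omega
  rw [outcome_of_rule hP e (o := (step, .left))]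
  · simp [GridMove.disp, flipY]
  · rw [rule, if_pos ha, ruleOff, if_pos (hnl e), if_neg (hnot e), if_pos]
    rw [NoneAbove, forall_mem_snapshot]
    intro j hja _ h0
    simp only [flipY_fst, flipY_snd, Prod.fst_sub, Prod.snd_sub, mul_sub] at h0 ⊢
    by_cases hjb : j = b
    · rw [hjb]
      have := h.below
      omega
    · have := h.right j hja hjb
      omega
  · rw [rule, if_pos ha, ruleOff, if_pos (hnl _), if_neg (hnot _), if_neg]
    intro hall
    have := hall _ (hmem (-e)) (by simp only [flipY_fst, Prod.fst_sub]; omega)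
    simp only [flipY_snd, Prod.snd_sub, mul_sub, Units.val_neg, neg_mul] at this
    omega

/-- The lights while the ends of the leftmost column step out. -/
def StepLights (light : Fin k → Fin 8) : Prop := ∀ j, light j = off ∨ light j = step ∨ light j = wait

theorem StepLights.not_onAxis (h : StepLights light) (s : ℤˣ) (i : Fin k) :
    ¬ OnAxis (snapshot pos light s i) := by
  refine not_onAxis_of_sole (fun j _ hj => ?_) s
  rcases h j with h' | h' | h' <;> rw [h'] at hj <;> exact absurd hj (by decide)

theorem StepLights.no_lead (h : StepLights light) (j : Fin k) : light j ≠ lead := by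
  rcases h j with h' | h' | h' <;> rw [h'] <;> decide

theorem partner_left (h : Ends pos a b x e) (hax : (pos a).1 = x) (hbx : (pos b).1 = x - 1) (s : ℤˣ) :
    (flipY s (pos b - pos a), light b) ∈ snapshot pos light s a ∧ (flipY s (pos b - pos a)).1 < 0 ∧
      ∀ p ∈ snapshot pos light s a, p.1.1 < 0 → p = (flipY s (pos b - pos a), light b) := by
  refine ⟨mem_snapshot_of_sees h.ne.symm (sees_of_adjacent (by omega)), ?_, ?_⟩
  · simp only [flipY_fst, Prod.fst_sub]
    omega
  · rw [forall_mem_snapshot]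
    intro j hja _ hlt
    simp only [flipY_fst, Prod.fst_sub] at hlt
    by_cases hjb : j = b
    · rw [hjb]
    · have := h.le_right hja hjb
      omega

/-- The second end steps out after the first one has announced to wait. -/
theorem off_second (h : Ends pos a b x e) (hP : 1 < P.card) (hl : StepLights light) (ha : light a = off)
    (hax : (pos a).1 = x) (hbx : (pos b).1 = x - 1) (hb : light b = wait) :
    outcome algorithm P orient pos light a = (step, (-1, 0)) := by
  have hnl : ∀ s, ¬ NoneLeft (snapshot pos light s a) := fun s h' => by
    have := h.partner_left (light := light) hax hbx s
    exact absurd (h' _ this.1) (by simp only; omega)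
  rw [outcome_of_rule hP e (o := (step, .left))]
  · simp [GridMove.disp, flipY]
  · rw [rule, if_pos ha, ruleOff, if_neg (hnl e), if_pos]
    refine ⟨⟨flipY e (pos b - pos a), ?_, ?_⟩, ?_⟩
    · have := h.partner_left (light := light) hax hbx e
      rwa [hb] at this
    · have := h.below
      simp only [flipY_snd, Prod.snd_sub, mul_sub]
      omega
    · rw [NoneAbove, forall_mem_snapshot]
      intro j hja _ h0
      simp only [flipY_fst, flipY_snd, Prod.fst_sub, Prod.snd_sub, mul_sub] at h0 ⊢
      by_cases hjb : j = b
      · subst hjb; omega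
      · have := h.right j hja hjb
        omega
  · rw [rule, if_pos ha]
    have hpl := h.partner_left (light := light) hax hbx (-e)
    refine ruleOff_eq_none ⟨_, hpl.1, hpl.2.1⟩ ?_ (hl.not_onAxis _ _) (not_called_of_no_lead hl.no_lead _ _)
    rintro q ⟨h1, h2, -⟩ hlt
    have := congrArg Prod.fst (hpl.2.2 _ h1 h2)
    simp only at this
    rw [this] at hlt
    simp only [flipY_snd, Prod.snd_sub, mul_sub, Units.val_neg, neg_mul] at hlt
    have := h.below
    omega

/-- The second end waits while the first one has not yet announced to wait. -/
theorem off_pause (h : Ends pos a b x e) (hP : 1 < P.card) (hl : StepLights light) (ha : light a = off)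
    (hax : (pos a).1 = x) (hbx : (pos b).1 = x - 1) (hb : light b = step) :
    Rests algorithm P orient pos light a := by
  refine rests_of_none hP fun s => ?_
  rw [rule, if_pos ha]
  have hpl := h.partner_left (light := light) hax hbx s
  refine ruleOff_eq_none ⟨_, hpl.1, hpl.2.1⟩ ?_ (hl.not_onAxis _ _) (not_called_of_no_lead hl.no_lead _ _)
  rintro q ⟨h1, h2, -⟩
  have := congrArg Prod.snd (hpl.2.2 _ h1 h2)
  simp only [hb] at this
  exact absurd this (by decide)

theorem noneLeft (h : Ends pos a b x e) (hax : (pos a).1 = x - 1) (s : ℤˣ) :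
    NoneLeft (snapshot pos light s a) := by
  rw [NoneLeft, forall_mem_snapshot]
  intro j hja _
  simp only [flipY_fst, Prod.fst_sub]
  by_cases hjb : j = b
  · have := h.place'
    subst hjb; omega
  · have := h.le_right hja hjb
    omega

theorem step_wait (h : Ends pos a b x e) (hP : 1 < P.card) (ha : light a = step)
    (hax : (pos a).1 = x - 1) : outcome algorithm P orient pos light a = (wait, 0) := by
  refine outcome_of_both hP fun s => ?_
  rw [ha]
  change ruleStep _ = _
  rw [ruleStep, if_pos (h.noneLeft hax s)]

theorem wait_pause (h : Ends pos a b x e) (hP : 1 < P.card) (ha : light a = wait)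
    (hax : (pos a).1 = x - 1) (hb : (pos b).1 = x ∨ light b = step) :
    Rests algorithm P orient pos light a := by
  refine rests_of_none hP fun s => ?_
  rw [ha]
  change ruleWait _ = _
  have hbel : ∀ l y, Below (snapshot pos light s a) l y → l = step := by
    rintro l y ⟨h1, -⟩
    obtain ⟨j, hja, -, hj⟩ := mem_snapshot.1 h1
    rw [Prod.mk.injEq] at hj
    have hx := congrArg Prod.fst hj.1
    simp only [flipY_fst, Prod.fst_sub] at hx
    have hjb : j = b := by
      by_contra hjb
      have := h.le_right hja hjb
      omega
    subst hjb
    rw [← hj.2]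
    exact hb.resolve_left (by omega)
  rw [ruleWait, if_neg (not_not.2 (h.noneLeft hax s)), if_neg, if_neg, if_neg, if_neg]
  · exact fun ⟨y, hy⟩ => absurd (hbel _ _ hy) (by decide)
  · exact fun ⟨y, hy, _⟩ => absurd (hbel _ _ hy) (by decide)
  · exact fun ⟨y, hy, _⟩ => absurd (hbel _ _ hy) (by decide)
  · exact fun ⟨y, hy⟩ => absurd (hbel _ _ hy) (by decide)

/-- The other robots see both ends, or robots in their directions, to the left, or are between them. -/
theorem rests_others (h : Ends pos a b x e) (hP : 1 < P.card) (hl : StepLights light)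
    (hla : (pos a).1 = x → light a ≠ wait) (hlb : (pos b).1 = x → light b ≠ wait) {i : Fin k}
    (hia : i ≠ a) (hib : i ≠ b) (hi : light i = off) (hwait : ∀ j, j ≠ a → j ≠ b → light j ≠ wait) :
    Rests algorithm P orient pos light i := by
  by_cases hboth : (pos a).1 = x - 1 ∧ (pos b).1 = x - 1
  · exact (h.pair hboth.1 hboth.2).rests_others hP hl.no_lead hia hib hi fun s => hl.not_onAxis s i
  refine rests_of_none hP fun s => ?_
  rw [rule, if_pos hi]
  rcases h.right i hia hib with hlt | ⟨hix, hilow, hihigh⟩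
  ·
    have key : ∀ {r : Fin k}, i ≠ r → (pos r).1 = x → light r ≠ wait →
        ∃ z, z ≠ i ∧ Sees pos i z ∧ (pos z).1 < (pos i).1 ∧ light z ≠ wait := by
      intro r hir hrx hr
      obtain ⟨z, hz, hsz, hz'⟩ := exists_sees_coords h.inj hir
      refine ⟨z, hz, hsz, ?_, ?_⟩
      · rcases hz' with rfl | hbt
        · omega
        · have := sbtw_coords hbt
          omega
      · rcases hz' with rfl | hbt
        · exact hr
        · have hc := sbtw_coords hbt
          refine hwait z ?_ ?_
          · rintro rfl
            have := h.place
            omega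
          · rintro rfl
            have := h.place'
            omega
    obtain ⟨z, hz, hsz, hzl, hzw⟩ : ∃ z, z ≠ i ∧ Sees pos i z ∧ (pos z).1 < (pos i).1 ∧
        light z ≠ wait := by
      rcases h.place with ha | ha
      · exact key hia ha (hla ha)
      · have hb := h.place'.resolve_right fun hb => hboth ⟨ha, hb⟩
        exact key hib hb (hlb hb)
    have hmem := mem_snapshot_of_sees (light := light) (e := s) hz hsz
    have hneg : (flipY s (pos z - pos i)).1 < 0 := by
      simp only [flipY_fst, Prod.fst_sub]; omega
    refine ruleOff_eq_none ⟨_, hmem, hneg⟩ ?_ (hl.not_onAxis _ _) (not_called_of_no_lead hl.no_lead _ _)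
    rintro q ⟨-, -, hall⟩
    exact absurd (congrArg Prod.snd (hall _ hmem hneg)) hzw
  · -- inside column `x`, between the ends
    have key : ∀ {r : Fin k}, i ≠ r → (pos r).1 = x → ∃ z, z ≠ i ∧ Sees pos i z ∧
        (pos z).1 = (pos i).1 ∧ ((pos i).2 < (pos r).2 → (pos i).2 < (pos z).2) ∧
        ((pos r).2 < (pos i).2 → (pos z).2 < (pos i).2) := by
      intro r hir hrx
      obtain ⟨z, hz, hsz, hz'⟩ := exists_sees_coords h.inj hir
      refine ⟨z, hz, hsz, ?_⟩
      rcases hz' with rfl | hbt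
      · omega
      · have := sbtw_coords hbt
        omega
    -- an end in this column prevents `NoneAbove` in the frame in which it is above
    have habove : ∀ {r : Fin k}, i ≠ r → (pos r).1 = x → (s : ℤ) * (pos i).2 < s * (pos r).2 →
        ¬ NoneAbove (snapshot pos light s i) := by
      intro r hir hrx hlt hna
      obtain ⟨z, hz, hsz, hz0, hz1, hz2⟩ := key hir hrx
      have := hna _ (mem_snapshot_of_sees hz hsz) (by simp only [flipY_fst, Prod.fst_sub]; omega)
      simp only [flipY_snd, Prod.snd_sub] at this
      rcases Int.units_eq_one_or s with rfl | rfl <;>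
        simp only [Units.val_neg, Units.val_one, neg_mul, one_mul] at this hlt <;> omega
    by_cases hax : (pos a).1 = x <;> by_cases hbx : (pos b).1 = x
    · have hnl : NoneLeft (snapshot pos light s i) := by
        rw [NoneLeft, forall_mem_snapshot]
        intro j _ _
        simp only [flipY_fst, Prod.fst_sub]
        by_cases hja : j = a
        · subst hja; omega
        by_cases hjb : j = b
        · subst hjb; omega
        have := h.le_right hja hjb
        omega
      rw [ruleOff, if_pos hnl, if_neg, if_neg]
      · rcases Int.units_eq_one_or s with rfl | rfl <;> rcases Int.units_eq_one_or e with rfl | rfl <;>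
          simp only [Units.val_neg, Units.val_one, neg_mul, one_mul] at hilow hihigh
        · exact habove hia hax (by simp only [Units.val_one, one_mul]; omega)
        · exact habove hib hbx (by simp only [Units.val_one, one_mul]; omega)
        · exact habove hib hbx (by simp only [Units.val_neg, Units.val_one, neg_mul, one_mul]; omega)
        · exact habove hia hax (by simp only [Units.val_neg, Units.val_one, neg_mul, one_mul]; omega)
      · intro hall
        obtain ⟨z, hz, hsz, hz0, -⟩ := key hia hax
        exact hall _ (mem_snapshot_of_sees hz hsz) (by simp only [flipY_fst, Prod.fst_sub]; omega)
    · have hbx' := h.place'.resolve_left hbx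
      have hsb : Sees pos i b := sees_of_adjacent (by omega)
      have hmem := mem_snapshot_of_sees (light := light) (e := s) hib.symm hsb
      have hneg : (flipY s (pos b - pos i)).1 < 0 := by
        simp only [flipY_fst, Prod.fst_sub]; omega
      refine ruleOff_eq_none ⟨_, hmem, hneg⟩ ?_ (hl.not_onAxis _ _)
        (not_called_of_no_lead hl.no_lead _ _)
      rintro q ⟨-, -, hall⟩ hq
      have := congrArg Prod.fst (hall _ hmem hneg)
      simp only at this
      rw [← this] at hq
      simp only [flipY_snd, Prod.snd_sub] at hq
      refine habove hia hax ?_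
      rcases Int.units_eq_one_or s with rfl | rfl <;> rcases Int.units_eq_one_or e with rfl | rfl <;>
        simp only [Units.val_neg, Units.val_one, neg_mul, one_mul] at hilow hihigh hq ⊢ <;> omega
    · have hax' := h.place.resolve_left hax
      have hsa : Sees pos i a := sees_of_adjacent (by omega)
      have hmem := mem_snapshot_of_sees (light := light) (e := s) hia.symm hsa
      have hneg : (flipY s (pos a - pos i)).1 < 0 := by
        simp only [flipY_fst, Prod.fst_sub]; omega
      refine ruleOff_eq_none ⟨_, hmem, hneg⟩ ?_ (hl.not_onAxis _ _)
        (not_called_of_no_lead hl.no_lead _ _)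
      rintro q ⟨-, -, hall⟩ hq
      have := congrArg Prod.fst (hall _ hmem hneg)
      simp only at this
      rw [← this] at hq
      simp only [flipY_snd, Prod.snd_sub] at hq
      refine habove hib hbx ?_
      rcases Int.units_eq_one_or s with rfl | rfl <;> rcases Int.units_eq_one_or e with rfl | rfl <;>
        simp only [Units.val_neg, Units.val_one, neg_mul, one_mul] at hilow hihigh hq ⊢ <;> omega
    · exact absurd ⟨h.place.resolve_left hax, h.place'.resolve_left hbx⟩ hboth

end Ends

end Apf

theorem two_self {k : ℕ} {α : Type*} (a b : Fin k) (z : Fin k → α) : two a b (z a) (z b) z = z := by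
  funext i
  by_cases h1 : i = a
  · subst h1; simp
  by_cases h2 : i = b
  · subst h2; rw [two_right (Ne.symm h1)]
  · rw [two_other h1 h2]

theorem two_injective {k : ℕ} {α : Type*} {a b : Fin k} {z : Fin k → α} (hz : Function.Injective z)
    {p q : α} (hpq : p ≠ q) (hp : ∀ j, j ≠ a → j ≠ b → z j ≠ p) (hq : ∀ j, j ≠ a → j ≠ b → z j ≠ q) :
    Function.Injective (two a b p q z) := by
  intro i j hij
  simp only [two] at hij
  split_ifs at hij with h1 h2 h3 h4 h5 h6 h7 h8
  · rw [h1, h2]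
  · exact absurd hij hpq
  · exact absurd hij.symm (hp j h2 h3)
  · exact absurd hij.symm hpq
  · rw [h4, h6]
  · exact absurd hij.symm (hq j h5 h6)
  · exact absurd hij (hp i h1 h4)
  · exact absurd hij (hq i h1 h4)
  · exact hz hij

theorem Rests.not_of_outcome {k c : ℕ} {A : RobotAlgorithm c} {P : Finset GridPt} {orient : Fin k → ℤˣ}
    {pos : Fin k → GridPt} {light : Fin k → Fin c} {i : Fin k} {l : Fin c} {d : GridPt}
    (h : outcome A P orient pos light i = (l, d)) (hne : l ≠ light i ∨ d ≠ 0) :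
    ¬ Rests A P orient pos light i := by
  intro h'
  rw [Rests, h, Prod.mk.injEq] at h'
  rcases hne with hne | hne
  · exact hne h'.1
  · exact hne h'.2

namespace Apf

variable {k : ℕ} {P : Finset GridPt} {orient : Fin k → ℤˣ} {pos : Fin k → GridPt}
  {light : Fin k → Fin 8} {a b : Fin k} {x : ℤ} {e : ℤˣ}

namespace Ends

/-- The positions of a robot that steps out of the column `x`. -/
def stops (x : ℤ) (p : GridPt) (m : ℕ) : GridPt := if m = 0 then p else (x - 1, p.2)

/-- The lights of a robot that steps out. -/
def stopLights (m : ℕ) : Fin 8 := if m = 0 then off else if m = 1 then step else wait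

theorem moved (h : Ends pos a b x e) (hax : (pos a).1 = x) (hbx : (pos b).1 = x) (m m' : ℕ) :
    Ends (two a b (stops x (pos a) m) (stops x (pos b) m') pos) a b x e := by
  have hs : ∀ (p : GridPt) m, p.1 = x → ((stops x p m).1 = x ∨ (stops x p m).1 = x - 1) ∧
      (stops x p m).2 = p.2 := by
    intro p m hp
    simp only [stops]
    split_ifs
    · exact ⟨.inl hp, rfl⟩
    · exact ⟨.inr rfl, rfl⟩
  obtain ⟨h1, h2⟩ := hs (pos a) m hax
  obtain ⟨h3, h4⟩ := hs (pos b) m' hbx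
  have hb := h.below
  refine ⟨two_injective h.inj ?_ ?_ ?_, ?_, ?_, ?_, ?_⟩
  · intro e'
    rw [← h2, ← h4, e'] at hb
    omega
  · rintro j hja hjb e'
    have h5 := h.right j hja hjb
    have e1 := congrArg Prod.fst e'
    have e2 := (congrArg Prod.snd e').trans h2
    rw [e2] at h5
    omega
  · rintro j hja hjb e'
    have h5 := h.right j hja hjb
    have e1 := congrArg Prod.fst e'
    have e2 := (congrArg Prod.snd e').trans h4
    rw [e2] at h5
    omega
  · rw [two_left]; exact h1
  · rw [two_right h.ne]; exact h3
  · rw [two_left, two_right h.ne, h2, h4]; exact hb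
  · intro j hja hjb
    rw [two_left, two_right h.ne, two_other hja hjb, h2, h4]
    exact h.right j hja hjb

theorem stepLights (a b : Fin k) (m m' : ℕ) :
    StepLights (two a b (stopLights m) (stopLights m') fun _ => off) := by
  have hs : ∀ m, stopLights m = off ∨ stopLights m = step ∨ stopLights m = wait := by
    intro m
    simp only [stopLights]
    split_ifs <;> simp
  intro j
  simp only [two]
  split_ifs
  · exact hs m
  · exact hs m'
  · exact .inl rfl

/-- What the first end does at its `m`-th stop. -/
theorem act_at_halt (h : Ends pos a b x e) (hax : (pos a).1 = x) (hbx : (pos b).1 = x) (hP : 1 < P.card)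
    {m m' y : ℕ} (hm : m ≤ 2) (hm' : m' + y ≤ 2) (hy : y ≤ 1)
    (hyp : y = 1 → stops x (pos b) (m' + 1) ≠ stops x (pos b) m') (hfin : ¬ (m = 2 ∧ m' = 2)) :
    (m = 0 ∧ m' + y = 1 ∨ m = 2) ∧ Rests algorithm P orient
      (two a b (stops x (pos a) m) (stops x (pos b) m') pos)
      (two a b (stopLights m) (stopLights (m' + y)) fun _ => off) a ∨
    m < 2 ∧ outcome algorithm P orient (two a b (stops x (pos a) m) (stops x (pos b) m') pos)
      (two a b (stopLights m) (stopLights (m' + y)) fun _ => off) a =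
        (stopLights (m + 1), stops x (pos a) (m + 1) - stops x (pos a) m) := by
  have hE := h.moved hax hbx m m'
  have hl := stepLights a b m (m' + y)
  have hpa : two a b (stops x (pos a) m) (stops x (pos b) m') pos a = stops x (pos a) m := two_left ..
  have hpb : two a b (stops x (pos a) m) (stops x (pos b) m') pos b = stops x (pos b) m' :=
    two_right h.ne ..
  have hla : two a b (stopLights m) (stopLights (m' + y)) (fun _ => off) a = stopLights m := two_left ..
  have hlb : two a b (stopLights m) (stopLights (m' + y)) (fun _ => off) b = stopLights (m' + y) :=
    two_right h.ne ..
  have hdiff : stops x (pos a) 1 - stops x (pos a) 0 = (-1, 0) := by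
    refine Prod.ext ?_ ?_ <;> simp [stops, hax]
  generalize two a b (stops x (pos a) m) (stops x (pos b) m') pos = pos' at *
  generalize two a b (stopLights m) (stopLights (m' + y)) (fun _ => off) = light' at *
  have hy0 : m' = 0 ∨ y = 0 := by
    by_contra hcon
    refine hyp (by omega) ?_
    simp only [stops]
    rw [if_neg (by omega), if_neg (by omega)]
  obtain rfl | rfl | rfl : m = 0 ∨ m = 1 ∨ m = 2 := by omega
  · have hax' : (pos' a).1 = x := by rw [hpa]; exact hax
    by_cases hm0 : m' = 0
    · subst hm0
      right
      refine ⟨by omega, ?_⟩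
      rw [hdiff]
      exact hE.off_first hP hla hax' (by rw [hpb]; exact hbx)
    · have hy1 := hy0.resolve_left hm0
      subst hy1
      have hbx' : (pos' b).1 = x - 1 := by rw [hpb, stops, if_neg hm0]
      by_cases hm1 : m' = 1
      · subst hm1
        exact .inl ⟨.inl ⟨rfl, rfl⟩, hE.off_pause hP hl hla hax' hbx' hlb⟩
      · right
        refine ⟨by omega, ?_⟩
        rw [hdiff]
        refine hE.off_second hP hl hla hax' hbx' ?_
        rw [hlb, stopLights, if_neg (by omega), if_neg (by omega)]
  · right
    refine ⟨by omega, ?_⟩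
    rw [hE.step_wait hP hla (by rw [hpa]; rfl)]
    refine Prod.ext rfl ?_
    simp [stops]
  · left
    refine ⟨.inr rfl, hE.wait_pause hP hla (by rw [hpa]; rfl) ?_⟩
    by_cases hm0 : m' = 0
    · subst hm0
      left
      rw [hpb]
      exact hbx
    · right
      have hy1 := hy0.resolve_left hm0
      have hm1 : m' = 1 := by omega
      subst hy1 hm1
      exact hlb

/-- Both ends of the leftmost column step out and wait for each other. -/
theorem completes (h : Ends pos a b x e) (hax : (pos a).1 = x) (hbx : (pos b).1 = x) (hP : 1 < P.card)
    {n : ℕ} (hend : Completes algorithm P orient n (Cfg.quiet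
      (two a b (x - 1, (pos a).2) (x - 1, (pos b).2) pos) (two a b wait wait fun _ => off))) :
    Completes algorithm P orient (n + 12) (Cfg.quiet pos fun _ => off) := by
  have hswap : ∀ m m', two a b (stops x (pos a) m) (stops x (pos b) m') pos =
      two b a (stops x (pos b) m') (stops x (pos a) m) pos := fun _ _ => two_swap h.ne ..
  have hswap' : ∀ m m', two a b (stopLights m) (stopLights m') (fun _ => off) =
      two b a (stopLights m') (stopLights m) fun _ => off := fun _ _ => two_swap h.ne ..
  have key := Completes.two_robots (A := algorithm) (P := P) (orient := orient) h.ne pos (fun _ => off)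
    (stops x (pos a)) (stops x (pos b)) stopLights stopLights 2 2 n
    (fun m _ m' _ => (h.moved hax hbx m m').inj)
    (fun m m' y z hm hm' hy hz hpy hpz hfin i hia hib => ?_)
    (fun m m' y hm hm' hy hyp hfin => ?_) (fun m m' y hm hm' hy hyp hfin => ?_)
    (fun m hm m' hm' hfin => ?_) hend
  · have h0 : two a b (stops x (pos a) 0) (stops x (pos b) 0) pos = pos := two_self a b pos
    have h1 : two a b (stopLights 0) (stopLights 0) (fun _ : Fin k => off) = fun _ => off :=
      two_self a b (fun _ => off)
    rw [h0, h1] at key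
    exact key
  · refine (h.moved hax hbx m m').rests_others hP (stepLights a b _ _) ?_ ?_ hia hib ?_ ?_
    · rw [two_left, two_left]
      intro hx hw
      have hm0 : m = 0 := by
        by_contra hm0
        rw [stops, if_neg hm0] at hx
        simp only at hx
        omega
      subst hm0
      obtain rfl | rfl : y = 0 ∨ y = 1 := by omega
      all_goals exact absurd hw (by decide)
    · rw [two_right h.ne, two_right h.ne]
      intro hx hw
      have hm0 : m' = 0 := by
        by_contra hm0
        rw [stops, if_neg hm0] at hx
        simp only at hx
        omega
      subst hm0
      obtain rfl | rfl : z = 0 ∨ z = 1 := by omega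
      all_goals exact absurd hw (by decide)
    · rw [two_other hia hib]
    · intro j hja hjb
      rw [two_other hja hjb]
      decide
  · exact (h.act_at_halt hax hbx hP hm hm' hy hyp hfin).imp_left And.right
  · rw [hswap, hswap']
    exact (h.symm.act_at_halt hbx hax hP hm' hm hy hyp fun h' => hfin h'.symm).imp_left And.right
  · have hA := h.act_at_halt (orient := orient) hax hbx hP (y := 0) hm hm' (by omega) (by omega) hfin
    have hB := h.symm.act_at_halt (orient := orient) hbx hax hP (y := 0) hm' hm (by omega) (by omega)
      fun h' => hfin h'.symm
    rw [hswap, hswap']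
    have hmove : ∀ {i : Fin k} {m : ℕ} {pos' : Fin k → GridPt} {light' : Fin k → Fin 8}, m < 2 →
        outcome algorithm P orient pos' light' i =
          (stopLights (m + 1), stops x (pos i) (m + 1) - stops x (pos i) m) →
        light' i = stopLights m → ¬ Rests algorithm P orient pos' light' i := by
      intro i m pos' light' hm ho hl
      refine Rests.not_of_outcome ho (.inl ?_)
      rw [hl]
      obtain rfl | rfl : m = 0 ∨ m = 1 := by omega
      all_goals decide
    rcases hA with ⟨hA, -⟩ | ⟨hA1, hA2⟩
    · rcases hB with ⟨hB, -⟩ | ⟨hB1, hB2⟩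
      · omega
      · exact .inr (hmove hB1 hB2 (two_left ..))
    · left
      rw [← hswap, ← hswap']
      exact hmove hA1 hA2 (two_left ..)

end Ends

end Apf

namespace Apf

variable {k : ℕ} {P : Finset GridPt} {orient : Fin k → ℤˣ} {base pos : Fin k → GridPt}
  {light : Fin k → Fin 8} {a b : Fin k} {X c : ℤ} {e : ℤˣ} {D K n : ℕ}

/-! ### Electing one of two robots -/

/-- The number of steps that suffice after a robot was elected, where `B` bounds the extents of the target
and of the robots waiting to be called, and `L` bounds the distance of any two rows with robots. -/
def electedSteps (k B L : ℕ) : ℕ :=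
  3 * (L + 1) + (3 * (3 * B + L) + 6) + (k * (3 * (3 * B) + 6) + (3 * B + 3))

/-- The lights when all robots but `a` and `b` are waiting to be called. -/
def lights (a b : Fin k) (l l' : Fin 8) : Fin k → Fin 8 := two a b l l' fun _ => off

theorem lights_left (l l' : Fin 8) : lights a b l l' a = l := two_left ..

theorem lights_right (hab : a ≠ b) (l l' : Fin 8) : lights a b l l' b = l' := two_right hab ..

theorem lights_other {j : Fin k} (hja : j ≠ a) (hjb : j ≠ b) (l l' : Fin 8) : lights a b l l' j = off :=
  two_other hja hjb ..

theorem lights_swap (hab : a ≠ b) (l l' : Fin 8) : lights a b l l' = lights b a l' l := two_swap hab ..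

theorem lights_no_lead {l l' : Fin 8} (hl : l ≠ lead) (hl' : l' ≠ lead) (j : Fin k) :
    lights a b l l' j ≠ lead := by
  simp only [lights, two]
  split_ifs
  · exact hl
  · exact hl'
  · decide

/-- Compared with the configuration `base` of extent at most `D`, only the robots `a` and `b` have moved:
one column to the left, and by at most `K` rows away from each other. -/
structure Spread (base pos : Fin k → GridPt) (a b : Fin k) (e : ℤˣ) (D K : ℕ) : Prop where
  width : ∀ i j, |(base i).1 - (base j).1| ≤ D
  height : ∀ i j, |(base i).2 - (base j).2| ≤ D
  same : ∀ j, j ≠ a → j ≠ b → pos j = base j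
  col : (pos a).1 = (base a).1 - 1
  col' : (pos b).1 = (base b).1 - 1
  up : (e : ℤ) * (base a).2 ≤ e * (pos a).2 ∧ (e : ℤ) * (pos a).2 ≤ e * (base a).2 + K
  down : (e : ℤ) * (pos b).2 ≤ e * (base b).2 ∧ (e : ℤ) * (base b).2 - K ≤ e * (pos b).2

theorem Spread.symm (h : Spread base pos a b e D K) : Spread base pos b a (-e) D K := by
  refine ⟨h.width, h.height, fun j h1 h2 => h.same j h2 h1, h.col', h.col, ?_, ?_⟩
  · have := h.down
    simp only [Units.val_neg, neg_mul]
    omega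
  · have := h.up
    simp only [Units.val_neg, neg_mul]
    omega

theorem Spread.row (h : Spread base pos a b e D K) (hab : a ≠ b) (i j : Fin k) :
    |(pos i).2 - (pos j).2| ≤ D + 2 * K := by
  have key : ∀ i, ∃ i', |(pos i).2 - (base i').2| ≤ K := by
    intro i
    by_cases hia : i = a
    · subst hia
      refine ⟨i, ?_⟩
      have := h.up
      rw [abs_le]
      rcases Int.units_eq_one_or e with rfl | rfl <;>
        simp only [Units.val_neg, Units.val_one, neg_mul, one_mul] at this <;> omega
    by_cases hib : i = b
    · subst hib
      refine ⟨i, ?_⟩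
      have := h.down
      rw [abs_le]
      rcases Int.units_eq_one_or e with rfl | rfl <;>
        simp only [Units.val_neg, Units.val_one, neg_mul, one_mul] at this <;> omega
    · exact ⟨i, by rw [h.same i hia hib, sub_self, abs_zero]; omega⟩
  obtain ⟨i', hi⟩ := key i
  obtain ⟨j', hj⟩ := key j
  have := h.height i' j'
  rw [abs_le] at *
  omega

namespace Pair

theorem rests_others_lights (h : Pair pos a b X e) (hP : 1 < P.card) {l l' : Fin 8} (hl : l ≠ lead)
    (hl' : l' ≠ lead) (hle : ¬ (l = elect ∧ l' = elect)) {i : Fin k} (hia : i ≠ a) (hib : i ≠ b) :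
    Rests algorithm P orient pos (lights a b l l') i := by
  refine h.rests_others hP (lights_no_lead hl hl') hia hib (lights_other hia hib _ _) fun s =>
    not_onAxis_of_sole (fun j j' hj hj' => ?_) s
  have key : ∀ j, lights a b l l' j = elect → j = a ∧ l = elect ∨ j = b ∧ l' = elect := by
    intro j hj
    by_cases hja : j = a
    · subst hja
      rw [lights_left] at hj
      exact .inl ⟨rfl, hj⟩
    by_cases hjb : j = b
    · subst hjb
      rw [lights_right h.ne] at hj
      exact .inr ⟨rfl, hj⟩
    · rw [lights_other hja hjb] at hj
      exact absurd hj (by decide)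
  rcases key j hj with ⟨rfl, h1⟩ | ⟨rfl, h1⟩ <;> rcases key j' hj' with ⟨rfl, h2⟩ | ⟨rfl, h2⟩
  · rfl
  · exact absurd ⟨h1, h2⟩ hle
  · exact absurd ⟨h2, h1⟩ hle
  · rfl

/-- The robot that gave in has told the other one that it is elected. -/
theorem elected (h : Pair pos a b X e) :
    Elected (Function.update pos b (pos b + (-1, 0))) (lights a b walk elect) b := by
  have hb : (pos b + (-1, 0)).1 = X - 1 := by rw [Prod.fst_add, h.left']; rfl
  have hright : ∀ j, j ≠ b → X ≤ (pos j).1 := by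
    intro j hj
    by_cases hja : j = a
    · rw [hja, h.left]
    · exact (h.right j hja hj).le
  refine ⟨injective_update h.inj fun j hj e' => ?_, lights_right h.ne _ _, fun j hj => ?_,
    fun j hj => ?_, fun m hm => ?_⟩
  · have := hright j hj
    rw [e'] at this
    omega
  · rw [Function.update_self, Function.update_of_ne hj]
    have := hright j hj
    omega
  · by_cases hja : j = a
    · rw [hja]; exact .inr (lights_left _ _)
    · exact .inl (lights_other hja hj _ _)
  · have hma : m = a := by
      by_contra hma
      by_cases hmb : m = b
      · rw [hmb, lights_right h.ne] at hm
        exact absurd hm (by decide)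
      · rw [lights_other hma hmb] at hm
        exact absurd hm (by decide)
    subst hma
    rw [Function.update_of_ne h.ne, Function.update_self]
    refine ⟨fun e' => ?_, fun j hj hjm => ?_⟩
    · have := h.below
      rw [Prod.snd_add, show ((-1, 0) : GridPt).2 = 0 from rfl, add_zero] at e'
      rw [e'] at this
      omega
    · rw [Function.update_of_ne hj, h.left]
      exact h.right j hjm hj

/-- Robot `a` gives in, and robot `b` is elected. -/
theorem completes_of_loser (h : Pair pos a b X e) (hs : Spread base pos a b e D K) (hP : 1 < P.card)
    (hk : P.card = k) (hBt : ∀ p ∈ P, -(place P p).1 ≤ (D + 2 : ℕ) ∧ -(place P p).2 ≤ (D + 2 : ℕ))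
    {l : Fin 8} (hl : l = wait ∨ l = search)
    (hA : outcome algorithm P orient pos (lights a b l l) a = (walk, 0))
    (hB : Rests algorithm P orient pos (lights a b l l) b)
    (hB' : outcome algorithm P orient pos (lights a b walk l) b = (elect, (-1, 0))) :
    Completes algorithm P orient (electedSteps k (D + 2) (D + 2 * K) + 6)
      (Cfg.quiet pos (lights a b l l)) := by
  have hlead : l ≠ lead := by rcases hl with rfl | rfl <;> decide
  have hle : l ≠ elect := by rcases hl with rfl | rfl <;> decide
  have hlw : l ≠ walk := by rcases hl with rfl | rfl <;> decide
  have hoff : ∀ l₁ l₂ {i : Fin k}, l₁ ≠ off → l₂ ≠ off → lights a b l₁ l₂ i = off → i ≠ a ∧ i ≠ b := by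
    intro l₁ l₂ i h1 h2 hi
    refine ⟨?_, ?_⟩
    · rintro rfl
      rw [lights_left] at hi
      exact h1 hi
    · rintro rfl
      rw [lights_right h.ne] at hi
      exact h2 hi
  have hupa : Function.update (lights a b l l) a walk = lights a b walk l := update_two_left ..
  have hupb : Function.update (lights a b walk l) b elect = lights a b walk elect :=
    update_two_right h.ne ..
  rw [show electedSteps k (D + 2) (D + 2 * K) + 6 = electedSteps k (D + 2) (D + 2 * K) + 3 + 3 by ring]
  refine Completes.light_step h.inj hA (by rw [lights_left]; exact hlw.symm) (fun i hi => ?_) ?_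
  · by_cases hib : i = b
    · rw [hib]; exact hB
    · exact h.rests_others_lights hP hlead hlead (fun h' => hle h'.1) hi hib
  rw [hupa]
  have hrest : ∀ l', l' ≠ lead → ∀ i, i ≠ b → Rests algorithm P orient pos (lights a b walk l') i := by
    intro l' hl' i hi
    by_cases hia : i = a
    · rw [hia]
      exact rests_walk_of_no_lead hP (lights_left _ _) (lights_no_lead (by decide) hl')
    · exact h.rests_others_lights hP (by decide) hl' (fun h' => absurd h'.1 (by decide)) hia hi
  refine Completes.seq_step h.inj hB' (by simp) (hrest l hlead) (fun _ => ?_) ?_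
  · rw [hupb]
    exact hrest elect (by decide)
  rw [hupb]
  have hother : ∀ {i}, i ≠ a → i ≠ b → Function.update pos b (pos b + (-1, 0)) i = base i := by
    intro i hia hib
    rw [Function.update_of_ne hib, hs.same i hia hib]
  refine h.elected.completes hP hk (fun i j => ?_) (fun i j => ?_) (fun i j hi hj => ?_)
    (fun m i hm hi => ?_) hBt
  · have key : ∀ i, ∃ i', |(Function.update pos b (pos b + (-1, 0)) i).1 - (base i').1 + 1| ≤ 1 := by
      intro i
      refine ⟨i, ?_⟩
      by_cases hib : i = b
      · subst hib
        rw [Function.update_self, Prod.fst_add, hs.col', abs_le]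
        constructor <;> simp only <;> omega
      · rw [Function.update_of_ne hib, abs_le]
        by_cases hia : i = a
        · subst hia
          rw [hs.col]
          constructor <;> simp
        · rw [hs.same i hia hib]
          constructor <;> simp
    obtain ⟨i', hi⟩ := key i
    obtain ⟨j', hj⟩ := key j
    have := hs.width i' j'
    rw [abs_le] at *
    push_cast
    omega
  · have hrow : ∀ i, (Function.update pos b (pos b + (-1, 0)) i).2 = (pos i).2 := by
      intro i
      by_cases hib : i = b
      · subst hib
        rw [Function.update_self, Prod.snd_add]
        simp
      · rw [Function.update_of_ne hib]
    rw [hrow, hrow]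
    exact_mod_cast hs.row h.ne i j
  · obtain ⟨h1, h2⟩ := hoff _ _ (by decide) (by decide) hi
    obtain ⟨h3, h4⟩ := hoff _ _ (by decide) (by decide) hj
    rw [hother h1 h2, hother h3 h4]
    have := hs.height i j
    push_cast
    omega
  · obtain ⟨h1, h2⟩ := hoff _ _ (by decide) (by decide) hi
    have hma : m = a := by
      by_contra hma
      by_cases hmb : m = b
      · rw [hmb, lights_right h.ne] at hm
        exact absurd hm (by decide)
      · rw [lights_other hma hmb] at hm
        exact absurd hm (by decide)
    subst hma
    rw [hother h1 h2, Function.update_of_ne h.ne, Function.update_self, Prod.snd_add]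
    have h3 := abs_le.1 (hs.height m i)
    have h4 := hs.up.1
    have h5 := h.below
    push_cast
    rcases Int.units_eq_one_or e with rfl | rfl <;>
      simp only [Units.val_neg, Units.val_one, neg_mul, one_mul] at h4 h5 <;> omega

/-- The column next to the two robots is not symmetric, and decides between them. -/
theorem completes_front (h : Pair pos a b X e) (hs : Spread base pos a b e D K) (hP : 1 < P.card)
    (hk : P.card = k) (hBt : ∀ p ∈ P, -(place P p).1 ≤ (D + 2 : ℕ) ∧ -(place P p).2 ≤ (D + 2 : ℕ))
    (hn : ¬ SymAbout (frontOf (others pos a b)) ((pos a).2 + (pos b).2)) :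
    Completes algorithm P orient (electedSteps k (D + 2) (D + 2 * K) + 6)
      (Cfg.quiet pos (lights a b wait wait)) := by
  have hfin : (frontOf (others pos a b)).Finite := finite_others.subset fun p hp => hp.1
  have main : ∀ {a b : Fin k} {e : ℤˣ}, Pair pos a b X e → Spread base pos a b e D K →
      ¬ SymAbout (frontOf (others pos a b)) ((pos a).2 + (pos b).2) →
      ¬ Wins e (frontOf (others pos a b)) ((pos a).2 + (pos b).2) →
      Wins (-e) (frontOf (others pos a b)) ((pos a).2 + (pos b).2) →
      Completes algorithm P orient (electedSteps k (D + 2) (D + 2 * K) + 6)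
        (Cfg.quiet pos (lights a b wait wait)) := by
    intro a b e h hs hn hw hw'
    refine h.completes_of_loser hs hP hk hBt (.inl rfl)
      (h.wait_lose hP (lights_left _ _) (lights_right h.ne _ _) hn hw) ?_ ?_
    · rw [others_swap, add_comm] at hn hw'
      exact h.symm.wait_win hP (lights_right h.ne _ _) (lights_left _ _) hn hw'
    · exact h.symm.wait_elected hP (lights_right h.ne _ _) (lights_left _ _)
  by_cases hw : Wins e (frontOf (others pos a b)) ((pos a).2 + (pos b).2)
  · rw [lights_swap h.ne]
    have hw' := (not_congr (wins_neg_iff (e := e) hfin hn)).2 (not_not.2 hw)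
    refine main h.symm hs.symm ?_ ?_ ?_
    · rwa [others_swap, add_comm]
    · rwa [others_swap, add_comm]
    · rwa [others_swap, add_comm, neg_neg]
  · exact main h hs hn hw ((wins_neg_iff hfin hn).2 hw)

/-- Both robots see everything, and the configuration is not symmetric. -/
theorem completes_asymmetric (h : Pair pos a b X e) (hs : Spread base pos a b e D K) (hP : 1 < P.card)
    (hk : P.card = k) (hBt : ∀ p ∈ P, -(place P p).1 ≤ (D + 2 : ℕ) ∧ -(place P p).2 ≤ (D + 2 : ℕ))
    (hc : Clear (pos a) (others pos a b)) (hc' : Clear (pos b) (others pos a b))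
    (hne : (others pos a b).Nonempty) (hf : SymAbout (frontOf (others pos a b)) c)
    (hn : ¬ SymAbout (others pos a b) c) :
    Completes algorithm P orient (electedSteps k (D + 2) (D + 2 * K) + 6)
      (Cfg.quiet pos (lights a b search search)) := by
  have main : ∀ {a b : Fin k} {e : ℤˣ}, Pair pos a b X e → Spread base pos a b e D K →
      Clear (pos a) (others pos a b) → Clear (pos b) (others pos a b) → (others pos a b).Nonempty →
      SymAbout (frontOf (others pos a b)) c → ¬ SymAbout (others pos a b) c →
      ¬ Wins e (others pos a b) c → Wins (-e) (others pos a b) c →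
      Completes algorithm P orient (electedSteps k (D + 2) (D + 2 * K) + 6)
        (Cfg.quiet pos (lights a b search search)) := by
    intro a b e h hs hc hc' hne hf hn hw hw'
    refine h.completes_of_loser hs hP hk hBt (.inr rfl)
      (h.search_lose hP hk (lights_left _ _) (lights_right h.ne _ _) hc hc' hne hf hn hw) ?_ ?_
    · rw [others_swap] at hc hc' hne hf hn hw'
      exact h.symm.search_win hP hk (lights_right h.ne _ _) (lights_left _ _) hc' hne hf hn hw'
    · rw [others_swap] at hc'
      rw [h.symm.search_elected hP hk (lights_right h.ne _ _) hc' (.inr (lights_left _ _)), lights_left,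
        if_neg (by decide)]
  by_cases hw : Wins e (others pos a b) c
  · rw [lights_swap h.ne]
    have hw' := (not_congr (wins_neg_iff (e := e) finite_others hn)).2 (not_not.2 hw)
    rw [others_swap] at hc hc' hne hf hn hw hw'
    exact main h.symm hs.symm hc' hc hne hf hn hw' (by rwa [neg_neg])
  · exact main h hs hc hc' hne hf hn hw ((wins_neg_iff finite_others hn).2 hw)

end Pair

end Apf

namespace Apf

variable {k : ℕ} {P : Finset GridPt} {orient : Fin k → ℤˣ} {base pos : Fin k → GridPt}
  {light : Fin k → Fin 8} {a b : Fin k} {X c : ℤ} {e : ℤˣ} {D K n : ℕ}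

/-! ### The search for a full view -/

/-- The positions of a robot climbing in its column. -/
def climb (e : ℤˣ) (p : GridPt) (m : ℕ) : GridPt := (p.1, p.2 + e * ((m - 1 : ℕ) : ℤ))

/-- The lights of a robot that starts to climb. -/
def climbLight (m : ℕ) : Fin 8 := if m = 0 then wait else search

theorem others_two {p q : GridPt} : others (two a b p q pos) a b = others pos a b := by
  ext x
  constructor
  · rintro ⟨j, h1, h2, rfl⟩
    exact ⟨j, h1, h2, by rw [two_other h1 h2]⟩
  · rintro ⟨j, h1, h2, rfl⟩
    exact ⟨j, h1, h2, by rw [two_other h1 h2]⟩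

/-- A lowest place from which, going upwards, everything is visible. -/
theorem exists_first_clear (h : Pair pos a b X e) (s : ℤˣ) (r : ℤ) :
    ∃ u ≤ k * k, Clear (X, r + s * (u : ℤ)) (others pos a b) ∧
      ∀ v < u, ¬ Clear (X, r + s * (v : ℤ)) (others pos a b) := by
  classical
  have hS : (((Finset.univ.filter fun j => j ≠ a ∧ j ≠ b).image pos : Finset GridPt) : Set GridPt) =
      others pos a b := by
    ext x
    simp [others, and_assoc]
  obtain ⟨u, hu, hc⟩ := exists_clear (S := (Finset.univ.filter fun j => j ≠ a ∧ j ≠ b).image pos)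
    (X := X) (by
      intro q hq
      obtain ⟨j, hj, rfl⟩ := Finset.mem_image.1 hq
      simp only [Finset.mem_filter, Finset.mem_univ, true_and] at hj
      exact h.right j hj.1 hj.2) r s
  rw [hS] at hc
  have hcard : ((Finset.univ.filter fun j => j ≠ a ∧ j ≠ b).image pos).card ≤ k :=
    Finset.card_image_le.trans ((Finset.card_le_univ _).trans (by simp))
  have hex : ∃ u : ℕ, Clear (X, r + s * (u : ℤ)) (others pos a b) := ⟨u, hc⟩
  refine ⟨Nat.find hex, (Nat.find_min' hex hc).trans (hu.trans (Nat.mul_le_mul hcard hcard)),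
    Nat.find_spec hex, fun v hv => Nat.find_min hex hv⟩

namespace Pair

theorem climbed (h : Pair pos a b X e) (m m' : ℕ) :
    Pair (two a b (climb e (pos a) m) (climb (-e) (pos b) m') pos) a b X e := by
  have hrow : (e : ℤ) * (climb (-e) (pos b) m').2 < e * (climb e (pos a) m).2 := by
    have h1 := h.below
    simp only [climb]
    generalize m - 1 = u
    generalize m' - 1 = u'
    rcases Int.units_eq_one_or e with rfl | rfl <;>
      simp only [Units.val_neg, Units.val_one, neg_mul, one_mul, neg_neg] at h1 ⊢ <;> omega
  refine ⟨two_injective h.inj ?_ ?_ ?_, ?_, ?_, ?_, ?_⟩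
  · intro e'
    rw [e'] at hrow
    omega
  · intro j hja hjb e'
    have h1 := h.right j hja hjb
    rw [e', ← h.left] at h1
    exact absurd h1 (lt_irrefl _)
  · intro j hja hjb e'
    have h1 := h.right j hja hjb
    rw [e', ← h.left'] at h1
    exact absurd h1 (lt_irrefl _)
  · rw [two_left]; exact h.left
  · rw [two_right h.ne]; exact h.left'
  · rw [two_left, two_right h.ne]; exact hrow
  · intro j hja hjb
    rw [two_other hja hjb]
    exact h.right j hja hjb

/-- What a climbing robot does at its `m`-th stop. -/
theorem act_at_climb (h : Pair pos a b X e) (hP : 1 < P.card) (hk : P.card = k)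
    (hf : SymAbout (frontOf (others pos a b)) ((pos a).2 + (pos b).2)) {u u' : ℕ}
    (hu : Clear (X, (pos a).2 + e * (u : ℤ)) (others pos a b))
    (hu' : ∀ v < u, ¬ Clear (X, (pos a).2 + e * (v : ℤ)) (others pos a b))
    (hw' : ∀ v < u', ¬ Clear (X, (pos b).2 + (-e : ℤˣ) * (v : ℤ)) (others pos a b))
    {m m' y : ℕ} (hm : m ≤ u + 1) (hm' : m' + y ≤ u' + 1) (hy : y ≤ 1)
    (hyp : y = 1 → climb (-e) (pos b) (m' + 1) ≠ climb (-e) (pos b) m')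
    (hfin : ¬ (m = u + 1 ∧ m' = u' + 1)) :
    m = u + 1 ∧ Rests algorithm P orient (two a b (climb e (pos a) m) (climb (-e) (pos b) m') pos)
      (lights a b (climbLight m) (climbLight (m' + y))) a ∨
    m < u + 1 ∧ outcome algorithm P orient (two a b (climb e (pos a) m) (climb (-e) (pos b) m') pos)
      (lights a b (climbLight m) (climbLight (m' + y))) a =
        (climbLight (m + 1), climb e (pos a) (m + 1) - climb e (pos a) m) := by
  have hC := h.climbed m m'
  have ho : others (two a b (climb e (pos a) m) (climb (-e) (pos b) m') pos) a b = others pos a b :=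
    others_two
  have hpa : two a b (climb e (pos a) m) (climb (-e) (pos b) m') pos a = climb e (pos a) m := two_left ..
  have hpb : two a b (climb e (pos a) m) (climb (-e) (pos b) m') pos b = climb (-e) (pos b) m' :=
    two_right h.ne ..
  have hla : lights a b (climbLight m) (climbLight (m' + y)) a = climbLight m := lights_left ..
  have hlb : lights a b (climbLight m) (climbLight (m' + y)) b = climbLight (m' + y) :=
    lights_right h.ne ..
  generalize two a b (climb e (pos a) m) (climb (-e) (pos b) m') pos = pos' at *
  generalize lights a b (climbLight m) (climbLight (m' + y)) = light' at *
  have hy0 : m' = 0 → y = 0 := by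
    rintro rfl
    by_contra hcon
    exact hyp (by omega) rfl
  have hlb' : light' b = if m' = 0 then wait else search := by
    rw [hlb, climbLight]
    by_cases h0 : m' = 0
    · rw [h0, hy0 h0, if_pos rfl]
    · rw [if_neg h0, if_neg (by omega)]
  by_cases hm0 : m = 0
  · subst hm0
    right
    refine ⟨by omega, ?_⟩
    have hz : climb e (pos a) (0 + 1) - climb e (pos a) 0 = 0 := sub_self _
    rw [hz]
    by_cases h0 : m' = 0
    · subst h0
      rw [if_pos rfl] at hlb'
      refine hC.wait_sym hP hla hlb' ?_
      have : (pos' a).2 + (pos' b).2 = (pos a).2 + (pos b).2 := by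
        rw [hpa, hpb]
        simp [climb]
      rw [ho, this]
      exact hf
    · rw [if_neg h0] at hlb'
      exact hC.wait_search hP hla hlb'
  have hla' : light' a = search := by rw [hla, climbLight, if_neg hm0]
  have hposa : pos' a = (X, (pos a).2 + e * ((m - 1 : ℕ) : ℤ)) := by rw [hpa, climb, h.left]
  rcases hm.lt_or_eq with hlt | heq
  · right
    refine ⟨hlt, ?_⟩
    rw [hC.search_climb hP hk hla' (by rw [ho, hposa]; exact hu' _ (by omega))]
    refine Prod.ext (by simp [climbLight]) ?_
    refine Prod.ext ?_ ?_
    · simp [climb]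
    · obtain ⟨v, rfl⟩ : ∃ v, m = v + 1 := ⟨m - 1, by omega⟩
      simp only [climb, Prod.snd_sub, Nat.add_sub_cancel]
      push_cast
      ring
  · left
    refine ⟨heq, hC.search_stay hP hk hla' ?_ ?_⟩
    · rw [ho, hposa, show m - 1 = u by omega]
      exact hu
    · by_cases h0 : m' = 0
      · rw [if_pos h0] at hlb'
        exact .inl hlb'
      · rw [if_neg h0] at hlb'
        refine .inr ⟨hlb', ?_⟩
        rw [ho, hpb, climb, h.left']
        exact hw' _ (by omega)

/-- Both robots climb until they see everything. -/
theorem completes_search (h : Pair pos a b X e) (hP : 1 < P.card) (hk : P.card = k)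
    (hf : SymAbout (frontOf (others pos a b)) ((pos a).2 + (pos b).2)) {u u' : ℕ}
    (hu : Clear (X, (pos a).2 + e * (u : ℤ)) (others pos a b))
    (hv : ∀ v < u, ¬ Clear (X, (pos a).2 + e * (v : ℤ)) (others pos a b))
    (hu' : Clear (X, (pos b).2 + (-e : ℤˣ) * (u' : ℤ)) (others pos a b))
    (hv' : ∀ v < u', ¬ Clear (X, (pos b).2 + (-e : ℤˣ) * (v : ℤ)) (others pos a b))
    (hend : Completes algorithm P orient n (Cfg.quiet
      (two a b (X, (pos a).2 + e * (u : ℤ)) (X, (pos b).2 + (-e : ℤˣ) * (u' : ℤ)) pos)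
      (lights a b search search))) :
    Completes algorithm P orient (n + (3 * (u + 1) + 3 * (u' + 1)))
      (Cfg.quiet pos (lights a b wait wait)) := by
  have hswap : ∀ m m', two a b (climb e (pos a) m) (climb (-e) (pos b) m') pos =
      two b a (climb (-e) (pos b) m') (climb (- -e) (pos a) m) pos := fun _ _ => by
    rw [neg_neg]; exact two_swap h.ne ..
  have hswap' : ∀ m m', lights a b (climbLight m) (climbLight m') =
      lights b a (climbLight m') (climbLight m) := fun _ _ => lights_swap h.ne ..
  have hA : ∀ {m m' y : ℕ}, m ≤ u + 1 → m' + y ≤ u' + 1 → y ≤ 1 → _ → _ → _ :=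
    fun {m m' y} => h.act_at_climb (orient := orient) hP hk hf hu hv hv' (m := m) (m' := m') (y := y)
  have hB : ∀ {m m' y : ℕ}, m ≤ u' + 1 → m' + y ≤ u + 1 → y ≤ 1 → _ → _ → _ :=
    fun {m m' y} => h.symm.act_at_climb (orient := orient) hP hk (by rwa [others_swap, add_comm])
      (by rwa [others_swap]) (by rwa [others_swap]) (by rwa [others_swap, neg_neg])
      (m := m) (m' := m') (y := y)
  have key := Completes.two_robots (A := algorithm) (P := P) (orient := orient) h.ne pos (fun _ => off)
    (climb e (pos a)) (climb (-e) (pos b)) climbLight climbLight (u + 1) (u' + 1) n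
    (fun m _ m' _ => (h.climbed m m').inj)
    (fun m m' y z hm hm' hy hz hpy hpz hfin i hia hib => ?_)
    (fun m m' y hm hm' hy hyp hfin => ?_) (fun m m' y hm hm' hy hyp hfin => ?_)
    (fun m hm m' hm' hfin => ?_) ?_
  · have h0 : two a b (climb e (pos a) 0) (climb (-e) (pos b) 0) pos = pos := by
      have : ∀ s : ℤˣ, ∀ p, climb s p 0 = p := fun s p => by simp [climb]
      rw [this, this, two_self]
    rw [h0] at key
    exact key
  · have hcl : ∀ m, climbLight m ≠ lead ∧ climbLight m ≠ elect := by
      intro m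
      rw [climbLight]
      split_ifs <;> decide
    exact (h.climbed m m').rests_others_lights hP (hcl _).1 (hcl _).1 (fun h' => (hcl _).2 h'.1) hia hib
  · exact (hA hm hm' hy hyp hfin).imp_left And.right
  · change Rests algorithm P orient _ (lights a b (climbLight (m + y)) (climbLight m')) b ∨
      m' < u' + 1 ∧ outcome algorithm P orient _ (lights a b (climbLight (m + y)) (climbLight m')) b = _
    rw [hswap, hswap']
    refine (hB hm' hm hy ?_ fun h' => hfin h'.symm).imp_left And.right
    rwa [neg_neg]
  · have hmove : ∀ {i : Fin k} {s : ℤˣ} {m : ℕ} {pos' : Fin k → GridPt} {light' : Fin k → Fin 8},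
        outcome algorithm P orient pos' light' i =
          (climbLight (m + 1), climb s (pos i) (m + 1) - climb s (pos i) m) →
        light' i = climbLight m → ¬ Rests algorithm P orient pos' light' i := by
      intro i s m pos' light' ho hl
      by_cases hm0 : m = 0
      · refine Rests.not_of_outcome ho (.inl ?_)
        rw [hl, hm0]
        decide
      · refine Rests.not_of_outcome ho (.inr fun h0 => ?_)
        have := congrArg Prod.snd h0
        obtain ⟨v, rfl⟩ : ∃ v, m = v + 1 := ⟨m - 1, by omega⟩
        simp only [climb, Prod.snd_sub, Nat.add_sub_cancel, Prod.snd_zero] at this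
        rcases Int.units_eq_one_or s with rfl | rfl <;>
          simp only [Units.val_neg, Units.val_one, neg_mul, one_mul] at this <;> omega
    change ¬ Rests algorithm P orient _ (lights a b (climbLight m) (climbLight m')) a ∨
      ¬ Rests algorithm P orient _ (lights a b (climbLight m) (climbLight m')) b
    rcases hA (y := 0) hm hm' (by omega) (by omega) hfin with ⟨hA1, -⟩ | ⟨hA1, hA2⟩
    · rcases hB (y := 0) hm' hm (by omega) (by omega) (fun h' => hfin h'.symm) with ⟨hB1, -⟩ | ⟨hB1, hB2⟩
      · exact absurd ⟨hA1, hB1⟩ hfin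
      · right
        rw [hswap, hswap']
        exact hmove hB2 (lights_left ..)
    · exact .inl (hmove hA2 (lights_left ..))
  · have h1 : ∀ (s : ℤˣ) (p : GridPt) (v : ℕ), p.1 = X → climb s p (v + 1) = (X, p.2 + s * (v : ℤ)) := by
      intro s p v hp
      simp [climb, hp]
    rw [h1 _ _ _ h.left, h1 _ _ _ h.left']
    exact hend

end Pair

end Apf

namespace Apf

variable {k : ℕ} {P : Finset GridPt} {orient : Fin k → ℤˣ} {base pos : Fin k → GridPt}
  {light : Fin k → Fin 8} {a b r : Fin k} {X c : ℤ} {e : ℤˣ} {D K n : ℕ}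

/-! ### A robot on the axis -/

/-- Both robots see everything, find a symmetry, and show the light `elect`. -/
theorem Pair.completes_symmetric (h : Pair pos a b X e) (hP : 1 < P.card) (hk : P.card = k)
    (hc : Clear (pos a) (others pos a b)) (hc' : Clear (pos b) (others pos a b))
    (hs : SymAbout (others pos a b) c)
    (hend : Completes algorithm P orient n (Cfg.quiet pos (lights a b elect elect))) :
    Completes algorithm P orient (n + 6) (Cfg.quiet pos (lights a b search search)) := by
  let l : ℕ → Fin 8 := fun m => if m = 0 then search else elect
  have main : ∀ {a b : Fin k} {e : ℤˣ}, Pair pos a b X e → Clear (pos a) (others pos a b) →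
      Clear (pos b) (others pos a b) → SymAbout (others pos a b) c → ∀ m m', m ≤ 1 → m' ≤ 1 →
      ¬ (m = 1 ∧ m' = 1) → m = 1 ∧ Rests algorithm P orient pos (lights a b (l m) (l m')) a ∨
        m < 1 ∧ outcome algorithm P orient pos (lights a b (l m) (l m')) a = (l (m + 1), 0) := by
    intro a b e h hc hc' hs m m' hm hm' hfin
    obtain rfl | rfl : m = 0 ∨ m = 1 := by omega
    · right
      refine ⟨by omega, ?_⟩
      obtain rfl | rfl : m' = 0 ∨ m' = 1 := by omega
      · exact h.search_sym hP hk (lights_left _ _) (lights_right h.ne _ _) hc hc' hs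
      · change outcome algorithm P orient pos (lights a b search elect) a = (elect, 0)
        rw [h.search_elected hP hk (lights_left _ _) hc (.inl (lights_right h.ne _ _)),
          lights_right h.ne]
        rfl
    · exact .inl ⟨rfl, h.rests_elect hP (lights_left _ _)⟩
  have hself : two a b (pos a) (pos b) pos = pos := two_self a b pos
  have hswap : ∀ m m', lights a b (l m) (l m') = lights b a (l m') (l m) := fun _ _ => lights_swap h.ne ..
  have hl1 : ∀ m, l m = search ∨ l m = elect := by
    intro m
    simp only [l]
    split_ifs <;> simp
  have hl : ∀ m, l m ≠ lead := by
    intro m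
    rcases hl1 m with h | h <;> rw [h] <;> decide
  have hA := main h hc hc' hs
  have hB := main h.symm (others_swap (pos := pos) ▸ hc') (others_swap (pos := pos) ▸ hc)
    (others_swap (pos := pos) ▸ hs)
  have key := Completes.two_robots (A := algorithm) (P := P) (orient := orient) h.ne pos (fun _ => off)
    (fun _ => pos a) (fun _ => pos b) l l 1 1 n
    (fun m _ m' _ => by rw [hself]; exact h.inj)
    (fun m m' y z hm hm' hy hz hpy hpz hfin i hia hib => ?_)
    (fun m m' y hm hm' hy hyp hfin => ?_) (fun m m' y hm hm' hy hyp hfin => ?_)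
    (fun m hm m' hm' hfin => ?_) ?_
  · rw [hself] at key
    exact key
  · obtain rfl : y = 0 := by
      by_contra h0
      exact hpy (by omega) rfl
    obtain rfl : z = 0 := by
      by_contra h0
      exact hpz (by omega) rfl
    rw [hself]
    refine h.rests_others_lights hP (hl _) (hl _) ?_ hia hib
    rintro ⟨h1, h2⟩
    simp only [l, add_zero] at h1 h2
    split_ifs at h1 h2 with h3 h4
    · exact absurd h1 (by decide)
    · exact absurd h1 (by decide)
    · exact absurd h2 (by decide)
    · exact hfin (by omega)
  · obtain rfl : y = 0 := by
      by_contra h0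
      exact hyp (by omega) rfl
    rw [hself, sub_self]
    exact (hA m m' hm hm' hfin).imp_left And.right
  · obtain rfl : y = 0 := by
      by_contra h0
      exact hyp (by omega) rfl
    rw [hself, sub_self]
    change Rests algorithm P orient pos (lights a b (l m) (l m')) b ∨
      m' < 1 ∧ outcome algorithm P orient pos (lights a b (l m) (l m')) b = _
    rw [hswap]
    exact (hB m' m hm' hm fun h' => hfin h'.symm).imp_left And.right
  · rw [hself]
    change ¬ Rests algorithm P orient pos (lights a b (l m) (l m')) a ∨
      ¬ Rests algorithm P orient pos (lights a b (l m) (l m')) b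
    have hmove : ∀ {i : Fin k} {m : ℕ} {light' : Fin k → Fin 8}, m < 1 →
        outcome algorithm P orient pos light' i = (l (m + 1), 0) → light' i = l m →
          ¬ Rests algorithm P orient pos light' i := by
      intro i m light' hm ho hl
      refine Rests.not_of_outcome ho (.inl ?_)
      obtain rfl : m = 0 := by omega
      rw [hl]
      decide
    rcases hA m m' hm hm' hfin with ⟨hA1, -⟩ | ⟨hA1, hA2⟩
    · rcases hB m' m hm' hm (fun h' => hfin h'.symm) with ⟨hB1, -⟩ | ⟨hB1, hB2⟩
      · exact absurd ⟨hA1, hB1⟩ hfin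
      · right
        rw [hswap]
        exact hmove hB1 hB2 (lights_left ..)
    · exact .inl (hmove hA1 hA2 (lights_left ..))
  · rw [hself]
    exact hend

/-- A robot is not on the axis if every two `elect` lights in one column that are symmetric with respect
to its row are accompanied by another visible `elect` light, or by a robot to the left in this row. -/
theorem not_onAxis (hinj : Function.Injective pos) {i : Fin k}
    (h : ∀ z w, z ≠ w → light z = elect → light w = elect → (pos z).1 = (pos w).1 →
      2 * (pos i).2 = (pos z).2 + (pos w).2 → (∃ l, (pos l).1 < (pos i).1 ∧ (pos l).2 = (pos i).2) ∨
        ∃ l, l ≠ i ∧ l ≠ z ∧ l ≠ w ∧ light l = elect ∧ Sees pos i l) (s : ℤˣ) :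
    ¬ OnAxis (snapshot pos light s i) := by
  rintro ⟨⟨x, y, hx, hy, h1, h2, hall⟩, hrow⟩
  obtain ⟨z, hzi, -, hz⟩ := mem_snapshot.1 h1
  obtain ⟨w, hwi, -, hw⟩ := mem_snapshot.1 h2
  rw [Prod.mk.injEq] at hz hw
  have hz1 := congrArg Prod.fst hz.1
  have hz2 := congrArg Prod.snd hz.1
  have hw1 := congrArg Prod.fst hw.1
  have hw2 := congrArg Prod.snd hw.1
  simp only [flipY_fst, flipY_snd, Prod.fst_sub, Prod.snd_sub] at hz1 hz2 hw1 hw2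
  have hzw : z ≠ w := by rintro rfl; omega
  have hsum : 2 * (pos i).2 = (pos z).2 + (pos w).2 := by
    rcases Int.units_eq_one_or s with rfl | rfl <;>
      simp only [Units.val_neg, Units.val_one, neg_mul, one_mul] at hz2 hw2 <;> omega
  rcases h z w hzw hz.2 hw.2 (by omega) hsum with ⟨l, hl1, hl2⟩ | ⟨l, hli, hlz, hlw, hle, hls⟩
  · have hli : i ≠ l := by rintro rfl; omega
    obtain ⟨v, hv, hsv, hv'⟩ := exists_sees_coords hinj hli
    have hcoord : (pos v).1 < (pos i).1 ∧ (pos v).2 = (pos i).2 := by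
      rcases hv' with rfl | hb
      · exact ⟨hl1, hl2⟩
      · have := sbtw_coords hb
        omega
    refine hrow _ (mem_snapshot_of_sees hv hsv) ?_ ?_
    · simp only [flipY_fst, Prod.fst_sub]; omega
    · simp only [flipY_snd, Prod.snd_sub, hcoord.2, sub_self, mul_zero]
  · rcases hall _ (mem_snapshot_of_sees hli hls) hle with h' | h'
    · exact hlz (hinj (sub_left_injective (flipY_injective s (h'.trans hz.1.symm))))
    · exact hlw (hinj (sub_left_injective (flipY_injective s (h'.trans hw.1.symm))))

/-- The robot `r` is the leftmost one on the axis of `a` and `b`, and on its way between them. The other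
robots see `a` and `b`, unless `r` hides them. -/
structure Centre (pos : Fin k → GridPt) (a b r : Fin k) (X : ℤ) (e : ℤˣ) : Prop where
  inj : Function.Injective pos
  ne : r ≠ a
  ne' : r ≠ b
  left : (pos a).1 = X
  left' : (pos b).1 = X
  below : (e : ℤ) * (pos b).2 < e * (pos a).2
  row : 2 * (pos r).2 = (pos a).2 + (pos b).2
  right : ∀ j, j ≠ a → j ≠ b → j ≠ r → X < (pos j).1
  start : X - 1 ≤ (pos r).1
  view : ∀ j, j ≠ a → j ≠ b → j ≠ r → ∀ l, l ≠ r → ∀ z, z = a ∨ z = b →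
    ¬ Sbtw ℝ (pos j).toPlane (pos l).toPlane (pos z).toPlane
  axis : ∀ j, j ≠ a → j ≠ b → j ≠ r → 2 * (pos j).2 = (pos a).2 + (pos b).2 → (pos r).1 < (pos j).1

namespace Centre

theorem hab (h : Centre pos a b r X e) : a ≠ b := by
  rintro rfl
  exact absurd h.below (by omega)

theorem symm (h : Centre pos a b r X e) : Centre pos b a r X (-e) := by
  refine ⟨h.inj, h.ne', h.ne, h.left', h.left, ?_, by rw [h.row, add_comm],
    fun j h1 h2 h3 => h.right j h2 h1 h3, h.start, fun j h1 h2 h3 l hl z hz => ?_,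
    fun j h1 h2 h3 h4 => h.axis j h2 h1 h3 (by rw [h4, add_comm])⟩
  · have := h.below
    simp only [Units.val_neg, neg_mul]
    omega
  · exact h.view j h2 h1 h3 l hl z hz.symm

/-- Somebody is seen in the direction of each of two robots of a column further left. -/
theorem exists_two_left (h : Centre pos a b r X e) {i : Fin k} (hi : X < (pos i).1) :
    ∃ z w, z ≠ w ∧ Sees pos i z ∧ (pos z).1 < (pos i).1 ∧ Sees pos i w ∧ (pos w).1 < (pos i).1 := by
  have hleft : ∀ {j z}, (pos j).1 = X → Toward pos i j z → (pos z).1 < (pos i).1 := by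
    intro j z hj hz
    rcases hz.coords h.inj with rfl | hb | rfl
    · omega
    · have := sbtw_coords hb
      omega
    · omega
  have hia : i ≠ a := by
    rintro rfl
    have := h.left
    omega
  have hib : i ≠ b := by
    rintro rfl
    have := h.left'
    omega
  obtain ⟨z, -, hz, hzt⟩ := exists_sees_toward (pos := pos) hia
  obtain ⟨w, -, hw, hwt⟩ := exists_sees_toward (pos := pos) hib
  refine ⟨z, w, ?_, hz, hleft h.left hzt, hw, hleft h.left' hwt⟩
  exact toward_ne_of_column h.inj h.hab (by rw [h.left, h.left']) (by rw [h.left]; omega) hzt hwt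

/-- The lights while the robot `r`, with light `l`, is on the axis of two searching robots `a` and `b`. -/
def AxisLights (light : Fin k → Fin 8) (a b r : Fin k) (l : Fin 8) : Prop :=
  light a = elect ∧ light b = elect ∧ light r = l ∧ ∀ j, j ≠ a → j ≠ b → j ≠ r → light j = off

theorem AxisLights.cases {l : Fin 8} (hl : AxisLights light a b r l) (j : Fin k) :
    light j = elect ∨ light j = l ∨ light j = off := by
  by_cases hja : j = a
  · rw [hja]; exact .inl hl.1
  by_cases hjb : j = b
  · rw [hjb]; exact .inl hl.2.1
  by_cases hjr : j = r
  · rw [hjr]; exact .inr (.inl hl.2.2.1)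
  · exact .inr (.inr (hl.2.2.2 j hja hjb hjr))

theorem not_onAxis (h : Centre pos a b r X e) {l : Fin 8} (hl : AxisLights light a b r l) {i : Fin k}
    (hia : i ≠ a) (hib : i ≠ b) (hir : i ≠ r) (s : ℤˣ) : ¬ OnAxis (snapshot pos light s i) := by
  have hel : ∀ j, light j = elect → j = a ∨ j = b ∨ j = r := by
    intro j hj
    by_contra hcon
    push Not at hcon
    rw [hl.2.2.2 j hcon.1 hcon.2.1 hcon.2.2] at hj
    exact absurd hj (by decide)
  have hi := h.right i hia hib hir
  -- the two robots `a` and `b` are visible, unless `r` is further to the right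
  have hsee : ∀ z, z = a ∨ z = b → (pos r).1 = X → Sees pos i z := by
    intro z hz hr l hlb
    by_cases hlr : l = r
    · have hc := sbtw_coords hlb
      have hzX : (pos z).1 = X := by
        rcases hz with rfl | rfl
        · exact h.left
        · exact h.left'
      rw [hlr] at hc
      omega
    · exact h.view i hia hib hir l hlr z hz hlb
  have hleft := h.left
  have hleft' := h.left'
  refine Apf.not_onAxis h.inj (fun z w hzw hz hw hcol hsum => ?_) s
  have haxis : 2 * (pos i).2 = (pos a).2 + (pos b).2 →
      ∃ l, (pos l).1 < (pos i).1 ∧ (pos l).2 = (pos i).2 := by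
    intro hs
    have := h.row
    exact ⟨r, h.axis i hia hib hir hs, by omega⟩
  rcases hel z hz with rfl | rfl | rfl <;> rcases hel w hw with rfl | rfl | rfl
  · exact absurd rfl hzw
  · exact .inl (haxis hsum)
  · exact .inr ⟨b, hib.symm, h.hab.symm, h.ne'.symm, hl.2.1, hsee b (.inr rfl) (by omega)⟩
  · exact .inl (haxis (by rw [hsum, add_comm]))
  · exact absurd rfl hzw
  · exact .inr ⟨a, hia.symm, h.hab, h.ne.symm, hl.1, hsee a (.inl rfl) (by omega)⟩
  · exact .inr ⟨b, hib.symm, h.ne'.symm, h.hab.symm, hl.2.1, hsee b (.inr rfl) (by omega)⟩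
  · exact .inr ⟨a, hia.symm, h.ne.symm, h.hab, hl.1, hsee a (.inl rfl) (by omega)⟩
  · exact absurd rfl hzw

theorem rests_elect (h : Centre pos a b r X e) (hP : 1 < P.card) (ha : light a = elect)
    (hr : X ≤ (pos r).1) : Rests algorithm P orient pos light a := by
  have hleft := h.left
  have hleft' := h.left'
  have hbel := h.below
  have hrow := h.row
  refine Apf.rests_elect hP ha (fun j hja => ?_) ?_ ⟨e, fun j hja hx => ?_⟩
  · by_cases hjb : j = b
    · rw [hjb]; omega
    by_cases hjr : j = r
    · rw [hjr]; omega
    · have := h.right j hja hjb hjr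
      omega
  · obtain ⟨z, hz, hsz, hz'⟩ := exists_sees_coords h.inj h.hab
    refine ⟨z, hz, hsz, ?_⟩
    rcases hz' with rfl | hb
    · omega
    · have := sbtw_coords hb
      omega
  · by_cases hjb : j = b
    · rw [hjb]; exact hbel
    by_cases hjr : j = r
    · rw [hjr]
      rcases Int.units_eq_one_or e with rfl | rfl <;>
        simp only [Units.val_neg, Units.val_one, neg_mul, one_mul] at hbel ⊢ <;> omega
    · have := h.right j hja hjb hjr
      omega

/-- While `r` is walking, all others rest. -/
theorem rests_others (h : Centre pos a b r X e) (hP : 1 < P.card) {l : Fin 8} (hlead : l ≠ lead)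
    (hl : AxisLights light a b r l) (hr : X ≤ (pos r).1) (i : Fin k) (hir : i ≠ r) :
    Rests algorithm P orient pos light i := by
  by_cases hia : i = a
  · rw [hia]; exact h.rests_elect hP hl.1 hr
  by_cases hib : i = b
  · rw [hib]; exact h.symm.rests_elect hP hl.2.1 hr
  obtain ⟨z, w, hzw, h1, h2, h3, h4⟩ := h.exists_two_left (h.right i hia hib hir)
  refine rests_off_of_two_left hP h.inj (hl.2.2.2 i hia hib hir) h1 h2 h3 h4 hzw
    (h.not_onAxis hl hia hib hir) fun j => ?_
  rcases AxisLights.cases hl j with h' | h' | h' <;> rw [h']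
  · decide
  · exact hlead
  · decide

/-- The robot `r` discovers that it is on the axis. -/
theorem outcome_start (h : Centre pos a b r X e) (hP : 1 < P.card) (hl : AxisLights light a b r off)
    (hr : X < (pos r).1) (hsa : Sees pos r a) (hsb : Sees pos r b) :
    outcome algorithm P orient pos light r = (elect, 0) := by
  have hleft := h.left
  have hleft' := h.left'
  have hbel := h.below
  have hrow := h.row
  refine outcome_of_both hP fun s => ?_
  have hma := mem_snapshot_of_sees (light := light) (e := s) h.ne.symm hsa
  have hmb := mem_snapshot_of_sees (light := light) (e := s) h.ne'.symm hsb
  rw [rule, if_pos hl.2.2.1, ruleOff, if_neg, if_neg, if_pos]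
  · constructor
    · have hxy : ∀ {z w : Fin k}, (pos z).1 = X → (pos w).1 = X → light z = elect → light w = elect →
          (∀ j, light j = elect → j = z ∨ j = w) → 2 * (pos r).2 = (pos z).2 + (pos w).2 →
          (flipY s (pos z - pos r), light z) ∈ snapshot pos light s r →
          (flipY s (pos w - pos r), light w) ∈ snapshot pos light s r →
          0 < (flipY s (pos z - pos r)).2 →
          ∃ x y : ℤ, x < 0 ∧ 0 < y ∧ ((x, y), elect) ∈ snapshot pos light s r ∧
            ((x, -y), elect) ∈ snapshot pos light s r ∧
              ∀ p ∈ snapshot pos light s r, p.2 = elect → p.1 = (x, y) ∨ p.1 = (x, -y) := by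
        intro z w hz hw hlz hlw hall hsum hmz hmw hpos
        have hww : flipY s (pos w - pos r) =
            ((flipY s (pos z - pos r)).1, -(flipY s (pos z - pos r)).2) := by
          refine Prod.ext ?_ ?_
          · simp only [flipY_fst, Prod.fst_sub]; omega
          · simp only [flipY_snd, Prod.snd_sub]
            rw [← mul_neg]
            congr 1
            omega
        refine ⟨(flipY s (pos z - pos r)).1, (flipY s (pos z - pos r)).2, ?_, hpos, ?_, ?_, ?_⟩
        · simp only [flipY_fst, Prod.fst_sub]; omega
        · rw [hlz] at hmz; exact hmz
        · rw [hlw, hww] at hmw; exact hmw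
        · rw [forall_mem_snapshot]
          intro j _ _ hj
          rcases hall j hj with rfl | rfl
          · exact .inl rfl
          · exact .inr hww
      have hel : ∀ j, light j = elect → j = a ∨ j = b := by
        intro j hj
        by_contra hcon
        push Not at hcon
        by_cases hjr : j = r
        · rw [hjr, hl.2.2.1] at hj
          exact absurd hj (by decide)
        · rw [hl.2.2.2 j hcon.1 hcon.2 hjr] at hj
          exact absurd hj (by decide)
      by_cases hside : 0 < (flipY s (pos a - pos r)).2
      · exact hxy hleft hleft' hl.1 hl.2.1 hel hrow hma hmb hside
      · refine hxy hleft' hleft hl.2.1 hl.1 (fun j hj => (hel j hj).symm) (by omega) hmb hma ?_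
        simp only [flipY_snd, Prod.snd_sub] at hside ⊢
        rcases Int.units_eq_one_or s with rfl | rfl <;> rcases Int.units_eq_one_or e with rfl | rfl <;>
          simp only [Units.val_neg, Units.val_one, neg_mul, one_mul] at hbel hside ⊢ <;> omega
    · rw [forall_mem_snapshot]
      intro j hjr _ hlt h0
      simp only [flipY_fst, flipY_snd, Prod.fst_sub, Prod.snd_sub] at hlt h0
      have hy : (pos j).2 = (pos r).2 := by
        rcases Int.units_eq_one_or s with rfl | rfl <;>
          simp only [Units.val_neg, Units.val_one, neg_mul, one_mul] at h0 <;> omega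
      have hne : (pos a).2 ≠ (pos b).2 := fun e' => by
        rw [e'] at hbel
        omega
      have := h.axis j (by rintro rfl; omega) (by rintro rfl; omega) hjr (by omega)
      omega
  · rintro ⟨⟨q, ⟨hq, -⟩, -⟩, -⟩
    obtain ⟨j, -, -, hj⟩ := mem_snapshot.1 hq
    have hj' : light j = wait := congrArg Prod.snd hj
    rcases AxisLights.cases hl j with h' | h' | h' <;> rw [h'] at hj' <;> exact absurd hj' (by decide)
  · intro hnl
    have := hnl _ hma
    simp only [flipY_fst, Prod.fst_sub] at this
    omega

/-- The robot on the axis walks to the left, also through the gap between `a` and `b`. -/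
theorem outcome_left (h : Centre pos a b r X e) (hP : 1 < P.card) (hl : light r = elect)
    (hr : X ≤ (pos r).1) : outcome algorithm P orient pos light r = (elect, (-1, 0)) := by
  have hleft := h.left
  have hleft' := h.left'
  have hbel := h.below
  have hrow := h.row
  refine outcome_of_both_left hP fun s => ?_
  rw [hl]
  change ruleElect _ = _
  rw [ruleElect]
  rcases hr.lt_or_eq with hlt | heq
  · obtain ⟨z, w, hzw, h1, h2, h3, h4⟩ := h.exists_two_left hlt
    rw [if_pos]
    refine ⟨_, mem_snapshot_of_sees (by rintro rfl; omega) h1, _,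
      mem_snapshot_of_sees (by rintro rfl; omega) h3, ?_, ?_, ?_⟩
    · intro e'
      exact hzw (h.inj (sub_left_injective (flipY_injective s (congrArg Prod.fst e'))))
    · simp only [flipY_fst, Prod.fst_sub]; omega
    · simp only [flipY_fst, Prod.fst_sub]; omega
  · have hnl : ∀ p ∈ snapshot pos light s r, ¬ p.1.1 < 0 := by
      rw [forall_mem_snapshot]
      intro j hjr _
      simp only [flipY_fst, Prod.fst_sub]
      by_cases hja : j = a
      · rw [hja]; omega
      by_cases hjb : j = b
      · rw [hjb]; omega
      · have := h.right j hja hjb hjr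
        omega
    have hcol : ∀ z, (pos z).1 = X → r ≠ z → ∃ v, v ≠ r ∧ Sees pos r v ∧ (pos v).1 = (pos r).1 ∧
        ((pos r).2 < (pos z).2 → (pos r).2 < (pos v).2) ∧
        ((pos z).2 < (pos r).2 → (pos v).2 < (pos r).2) := by
      intro z hz hrz
      obtain ⟨v, hv, hsv, hv'⟩ := exists_sees_coords h.inj hrz
      refine ⟨v, hv, hsv, ?_⟩
      rcases hv' with rfl | hb
      · omega
      · have := sbtw_coords hb
        omega
    obtain ⟨v, hv, hsv, hv0, hv1, hv2⟩ := hcol a hleft h.ne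
    obtain ⟨w, hw, hsw, hw0, hw1, hw2⟩ := hcol b hleft' h.ne'
    have hmv := mem_snapshot_of_sees (light := light) (e := s) hv hsv
    have hmw := mem_snapshot_of_sees (light := light) (e := s) hw hsw
    rw [if_neg, if_pos]
    · refine ⟨fun p hp => not_lt.1 (hnl p hp), ?_⟩
      rcases Int.units_eq_one_or s with rfl | rfl <;> rcases Int.units_eq_one_or e with rfl | rfl <;>
        simp only [Units.val_neg, Units.val_one, neg_mul, one_mul] at hbel
      · refine ⟨⟨_, hmv, ?_, ?_⟩, _, hmw, ?_, ?_⟩ <;>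
          simp only [flipY_fst, flipY_snd, Prod.fst_sub, Prod.snd_sub, Units.val_one] <;> omega
      · refine ⟨⟨_, hmw, ?_, ?_⟩, _, hmv, ?_, ?_⟩ <;>
          simp only [flipY_fst, flipY_snd, Prod.fst_sub, Prod.snd_sub, Units.val_one] <;> omega
      · refine ⟨⟨_, hmw, ?_, ?_⟩, _, hmv, ?_, ?_⟩ <;>
          simp only [flipY_fst, flipY_snd, Prod.fst_sub, Prod.snd_sub, Units.val_one, Units.val_neg] <;>
          omega
      · refine ⟨⟨_, hmv, ?_, ?_⟩, _, hmw, ?_, ?_⟩ <;>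
          simp only [flipY_fst, flipY_snd, Prod.fst_sub, Prod.snd_sub, Units.val_one, Units.val_neg] <;>
          omega
    · rintro ⟨p, hp, -, -, -, h0, -⟩
      exact hnl p hp h0

theorem move (h : Centre pos a b r X e) (hr : X ≤ (pos r).1) :
    Centre (Function.update pos r (pos r + (-1, 0))) a b r X e := by
  have hrow := h.row
  have hbel := h.below
  have hne : (pos a).2 ≠ (pos b).2 := fun e' => by
    rw [e'] at hbel
    omega
  have ha : Function.update pos r (pos r + (-1, 0)) a = pos a := Function.update_of_ne h.ne.symm _ _
  have hb : Function.update pos r (pos r + (-1, 0)) b = pos b := Function.update_of_ne h.ne'.symm _ _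
  have hj : ∀ {j}, j ≠ r → Function.update pos r (pos r + (-1, 0)) j = pos j :=
    fun hj => Function.update_of_ne hj _ _
  have hself : Function.update pos r (pos r + (-1, 0)) r = ((pos r).1 - 1, (pos r).2) := by
    rw [Function.update_self]
    refine Prod.ext ?_ ?_ <;> simp; rfl
  refine ⟨injective_update h.inj fun j hjr e' => ?_, h.ne, h.ne', by rw [ha, h.left], by rw [hb, h.left'],
    by rw [ha, hb]; exact hbel, by rw [ha, hb, hself]; exact hrow, fun j h1 h2 h3 => ?_, ?_,
    fun j h1 h2 h3 l hl z hz => ?_, fun j h1 h2 h3 h4 => ?_⟩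
  · have e1 := congrArg Prod.fst e'
    have e2 := congrArg Prod.snd e'
    simp only [Prod.fst_add, Prod.snd_add] at e1 e2
    have := h.axis j (by rintro rfl; omega) (by rintro rfl; omega) hjr (by omega)
    omega
  · rw [hj h3]; exact h.right j h1 h2 h3
  · rw [hself]
    simp only
    omega
  · have hzr : z ≠ r := by
      rcases hz with rfl | rfl
      · exact h.ne.symm
      · exact h.ne'.symm
    rw [hj h3, hj hl, hj hzr]
    exact h.view j h1 h2 h3 l hl z hz
  · rw [hj h3, ha, hb] at h4
    rw [hj h3, hself]
    have := h.axis j h1 h2 h3 h4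
    simp only
    omega

/-- The robot on the axis walks to the column on the left of `a` and `b`. -/
theorem completes_walk (hP : 1 < P.card) (hl : AxisLights light a b r elect) {y : ℤ} (N : ℕ) :
    ∀ {pos : Fin k → GridPt}, Centre pos a b r X e → (pos r).1 = X - 1 + N → (pos r).2 = y →
    (Centre (Function.update pos r (X - 1, y)) a b r X e →
      Completes algorithm P orient n (Cfg.quiet (Function.update pos r (X - 1, y)) light)) →
    Completes algorithm P orient (n + 3 * N) (Cfg.quiet pos light) := by
  induction N with
  | zero =>
    intro pos h hN hy hend
    have : (X - 1, y) = pos r := by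
      refine Prod.ext ?_ hy.symm
      simp only
      push_cast at hN
      omega
    rw [this, Function.update_eq_self] at hend
    exact hend h
  | succ N ih =>
    intro pos h hN hy hend
    push_cast at hN
    have hr : X ≤ (pos r).1 := by omega
    rw [show n + 3 * (N + 1) = n + 3 * N + 3 by ring]
    refine Completes.move_step h.inj (d := (-1, 0)) (by rw [h.outcome_left hP hl.2.2.1 hr, hl.2.2.1])
      (by decide) (h.rests_others hP (by decide) hl hr) ?_
    refine ih (h.move hr) ?_ ?_ ?_
    · rw [Function.update_self, Prod.fst_add]
      simp only
      omega
    · rw [Function.update_self, Prod.snd_add, hy]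
      simp
    · rw [Function.update_idem]
      exact hend

end Centre

end Apf

namespace Apf

variable {k : ℕ} {P : Finset GridPt} {orient : Fin k → ℤˣ} {pos : Fin k → GridPt}
  {light : Fin k → Fin 8} {a b r : Fin k} {X : ℤ} {e : ℤˣ} {n u : ℕ}

/-! ### The return of the two searching robots -/

/-- The robot `r` of the axis is alone in the column on the left of `a` and `b`, in a row between them. -/
structure Return (pos : Fin k → GridPt) (a b r : Fin k) (X : ℤ) (e : ℤˣ) : Prop where
  inj : Function.Injective pos
  left : (pos a).1 = X
  left' : (pos b).1 = X
  head : (pos r).1 = X - 1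
  above : (e : ℤ) * (pos r).2 < e * (pos a).2
  below : (e : ℤ) * (pos b).2 < e * (pos r).2
  right : ∀ j, j ≠ a → j ≠ b → j ≠ r → X < (pos j).1

/-- The lights while the robots `a` and `b` return from their search. -/
structure ReturnLights (light : Fin k → Fin 8) (a b r : Fin k) : Prop where
  head : light r = elect
  kind : light a = elect ∨ light a = step ∨ light a = off
  kind' : light b = elect ∨ light b = step ∨ light b = off
  other : ∀ j, j ≠ a → j ≠ b → j ≠ r → light j = off

theorem ReturnLights.cases (hl : ReturnLights light a b r) (j : Fin k) :
    light j = elect ∨ light j = step ∨ light j = off := by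
  by_cases hja : j = a
  · rw [hja]; exact hl.kind
  by_cases hjb : j = b
  · rw [hjb]; exact hl.kind'
  by_cases hjr : j = r
  · rw [hjr]; exact .inl hl.head
  · exact .inr (.inr (hl.other j hja hjb hjr))

theorem ReturnLights.not_wait (hl : ReturnLights light a b r) (j : Fin k) : light j ≠ wait := by
  rcases hl.cases j with h | h | h <;> rw [h] <;> decide

theorem ReturnLights.no_lead (hl : ReturnLights light a b r) (j : Fin k) : light j ≠ lead := by
  rcases hl.cases j with h | h | h <;> rw [h] <;> decide

theorem ReturnLights.elect_cases (hl : ReturnLights light a b r) {j : Fin k} (hj : light j = elect) :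
    j = a ∨ j = b ∨ j = r := by
  by_contra hcon
  push Not at hcon
  rw [hl.other j hcon.1 hcon.2.1 hcon.2.2] at hj
  exact absurd hj (by decide)

namespace Return

theorem symm (h : Return pos a b r X e) : Return pos b a r X (-e) := by
  have h1 := h.above
  have h2 := h.below
  refine ⟨h.inj, h.left', h.left, h.head, ?_, ?_, fun j h1 h2 => h.right j h2 h1⟩ <;>
    simp only [Units.val_neg, neg_mul] <;> omega

theorem ne (h : Return pos a b r X e) : a ≠ b := by
  rintro rfl
  have h1 := h.above
  have h2 := h.below
  omega

theorem head_ne (h : Return pos a b r X e) : r ≠ a := by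
  rintro rfl
  have h1 := h.head
  have h2 := h.left
  omega

/-- Only the robot `r` is to the left of the robot `a`. -/
theorem only_head (h : Return pos a b r X e) {j : Fin k} (hj : (pos j).1 < (pos a).1) : j = r := by
  have h1 := h.left
  by_contra hjr
  by_cases hja : j = a
  · subst hja; omega
  by_cases hjb : j = b
  · have := h.left'
    subst hjb; omega
  · have := h.right j hja hjb hjr
    omega

theorem sees_head (h : Return pos a b r X e) : Sees pos a r :=
  Ends.sees_of_adjacent (.inl (by rw [h.left, h.head]; omega))

theorem oneLeft (h : Return pos a b r X e) (hr : light r = elect) (s : ℤˣ) :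
    OneLeft (snapshot pos light s a) elect (flipY s (pos r - pos a)) := by
  have hmem := mem_snapshot_of_sees (light := light) (e := s) h.head_ne h.sees_head
  rw [hr] at hmem
  refine ⟨hmem, ?_, ?_⟩
  · simp only [flipY_fst, Prod.fst_sub, h.left, h.head]
    omega
  · rw [forall_mem_snapshot]
    intro j _ _ hlt
    simp only [flipY_fst, Prod.fst_sub] at hlt
    rw [h.only_head (j := j) (by omega), hr]

theorem oneLeft_unique {V : Snapshot 8} {l l' : Fin 8} {q q' : GridPt} (h : OneLeft V l q)
    (h' : OneLeft V l' q') : q = q' :=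
  congrArg Prod.fst (h'.2.2 _ h.1 h.2.1)

theorem not_noneLeft {V : Snapshot 8} {l : Fin 8} {q : GridPt} (h : OneLeft V l q) : ¬ NoneLeft V :=
  fun h' => absurd (h' _ h.1) (not_le.2 h.2.1)

theorem outcome_elect (h : Return pos a b r X e) (hP : 1 < P.card) (hr : light r = elect)
    (ha : light a = elect) : outcome algorithm P orient pos light a = (step, 0) := by
  refine outcome_of_both hP fun s => ?_
  have h1 := h.oneLeft hr s
  rw [ha]
  change ruleElect _ = _
  rw [ruleElect, if_neg, if_neg (fun h' => not_noneLeft h1 h'.1), if_pos ⟨_, h1⟩]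
  rintro ⟨p, hp, q, hq, hpq, hp0, hq0⟩
  exact hpq ((h1.2.2 p hp hp0).trans (h1.2.2 q hq hq0).symm)

theorem outcome_step (h : Return pos a b r X e) (hP : 1 < P.card) (hr : light r = elect)
    (ha : light a = step) {v : ℕ} (hv : (pos a).2 = (pos r).2 + e * ((v : ℤ) + 2)) :
    outcome algorithm P orient pos light a = (step, (0, -(e : ℤ))) := by
  have hy : ∀ s : ℤˣ, (flipY s (pos r - pos a)).2 = -(s * e * ((v : ℤ) + 2)) := by
    intro s
    simp only [flipY_snd, Prod.snd_sub, hv]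
    ring
  have h1 := h.oneLeft hr e
  have h2 := h.oneLeft hr (-e)
  have he : ((e : ℤˣ) : ℤ) * (e : ℤ) = 1 := by
    rcases Int.units_eq_one_or e with rfl | rfl <;> rfl
  rw [outcome_of_rule hP e (o := (step, .down))]
  · refine Prod.ext rfl (Prod.ext rfl ?_)
    simp [GridMove.disp]
  · rw [ha]
    change ruleStep _ = _
    have hlt : (flipY e (pos r - pos a)).2 < -1 := by
      rw [hy, he]
      omega
    rw [ruleStep, if_neg (not_noneLeft h1), if_pos ⟨_, h1, hlt⟩]
  · rw [ha]
    change ruleStep _ = _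
    have hy2 : (flipY (-e) (pos r - pos a)).2 = (v : ℤ) + 2 := by
      rw [hy, Units.val_neg, neg_mul, he]
      ring
    rw [ruleStep, if_neg (not_noneLeft h2), if_neg, if_neg]
    · rintro ⟨q, hq, hlt⟩
      rw [oneLeft_unique hq h2, hy2, abs_le] at hlt
      omega
    · rintro ⟨q, hq, hlt⟩
      rw [oneLeft_unique hq h2, hy2] at hlt
      omega

theorem outcome_last (h : Return pos a b r X e) (hP : 1 < P.card) (hr : light r = elect)
    (ha : light a = step) (hv : (pos a).2 = (pos r).2 + e) :
    outcome algorithm P orient pos light a = (off, 0) := by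
  refine outcome_of_both hP fun s => ?_
  have h1 := h.oneLeft hr s
  have hy : |(flipY s (pos r - pos a)).2| = 1 := by
    simp only [flipY_snd, Prod.snd_sub, hv]
    rcases Int.units_eq_one_or s with rfl | rfl <;> rcases Int.units_eq_one_or e with rfl | rfl <;> simp
  rw [ha]
  change ruleStep _ = _
  rw [ruleStep, if_neg (not_noneLeft h1), if_neg, if_pos ⟨_, h1, hy.le⟩]
  rintro ⟨q, hq, hlt⟩
  rw [oneLeft_unique hq h1] at hlt
  rw [abs_of_neg (by omega)] at hy
  omega

theorem not_onAxis (h : Return pos a b r X e) (hl : ReturnLights light a b r)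
    (haxis : light a = elect → light b = elect → 2 * (pos r).2 = (pos a).2 + (pos b).2) {i : Fin k}
    (hi : X ≤ (pos i).1) (s : ℤˣ) : ¬ OnAxis (snapshot pos light s i) := by
  have h1 := h.left
  have h2 := h.left'
  have h3 := h.head
  refine Apf.not_onAxis h.inj (fun z w hzw hz hw hcol hsum => .inl ⟨r, by omega, ?_⟩) s
  rcases hl.elect_cases hz with rfl | rfl | rfl <;> rcases hl.elect_cases hw with rfl | rfl | rfl
  · exact absurd rfl hzw
  · have := haxis hz hw
    omega
  · omega
  · have := haxis hw hz
    omega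
  · exact absurd rfl hzw
  · omega
  · omega
  · omega
  · exact absurd rfl hzw

/-- A robot that has returned waits to be called. -/
theorem rests_returned (h : Return pos a b r X e) (hP : 1 < P.card) (hl : ReturnLights light a b r)
    (ha : light a = off) : Rests algorithm P orient pos light a := by
  refine rests_of_none hP fun s => ?_
  rw [rule, if_pos ha]
  have h1 := h.oneLeft hl.head s
  refine ruleOff_eq_none ⟨_, h1.1, h1.2.1⟩ ?_
    (h.not_onAxis hl (fun h' => absurd (ha.symm.trans h') (by decide)) h.left.ge s)
    (not_called_of_no_lead hl.no_lead _ _)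
  rintro q ⟨hq, -⟩
  obtain ⟨j, -, -, hj⟩ := mem_snapshot.1 hq
  exact absurd (congrArg Prod.snd hj) (hl.not_wait j)

/-- The robot `r` waits until both robots have returned. -/
theorem rests_head (h : Return pos a b r X e) (hP : 1 < P.card) (hr : light r = elect)
    (ha : light a = elect ∨ light a = step) : Rests algorithm P orient pos light r := by
  refine rests_of_none hP fun s => ?_
  rw [hr]
  change ruleElect _ = none
  have h1 := h.left
  have h2 := h.left'
  have h3 := h.head
  have hpos : ∀ p ∈ snapshot pos light s r, 0 < p.1.1 := by
    rw [forall_mem_snapshot]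
    intro j hjr _
    simp only [flipY_fst, Prod.fst_sub]
    by_cases hja : j = a
    · rw [hja]; omega
    by_cases hjb : j = b
    · rw [hjb]; omega
    · have := h.right j hja hjb hjr
      omega
  rw [ruleElect, if_neg, if_neg, if_neg, if_neg]
  · rintro ⟨-, hall⟩
    have := hall _ (mem_snapshot_of_sees (light := light) (e := s) h.head_ne.symm
      (Ends.sees_of_adjacent (.inr (by omega))))
    exact ha.elim this.1 this.2
  · rintro ⟨q, hq, hlt, -⟩
    exact absurd (hpos _ hq) (not_lt.2 hlt.le)
  · rintro ⟨-, ⟨p, hp, h0, -⟩, -⟩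
    exact absurd (hpos p hp) (by omega)
  · rintro ⟨p, hp, -, -, -, h0, -⟩
    exact absurd (hpos p hp) (not_lt.2 h0.le)

theorem rests_others (h : Return pos a b r X e) (hP : 1 < P.card) (hl : ReturnLights light a b r)
    (haxis : light a = elect → light b = elect → 2 * (pos r).2 = (pos a).2 + (pos b).2) {i : Fin k}
    (hia : i ≠ a) (hib : i ≠ b) (hir : i ≠ r) : Rests algorithm P orient pos light i := by
  have hi := h.right i hia hib hir
  have hleft : ∀ {j z}, (pos j).1 = X → Toward pos i j z → (pos z).1 < (pos i).1 := by
    intro j z hj hz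
    rcases hz.coords h.inj with rfl | hb | rfl
    · omega
    · have := sbtw_coords hb
      omega
    · omega
  obtain ⟨z, -, hz, hzt⟩ := exists_sees_toward (pos := pos) hia
  obtain ⟨w, -, hw, hwt⟩ := exists_sees_toward (pos := pos) hib
  refine rests_off_of_two_left hP h.inj (hl.other i hia hib hir) hz (hleft h.left hzt) hw
    (hleft h.left' hwt) ?_ (h.not_onAxis hl haxis hi.le) hl.no_lead
  exact toward_ne_of_column h.inj h.ne (by rw [h.left, h.left']) (by rw [h.left]; omega) hzt hwt

/-- The positions of a robot that returns to the row next to the row `y`, from `u` rows away. -/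
def stops (X y : ℤ) (e : ℤˣ) (u m : ℕ) : GridPt := (X, y + e * (((u - 1 - (m - 1) : ℕ) : ℤ) + 1))

/-- The lights of a robot that returns. -/
def stopLights (u m : ℕ) : Fin 8 := if m = 0 then elect else if m ≤ u then step else off

theorem moved (h : Return pos a b r X e) (m m' : ℕ) :
    Return (two a b (stops X (pos r).2 e u m) (stops X (pos r).2 (-e) u m') pos) a b r X e := by
  have hrb : r ≠ b := h.symm.head_ne
  have hr := h.head
  have hrow : (e : ℤ) * (pos r).2 < e * (stops X (pos r).2 e u m).2 ∧
      (e : ℤ) * (stops X (pos r).2 (-e) u m').2 < e * (pos r).2 := by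
    simp only [stops]
    generalize u - 1 - (m - 1) = v
    generalize u - 1 - (m' - 1) = v'
    rcases Int.units_eq_one_or e with rfl | rfl <;>
      simp only [Units.val_neg, Units.val_one, neg_mul, one_mul, neg_neg] <;> omega
  refine ⟨two_injective h.inj ?_ ?_ ?_, ?_, ?_, ?_, ?_, ?_, ?_⟩
  · intro e'
    rw [e'] at hrow
    omega
  · intro j hja hjb e'
    by_cases hjr : j = r
    · subst hjr
      have := congrArg Prod.fst e'
      simp only [stops] at this
      omega
    · have := h.right j hja hjb hjr
      rw [e'] at this
      exact absurd this (lt_irrefl _)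
  · intro j hja hjb e'
    by_cases hjr : j = r
    · subst hjr
      have := congrArg Prod.fst e'
      simp only [stops] at this
      omega
    · have := h.right j hja hjb hjr
      rw [e'] at this
      exact absurd this (lt_irrefl _)
  · rw [two_left]; rfl
  · rw [two_right h.ne]; rfl
  · rw [two_other h.head_ne hrb]; exact hr
  · rw [two_left, two_other h.head_ne hrb]; exact hrow.1
  · rw [two_right h.ne, two_other h.head_ne hrb]; exact hrow.2
  · intro j hja hjb hjr
    rw [two_other hja hjb]
    exact h.right j hja hjb hjr

theorem returnLights (h : Return pos a b r X e) (m m' : ℕ) :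
    ReturnLights (two a b (stopLights u m) (stopLights u m') (Function.update (fun _ => off) r elect))
      a b r := by
  have hs : ∀ m, stopLights u m = elect ∨ stopLights u m = step ∨ stopLights u m = off := by
    intro m
    rw [stopLights]
    split_ifs <;> simp
  refine ⟨?_, ?_, ?_, fun j hja hjb hjr => ?_⟩
  · rw [two_other h.head_ne h.symm.head_ne, Function.update_self]
  · rw [two_left]; exact hs m
  · rw [two_right h.ne]; exact hs m'
  · rw [two_other hja hjb, Function.update_of_ne hjr]

/-- What a returning robot does at its `m`-th stop. -/
theorem act_at_halt (h : Return pos a b r X e) (hP : 1 < P.card) (hu : 0 < u) {m m' y : ℕ}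
    (hm : m ≤ u + 1) :
    m = u + 1 ∧ Rests algorithm P orient
      (two a b (stops X (pos r).2 e u m) (stops X (pos r).2 (-e) u m') pos)
      (two a b (stopLights u m) (stopLights u (m' + y)) (Function.update (fun _ => off) r elect)) a ∨
    m < u + 1 ∧ outcome algorithm P orient
      (two a b (stops X (pos r).2 e u m) (stops X (pos r).2 (-e) u m') pos)
      (two a b (stopLights u m) (stopLights u (m' + y)) (Function.update (fun _ => off) r elect)) a =
        (stopLights u (m + 1), stops X (pos r).2 e u (m + 1) - stops X (pos r).2 e u m) := by
  have hR := h.moved (u := u) m m'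
  have hl := h.returnLights (u := u) m (m' + y)
  have hpa : two a b (stops X (pos r).2 e u m) (stops X (pos r).2 (-e) u m') pos a =
    stops X (pos r).2 e u m := two_left ..
  have hpr : two a b (stops X (pos r).2 e u m) (stops X (pos r).2 (-e) u m') pos r = pos r :=
    two_other h.head_ne h.symm.head_ne ..
  have hla : two a b (stopLights u m) (stopLights u (m' + y))
    (Function.update (fun _ => off) r elect) a = stopLights u m := two_left ..
  generalize two a b (stops X (pos r).2 e u m) (stops X (pos r).2 (-e) u m') pos = pos' at *
  generalize two a b (stopLights u m) (stopLights u (m' + y))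
    (Function.update (fun _ => off) r elect) = light' at *
  rcases hm.lt_or_eq with hlt | rfl
  · right
    refine ⟨hlt, ?_⟩
    by_cases hm0 : m = 0
    · subst hm0
      rw [hR.outcome_elect hP hl.head hla]
      refine Prod.ext ?_ ?_
      · simp only [stopLights]
        rw [if_neg (by omega), if_pos (by omega)]
      · exact (sub_self _).symm
    · have hst : light' a = step := by rw [hla, stopLights, if_neg hm0, if_pos (by omega)]
      by_cases hmu : m = u
      · subst hmu
        rw [hR.outcome_last hP hl.head hst]
        · refine Prod.ext ?_ ?_
          · simp only [stopLights]
            rw [if_neg (by omega), if_neg (by omega)]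
          · simp only [stops]
            rw [show m - 1 - (m + 1 - 1) = m - 1 - (m - 1) by omega]
            exact (sub_self _).symm
        · rw [hpa, hpr, stops]
          simp
      · obtain ⟨v, hv⟩ : ∃ v, u = m + 1 + v := ⟨u - m - 1, by omega⟩
        rw [hR.outcome_step hP hl.head hst (v := v)]
        · refine Prod.ext ?_ (Prod.ext ?_ ?_)
          · simp only [stopLights]
            rw [if_neg (by omega), if_pos (by omega)]
          · simp [stops]
          · simp only [stops, Prod.snd_sub]
            rw [show u - 1 - (m + 1 - 1) = v by omega, show u - 1 - (m - 1) = v + 1 by omega]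
            push_cast
            ring
        · rw [hpa, hpr, stops, show u - 1 - (m - 1) = v + 1 by omega]
          push_cast
          ring
  · left
    refine ⟨rfl, hR.rests_returned hP hl ?_⟩
    rw [hla, stopLights, if_neg (by omega), if_neg (by omega)]

/-- Both robots return to the rows next to the row of `r`. -/
theorem completes (h : Return pos a b r X e) (hP : 1 < P.card) (hu : 0 < u)
    (ha : (pos a).2 = (pos r).2 + e * (u : ℤ)) (hb : (pos b).2 = (pos r).2 - e * (u : ℤ))
    (hend : Completes algorithm P orient n (Cfg.quiet
      (two a b (X, (pos r).2 + e) (X, (pos r).2 - e) pos) (Function.update (fun _ => off) r elect))) :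
    Completes algorithm P orient (n + (3 * (u + 1) + 3 * (u + 1)))
      (Cfg.quiet pos (two a b elect elect (Function.update (fun _ => off) r elect))) := by
  have hrb : r ≠ b := h.symm.head_ne
  have hswap : ∀ m m', two a b (stops X (pos r).2 e u m) (stops X (pos r).2 (-e) u m') pos =
      two b a (stops X (pos r).2 (-e) u m') (stops X (pos r).2 (- -e) u m) pos := fun _ _ => by
    rw [neg_neg]; exact two_swap h.ne ..
  have hswap' : ∀ m m', two a b (stopLights u m) (stopLights u m')
      (Function.update (fun _ => off) r elect) = two b a (stopLights u m') (stopLights u m)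
        (Function.update (fun _ => off) r elect) := fun _ _ => two_swap h.ne ..
  -- the light tells how many stops were made
  have hlit : ∀ {s : ℤˣ} {m y : ℕ}, m + y ≤ u + 1 → y ≤ 1 → (y = 1 → stops X (pos r).2 s u (m + 1) ≠
      stops X (pos r).2 s u m) → (stopLights u (m + y) = elect → m = 0 ∧ y = 0) ∧
        (m ≠ u + 1 → stopLights u (m + y) = elect ∨ stopLights u (m + y) = step) := by
    intro s m y hm hy hyp
    have h0 : y = 1 → m ≠ 0 ∧ m ≠ u := by
      intro hy1
      refine ⟨fun h0 => hyp hy1 ?_, fun h0 => hyp hy1 ?_⟩ <;> simp only [stops]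
      · rw [show u - 1 - (m + 1 - 1) = u - 1 - (m - 1) by omega]
      · rw [show u - 1 - (m + 1 - 1) = u - 1 - (m - 1) by omega]
    simp only [stopLights]
    constructor
    · intro hel
      split_ifs at hel with h1 h2
      · omega
      · exact absurd hel (by decide)
      · exact absurd hel (by decide)
    · intro hmu
      split_ifs with h1 h2
      · exact .inl rfl
      · exact .inr rfl
      · omega
  have key := Completes.two_robots (A := algorithm) (P := P) (orient := orient) h.ne pos
    (Function.update (fun _ => off) r elect)
    (stops X (pos r).2 e u) (stops X (pos r).2 (-e) u) (stopLights u) (stopLights u) (u + 1) (u + 1) n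
    (fun m _ m' _ => (h.moved m m').inj)
    (fun m m' y z hm hm' hy hz hpy hpz hfin i hia hib => ?_)
    (fun m m' y hm hm' hy hyp hfin => ?_) (fun m m' y hm hm' hy hyp hfin => ?_)
    (fun m hm m' hm' hfin => ?_) ?_
  · have h0 : two a b (stops X (pos r).2 e u 0) (stops X (pos r).2 (-e) u 0) pos = pos := by
      have hsa : stops X (pos r).2 e u 0 = pos a := by
        refine Prod.ext h.left.symm ?_
        rw [ha, stops]
        simp only
        congr 2
        omega
      have hsb : stops X (pos r).2 (-e) u 0 = pos b := by
        refine Prod.ext h.left'.symm ?_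
        rw [hb, stops, sub_eq_add_neg, ← neg_mul, Units.val_neg]
        simp only
        congr 2
        omega
      rw [hsa, hsb, two_self]
    rw [h0] at key
    exact key
  · have hR := h.moved (u := u) m m'
    have hl := h.returnLights (u := u) (m + y) (m' + z)
    have h1 := hlit hm hy hpy
    have h2 := hlit hm' hz hpz
    by_cases hir : i = r
    · subst hir
      by_cases hmu : m = u + 1
      · refine hR.symm.rests_head hP hl.head ?_
        rw [two_right h.ne]
        exact h2.2 fun h' => hfin ⟨hmu, h'⟩
      · refine hR.rests_head hP hl.head ?_
        rw [two_left]
        exact h1.2 hmu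
    · refine hR.rests_others hP hl ?_ hia hib hir
      rw [two_left, two_right h.ne, two_left, two_right h.ne, two_other h.head_ne hrb]
      intro h3 h4
      rw [(h1.1 h3).1, (h2.1 h4).1]
      simp only [stops, Units.val_neg]
      ring
  · exact (h.act_at_halt hP hu hm).imp_left And.right
  · rw [hswap, hswap']
    exact (h.symm.act_at_halt hP hu hm').imp_left And.right
  · have hmove : ∀ {i : Fin k} {s : ℤˣ} {m : ℕ} {pos' : Fin k → GridPt} {light' : Fin k → Fin 8},
        outcome algorithm P orient pos' light' i =
          (stopLights u (m + 1), stops X (pos r).2 s u (m + 1) - stops X (pos r).2 s u m) →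
        m < u + 1 → light' i = stopLights u m → ¬ Rests algorithm P orient pos' light' i := by
      intro i s m pos' light' ho hm hl
      by_cases hm0 : m = 0 ∨ m = u
      · refine Rests.not_of_outcome ho (.inl ?_)
        rw [hl]
        simp only [stopLights]
        rcases hm0 with rfl | rfl
        · rw [if_neg (by omega), if_pos (by omega), if_pos rfl]
          decide
        · rw [if_neg (by omega), if_neg (by omega), if_neg (by omega), if_pos le_rfl]
          decide
      · refine Rests.not_of_outcome ho (.inr fun h0 => ?_)
        have := congrArg Prod.snd h0
        simp only [stops, Prod.snd_sub, Prod.snd_zero] at this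
        obtain ⟨v, hv⟩ : ∃ v, u = m + 1 + v := ⟨u - m - 1, by omega⟩
        rw [show u - 1 - (m + 1 - 1) = v by omega, show u - 1 - (m - 1) = v + 1 by omega] at this
        rcases Int.units_eq_one_or s with rfl | rfl <;>
          simp only [Units.val_neg, Units.val_one, neg_mul, one_mul] at this <;> omega
    have hA := h.act_at_halt (orient := orient) hP hu (m' := m') (y := 0) hm
    have hB := h.symm.act_at_halt (orient := orient) hP hu (m' := m) (y := 0) hm'
    rcases hA with ⟨hA1, -⟩ | ⟨hA1, hA2⟩
    · rcases hB with ⟨hB1, -⟩ | ⟨hB1, hB2⟩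
      · exact absurd ⟨hA1, hB1⟩ hfin
      · right
        rw [hswap, hswap']
        exact hmove hB2 hB1 (two_left ..)
    · exact .inl (hmove hA2 hA1 (two_left ..))
  · have h1 : ∀ s, stops X (pos r).2 s u (u + 1) = (X, (pos r).2 + s) := by
      intro s
      rw [stops, show u - 1 - (u + 1 - 1) = 0 by omega]
      simp
    have h2 : stopLights u (u + 1) = off := by
      rw [stopLights, if_neg (by omega), if_neg (by omega)]
    have h3 : two a b off off (Function.update (fun _ => off) r elect) =
        Function.update (fun _ => off) r elect := by
      have := two_self a b (Function.update (fun _ => off) r elect)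
      rwa [Function.update_of_ne h.head_ne.symm, Function.update_of_ne hrb.symm] at this
    rw [h1, h1, h2, h3, Units.val_neg, ← sub_eq_add_neg]
    exact hend

end Return

end Apf

namespace Apf

variable {k : ℕ} {P : Finset GridPt} {orient : Fin k → ℤˣ} {base pos : Fin k → GridPt}
  {light : Fin k → Fin 8} {a b r : Fin k} {X c : ℤ} {e : ℤˣ} {D K n : ℕ}

/-! ### From two waiting robots to the pattern -/

theorem Return.elected (h : Return pos a b r X e) :
    Elected (two a b (X, (pos r).2 + e) (X, (pos r).2 - e) pos) (Function.update (fun _ => off) r elect)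
      r := by
  have hm := h.moved (u := 0) 0 0
  have h1 : ∀ s : ℤˣ, stops X (pos r).2 s 0 0 = (X, (pos r).2 + s) := fun s => by simp [stops]
  rw [h1, h1, Units.val_neg, ← sub_eq_add_neg] at hm
  have h2 := hm.left
  have h3 := hm.left'
  have h4 := hm.head
  refine ⟨hm.inj, Function.update_self _ _ _, fun j hjr => ?_, fun j hjr => .inl ?_, fun m hm => ?_⟩
  · by_cases hja : j = a
    · rw [hja]; omega
    by_cases hjb : j = b
    · rw [hjb]; omega
    · have := hm.right j hja hjb hjr
      omega
  · rw [Function.update_of_ne hjr]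
  · by_cases hmr : m = r
    · rw [hmr, Function.update_self] at hm
      exact absurd hm (by decide)
    · rw [Function.update_of_ne hmr] at hm
      exact absurd hm (by decide)

theorem update_lights (hra : r ≠ a) (hrb : r ≠ b) (l l' l'' : Fin 8) :
    Function.update (lights a b l l') r l'' = two a b l l' (Function.update (fun _ => off) r l'') := by
  funext j
  by_cases hjr : j = r
  · subst hjr
    rw [Function.update_self, two_other hra hrb, Function.update_self]
  rw [Function.update_of_ne hjr]
  by_cases hja : j = a
  · subst hja
    rw [lights_left, two_left]
  by_cases hjb : j = b
  · subst hjb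
    rw [lights_right (Ne.symm hja), two_right (Ne.symm hja)]
  · rw [lights_other hja hjb, two_other hja hjb, Function.update_of_ne hjr]

/-- The robot on the axis takes the lead, and the two searching robots return. -/
theorem Centre.completes (h : Centre pos a b r X e) (hs : Spread base pos a b e D K) (hP : 1 < P.card)
    (hk : P.card = k) (hBt : ∀ p ∈ P, -(place P p).1 ≤ (D + 2 : ℕ) ∧ -(place P p).2 ≤ (D + 2 : ℕ))
    (hr : X < (pos r).1) (hsa : Sees pos r a) (hsb : Sees pos r b)
    (hbase : (e : ℤ) * (base b).2 < e * (base a).2)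
    (hmid : 2 * (pos r).2 = (base a).2 + (base b).2) :
    Completes algorithm P orient
      (electedSteps k (D + 2) (D + 2 * K) + (6 * (D + K + 1) + 3 * (D + 2) + 3))
      (Cfg.quiet pos (lights a b elect elect)) := by
  have hab := h.hab
  have hAL : AxisLights (lights a b elect elect) a b r off :=
    ⟨lights_left _ _, lights_right hab _ _, lights_other h.ne h.ne' _ _,
      fun j h1 h2 _ => lights_other h1 h2 _ _⟩
  have hAL' : AxisLights (two a b elect elect (Function.update (fun _ => off) r elect)) a b r elect :=
    ⟨two_left .., two_right hab .., by rw [two_other h.ne h.ne', Function.update_self],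
      fun j h1 h2 h3 => by rw [two_other h1 h2, Function.update_of_ne h3]⟩
  have hleft := h.left
  have hleft' := h.left'
  have hrow := h.row
  have hbelow := h.below
  have hup := hs.up
  have hdown := hs.down
  have hcol := hs.col
  have hcol' := hs.col'
  have hpr := hs.same r h.ne h.ne'
  have hwr := abs_le.1 (hs.width r a)
  have hhr := abs_le.1 (hs.height r a)
  rw [← hpr] at hwr hhr
  -- the number of rows by which the searching robots are away from the axis
  obtain ⟨u, hu⟩ : ∃ u : ℕ, (u : ℤ) = e * ((pos a).2 - (pos r).2) := by
    refine ⟨_, Int.toNat_of_nonneg ?_⟩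
    rcases Int.units_eq_one_or e with rfl | rfl <;>
      simp only [Units.val_neg, Units.val_one, neg_mul, one_mul] at * <;> omega
  have hu1 : 0 < u := by
    rcases Int.units_eq_one_or e with rfl | rfl <;>
      simp only [Units.val_neg, Units.val_one, neg_mul, one_mul] at * <;> omega
  have huD : u ≤ D + K := by
    rcases Int.units_eq_one_or e with rfl | rfl <;>
      simp only [Units.val_neg, Units.val_one, neg_mul, one_mul] at * <;> omega
  have hua : (pos a).2 = (pos r).2 + e * (u : ℤ) ∧ (pos b).2 = (pos r).2 - e * (u : ℤ) := by
    rcases Int.units_eq_one_or e with rfl | rfl <;>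
      simp only [Units.val_neg, Units.val_one, neg_mul, one_mul] at * <;> omega
  obtain ⟨N, hN⟩ : ∃ N : ℕ, (pos r).1 = X - 1 + N := ⟨((pos r).1 - (X - 1)).toNat, by omega⟩
  refine Completes.mono (n := electedSteps k (D + 2) (D + 2 * K) + (3 * (u + 1) + 3 * (u + 1)) + 3 * N + 3)
    ?_ (by omega)
  refine Completes.light_step h.inj (h.outcome_start hP hAL hr hsa hsb) ?_
    (h.rests_others hP (by decide) hAL hr.le) ?_
  · rw [hAL.2.2.1]; decide
  rw [update_lights h.ne h.ne']
  refine Centre.completes_walk hP hAL' N h hN rfl fun hC => ?_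
  have hR : Return (Function.update pos r (X - 1, (pos r).2)) a b r X e := by
    refine ⟨hC.inj, hC.left, hC.left', by rw [Function.update_self], ?_, ?_, hC.right⟩ <;>
      rw [Function.update_self, Function.update_of_ne (by first | exact h.ne.symm | exact h.ne'.symm)] <;>
      rcases Int.units_eq_one_or e with rfl | rfl <;>
      simp only [Units.val_neg, Units.val_one, neg_mul, one_mul] at hbelow ⊢ <;> omega
  refine hR.completes hP hu1 ?_ ?_ ?_
  · rw [Function.update_self, Function.update_of_ne h.ne.symm]; exact hua.1
  · rw [Function.update_self, Function.update_of_ne h.ne'.symm]; exact hua.2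
  have hE := hR.elected
  rw [Function.update_self] at hE ⊢
  -- no robot is outside the rows and columns of the initial configuration, except for two columns
  have hx : ∀ i, X - 1 ≤ (two a b (X, (pos r).2 + (e : ℤ)) (X, (pos r).2 - (e : ℤ))
      (Function.update pos r (X - 1, (pos r).2)) i).1 ∧
      (two a b (X, (pos r).2 + (e : ℤ)) (X, (pos r).2 - (e : ℤ))
        (Function.update pos r (X - 1, (pos r).2)) i).1 ≤ X + 1 + D := by
    intro i
    by_cases hia : i = a
    · rw [hia, two_left]; constructor <;> simp only <;> omega
    by_cases hib : i = b
    · rw [hib, two_right hab]; constructor <;> simp only <;> omega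
    rw [two_other hia hib]
    by_cases hir : i = r
    · rw [hir, Function.update_self]; constructor <;> simp only <;> omega
    · rw [Function.update_of_ne hir]
      have h1 := h.right i hia hib hir
      have h2 := abs_le.1 (hs.width i a)
      rw [← hs.same i hia hib] at h2
      omega
  have hy : ∀ i, ∃ j j', (base j).2 ≤ (two a b (X, (pos r).2 + (e : ℤ)) (X, (pos r).2 - (e : ℤ))
      (Function.update pos r (X - 1, (pos r).2)) i).2 ∧
      (two a b (X, (pos r).2 + (e : ℤ)) (X, (pos r).2 - (e : ℤ))
        (Function.update pos r (X - 1, (pos r).2)) i).2 ≤ (base j').2 := by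
    obtain ⟨j, j', h1, h2⟩ : ∃ j j', (base j).2 < (pos r).2 ∧ (pos r).2 < (base j').2 := by
      rcases Int.units_eq_one_or e with rfl | rfl <;>
        simp only [Units.val_neg, Units.val_one, neg_mul, one_mul] at hbase
      · exact ⟨b, a, by omega, by omega⟩
      · exact ⟨a, b, by omega, by omega⟩
    have hnear : ∀ y : ℤ, |y - (pos r).2| ≤ 1 → ∃ j j', (base j).2 ≤ y ∧ y ≤ (base j').2 := by
      intro y hy
      rw [abs_le] at hy
      exact ⟨j, j', by omega, by omega⟩
    have he : |(e : ℤ)| ≤ 1 := by rcases Int.units_eq_one_or e with rfl | rfl <;> simp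
    intro i
    by_cases hia : i = a
    · rw [hia, two_left]
      exact hnear _ (by simpa using he)
    by_cases hib : i = b
    · rw [hib, two_right hab]
      exact hnear _ (by simpa using he)
    rw [two_other hia hib]
    by_cases hir : i = r
    · rw [hir, Function.update_self]
      exact hnear _ (by simp)
    · rw [Function.update_of_ne hir, hs.same i hia hib]
      exact ⟨i, i, le_rfl, le_rfl⟩
  have hL : ∀ i j, |(two a b (X, (pos r).2 + (e : ℤ)) (X, (pos r).2 - (e : ℤ))
      (Function.update pos r (X - 1, (pos r).2)) i).2 -
      (two a b (X, (pos r).2 + (e : ℤ)) (X, (pos r).2 - (e : ℤ))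
        (Function.update pos r (X - 1, (pos r).2)) j).2| ≤ D := by
    intro i j
    obtain ⟨i1, i2, hi1, hi2⟩ := hy i
    obtain ⟨j1, j2, hj1, hj2⟩ := hy j
    have h1 := abs_le.1 (hs.height i2 j1)
    have h2 := abs_le.1 (hs.height j2 i1)
    rw [abs_le]
    omega
  refine hE.completes hP hk (fun i j => ?_) (fun i j => ?_) (fun i j _ _ => ?_) (fun m i hm => ?_) hBt
  · have h1 := hx i
    have h2 := hx j
    rw [abs_le]
    push_cast
    omega
  · refine (hL i j).trans ?_
    push_cast
    omega
  · refine (hL i j).trans ?_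
    push_cast
    omega
  · by_cases hmr : m = r
    · rw [hmr, Function.update_self] at hm
      exact absurd hm (by decide)
    · rw [Function.update_of_ne hmr] at hm
      exact absurd hm (by decide)

theorem Spread.mono {K' : ℕ} (h : Spread base pos a b e D K) (hK : K ≤ K') :
    Spread base pos a b e D K' := by
  have h1 := h.up
  have h2 := h.down
  exact ⟨h.width, h.height, h.same, h.col, h.col', by omega, by omega⟩

/-- An upper bound for the number of steps from the moment when the two ends of the leftmost column have
stepped out. -/
def waitSteps (k D : ℕ) : ℕ :=
  electedSteps k (D + 2) (D + 2 * (k * k)) + (12 * (k * k) + 9 * D + 33)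

/-- The next column decides between the two waiting robots; otherwise they search for a full view, and
either the whole configuration decides between them, or it is symmetric and a robot is on the axis. -/
theorem Pair.completes (h : Pair pos a b X e) (hs : Spread base pos a b e D 0) (hP : 1 < P.card)
    (hk : P.card = k) (hBt : ∀ p ∈ P, -(place P p).1 ≤ (D + 2 : ℕ) ∧ -(place P p).2 ≤ (D + 2 : ℕ))
    (hfree : ¬ HasFreeAxisSymmetry base) (hne : (others pos a b).Nonempty) :
    Completes algorithm P orient (waitSteps k D) (Cfg.quiet pos (lights a b wait wait)) := by
  classical
  by_cases hf : SymAbout (frontOf (others pos a b)) ((pos a).2 + (pos b).2)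
  swap
  · exact (h.completes_front (hs.mono (Nat.zero_le (k * k))) hP hk hBt hf).mono (by rw [waitSteps]; omega)
  obtain ⟨u, hu, hc, hv⟩ := exists_first_clear h e (pos a).2
  obtain ⟨u', hu', hc', hv'⟩ := exists_first_clear h (-e) (pos b).2
  have hp := h.climbed (u + 1) (u' + 1)
  have hcl : ∀ (s : ℤˣ) (p : GridPt) (v : ℕ), p.1 = X → climb s p (v + 1) = (X, p.2 + s * (v : ℤ)) :=
    fun s p v hp => by simp [climb, hp]
  rw [hcl _ _ _ h.left, hcl _ _ _ h.left'] at hp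
  have hsearch := fun n => h.completes_search (orient := orient) (n := n) hP hk hf hc hv hc' hv'
  obtain ⟨pos', hpos'⟩ : ∃ pos', pos' = two a b (X, (pos a).2 + e * (u : ℤ)) (X, (pos b).2 + (-e : ℤˣ) * (u' : ℤ)) pos := ⟨_, rfl⟩
  rw [← hpos'] at hp hsearch
  have hrows : (base a).2 = (pos a).2 ∧ (base b).2 = (pos b).2 := by
    have h1 := hs.up
    have h2 := hs.down
    rcases Int.units_eq_one_or e with rfl | rfl <;>
      simp only [Units.val_neg, Units.val_one, neg_mul, one_mul] at h1 h2 <;> omega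
  have hs1 : Spread base pos' a b e D (k * k) := by
    rw [hpos']
    have hee : (e : ℤ) * (e * (u : ℤ)) = u ∧ (e : ℤ) * ((-e : ℤˣ) * (u' : ℤ)) = -u' := by
      rcases Int.units_eq_one_or e with rfl | rfl <;> simp
    refine ⟨hs.width, hs.height, fun j h1 h2 => ?_, ?_, ?_, ?_, ?_⟩
    · rw [two_other h1 h2]; exact hs.same j h1 h2
    · rw [two_left, ← h.left]; exact hs.col
    · rw [two_right h.ne, ← h.left']; exact hs.col'
    · rw [two_left, hrows.1, mul_add, hee.1]
      push_cast
      constructor <;> nlinarith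
    · rw [two_right h.ne, hrows.2, mul_add, hee.2]
      push_cast
      constructor <;> nlinarith
  have hot : others pos' a b = others pos a b := by rw [hpos', others_two]
  have hpa : pos' a = (X, (pos a).2 + e * (u : ℤ)) := by rw [hpos', two_left]
  have hpb : pos' b = (X, (pos b).2 + (-e : ℤˣ) * (u' : ℤ)) := by rw [hpos', two_right h.ne]
  have hca : Clear (pos' a) (others pos' a b) := by rw [hot, hpa]; exact hc
  have hcb : Clear (pos' b) (others pos' a b) := by rw [hot, hpb]; exact hc'
  by_cases hsym : SymAbout (others pos a b) ((pos a).2 + (pos b).2)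
  swap
  · refine Completes.mono (hsearch
      (electedSteps k (D + 2) (D + 2 * (k * k)) + 6) ?_) (by rw [waitSteps]; nlinarith)
    refine hp.completes_asymmetric (c := (pos a).2 + (pos b).2) hs1 hP hk hBt hca hcb ?_ ?_ ?_
    · rw [hot]; exact hne
    · rw [hot]; exact hf
    · rw [hot]; exact hsym
  -- by symmetry, both robots have climbed equally far
  have hmirror : ∀ v : ℕ, Clear (X, (pos b).2 + (-e : ℤˣ) * (v : ℤ)) (others pos a b) ↔
      Clear (X, (pos a).2 + e * (v : ℤ)) (others pos a b) := by
    intro v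
    rw [← hsym.clear_iff (y := (pos a).2 + e * (v : ℤ)), show (pos a).2 + (pos b).2 -
      ((pos a).2 + e * (v : ℤ)) = (pos b).2 + (-e : ℤˣ) * (v : ℤ) by rw [Units.val_neg]; ring]
  obtain rfl : u = u' := by
    rcases lt_trichotomy u u' with hlt | heq | hlt
    · exact absurd ((hmirror u).2 hc) (hv' u hlt)
    · exact heq
    · exact absurd ((hmirror u').1 hc') (hv u' hlt)
  -- some robot is on the axis
  have hbel := h.below
  obtain ⟨i, hi⟩ : ∃ i, 2 * (base i).2 = (pos a).2 + (pos b).2 := by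
    by_contra hno
    push Not at hno
    refine hfree ⟨(((pos a).2 + (pos b).2 : ℤ) : ℝ) / 2, fun i => ?_, fun i hi => hno i ?_⟩
    · by_cases hia : i = a
      · refine ⟨b, ?_, ?_⟩
        · have h1 := hs.col
          have h2 := hs.col'
          have h3 := h.left
          have h4 := h.left'
          rw [hia]
          omega
        · rw [hia, hrows.1, hrows.2]; push_cast; ring
      by_cases hib : i = b
      · refine ⟨a, ?_, ?_⟩
        · have h1 := hs.col
          have h2 := hs.col'
          have h3 := h.left
          have h4 := h.left'
          rw [hib]
          omega
        · rw [hib, hrows.1, hrows.2]; push_cast; ring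
      · obtain ⟨j, hja, hjb, hj⟩ := hsym _ ⟨i, hia, hib, rfl⟩
        rw [hs.same j hja hjb, hs.same i hia hib] at hj
        refine ⟨j, by rw [hj], ?_⟩
        rw [hj]
        push_cast
        ring
    · have : ((2 * (base i).2 : ℤ) : ℝ) = ((pos a).2 + (pos b).2 : ℤ) := by
        push_cast at hi ⊢
        linarith
      exact_mod_cast this
  have hax : ∀ j, 2 * (base j).2 = (pos a).2 + (pos b).2 → j ≠ a ∧ j ≠ b := by
    intro j hj
    refine ⟨?_, ?_⟩ <;> rintro rfl <;> rcases Int.units_eq_one_or e with rfl | rfl <;>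
      simp only [Units.val_neg, Units.val_one, neg_mul, one_mul] at hbel <;> omega
  -- the leftmost of them cannot be confused with others, which see a robot to the left in their row
  obtain ⟨r, hr, hmin⟩ := Finset.exists_min_image
    (Finset.univ.filter fun j => 2 * (base j).2 = (pos a).2 + (pos b).2) (fun j => (base j).1)
    ⟨i, by simpa using hi⟩
  simp only [Finset.mem_filter, Finset.mem_univ, true_and] at hr hmin
  obtain ⟨hra, hrb⟩ := hax r hr
  have hpr : pos' r = base r := by rw [hpos', two_other hra hrb, hs.same r hra hrb]
  have hrX : X < (base r).1 := by
    have := h.right r hra hrb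
    rwa [hs.same r hra hrb] at this
  rw [← hot] at hsym
  have hseesym : ∀ {i j : Fin k}, Sees pos' i j → Sees pos' j i := fun h' l hl => h' l hl.symm
  have hsa : ∀ j, j ≠ a → Sees pos' j a := fun j hj => hseesym (hp.sees_of_clear hca hj)
  have hsb : ∀ j, j ≠ b → Sees pos' j b := by
    intro j hj
    rw [others_swap] at hcb
    exact hseesym (hp.symm.sees_of_clear hcb hj)
  have hsum : (pos' a).2 + (pos' b).2 = (pos a).2 + (pos b).2 := by
    rw [hpa, hpb, Units.val_neg]
    ring
  have hC : Centre pos' a b r X e := by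
    refine ⟨hp.inj, hra, hrb, hp.left, hp.left', hp.below, by rw [hpr, hsum, hr],
      fun j h1 h2 _ => hp.right j h1 h2, by rw [hpr]; omega, ?_, fun j h1 h2 h3 h4 => ?_⟩
    · rintro j hja hjb hjr l - z (rfl | rfl)
      · exact hsa j hja l
      · exact hsb j hjb l
    · rw [hsum] at h4
      have hj : pos' j = base j := by
        rw [hpos', two_other h1 h2, hs.same j h1 h2]
      rw [hj] at h4
      rw [hpr, hj]
      refine lt_of_le_of_ne (hmin j h4) fun h5 => h3 (hp.inj ?_)
      rw [hj, hpr]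
      exact Prod.ext h5.symm (by omega)
  refine Completes.mono (hsearch
    (electedSteps k (D + 2) (D + 2 * (k * k)) + (6 * (D + k * k + 1) + 3 * (D + 2) + 3) + 6) ?_)
    (by rw [waitSteps]; nlinarith)
  exact hp.completes_symmetric hP hk hca hcb hsym (hC.completes hs1 hP hk hBt (by rw [hpr]; exact hrX)
    (hsa r hra) (hsb r hrb) (by rw [hrows.1, hrows.2]; exact h.below)
    (by rw [hpr, hr, hrows.1, hrows.2]))

end Apf

namespace Apf

variable {k : ℕ} {P : Finset GridPt} {orient : Fin k → ℤˣ} {init : Fin k → GridPt}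
  {a b ℓ : Fin k} {x : ℤ} {e : ℤˣ} {D : ℕ}

/-! ### From the initial configuration to the pattern -/

/-- A robot that is alone in the leftmost column is elected. -/
theorem completes_of_sole (hinj : Function.Injective init) (hℓ : ∀ j, j ≠ ℓ → (init ℓ).1 < (init j).1)
    (hP : 1 < P.card) (hk : P.card = k)
    (hx : ∀ i j, |(init i).1 - (init j).1| ≤ D) (hy : ∀ i j, |(init i).2 - (init j).2| ≤ D)
    (hBt : ∀ p ∈ P, -(place P p).1 ≤ (D + 2 : ℕ) ∧ -(place P p).2 ≤ (D + 2 : ℕ)) :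
    Completes algorithm P orient (electedSteps k (D + 2) D + 3) (Cfg.quiet init fun _ => off) := by
  have hlight : ∀ j, Function.update (fun _ : Fin k => off) ℓ elect j = elect ∧ j = ℓ ∨
      Function.update (fun _ : Fin k => off) ℓ elect j = off ∧ j ≠ ℓ := by
    intro j
    by_cases h : j = ℓ
    · rw [h, Function.update_self]; exact .inl ⟨rfl, rfl⟩
    · rw [Function.update_of_ne h]; exact .inr ⟨rfl, h⟩
  have hE : Elected init (Function.update (fun _ => off) ℓ elect) ℓ := by
    refine ⟨hinj, Function.update_self _ _ _, hℓ, fun j hj => ?_, fun m hm => ?_⟩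
    · rcases hlight j with h | h
      · exact absurd h.2 hj
      · exact .inl h.1
    · rcases hlight m with h | h <;> rw [h.1] at hm <;> exact absurd hm (by decide)
  refine Completes.light_step hinj (j := ℓ) (l := elect) (outcome_of_both hP fun s => ?_) (by decide)
    (fun i hi => rests_of_none hP fun s => ?_)
    (hE.completes hP hk (fun i j => (hx i j).trans ?_) hy (fun i j _ _ => (hy i j).trans ?_)
      (fun m i hm => ?_) hBt)
  · have hpos : ∀ p ∈ snapshot init (fun _ => off) s ℓ, 0 < p.1.1 := by
      rw [forall_mem_snapshot]
      intro j hj _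
      simp only [flipY_fst, Prod.fst_sub]
      have := hℓ j hj
      omega
    have hnl : NoneLeft (snapshot init (fun _ => off) s ℓ) := fun p hp => (hpos p hp).le
    rw [rule, if_pos rfl, ruleOff, if_pos hnl, if_pos fun p hp => (hpos p hp).ne']
  · rw [rule, if_pos rfl]
    obtain ⟨z, hz, hsz, hz'⟩ := exists_sees_coords hinj hi
    refine ruleOff_eq_none ⟨_, mem_snapshot_of_sees hz hsz, ?_⟩ ?_
      (not_onAxis_of_sole (fun j j' hj => absurd hj (by decide)) s)
      (not_called_of_no_lead (fun j => by decide) _ _)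
    · have := hℓ i hi
      simp only [flipY_fst, Prod.fst_sub]
      rcases hz' with rfl | hb
      · omega
      · have := sbtw_coords hb
        omega
    · rintro q ⟨hq, -⟩
      obtain ⟨j, -, -, hj⟩ := mem_snapshot.1 hq
      exact absurd (congrArg Prod.snd hj) (show off ≠ wait by decide)
  · push_cast; omega
  · push_cast; omega
  · rcases hlight m with h | h <;> rw [h.1] at hm <;> exact absurd hm (by decide)

/-- The two ends of a leftmost column with several robots step out and search for an asymmetry. -/
theorem Ends.completes_pattern (h : Ends init a b x e) (hax : (init a).1 = x) (hbx : (init b).1 = x)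
    (hP : 1 < P.card) (hk : P.card = k)
    (hx : ∀ i j, |(init i).1 - (init j).1| ≤ D) (hy : ∀ i j, |(init i).2 - (init j).2| ≤ D)
    (hBt : ∀ p ∈ P, -(Apf.place P p).1 ≤ (D + 2 : ℕ) ∧ -(Apf.place P p).2 ≤ (D + 2 : ℕ))
    (hfree : ¬ HasFreeAxisSymmetry init) :
    Completes algorithm P orient (waitSteps k D + 12) (Cfg.quiet init fun _ => off) := by
  refine h.completes hax hbx hP ?_
  have hm := h.moved hax hbx 1 1
  have hst : ∀ p : GridPt, stops x p 1 = (x - 1, p.2) := fun p => by simp [stops]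
  rw [hst, hst] at hm
  have hpair := hm.pair (by rw [two_left]) (by rw [two_right h.ne])
  refine hpair.completes (base := init) ⟨hx, hy, fun j h1 h2 => two_other h1 h2 .., ?_, ?_, ?_, ?_⟩
    hP hk hBt hfree ?_
  · rw [two_left, hax]
  · rw [two_right h.ne, hbx]
  · rw [two_left]; simp
  · rw [two_right h.ne]; simp
  · rw [others_two]
    by_contra hempty
    have hall : ∀ j, j = a ∨ j = b := by
      intro j
      by_contra hj
      push Not at hj
      exact hempty ⟨_, j, hj.1, hj.2, rfl⟩
    -- two robots in one column are symmetric
    have hrow : ((init a).2 : ℝ) ≠ (init b).2 := by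
      intro h'
      have h1 := h.below
      have h2 : (init a).2 = (init b).2 := by exact_mod_cast h'
      rw [h2] at h1
      omega
    refine hfree ⟨((init a).2 + (init b).2 : ℝ) / 2, fun i => ?_, fun i hi => hrow ?_⟩
    · rcases hall i with rfl | rfl
      · exact ⟨b, by rw [hax, hbx], by ring⟩
      · exact ⟨a, by rw [hax, hbx], by ring⟩
    · rcases hall i with rfl | rfl <;> linarith

/-- An upper bound for the number of steps from the initial configuration, hence for the number of moves. -/
def totalSteps (k D : ℕ) : ℕ := waitSteps k D + 12

theorem completes_of_not_freeAxisSymmetry (hinj : Function.Injective init) (hP : 1 < P.card)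
    (hk : P.card = k)
    (hx : ∀ i j, |(init i).1 - (init j).1| ≤ D) (hy : ∀ i j, |(init i).2 - (init j).2| ≤ D)
    (hBt : ∀ p ∈ P, -(place P p).1 ≤ (D + 2 : ℕ) ∧ -(place P p).2 ≤ (D + 2 : ℕ))
    (hfree : ¬ HasFreeAxisSymmetry init) :
    Completes algorithm P orient (totalSteps k D) (Cfg.quiet init fun _ => off) := by
  classical
  have hne : (Finset.univ : Finset (Fin k)).Nonempty := ⟨⟨0, by omega⟩, Finset.mem_univ _⟩
  obtain ⟨m, -, hm⟩ := Finset.exists_min_image Finset.univ (fun j => (init j).1) hne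
  have hcol : (Finset.univ.filter fun j => (init j).1 = (init m).1).Nonempty := ⟨m, by simp⟩
  obtain ⟨a, ha, hamax⟩ := Finset.exists_max_image _ (fun j => (init j).2) hcol
  obtain ⟨b, hb, hbmin⟩ := Finset.exists_min_image _ (fun j => (init j).2) hcol
  simp only [Finset.mem_filter, Finset.mem_univ, true_and, true_implies] at hm ha hamax hb hbmin
  by_cases hab : a = b
  · refine (completes_of_sole (ℓ := a) hinj (fun j hj => ?_) hP hk hx hy hBt).mono ?_
    · rw [ha]
      refine lt_of_le_of_ne (hm j) fun hj' => hj (hinj (Prod.ext (by omega) ?_))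
      have h1 := hamax j hj'.symm
      have h2 := hbmin j hj'.symm
      rw [← hab] at h2
      omega
    · simp only [totalSteps, waitSteps, electedSteps]
      omega
  · have hlt : ∀ j, (init j).1 = (init m).1 → j ≠ a → (init j).2 < (init a).2 := fun j hj hja =>
      lt_of_le_of_ne (hamax j hj) fun h' => hja (hinj (Prod.ext (by omega) h'))
    have hgt : ∀ j, (init j).1 = (init m).1 → j ≠ b → (init b).2 < (init j).2 := fun j hj hjb =>
      lt_of_le_of_ne (hbmin j hj) fun h' => hjb (hinj (Prod.ext (by omega) h'.symm))
    have hE : Ends init a b (init m).1 1 := by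
      refine ⟨hinj, .inl ha, .inl hb, ?_, fun j hja hjb => ?_⟩
      · rw [Units.val_one, one_mul, one_mul]
        exact hlt b hb (Ne.symm hab)
      · rcases (hm j).lt_or_eq with h | h
        · exact .inl h
        · refine .inr ⟨h.symm, ?_, ?_⟩
          · rw [Units.val_one, one_mul, one_mul]
            exact hgt j h.symm hjb
          · rw [Units.val_one, one_mul, one_mul]
            exact hlt j h.symm hja
    exact hE.completes_pattern ha hb hP hk hx hy hBt hfree

theorem completes_of_card_le (hinj : Function.Injective init) (hP : P.card ≤ 1) (hk : P.card = k)
    (hk0 : 0 < k) : Completes algorithm P orient 0 (Cfg.quiet init fun _ => off) := by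
  obtain rfl : k = 1 := by omega
  refine .done hinj (fun i => not_or.2 ⟨fun h => h rfl, fun h => h (rests_of_card_le hP)⟩) ?_
  obtain ⟨p, rfl⟩ := Finset.card_eq_one.1 hk
  refine ⟨init 0 - p, 1, ?_⟩
  simp [Cfg.quiet]

/-! ### The size of the configuration -/

theorem abs_sub_le_gridWidth {S : Finset GridPt} {p q : GridPt} (hp : p ∈ S) (hq : q ∈ S) :
    |p.1 - q.1| ≤ gridWidth S := by
  have key : ∀ {p q : GridPt}, p ∈ S → q ∈ S → (p.1 - q.1).toNat ≤ gridWidth S := fun {p q} hp hq =>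
    (Finset.le_sup (f := fun q : GridPt => (p.1 - q.1).toNat) hq).trans
      (Finset.le_sup (f := fun p : GridPt => S.sup fun q => (p.1 - q.1).toNat) hp)
  have h1 := key hp hq
  have h2 := key hq hp
  rw [abs_le]
  omega

theorem abs_sub_le_gridHeight {S : Finset GridPt} {p q : GridPt} (hp : p ∈ S) (hq : q ∈ S) :
    |p.2 - q.2| ≤ gridHeight S := by
  have key : ∀ {p q : GridPt}, p ∈ S → q ∈ S → (p.2 - q.2).toNat ≤ gridHeight S := fun {p q} hp hq =>
    (Finset.le_sup (f := fun q : GridPt => (p.2 - q.2).toNat) hq).trans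
      (Finset.le_sup (f := fun p : GridPt => S.sup fun q => (p.2 - q.2).toNat) hp)
  have h1 := key hp hq
  have h2 := key hq hp
  rw [abs_le]
  omega

theorem sizeParam_bounds (init : Fin k → GridPt) (P : Finset GridPt) :
    (∀ i j, |(init i).1 - (init j).1| ≤ sizeParam init P) ∧
    (∀ i j, |(init i).2 - (init j).2| ≤ sizeParam init P) ∧
    (∀ p ∈ P, ∀ q ∈ P, |p.1 - q.1| ≤ sizeParam init P ∧ |p.2 - q.2| ≤ sizeParam init P) ∧
    k ≤ sizeParam init P := by
  have h1 : gridHeight (Finset.univ.image init) ≤ sizeParam init P :=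
    (le_max_left _ _).trans (le_max_left _ _)
  have h2 : gridWidth (Finset.univ.image init) ≤ sizeParam init P :=
    (le_max_right _ _).trans (le_max_left _ _)
  have h3 : gridHeight P ≤ sizeParam init P :=
    (le_max_left _ _).trans ((le_max_left _ _).trans (le_max_right _ _))
  have h4 : gridWidth P ≤ sizeParam init P :=
    (le_max_right _ _).trans ((le_max_left _ _).trans (le_max_right _ _))
  have hmem : ∀ i, init i ∈ Finset.univ.image init := fun i =>
    Finset.mem_image_of_mem _ (Finset.mem_univ i)
  refine ⟨fun i j => ?_, fun i j => ?_, fun p hp q hq => ⟨?_, ?_⟩,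
    (le_max_right _ _).trans (le_max_right _ _)⟩
  · exact (abs_sub_le_gridWidth (hmem i) (hmem j)).trans (by exact_mod_cast h2)
  · exact (abs_sub_le_gridHeight (hmem i) (hmem j)).trans (by exact_mod_cast h1)
  · exact (abs_sub_le_gridWidth hp hq).trans (by exact_mod_cast h4)
  · exact (abs_sub_le_gridHeight hp hq).trans (by exact_mod_cast h3)

theorem neg_place_le (hP : 1 < P.card)
    (hD : ∀ p ∈ P, ∀ q ∈ P, |p.1 - q.1| ≤ D ∧ |p.2 - q.2| ≤ D) :
    ∀ p ∈ P, -(place P p).1 ≤ (D + 2 : ℕ) ∧ -(place P p).2 ≤ (D + 2 : ℕ) := by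
  intro p hp
  obtain ⟨⟨q, hq, hqx⟩, -⟩ := maxX_spec (Finset.card_pos.1 (by omega : 0 < P.card))
  have h1 := abs_le.1 (hD p hp q hq).1
  have h2 := abs_le.1 (hD p hp _ (topRight_mem hP)).2
  simp only [place]
  push_cast
  omega

theorem totalSteps_le (hk : 0 < k) (hD : k ≤ D) : totalSteps k D ≤ 200 * (k * D) := by
  have h1 : k * k ≤ k * D := Nat.mul_le_mul_left k hD
  have h2 : D ≤ k * D := Nat.le_mul_of_pos_left D hk
  have h3 : k ≤ k * D := Nat.le_mul_of_pos_right k (by omega)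
  have h4 : k * (3 * (3 * (D + 2)) + 6) = 9 * (k * D) + 24 * k := by ring
  simp only [totalSteps, waitSteps, electedSteps, h4]
  omega

/-- The algorithm forms every pattern from every configuration without free symmetry axis, however the
frames are oriented. -/
theorem completes (hk0 : 0 < k) (hinj : Function.Injective init) (hfree : ¬ HasFreeAxisSymmetry init)
    (hk : P.card = k) : Completes algorithm P orient (200 * (k * sizeParam init P))
      (Cfg.start algorithm.off init) := by
  obtain ⟨h1, h2, h3, h4⟩ := sizeParam_bounds init P
  by_cases hP : P.card ≤ 1
  · exact (completes_of_card_le hinj hP hk hk0).mono (Nat.zero_le _)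
  · have hP : 1 < P.card := by omega
    exact (completes_of_not_freeAxisSymmetry hinj hP hk h1 h2 (neg_place_le hP h3) hfree).mono
      (totalSteps_le hk0 h4)

end Apf

theorem theorem1 :
    (∀ (k : ℕ), 0 < k → ∀ init : Fin k → GridPt, Function.Injective init →
      (APFSolvable init ↔ ¬ HasFreeAxisSymmetry init)) ∧
    (∃ (A : RobotAlgorithm 8) (C : ℕ),
      ∀ (k : ℕ), 0 < k → ∀ init : Fin k → GridPt, Function.Injective init →
        ¬ HasFreeAxisSymmetry init → ∀ P : Finset GridPt, P.card = k →
          SolvesPattern A P init ∧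
          ∀ (orient : Fin k → ℤˣ) (sched : ℕ → Finset (Fin k)), FairSchedule sched →
            ∀ T : ℕ, moveCount A P init orient sched T ≤ C * (k * sizeParam init P)) := by
  refine ⟨fun k hk init hinj => ⟨fun h hsym => not_solvable_of_freeAxisSymmetry hk init hinj hsym h,
    fun hfree => ⟨8, Apf.algorithm, fun P hP => ?_⟩⟩, Apf.algorithm, 200,
    fun k hk init hinj hfree P hP => ⟨?_, fun orient sched _ T => ?_⟩⟩
  · exact Completes.solves fun orient => ⟨_, Apf.completes hk hinj hfree hP⟩
  · exact Completes.solves fun orient => ⟨_, Apf.completes hk hinj hfree hP⟩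
  · exact (Apf.completes hk hinj hfree hP).moveCount_le T
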